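/- **Setting.** Fix $\alpha>0$ and an additive length $|{\bf n}|=w_1n_1+w_2n_2$ on $\mathbb N_0^2$ with $w_1,w_2>0$ (for example the parabolic one, $|{\bf n}|=n_1+2n_2$). Multi-indices $\beta,\gamma$ are finitely supported maps from $\{k\ge 0\}\cup\{{\bf n}\in\mathbb N_0^2:{\bf n}\ne{\bf 0}\}$ to $\mathbb N_0$, with unit multi-indices $e_k,e_{\bf n}$. Put $[\gamma]=\sum_k k\gamma(k)-\sum_{{\bf n}\neq{\bf 0}}\gamma({\bf n})$ and $|\gamma|=\alpha([\gamma]+1)+\sum_{{\bf n}\ne{\bf 0}}|{\bf n}|\gamma({\bf n})$. The space $\mathsf T$ has the basis $\{\mathsf z_\gamma\}$ indexed by those $\gamma$ with $[\gamma]\ge0$ or $\gamma=e_{\bf n}$ for some ${\bf n}\neq{\bf 0}$. **The structure $(\mathsf T^+,\Delta,\Delta^+)$.** On $\mathbb R[\mathsf z_k,\mathsf z_{\bf n}]$ consider the derivations $D^{({\bf 0})}=\sum_k(k+1)\mathsf z_{k+1}\partial_{\mathsf z_k}$, $D^{({\bf n})}=\partial_{\mathsf z_{\bf n}}$ for ${\bf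 n}\ne{\bf 0}$, and $\partial_i=\sum_{\bf n}(n_i+1)\mathsf z_{{\bf n}+{\bf e}_i}D^{({\bf n})}$, where $i=1,2$ and ${\bf e}_1=(1,0)$, ${\bf e}_2=(0,1)$. For an operator $D$, let $D_\beta^\gamma$ be the coefficient of $\mathsf z^\beta$ in $D\mathsf z^\gamma$. Let $\mathsf L$ be the Lie algebra generated by $\partial_1,\partial_2$ and the $\mathsf z^\gamma D^{({\bf n})}$ for admissible $(\gamma,{\bf n})$, i.e. $[\gamma]\ge 0$ and $|\gamma|>|{\bf n}|$. Let $U(\mathsf L)$ be its universal enveloping algebra and $\rho:U(\mathsf L)\to{\rm End}(\mathbb R[\mathsf z_k,\mathsf z_{\bf n}])$ the induced morphism. Define linear maps $U\mapsto\mathsf z^\gamma UD^{({\bf n})}$ of $U(\mathsf L)$ by $\mathsf z^\gamma1D^{({\bf n})}=\mathsf z^\gamma D^{({\bf n})}$ (read as $0$ if $(\gamma,{\bf n})$ is not admissible) and $$\mathsf z^\gamma DUD^{({\bf n})}=D\,\mathsf z^\gamma UD^{({\bf n})}-\sum_\beta D_\beta^\gamma\,\mathsf z^\beta UD^{({\bf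 n})}\qquad(D\in\mathsf L).$$ For a multi-index $J$ over the admissible pairs and ${\bf m}\in\mathbb N_0^2$, let $\mathsf D_{(J,{\bf m})}=\frac1{J!{\bf m}!}\prod(\mathsf z^\gamma)^{J(\gamma,{\bf n})}\,\partial_1^{m_1}\partial_2^{m_2}\prod(D^{({\bf n})})^{J(\gamma,{\bf n})}\in U(\mathsf L)$, where the factors are applied one after the other through these maps, starting from $\partial_1^{m_1}\partial_2^{m_2}$. Let $\mathsf T^+$ be the algebra with basis $\mathsf Z^{(J,{\bf m})}$ and product $\mathsf Z^{(J',{\bf m}')}\mathsf Z^{(J'',{\bf m}'')}=\mathsf Z^{(J'+J'',{\bf m}'+{\bf m}'')}$, and put $\mathcal J_{\bf n}\mathsf z_\beta={\bf n}!\,\mathsf Z^{(e_{(\beta,{\bf n})},{\bf 0})}$ for admissible $(\beta,{\bf n})$. Define $$\Delta\mathsf z_\beta=\sum_{(J,{\bf m}),\gamma}(\rho\mathsf D_{(J,{\bf m})})_\beta^\gamma\;\mathsf Z^{(J,{\bf m})}\otimes\mathsf z_\gamma\in\mathsf T^+\otimes\mathsf T,$$ where $\gamma$ runs over the index set of $\mathsf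 T$, and let $\Delta^+:\mathsf T^+\to\mathsf T^+\otimes\mathsf T^+$ be dual to the product of $U(\mathsf L)$: the coefficient of $\mathsf Z^{(J',{\bf m}')}\otimes\mathsf Z^{(J'',{\bf m}'')}$ in $\Delta^+\mathsf Z^{(J,{\bf m})}$ is the coefficient of $\mathsf D_{(J,{\bf m})}$ in $\mathsf D_{(J',{\bf m}')}\mathsf D_{(J'',{\bf m}'')}$. The counit of $\mathsf T^+$ is the coefficient of $\mathsf Z^{(0,{\bf 0})}$. **Trees for gPAM and the dictionary.** Consider trees of the inductive form $\Xi\,(\prod_{i}\mathscr{I}X^{{\bf n}_i})(\prod_j\mathcal I\tau_j)$ with ${\bf n}_i\neq{\bf 0}$, finite products and no order among the factors. Here $\Xi$ is the noise, $\mathcal I$ the abstract integration, and the symbols $\mathscr IX^{\bf n}$ are not multiplied with each other. Recursively in the length of $\beta$, let $$\mathring\phi_-\mathsf z_\beta=\sum_{k\ge0}\ \sum_{e_k+\beta_1+\dots+\beta_k=\beta}(\mathring\phi\mathsf z_{\beta_1})\cdots(\mathring\phi\mathsf z_{\beta_k})\,\Xi,\qquad \mathring\phi\mathsf z_\beta=\begin{cases}\mathscr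 IX^{\bf n}&\text{if }\beta=e_{\bf n},\\ \mathcal I\mathring\phi_-\mathsf z_\beta&\text{otherwise,}\end{cases}$$ so that $\mathring\phi_-\mathsf z_{\beta}=0$ for $\beta=0$ and $\beta=e_{\bf n}$. Let $\mathcal Q$ be the contraction of the polynomial decorations, $\mathcal Q\big(\Xi\prod_i\mathscr IX^{{\bf n}_i}\prod_j\mathcal I\tau_j\big)=\Xi X^{\sum_i{\bf n}_i}\prod_j\mathcal I\mathcal Q\tau_j$, and $\phi_-=\mathcal Q\mathring\phi_-$. **Hairer's structure.** Let $\mathsf T_H$ be spanned by the trees of the inductive form $\tau=\Xi X^{\bf n}\prod_j\mathcal I\tau_j$, the planted trees $\mathcal I\tau$ and the polynomials $X^{\bf n}$, regarded as a subspace of the commutative polynomial algebra $\mathcal A$ in $\Xi$, $X_1$, $X_2$ and all $\mathcal I\tau$. The homogeneity is $|\Xi|_H=\alpha-2$, $|X^{\bf n}|_H=|{\bf n}|$, $|\tau\tau'|_H=|\tau|_H+|\tau'|_H$, $|\mathcal I\tau|_H=|\tau|_H+2$. Let $\mathsf T_H^+$ be the polynomial algebra in $X_1,X_2$ and the symbols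 $\mathcal J^H_{\bf n}\tau$, where $\tau$ is a tree $\Xi X^{\bf n'}\prod_j\mathcal I\tau_j$ or a planted tree, and $|{\bf n}|<|\tau|_H+2$. Then $\mathcal J_{\bf n}^H$ is a linear map, where $\mathcal J_{\bf n}^HX^{{\bf n}'}=0$, and $\mathcal J_{\bf n}^H\tau=0$ if $|{\bf n}|\ge|\tau|_H+2$. Let $\Delta_H:\mathcal A\to\mathsf T_H^+\otimes\mathcal A$ and $\Delta_H^+:\mathsf T_H^+\to\mathsf T_H^+\otimes\mathsf T_H^+$ be the multiplicative and unital maps with $$\Delta_H\Xi=1\otimes\Xi,\quad \Delta_HX_i=1\otimes X_i+X_i\otimes1,\quad \Delta_H\mathcal I\tau=({\rm id}\otimes\mathcal I)\Delta_H\tau+\sum_{\bf n}\mathcal J_{\bf n}^H\tau\otimes\tfrac{X^{\bf n}}{{\bf n}!},$$ $$\Delta_H^+X_i=1\otimes X_i+X_i\otimes1,\quad \Delta_H^+\mathcal J^H_{\bf n}\tau=({\rm id}\otimes\mathcal J_{\bf n}^H)\Delta_H\tau+\sum_{\bf m}\mathcal J^H_{{\bf n}+{\bf m}}\tau\otimes\tfrac{X^{\bf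 m}}{{\bf m}!}.$$ The counit of $\mathsf T_H^+$ is the multiplicative functional that vanishes on all generators. Finally, let $\Phi:\mathsf T^+\to\mathsf T_H^+$ be the multiplicative and unital map with $\Phi\mathsf Z^{(0,{\bf e}_i)}=X_i$ for $i=1,2$ and $\Phi\mathcal J_{\bf n}\mathsf z_\beta=\mathcal J_{\bf n}^H\phi_-\mathsf z_\beta$ for admissible $(\beta,{\bf n})$. **Proposition.** The $\mathsf D_{(J,{\bf m})}$ form a basis of $U(\mathsf L)$. For fixed $\beta$ and fixed $(J,{\bf m})$, respectively, the sums defining $\Delta\mathsf z_\beta$ and $\Delta^+\mathsf Z^{(J,{\bf m})}$ are finite. The map $\phi_-$ takes values in $\mathsf T_H$, and $\Delta_H$ maps $\mathsf T_H$ into $\mathsf T_H^+\otimes\mathsf T_H$. Moreover, $$\Delta_H\,\phi_-=(\Phi\otimes\phi_-)\,\Delta\quad\text{on }\mathsf T,\qquad \Delta_H^+\,\Phi=(\Phi\otimes\Phi)\,\Delta^+\quad\text{on }\mathsf T^+.$$ Furthermore $\mathsf T^+$ and $\mathsf T_H^+$, with the above products, coproducts $\Delta^+$, $\Delta_H^+$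 and counits, are Hopf algebras, and $\Phi$ is a Hopf algebra morphism: it preserves product, unit, coproduct, counit and antipode. -/

import Mathlib

open TensorProduct

noncomputable section

namespace GPAM

attribute [local instance 100] LieRing.ofAssociativeRing

/-! ## Multi-indices and their homogeneity -/

/-- Elements `n = (n₁, n₂)` of `ℕ₀²`. -/
abbrev N2 : Type := Fin 2 →₀ ℕ

/-- `n! = n₁! n₂!`. -/
def fact (n : N2) : ℕ := ∏ i, (n i).factorial

/-- The scaled length `|n| = w₁ n₁ + w₂ n₂`, i.e. the additive map with `|(1,0)| = w₁` and
`|(0,1)| = w₂`. -/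
def len (w : Fin 2 → ℝ) (n : N2) : ℝ := ∑ i, w i * n i

/-- The indices `n ≠ 0`. -/
abbrev N2ne : Type := {n : N2 // n ≠ 0}

/-- The index set of the variables: `Sum.inl k` stands for `z_k` with `k ≥ 0`, and `Sum.inr n`
stands for `z_n` with `n ≠ 0` in `ℕ₀²`. -/
abbrev Var : Type := ℕ ⊕ N2ne

/-- Multi-indices over the variables. -/
abbrev MI : Type := Var →₀ ℕ

/-- The multi-index `e_n` for `n ≠ 0`. -/
def ePoly (n : N2ne) : MI := Finsupp.single (Sum.inr n) 1

/-- `[γ] = ∑ k γ(k) - ∑_{n ≠ 0} γ(n)`. -/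
def bra (γ : MI) : ℤ := γ.sum fun v e => (e : ℤ) * Sum.elim (fun k : ℕ => (k : ℤ)) (fun _ => -1) v

/-- The homogeneity `|γ| = α ([γ] + 1) + ∑_{n ≠ 0} |n| γ(n)`. -/
def hom (α : ℝ) (w : Fin 2 → ℝ) (γ : MI) : ℝ :=
  α * ((bra γ : ℝ) + 1) + γ.sum fun v e => (e : ℝ) * Sum.elim (fun _ => 0) (fun n => len w n.1) v

/-- The index set of the abstract model space: `[γ] ≥ 0` or `γ = e_n` for some `n ≠ 0`. -/
abbrev TIdx : Type := {γ : MI // 0 ≤ bra γ ∨ ∃ n : N2ne, γ = ePoly n}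

/-- The abstract model space `T`, with basis `z_γ`. -/
abbrev T : Type := TIdx →₀ ℝ

/-! ## The derivations and the Lie algebra `L`

All the derivations below map polynomials to polynomials, so that their matrix entries
`D_β^γ` (the coefficient of `z^β` in `D z^γ`) can be read off on `ℝ[z_k, z_n]`. -/

/-- The polynomial algebra `ℝ[z_k, z_n]`. -/
abbrev Poly : Type := MvPolynomial Var ℝ

/-- The monomial `z^γ`. -/
def mono (γ : MI) : Poly := MvPolynomial.monomial γ 1

/-- `D^(0) = ∑_k (k+1) z_{k+1} ∂_{z_k}`. -/
def tiltZero : Derivation ℝ Poly Poly :=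
  MvPolynomial.mkDerivation ℝ
    (Sum.elim (fun k => ((k : ℝ) + 1) • MvPolynomial.X (Sum.inl (k + 1))) (fun _ => 0))

open Classical in
/-- `D^(n)`, which is `∂_{z_n}` for `n ≠ 0`. -/
def tilt (n : N2) : Derivation ℝ Poly Poly :=
  if h : n = 0 then tiltZero else MvPolynomial.pderiv (Sum.inr ⟨n, h⟩)

theorem add_single_ne_zero (n : N2) (i : Fin 2) : n + Finsupp.single i 1 ≠ 0 := by
  intro h
  have := DFunLike.congr_fun h i
  simp at this

/-- The variable `z_{n + e_i}`, where `e_0 = (1,0)` and `e_1 = (0,1)`. -/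
def raised (n : N2) (i : Fin 2) : Poly :=
  MvPolynomial.X (Sum.inr ⟨n + Finsupp.single i 1, add_single_ne_zero n i⟩)

/-- The derivation `∂_i = ∑_n (n_i + 1) z_{n + e_i} D^(n)` (sum over all `n`, including `n = 0`),
given by its values `z_{e_i} D^(0) z_k` on `z_k` and `(n_i + 1) z_{n + e_i}` on `z_n`. -/
def shift (i : Fin 2) : Derivation ℝ Poly Poly :=
  MvPolynomial.mkDerivation ℝ
    (Sum.elim (fun k => raised 0 i * tiltZero (MvPolynomial.X (Sum.inl k)))
      (fun n => ((n.1 i : ℝ) + 1) • raised n.1 i))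

/-- The restriction `[γ] ≥ 0`, `|γ| > |n|` on the pairs `(γ, n)`. -/
def Admissible (α : ℝ) (w : Fin 2 → ℝ) (γ : MI) (n : N2) : Prop :=
  0 ≤ bra γ ∧ len w n < hom α w γ

/-- The index set of `L`: the admissible pairs `(γ, n)` and `{1, 2}`. -/
abbrev LIdx (α : ℝ) (w : Fin 2 → ℝ) : Type :=
  {p : MI × N2 // Admissible α w p.1 p.2} ⊕ Fin 2

/-- The operators `z^γ D^(n)` and `∂_i`. -/
def genOp (α : ℝ) (w : Fin 2 → ℝ) : LIdx α w → Module.End ℝ Poly :=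
  Sum.elim (fun p => ((mono p.1.1 • tilt p.1.2 : Derivation ℝ Poly Poly) : Poly →ₗ[ℝ] Poly))
    (fun i => (shift i : Poly →ₗ[ℝ] Poly))

/-- The Lie algebra `L` of the operators `z^γ D^(n)`, `(γ, n)` admissible, and `∂_1, ∂_2`. Their
linear span is closed under commutators, so that the Lie algebra they generate is their span. -/
def L (α : ℝ) (w : Fin 2 → ℝ) : LieSubalgebra ℝ (Module.End ℝ Poly) :=
  LieSubalgebra.lieSpan ℝ (Module.End ℝ Poly) (Set.range (genOp α w))

/-- The generators `z^γ D^(n)` and `∂_i` as elements of `L`. -/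
def gen (α : ℝ) (w : Fin 2 → ℝ) (v : LIdx α w) : L α w :=
  ⟨genOp α w v, LieSubalgebra.subset_lieSpan ⟨v, rfl⟩⟩

/-! ## The universal enveloping algebra and its basis `D_(J,m)` -/

/-- The universal enveloping algebra `U(L)`. -/
abbrev U (α : ℝ) (w : Fin 2 → ℝ) : Type := UniversalEnvelopingAlgebra ℝ (L α w)

/-- The canonical embedding of `L` into `U(L)`. -/
def emb (α : ℝ) (w : Fin 2 → ℝ) : L α w →ₗ⁅ℝ⁆ U α w := UniversalEnvelopingAlgebra.ι ℝ

/-- The canonical projection `ρ`, which replaces symbols by the corresponding endomorphisms. -/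
def rho (α : ℝ) (w : Fin 2 → ℝ) : U α w →ₐ[ℝ] Module.End ℝ Poly :=
  UniversalEnvelopingAlgebra.lift ℝ (L α w).incl

/-- The action of `L` on linear maps `G` from polynomials to `U(L)`, given by
`(D · G) p = D (G p) - G (D p)`. -/
def homAct (α : ℝ) (w : Fin 2 → ℝ) : L α w →ₗ⁅ℝ⁆ Module.End ℝ (Poly →ₗ[ℝ] U α w) where
  toFun D :=
    { toFun := fun G => LinearMap.mulLeft ℝ (emb α w D) ∘ₗ G - G ∘ₗ (D : Module.End ℝ Poly)
      map_add' := by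
        intro G G'; ext p; simp [mul_add]; abel
      map_smul' := by
        intro c G; ext p; simp [smul_sub] }
  map_add' := by
    intro D D'; ext G p; simp [add_mul]; abel
  map_smul' := by
    intro c D; ext G p; simp [smul_sub]
  map_lie' := by
    intro D D'; ext G p
    simp [LieRing.of_associative_ring_bracket, sub_mul, mul_sub, mul_assoc]; abel

open Classical in
/-- The linear map `z^γ ↦ z^γ D^(n) ∈ L ⊂ U(L)` for `(γ, n)` admissible (and `z^γ ↦ 0`
otherwise). -/
def base (α : ℝ) (w : Fin 2 → ℝ) (n : N2) : Poly →ₗ[ℝ] U α w :=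
  (MvPolynomial.basisMonomials Var ℝ).constr ℝ fun γ =>
    if h : Admissible α w γ n then emb α w (gen α w (Sum.inl ⟨(γ, n), h⟩)) else 0

/-- The map `U ↦ z^γ U D^(n)` of `U(L)` into itself. See `sandwich_one` and `sandwich_mul` for the
recursion that characterizes it. -/
def sandwich (α : ℝ) (w : Fin 2 → ℝ) (γ : MI) (n : N2) (u : U α w) : U α w :=
  UniversalEnvelopingAlgebra.lift ℝ (homAct α w) u (base α w n) (mono γ)

/-- `z^γ 1 D^(n) = z^γ D^(n)`. -/
theorem sandwich_one (α : ℝ) (w : Fin 2 → ℝ) (γ : MI) (n : N2) (h : Admissible α w γ n) :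
    sandwich α w γ n 1 = emb α w (gen α w (Sum.inl ⟨(γ, n), h⟩)) := by
  have e : mono γ = MvPolynomial.basisMonomials Var ℝ γ := by simp [mono]
  rw [sandwich, map_one, Module.End.one_apply, base, e, Module.Basis.constr_basis, dif_pos h]

/-- `z^γ D U D^(n) = D z^γ U D^(n) - ∑_β D_β^γ z^β U D^(n)`. -/
theorem sandwich_mul (α : ℝ) (w : Fin 2 → ℝ) (γ : MI) (n : N2) (D : L α w) (u : U α w) :
    sandwich α w γ n (emb α w D * u) = emb α w D * sandwich α w γ n u -
      ∑ β ∈ ((D : Module.End ℝ Poly) (mono γ)).support,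
        MvPolynomial.coeff β ((D : Module.End ℝ Poly) (mono γ)) • sandwich α w β n u := by
  have key : ∀ (F : Poly →ₗ[ℝ] U α w) (p : Poly),
      F p = ∑ β ∈ p.support, MvPolynomial.coeff β p • F (mono β) := by
    intro F p
    conv_lhs => rw [p.as_sum]
    rw [map_sum]
    refine Finset.sum_congr rfl fun β _ => ?_
    rw [← F.map_smul]
    congr 1
    simp [mono, MvPolynomial.smul_monomial]
  simp only [sandwich, map_mul, Module.End.mul_apply]
  have : UniversalEnvelopingAlgebra.lift ℝ (homAct α w) (emb α w D) = homAct α w D :=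
    UniversalEnvelopingAlgebra.lift_ι_apply ℝ (homAct α w) D
  rw [this, ← key]
  rfl

/-- The index set of the pairs `(J, m)`: multi-indices over the index set of `L`, where `J` is the
restriction to the admissible pairs `(γ, n)` and `m ∈ ℕ₀²` is the restriction to `{1, 2}`. -/
abbrev PIdx (α : ℝ) (w : Fin 2 → ℝ) : Type := LIdx α w →₀ ℕ

/-- The elements `z^γ₁ ⋯ z^γₖ U D^(nₖ) ⋯ D^(n₁)`, where `(γ₁, n₁), …, (γₖ, nₖ)` is the given list
of admissible pairs. -/
def sandwichList (α : ℝ) (w : Fin 2 → ℝ) (l : List {p : MI × N2 // Admissible α w p.1 p.2})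
    (u : U α w) : U α w :=
  l.foldr (fun p => sandwich α w p.1.1 p.1.2) u

/-- The element `D_(J,m) = (1 / (J! m!)) ∏ (z^γ)^J(γ,n) ∂₁^m₁ ∂₂^m₂ ∏ (D^(n))^J(γ,n)` of `U(L)`.
The maps `U ↦ z^γ U D^(n)` commute, so that the order in which they are applied is immaterial. -/
def DD (α : ℝ) (w : Fin 2 → ℝ) (p : PIdx α w) : U α w :=
  (p.prod fun _ e => (e.factorial : ℝ))⁻¹ •
    sandwichList α w
      (Finsupp.toMultiset (p.comapDomain Sum.inl Sum.inl_injective.injOn)).toList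
      (emb α w (gen α w (Sum.inr 0)) ^ p (Sum.inr 0) *
        emb α w (gen α w (Sum.inr 1)) ^ p (Sum.inr 1))

/-! ## `T⁺`, `Δ`, `Δ⁺` and `𝒥_n` -/

/-- `T⁺`, the linear space with basis `Z^(J,m)` and product `Z^(J',m') Z^(J'',m'') =
Z^((J',m') + (J'',m''))`, i.e. the polynomial algebra over the index set of `L`. -/
abbrev TPlus (α : ℝ) (w : Fin 2 → ℝ) : Type := MvPolynomial (LIdx α w) ℝ

/-- The basis element `Z^(J,m)`. -/
def ZZ (α : ℝ) (w : Fin 2 → ℝ) (p : PIdx α w) : TPlus α w := MvPolynomial.monomial p 1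

/-- The matrix entries `Δ_{β (J,m)}^γ = (D_(J,m))_β^γ` of `ρ D_(J,m)`. -/
def deltaCoeff (α : ℝ) (w : Fin 2 → ℝ) (β γ : MI) (p : PIdx α w) : ℝ :=
  MvPolynomial.coeff β (rho α w (DD α w p) (mono γ))

/-- The comodule `Δ : T → T⁺ ⊗ T`, `Δ z_β = ∑ Δ_{β (J,m)}^γ Z^(J,m) ⊗ z_γ`. -/
def Delta (α : ℝ) (w : Fin 2 → ℝ) : T →ₗ[ℝ] TPlus α w ⊗[ℝ] T :=
  Finsupp.linearCombination ℝ fun β : TIdx =>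
    ∑ᶠ q : PIdx α w × TIdx,
      deltaCoeff α w β.1 q.2.1 q.1 • (ZZ α w q.1 ⊗ₜ[ℝ] (Finsupp.single q.2 1 : T))

/-- The coproduct `Δ⁺ : T⁺ → T⁺ ⊗ T⁺` dual to the product of `U(L)` with respect to a basis `b` of
`U(L)` indexed by the `(J, m)`: `Δ⁺ Z^(J,m) = ∑ c Z^(J',m') ⊗ Z^(J'',m'')`, where `c` is the
coefficient of `b_(J,m)` in the product `b_(J',m') b_(J'',m'')`. -/
def DeltaPlus (α : ℝ) (w : Fin 2 → ℝ) (b : Module.Basis (PIdx α w) ℝ (U α w)) :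
    TPlus α w →ₗ[ℝ] TPlus α w ⊗[ℝ] TPlus α w :=
  (MvPolynomial.basisMonomials (LIdx α w) ℝ).constr ℝ fun p =>
    ∑ᶠ q : PIdx α w × PIdx α w,
      b.repr (b q.1 * b q.2) p • (ZZ α w q.1 ⊗ₜ[ℝ] ZZ α w q.2)

/-- The counit of `T⁺`, which maps `Z^(0,0)` to `1` and every other basis element to `0`. -/
def epsPlus (α : ℝ) (w : Fin 2 → ℝ) : TPlus α w →ₗ[ℝ] ℝ :=
  (MvPolynomial.aeval (fun _ => (0 : ℝ)) : TPlus α w →ₐ[ℝ] ℝ).toLinearMap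

/-! ## Decorated rooted trees -/

/-- Planar rooted trees with nodes decorated by `A`. -/
inductive PTree (A : Type) : Type
  | node : A → List (PTree A) → PTree A

/-- Two planar trees are related if they differ by a permutation of the children of one node. -/
inductive PTree.Swap {A : Type} : PTree A → PTree A → Prop
  | perm (a : A) {l l' : List (PTree A)} : l.Perm l' → Swap (.node a l) (.node a l')
  | child (a : A) (l₁ l₂ : List (PTree A)) {t t' : PTree A} :
      Swap t t' → Swap (.node a (l₁ ++ t :: l₂)) (.node a (l₁ ++ t' :: l₂))

/-- Rooted trees with nodes decorated by `A`: planar trees up to the order of the children. -/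
def RTree (A : Type) : Type := Quot (PTree.Swap (A := A))

/-- The rooted tree underlying a planar one. -/
def RTree.mk {A : Type} (t : PTree A) : RTree A := Quot.mk _ t

/-- A planar representative. -/
def RTree.out {A : Type} (τ : RTree A) : PTree A := Quot.out τ

/-- The tree with root decoration `a` and the multiset `s` of branches at the root. -/
def RTree.node {A : Type} (a : A) (s : Multiset (RTree A)) : RTree A :=
  RTree.mk (.node a (s.toList.map RTree.out))

/-- Recursion on planar trees, see `RTree.para`. -/
def PTree.para {A B : Type} (f : A → Multiset (RTree A × B) → B) : PTree A → B
  | .node a l => f a (Multiset.ofList (l.attach.map fun t => (RTree.mk t.1, PTree.para f t.1)))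
termination_by t => sizeOf t
decreasing_by
  have := List.sizeOf_lt_of_mem t.2
  simp only [PTree.node.sizeOf_spec]
  omega

theorem PTree.para_node {A B : Type} (f : A → Multiset (RTree A × B) → B) (a : A)
    (l : List (PTree A)) :
    PTree.para f (.node a l) =
      f a (Multiset.ofList (l.map fun t => (RTree.mk t, PTree.para f t))) := by
  rw [PTree.para]
  congr 2
  exact List.attach_map_val (l := l) (f := fun t => (RTree.mk t, PTree.para f t))

theorem PTree.para_swap {A B : Type} (f : A → Multiset (RTree A × B) → B) {t t' : PTree A}
    (h : PTree.Swap t t') : PTree.para f t = PTree.para f t' := by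
  induction h with
  | perm a h =>
    rw [PTree.para_node, PTree.para_node]
    congr 1
    exact Multiset.coe_eq_coe.2 (h.map _)
  | @child a l₁ l₂ t t' h ih =>
    have e : RTree.mk t = RTree.mk t' := Quot.sound h
    rw [PTree.para_node, PTree.para_node]
    simp [ih, e]

/-- Recursion on rooted trees: the function `F` with
`F (node a {τ₁, …, τₖ}) = f a {(τ₁, F τ₁), …, (τₖ, F τₖ)}`, see `RTree.para_node`. -/
def RTree.para {A B : Type} (f : A → Multiset (RTree A × B) → B) : RTree A → B :=
  Quot.lift (PTree.para f) fun _ _ h => PTree.para_swap f h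

theorem RTree.para_node {A B : Type} (f : A → Multiset (RTree A × B) → B) (a : A)
    (s : Multiset (RTree A)) :
    RTree.para f (RTree.node a s) = f a (s.map fun τ => (τ, RTree.para f τ)) := by
  have h : ∀ τ : RTree A, (RTree.mk τ.out, PTree.para f τ.out) = (τ, RTree.para f τ) := by
    intro τ
    have e : RTree.mk τ.out = τ := Quot.out_eq τ
    have e' : PTree.para f τ.out = RTree.para f (RTree.mk τ.out) := rfl
    rw [e', e]
  have e : RTree.para f (RTree.node a s) =
      PTree.para f (.node a (s.toList.map RTree.out)) := rfl
  rw [e, PTree.para_node, List.map_map]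
  congr 1
  conv_rhs => rw [← Multiset.coe_toList s]
  rw [Multiset.map_coe]
  congr 1
  exact List.map_congr_left fun τ _ => h τ

/-- The symbols from which trees are multiplied together: the noise, the polynomial symbols
indexed by `P`, and the planted trees `ℐ τ`. Every node of `τ` carries a noise and a monomial in
the polynomial symbols, which is recorded as its decoration in `P →₀ ℕ`. -/
inductive Sym (P : Type) : Type
  | noise : Sym P
  | poly : P → Sym P
  | int : RTree (P →₀ ℕ) → Sym P

/-- Monomials in these symbols. -/
abbrev Mon (P : Type) : Type := Sym P →₀ ℕ

/-- The commutative algebra of these symbols, in which linear combinations of trees are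
multiplied. -/
abbrev Alg (P : Type) : Type := MvPolynomial (Sym P) ℝ

theorem Sym.poly_injective {P : Type} : Function.Injective (Sym.poly (P := P)) :=
  fun _ _ h => by injection h

theorem Sym.int_injective {P : Type} : Function.Injective (Sym.int (P := P)) :=
  fun _ _ h => by injection h

/-- The tree whose root carries the polynomial symbols of the monomial `m` and to whose root the
planted trees of `m` are attached. -/
def toTree {P : Type} (m : Mon P) : RTree (P →₀ ℕ) :=
  RTree.node (m.comapDomain Sym.poly Sym.poly_injective.injOn)
    (Finsupp.toMultiset (m.comapDomain Sym.int Sym.int_injective.injOn))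

open Classical in
/-- The abstract integration `τ ↦ ℐ τ`. A monomial which contains the noise exactly once is a tree
`τ`, and it is mapped to the symbol `ℐ τ`; the other monomials are not integrated, and mapped
to `0`. -/
def integ {P : Type} : Alg P →ₗ[ℝ] Alg P :=
  (MvPolynomial.basisMonomials (Sym P) ℝ).constr ℝ fun m =>
    if m Sym.noise = 1 then MvPolynomial.X (Sym.int (toTree m)) else 0

/-! ## The dictionary -/

theorem degree_lt_of_mem {β : MI} {v : Var} (hv : v ∈ β.support) {k : ℕ} {b : Fin k → MI}
    (hb : b ∈ Finset.piAntidiag Finset.univ (β - Finsupp.single v 1)) (i : Fin k) :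
    (b i).degree < β.degree := by
  have h1 : ∑ j, b j = β - Finsupp.single v 1 := (Finset.mem_piAntidiag.1 hb).1
  have h2 : b i ≤ β - Finsupp.single v 1 :=
    h1 ▸ Finset.single_le_sum (f := b) (fun _ _ => zero_le) (Finset.mem_univ i)
  have h3 : β - Finsupp.single v 1 + Finsupp.single v 1 = β :=
    tsub_add_cancel_of_le (by
      rw [Finsupp.single_le_iff]
      exact Nat.one_le_iff_ne_zero.2 (Finsupp.mem_support_iff.1 hv))
  have h4 := congrArg Finsupp.degree h3
  have h5 : (b i).degree ≤ (β - Finsupp.single v 1).degree := Finsupp.degree_mono h2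
  simp only [map_add, Finsupp.degree_single] at h4
  omega

open Classical in
/-- The detailed dictionary `φ̊_-`, with values in linear combinations of trees in which the
polynomial symbols `𝓘 X^n`, `n ≠ 0`, are not multiplied:
`φ̊_- z_β = ∑_k ∑_{e_k + β₁ + ⋯ + βₖ = β} (φ̊ z_β₁) ⋯ (φ̊ z_βₖ) Ξ`, where `Ξ` is the noise,
`φ̊ z_β = 𝓘 X^n` if `β = e_n`, and `φ̊ z_β = ℐ φ̊_- z_β` otherwise. In particular, it vanishes for
`β = 0` and for `β = e_n`. -/
def dictMinus (β : MI) : Alg N2ne :=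
  ∑ v ∈ β.support.attach,
    match hv : v.1 with
    | Sum.inr _ => 0
    | Sum.inl k =>
      ∑ b ∈ (Finset.piAntidiag (Finset.univ : Finset (Fin k))
          (β - Finsupp.single v.1 1)).attach,
        (∏ i, if h : ∃ n : N2ne, b.1 i = ePoly n then MvPolynomial.X (Sym.poly h.choose)
          else integ (dictMinus (b.1 i))) * MvPolynomial.X Sym.noise
termination_by β.degree
decreasing_by exact degree_lt_of_mem v.2 b.2 i

open Classical in
/-- The companion `φ̊` of the detailed dictionary. -/
def dict (β : MI) : Alg N2ne :=
  if h : ∃ n : N2ne, β = ePoly n then MvPolynomial.X (Sym.poly h.choose)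
  else integ (dictMinus β)

theorem dictMinus_eq (β : MI) :
    dictMinus β = ∑ v ∈ β.support,
      Sum.elim (fun k => ∑ b ∈ Finset.piAntidiag (Finset.univ : Finset (Fin k))
          (β - Finsupp.single v 1), (∏ i, dict (b i)) * MvPolynomial.X Sym.noise)
        (fun _ => 0) v := by
  rw [dictMinus, ← Finset.sum_attach β.support]
  refine Finset.sum_congr rfl fun v _ => ?_
  obtain ⟨v, hv⟩ := v
  cases v with
  | inr n => rfl
  | inl k =>
    simp only [Sum.elim_inl]
    rw [← Finset.sum_attach (Finset.piAntidiag _ _)]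
    rfl

/-- `X^n` in the algebra generated by the noise, `X_1, X_2` and the planted trees. -/
def xPow (n : N2) : Alg (Fin 2) := ∏ i, MvPolynomial.X (Sym.poly i) ^ n i

/-- The contraction of the polynomial decorations of a tree, node by node: the polynomial symbols
`𝓘 X^n₁, …, 𝓘 X^nₖ` at a node are replaced by `X^(n₁ + ⋯ + nₖ)`. -/
def contractTree : RTree (N2ne →₀ ℕ) → RTree N2 :=
  RTree.para fun a s => RTree.node (a.sum fun n e => e • n.1) (s.map Prod.snd)

/-- The contraction `𝒬` of the polynomial decorations: on a tree `τ = Ξ (∏ 𝓘 X^nᵢ) (∏ ℐ τⱼ)` it is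
`𝒬 τ = Ξ X^(∑ nᵢ) ∏ ℐ 𝒬 τⱼ`. -/
def contract : Alg N2ne →ₐ[ℝ] Alg (Fin 2) :=
  MvPolynomial.aeval fun
    | Sym.noise => MvPolynomial.X Sym.noise
    | Sym.poly n => xPow n.1
    | Sym.int τ => MvPolynomial.X (Sym.int (contractTree τ))

/-- The dictionary `φ_- = 𝒬 φ̊_-`. -/
def phiMinus : T →ₗ[ℝ] Alg (Fin 2) :=
  Finsupp.linearCombination ℝ fun β : TIdx => contract (dictMinus β.1)

/-! ## The spaces `T_H`, `T_H⁺`, the comodule `Δ_H` and the coproduct `Δ_H⁺` -/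

/-- The monomial `m` is a tree `Ξ X^n ∏ ℐ τⱼ`. -/
def IsTree (m : Mon (Fin 2)) : Prop := m Sym.noise = 1

/-- The monomial `m` is a planted tree `ℐ τ`. -/
def IsPlanted (m : Mon (Fin 2)) : Prop := ∃ τ, m = Finsupp.single (Sym.int τ) 1

/-- The monomial `m` is a polynomial `X^n`. -/
def IsPolynomial (m : Mon (Fin 2)) : Prop := m Sym.noise = 0 ∧ ∀ τ, m (Sym.int τ) = 0

/-- The model space `T_H`, spanned by the trees `Ξ X^n ∏ ℐ τⱼ`, the planted trees `ℐ τ` and the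
polynomials `X^n`, inside the algebra in which its elements are multiplied. -/
def TH : Submodule ℝ (Alg (Fin 2)) :=
  Submodule.span ℝ ((fun m => MvPolynomial.monomial m (1 : ℝ)) ''
    {m | IsTree m ∨ IsPlanted m ∨ IsPolynomial m})

/-- The homogeneity `|Ξ X^n ∏ ℐ τⱼ|_H = α - 2 + |n| + ∑ (|τⱼ|_H + 2)` of a tree. -/
def treeHom (α : ℝ) (w : Fin 2 → ℝ) : RTree N2 → ℝ :=
  RTree.para fun a s => α - 2 + len w a + (s.map fun t => t.2 + 2).sum

/-- The homogeneity `|·|_H` of a symbol. -/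
def symHom (α : ℝ) (w : Fin 2 → ℝ) : Sym (Fin 2) → ℝ
  | Sym.noise => α - 2
  | Sym.poly i => w i
  | Sym.int τ => treeHom α w τ + 2

/-- The homogeneity `|·|_H` of a monomial, defined by `|τ τ'|_H = |τ|_H + |τ'|_H`. -/
def monHom (α : ℝ) (w : Fin 2 → ℝ) (m : Mon (Fin 2)) : ℝ :=
  m.sum fun g e => (e : ℝ) * symHom α w g

/-- The pairs `(n, τ)` for which `𝒥_n^H τ` is a generator of `T_H⁺`: `τ` is a basis element of `T_H`
that is not a polynomial, and `|n| < |τ|_H + 2`. -/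
abbrev JIdx (α : ℝ) (w : Fin 2 → ℝ) : Type :=
  {p : N2 × Mon (Fin 2) // (IsTree p.2 ∨ IsPlanted p.2) ∧ len w p.1 < monHom α w p.2 + 2}

/-- `T_H⁺`, with basis `X^m ∏ 𝒥_{nᵢ}^H τᵢ`: the polynomial algebra over the `𝒥_n^H τ` and
`X_1, X_2`. -/
abbrev THPlus (α : ℝ) (w : Fin 2 → ℝ) : Type := MvPolynomial (JIdx α w ⊕ Fin 2) ℝ

open Classical in
/-- The linear map `𝒥_n^H`. It vanishes on polynomials `X^n'`, and on `τ` if `|n| ≥ |τ|_H + 2`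
(and, by convention, on monomials outside `T_H`). -/
def JH (α : ℝ) (w : Fin 2 → ℝ) (n : N2) : Alg (Fin 2) →ₗ[ℝ] THPlus α w :=
  (MvPolynomial.basisMonomials (Sym (Fin 2)) ℝ).constr ℝ fun m =>
    if h : (IsTree m ∨ IsPlanted m) ∧ len w n < monHom α w m + 2 then
      MvPolynomial.X (Sum.inl ⟨(n, m), h⟩)
    else 0

/-- `X_i ⊗ 1 + 1 ⊗ X_i` in `T_H⁺ ⊗ T_H`. -/
def deltaX (α : ℝ) (w : Fin 2 → ℝ) (i : Fin 2) : THPlus α w ⊗[ℝ] Alg (Fin 2) :=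
  1 ⊗ₜ[ℝ] MvPolynomial.X (Sym.poly i) + MvPolynomial.X (Sum.inr i) ⊗ₜ[ℝ] 1

/-- The tree `Ξ X^a ∏_{τ ∈ s} ℐ τ` as an element of the algebra. -/
def treePoly (a : N2) (s : Multiset (RTree N2)) : Alg (Fin 2) :=
  MvPolynomial.X Sym.noise * xPow a * (s.map fun τ => MvPolynomial.X (Sym.int τ)).prod

/-- `∑_k 𝒥_{n+k}^H x ⊗ X^k / k!` in `T_H⁺ ⊗ T_H`; the sum is finite, see
`finite_JH_ne_zero`. -/
def jetSum (α : ℝ) (w : Fin 2 → ℝ) (n : N2) (x : Alg (Fin 2)) :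
    THPlus α w ⊗[ℝ] Alg (Fin 2) :=
  ∑ᶠ k : N2, JH α w (n + k) x ⊗ₜ[ℝ] ((fact k : ℝ)⁻¹ • xPow k)

theorem finite_JH_ne_zero (α : ℝ) (w : Fin 2 → ℝ) (hw : ∀ i, 0 < w i) (n : N2)
    (x : Alg (Fin 2)) : {k : N2 | JH α w (n + k) x ≠ 0}.Finite := by
  have key : ∀ c : ℝ, {k : N2 | len w (n + k) < c}.Finite := by
    intro c
    refine (Set.finite_Iic (Finsupp.equivFunOnFinite.symm fun i => ⌈c / w i⌉₊ : N2)).subset ?_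
    intro k hk i
    have h1 : w i * (k i : ℝ) ≤ len w (n + k) := by
      have h2 : w i * (k i : ℝ) ≤ w i * ((n + k) i : ℝ) := by
        have : ((k i : ℕ) : ℝ) ≤ ((n + k) i : ℝ) := by simp
        exact mul_le_mul_of_nonneg_left this (hw i).le
      refine h2.trans (Finset.single_le_sum (f := fun i => w i * ((n + k) i : ℝ)) ?_
        (Finset.mem_univ i))
      exact fun j _ => mul_nonneg (hw j).le (Nat.cast_nonneg _)
    have h3 : (k i : ℝ) ≤ c / w i := by
      rw [le_div_iff₀ (hw i), mul_comm]
      exact h1.trans (le_of_lt hk)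
    have h4 : (k i : ℝ) ≤ (⌈c / w i⌉₊ : ℝ) := h3.trans (Nat.le_ceil _)
    simpa using (by exact_mod_cast h4 : k i ≤ ⌈c / w i⌉₊)
  refine (x.support.finite_toSet.biUnion fun m _ => key (monHom α w m + 2)).subset ?_
  intro k hk
  by_contra hc
  apply hk
  rw [x.as_sum, map_sum]
  refine Finset.sum_eq_zero fun m hm => ?_
  have e : MvPolynomial.monomial m (MvPolynomial.coeff m x) =
      MvPolynomial.coeff m x • MvPolynomial.basisMonomials (Sym (Fin 2)) ℝ m := by
    simp [MvPolynomial.smul_monomial]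
  rw [e, map_smul, JH, Module.Basis.constr_basis, dif_neg, smul_zero]
  intro h
  exact hc (Set.mem_biUnion hm h.2)

/-- `Δ_H ℐ τ`, by recursion on the tree `τ`. See `DeltaH_int`. -/
def deltaInt (α : ℝ) (w : Fin 2 → ℝ) : RTree N2 → THPlus α w ⊗[ℝ] Alg (Fin 2) :=
  RTree.para fun a s =>
    integ.lTensor (THPlus α w)
        ((1 ⊗ₜ[ℝ] MvPolynomial.X Sym.noise) * (∏ i, deltaX α w i ^ a i) * (s.map Prod.snd).prod)
      + jetSum α w 0 (treePoly a (s.map Prod.fst))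

/-- The comodule `Δ_H`, which is multiplicative with `Δ_H Ξ = 1 ⊗ Ξ`,
`Δ_H X_i = 1 ⊗ X_i + X_i ⊗ 1` and
`Δ_H ℐ τ = (id ⊗ ℐ) Δ_H τ + ∑_n 𝒥_n^H τ ⊗ X^n / n!`. -/
def DeltaH (α : ℝ) (w : Fin 2 → ℝ) : Alg (Fin 2) →ₐ[ℝ] THPlus α w ⊗[ℝ] Alg (Fin 2) :=
  MvPolynomial.aeval fun
    | Sym.noise => 1 ⊗ₜ[ℝ] MvPolynomial.X Sym.noise
    | Sym.poly i => deltaX α w i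
    | Sym.int τ => deltaInt α w τ

theorem DeltaH_int (α : ℝ) (w : Fin 2 → ℝ) (a : N2) (s : Multiset (RTree N2)) :
    DeltaH α w (MvPolynomial.X (Sym.int (RTree.node a s))) =
      integ.lTensor (THPlus α w) (DeltaH α w (treePoly a s)) + jetSum α w 0 (treePoly a s) := by
  have h : DeltaH α w (MvPolynomial.X (Sym.int (RTree.node a s))) =
      deltaInt α w (RTree.node a s) := by
    simp [DeltaH]
  rw [h, deltaInt, RTree.para_node]
  have h' : DeltaH α w (treePoly a s) =
      (1 ⊗ₜ[ℝ] MvPolynomial.X Sym.noise) * (∏ i, deltaX α w i ^ a i) *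
        (s.map (deltaInt α w)).prod := by
    simp [DeltaH, treePoly, xPow, map_multiset_prod, Multiset.map_map]
  rw [h']
  simp [Multiset.map_map, deltaInt]

/-- The integration maps the tree `Ξ X^a ∏_{τ ∈ s} ℐ τ` to the planted tree. -/
theorem integ_treePoly (a : N2) (s : Multiset (RTree N2)) :
    integ (treePoly a s) = MvPolynomial.X (Sym.int (RTree.node a s)) := by
  classical
  set m : Mon (Fin 2) := Finsupp.single Sym.noise 1 +
    Finsupp.mapDomain Sym.poly a + Finsupp.mapDomain Sym.int s.toFinsupp with hm
  have hint : ∀ s : Multiset (RTree N2),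
      (MvPolynomial.monomial (Finsupp.mapDomain Sym.int s.toFinsupp) 1 : Alg (Fin 2)) =
        (s.map fun τ => MvPolynomial.X (Sym.int τ)).prod := by
    intro s
    induction s using Multiset.induction_on with
    | empty => simp
    | cons τ s ih =>
      rw [Multiset.map_cons, Multiset.prod_cons, ← ih, ← Multiset.singleton_add, map_add,
        Finsupp.mapDomain_add, Multiset.toFinsupp_singleton, Finsupp.mapDomain_single,
        MvPolynomial.X, MvPolynomial.monomial_mul, one_mul]
  have hpoly : (MvPolynomial.monomial (Finsupp.mapDomain Sym.poly a) 1 : Alg (Fin 2)) =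
      xPow a := by
    rw [MvPolynomial.monomial_eq, Finsupp.prod_mapDomain_index_inj Sym.poly_injective,
      Finsupp.prod_fintype _ _ (by simp)]
    simp [xPow]
  have e : treePoly a s = MvPolynomial.basisMonomials (Sym (Fin 2)) ℝ m := by
    rw [MvPolynomial.coe_basisMonomials, treePoly, ← hint, ← hpoly, hm, MvPolynomial.X,
      MvPolynomial.monomial_mul, MvPolynomial.monomial_mul]
    simp
  have n1 : ∀ i : Fin 2, (Finsupp.mapDomain Sym.int s.toFinsupp : Mon (Fin 2)) (Sym.poly i) = 0 :=
    fun i => Finsupp.mapDomain_of_notMem_range _ _ (by rintro ⟨τ, h⟩; cases h)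
  have n2 : ∀ τ, (Finsupp.mapDomain Sym.poly a : Mon (Fin 2)) (Sym.int τ) = 0 :=
    fun τ => Finsupp.mapDomain_of_notMem_range _ _ (by rintro ⟨i, h⟩; cases h)
  have h1 : m Sym.noise = 1 := by
    have a1 : (Finsupp.mapDomain Sym.int s.toFinsupp : Mon (Fin 2)) Sym.noise = 0 :=
      Finsupp.mapDomain_of_notMem_range _ _ (by rintro ⟨τ, h⟩; cases h)
    have a2 : (Finsupp.mapDomain Sym.poly a : Mon (Fin 2)) Sym.noise = 0 :=
      Finsupp.mapDomain_of_notMem_range _ _ (by rintro ⟨i, h⟩; cases h)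
    simp [hm, a1, a2]
  have h2 : toTree m = RTree.node a s := by
    have b1 : m.comapDomain Sym.poly Sym.poly_injective.injOn = a := by
      ext i
      simp [hm, n1, Finsupp.mapDomain_apply Sym.poly_injective]
    have b2 : m.comapDomain Sym.int Sym.int_injective.injOn = s.toFinsupp := by
      ext τ
      simp [hm, n2, Finsupp.mapDomain_apply Sym.int_injective]
    rw [toTree, b1, b2, Multiset.toFinsupp_toMultiset]
  rw [e, integ, Module.Basis.constr_basis, if_pos h1, h2]

/-- The multiplicative map `Φ : T⁺ → T_H⁺` with `Φ Z^(0,(1,0)) = X_1`, `Φ Z^(0,(0,1)) = X_2` and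
`Φ 𝒥_n z_β = 𝒥_n^H φ_- z_β`, where `𝒥_n z_β = n! Z^(e_(β,n),0)` for admissible `(β, n)`. -/
def Phi (α : ℝ) (w : Fin 2 → ℝ) : TPlus α w →ₐ[ℝ] THPlus α w :=
  MvPolynomial.aeval (Sum.elim
    (fun p => (fact p.1.2 : ℝ)⁻¹ •
      JH α w p.1.2 (phiMinus (Finsupp.single ⟨p.1.1, Or.inl p.2.1⟩ 1)))
    (fun i => MvPolynomial.X (Sum.inr i)))

/-- `X^k` in `T_H⁺`. -/
def xPowPlus (α : ℝ) (w : Fin 2 → ℝ) (k : N2) : THPlus α w :=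
  ∏ i, MvPolynomial.X (Sum.inr i) ^ k i

/-- The coproduct `Δ_H⁺`, which is multiplicative with `Δ_H⁺ X_i = 1 ⊗ X_i + X_i ⊗ 1` and
`Δ_H⁺ 𝒥_n^H τ = (id ⊗ 𝒥_n^H) Δ_H τ + ∑_k 𝒥_{n+k}^H τ ⊗ X^k / k!`. -/
def DeltaHPlus (α : ℝ) (w : Fin 2 → ℝ) : THPlus α w →ₐ[ℝ] THPlus α w ⊗[ℝ] THPlus α w :=
  MvPolynomial.aeval (Sum.elim
    (fun p => (JH α w p.1.1).lTensor (THPlus α w) (DeltaH α w (MvPolynomial.monomial p.1.2 1)) +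
      ∑ᶠ k : N2, JH α w (p.1.1 + k) (MvPolynomial.monomial p.1.2 1) ⊗ₜ[ℝ]
        ((fact k : ℝ)⁻¹ • xPowPlus α w k))
    (fun i => 1 ⊗ₜ[ℝ] MvPolynomial.X (Sum.inr i) + MvPolynomial.X (Sum.inr i) ⊗ₜ[ℝ] 1))

/-- The counit of `T_H⁺`, the multiplicative functional which vanishes on the generators. -/
def epsHPlus (α : ℝ) (w : Fin 2 → ℝ) : THPlus α w →ₗ[ℝ] ℝ :=
  (MvPolynomial.aeval (fun _ => (0 : ℝ)) : THPlus α w →ₐ[ℝ] ℝ).toLinearMap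

/-! ## Hopf algebras -/

/-- The commutative algebra `A` is a Hopf algebra with coproduct `Δ`, counit `ε` and
antipode `S`. -/
structure IsHopfAlgebra {A : Type} [CommRing A] [Algebra ℝ A] (Δ : A →ₗ[ℝ] A ⊗[ℝ] A)
    (ε : A →ₗ[ℝ] ℝ) (S : A →ₗ[ℝ] A) : Prop where
  comul_one : Δ 1 = 1
  comul_mul : ∀ a b, Δ (a * b) = Δ a * Δ b
  counit_one : ε 1 = 1
  counit_mul : ∀ a b, ε (a * b) = ε a * ε b
  coassoc : TensorProduct.assoc ℝ A A A ∘ₗ Δ.rTensor A ∘ₗ Δ = Δ.lTensor A ∘ₗ Δ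
  rTensor_counit_comp_comul : ε.rTensor A ∘ₗ Δ = TensorProduct.mk ℝ ℝ A 1
  lTensor_counit_comp_comul : ε.lTensor A ∘ₗ Δ = (TensorProduct.mk ℝ A ℝ).flip 1
  mul_antipode_rTensor_comul :
    LinearMap.mul' ℝ A ∘ₗ S.rTensor A ∘ₗ Δ = Algebra.linearMap ℝ A ∘ₗ ε
  mul_antipode_lTensor_comul :
    LinearMap.mul' ℝ A ∘ₗ S.lTensor A ∘ₗ Δ = Algebra.linearMap ℝ A ∘ₗ ε

/-- The axioms are those of Mathlib's Hopf algebras. -/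
@[reducible]
def IsHopfAlgebra.toHopfAlgebra {A : Type} [CommRing A] [Algebra ℝ A] {Δ : A →ₗ[ℝ] A ⊗[ℝ] A}
    {ε : A →ₗ[ℝ] ℝ} {S : A →ₗ[ℝ] A} (h : IsHopfAlgebra Δ ε S) : HopfAlgebra ℝ A :=
  letI : Coalgebra ℝ A :=
    { comul := Δ
      counit := ε
      coassoc := h.coassoc
      rTensor_counit_comp_comul := h.rTensor_counit_comp_comul
      lTensor_counit_comp_comul := h.lTensor_counit_comp_comul }
  letI : Bialgebra ℝ A :=
    Bialgebra.mk' ℝ A h.counit_one (h.counit_mul _ _) h.comul_one (h.comul_mul _ _)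
  { antipode := S
    mul_antipode_rTensor_comul := h.mul_antipode_rTensor_comul
    mul_antipode_lTensor_comul := h.mul_antipode_lTensor_comul }

end GPAM

end

open TensorProduct

noncomputable section

namespace GPAM

attribute [local instance 100] LieRing.ofAssociativeRing

open MvPolynomial

section

/-! ## Weights on tensor products of polynomial algebras, and antipodes -/

section Weights

variable {ρ σ τ : Type}

/-! The proof does not use the Poincaré–Birkhoff–Witt theorem. It rests on a pairing of U(L) with T⁺
for which left multiplication by D ∈ L is dual to a derivation of T⁺. Let x_n(β) stand for 𝒥_n z_β /
n!, extended by x_n(e_m) = binom(m,n) X^(m-n) (`xx`). The derivation `rder D` sends x_n(β) to ∑_γ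
D_β^γ x_n(γ) and, for n = 0, adds the coefficient at β of the polynomial c with D z_k = c D^(0) z_k
(`tiltPart`). This formula is consistent on all β, not only on the generators (`rder_xxL`), and c is
a cocycle (`tiltPart_lie`). Hence D ↦ `rder D` reverses brackets (`rder_lie`) and defines the
pairing `pair`. Under it, u ↦ z^γ u D^(n) is dual to the partial derivative in the generator with
index (γ,n) (`pair_sw`), while ∂_i acts on pure powers of X as ∂/∂X_i (`coeff_rder_shift`). So the
D_(J,m) pair with the Z^(J,m) as a dual basis (`pair_DD`) and are linearly independent. They span
because products with generators can be reordered (`orderedSpan_eq_top`).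

Both coproducts are then read off by duality. Pairing the left leg of Δ with u gives the transpose
of ρ(u) (`pairL_DeltaExt`). An algebra morphism `comulT` is defined on generators by the expected
formula and shown to commute with the derivations (`derR_comulT`). It follows that ⟨u ⊗ v, `comulT`
f⟩ = ⟨uv, f⟩ (`pair_pairL_comulT`), so that `comulT` is Δ⁺, and coassociativity is the associativity
of U(L).

Finiteness and antipodes use the homogeneity with α replaced by α + 1. The generators of T⁺ and T_H⁺
then have weight at least min(1, w_1, w_2), whereas for α itself the weights are merely positive. A
polynomial bialgebra graded in this way has an antipode given by a geometric series for the
convolution product (`exists_antipode`), and bialgebra morphisms preserve antipodes automatically.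

The comodule identity comes from a generating series. The recursion for φ_- says that φ_- is the
sequence of coefficients of ∑_k z_k F^k Ξ, where F is the series of the companion φ. If a derivation
acts on F like the transpose of D up to the constant term c, then it acts on ∑_k z_k F^k Ξ exactly
like the transpose, since D z_k = (k+1) z_{k+1} c makes the sum telescope (`seriesDer_partSeries`,
`der_recM`). Together with the uniqueness statement `intertwiner_ext` this shows that (id ⊗ φ_-)Δ
obeys the recursion of φ_- (`coactM_single`). After application of Φ this is the recursion of Δ_H
φ_-, by induction on the length of β (`DeltaH_phiM_single`). Applying 𝒥_n to the result gives the
compatibility of Φ with the coproducts (`PhiPhi_cop_single`, `DeltaHPlus_comp_Phi`).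

On the side of trees, coassociativity follows by induction on trees from one lemma,
`mem_coassocSub_of_jet`, which serves ℐ and 𝒥_n alike and whose only computation is the binomial
theorem. -/

/-- The span of the tensor products of monomials of total weight `c`. -/
def wtTensor (u : σ → ℝ) (v : τ → ℝ) (c : ℝ) :
    Submodule ℝ (MvPolynomial σ ℝ ⊗[ℝ] MvPolynomial τ ℝ) :=
  Submodule.span ℝ {t | ∃ q r, Finsupp.weight u q + Finsupp.weight v r = c ∧
    t = monomial q 1 ⊗ₜ[ℝ] monomial r 1}

variable {u : σ → ℝ} {v : τ → ℝ}

theorem tmul_mem_wtTensor {q : σ →₀ ℕ} {r : τ →₀ ℕ} {c : ℝ}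
    (h : Finsupp.weight u q + Finsupp.weight v r = c) :
    (monomial q (1 : ℝ) ⊗ₜ[ℝ] monomial r (1 : ℝ)) ∈ wtTensor u v c :=
  Submodule.subset_span ⟨q, r, h, rfl⟩

theorem one_mem_wtTensor : (1 : MvPolynomial σ ℝ ⊗[ℝ] MvPolynomial τ ℝ) ∈ wtTensor u v 0 := by
  have := tmul_mem_wtTensor (u := u) (v := v) (q := 0) (r := 0) (c := 0) (by simp)
  simpa [Algebra.TensorProduct.one_def] using this

theorem mul_mem_wtTensor {a b c : ℝ} (h : a + b = c)
    {x y : MvPolynomial σ ℝ ⊗[ℝ] MvPolynomial τ ℝ} (hx : x ∈ wtTensor u v a)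
    (hy : y ∈ wtTensor u v b) : x * y ∈ wtTensor u v c := by
  induction hx using Submodule.span_induction with
  | mem x hx =>
    obtain ⟨q, r, hqr, rfl⟩ := hx
    induction hy using Submodule.span_induction with
    | mem y hy =>
      obtain ⟨q', r', hqr', rfl⟩ := hy
      rw [Algebra.TensorProduct.tmul_mul_tmul, monomial_mul, monomial_mul, one_mul]
      refine tmul_mem_wtTensor ?_
      rw [map_add, map_add]
      linarith
    | zero => simp
    | add y y' _ _ h h' => rw [mul_add]; exact add_mem h h'
    | smul t y _ h => rw [mul_smul_comm]; exact Submodule.smul_mem _ _ h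
  | zero => simp
  | add x x' _ _ h h' => rw [add_mul]; exact add_mem h h'
  | smul t x _ h => rw [smul_mul_assoc]; exact Submodule.smul_mem _ _ h

theorem pow_mem_wtTensor {a : ℝ} {x : MvPolynomial σ ℝ ⊗[ℝ] MvPolynomial τ ℝ}
    (hx : x ∈ wtTensor u v a) (k : ℕ) : x ^ k ∈ wtTensor u v (k • a) := by
  induction k with
  | zero => simpa using one_mem_wtTensor
  | succ k ih => rw [pow_succ]; exact mul_mem_wtTensor (succ_nsmul a k).symm ih hx

theorem prod_mem_wtTensor {ι : Type} (s : Finset ι) (a : ι → ℝ)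
    (x : ι → MvPolynomial σ ℝ ⊗[ℝ] MvPolynomial τ ℝ) (hx : ∀ i ∈ s, x i ∈ wtTensor u v (a i)) :
    ∏ i ∈ s, x i ∈ wtTensor u v (∑ i ∈ s, a i) := by
  classical
  induction s using Finset.induction_on with
  | empty => simpa using one_mem_wtTensor
  | insert i s hi ih =>
    rw [Finset.prod_insert hi]
    exact mul_mem_wtTensor (Finset.sum_insert hi).symm (hx i (Finset.mem_insert_self i s))
      (ih fun j hj => hx j (Finset.mem_insert_of_mem hj))

/-- An algebra morphism that respects the weights of the generators respects the weights of all
monomials. -/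
theorem map_monomial_mem_wtTensor {wt : ρ → ℝ}
    (f : MvPolynomial ρ ℝ →ₐ[ℝ] MvPolynomial σ ℝ ⊗[ℝ] MvPolynomial τ ℝ)
    (h : ∀ s, f (X s) ∈ wtTensor u v (wt s)) (p : ρ →₀ ℕ) :
    f (monomial p 1) ∈ wtTensor u v (Finsupp.weight wt p) := by
  rw [monomial_eq, map_mul, Finsupp.prod, map_prod, Finsupp.weight_apply, Finsupp.sum]
  simp only [map_one, one_mul, map_pow]
  exact prod_mem_wtTensor _ _ _ fun s _ => pow_mem_wtTensor (h s) _

/-- A linear map that vanishes on all monomials on the right of an element vanishes there. -/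
theorem lTensor_eq_zero_of_mem_wtTensor {W : Type} [AddCommGroup W] [Module ℝ W]
    (f : MvPolynomial τ ℝ →ₗ[ℝ] W) {c : ℝ} (hu : ∀ s, 0 ≤ u s)
    (hf : ∀ r, Finsupp.weight v r ≤ c → f (monomial r 1) = 0)
    {x : MvPolynomial σ ℝ ⊗[ℝ] MvPolynomial τ ℝ} (hx : x ∈ wtTensor u v c) :
    f.lTensor (MvPolynomial σ ℝ) x = 0 := by
  induction hx using Submodule.span_induction with
  | mem x hx =>
    obtain ⟨q, r, h, rfl⟩ := hx
    have hq : 0 ≤ Finsupp.weight u q := by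
      rw [Finsupp.weight_apply]
      exact Finset.sum_nonneg fun s _ => nsmul_nonneg (hu s) _
    rw [LinearMap.lTensor_tmul, hf r (by linarith), tmul_zero]
  | zero => simp
  | add x y _ _ h h' => rw [map_add, h, h', add_zero]
  | smul t x _ h => rw [map_smul, h, smul_zero]

end Weights

/-! ### Convolution inverses and antipodes of graded polynomial bialgebras -/

section Antipode

open WithConv

variable {σ : Type}

/-- The augmentation of a polynomial algebra. -/
abbrev aug (σ : Type) : MvPolynomial σ ℝ →ₐ[ℝ] ℝ := MvPolynomial.aeval (fun _ => (0 : ℝ))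

theorem weight_nonneg_of_le {wt : σ → ℝ} {δ : ℝ} (hδ : 0 < δ) (h : ∀ s, δ ≤ wt s) (p : σ →₀ ℕ) :
    0 ≤ Finsupp.weight wt p := by
  rw [Finsupp.weight_apply]
  exact Finset.sum_nonneg fun s _ => nsmul_nonneg (hδ.le.trans (h s)) _

theorem degree_mul_le_weight {wt : σ → ℝ} {δ : ℝ} (h : ∀ s, δ ≤ wt s) (p : σ →₀ ℕ) :
    p.degree * δ ≤ Finsupp.weight wt p := by
  rw [Finsupp.weight_apply, Finsupp.degree_apply, Nat.cast_sum, Finset.sum_mul]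
  refine Finset.sum_le_sum fun s _ => ?_
  simp only [nsmul_eq_mul]
  exact mul_le_mul_of_nonneg_left (h s) (Nat.cast_nonneg _)

theorem le_weight_of_ne_zero {wt : σ → ℝ} {δ : ℝ} (hδ : 0 < δ) (h : ∀ s, δ ≤ wt s) {p : σ →₀ ℕ}
    (hp : p ≠ 0) : δ ≤ Finsupp.weight wt p := by
  refine le_trans ?_ (degree_mul_le_weight h p)
  have : 1 ≤ p.degree := Nat.one_le_iff_ne_zero.2 (by rwa [Ne, Finsupp.degree_eq_zero_iff])
  have : (1 : ℝ) ≤ p.degree := by exact_mod_cast this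
  nlinarith

section Series

variable {A : Type} [CommRing A] [Algebra ℝ A]

/-- A polynomial bialgebra that is graded with generators of weight bounded below by `δ > 0`: all
convolution inverses of maps that are unital exist. -/
theorem exists_convolution_inverse [Coalgebra ℝ (MvPolynomial σ ℝ)]
    (hε : (Coalgebra.counit : MvPolynomial σ ℝ →ₗ[ℝ] ℝ) = (aug σ).toLinearMap)
    {wt : σ → ℝ} {δ : ℝ} (hδ : 0 < δ) (h : ∀ s, δ ≤ wt s)
    (hΔ : ∀ p : σ →₀ ℕ, (Coalgebra.comul (R := ℝ) (monomial p (1 : ℝ)) :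
      MvPolynomial σ ℝ ⊗[ℝ] MvPolynomial σ ℝ) ∈ wtTensor wt wt (Finsupp.weight wt p))
    (f : WithConv (MvPolynomial σ ℝ →ₗ[ℝ] A)) (hf : f 1 = 1) :
    ∃ g : WithConv (MvPolynomial σ ℝ →ₗ[ℝ] A), f * g = 1 ∧ g * f = 1 := by
  classical
  -- The inverse is the geometric series ∑ J^k. It is locally finite because J vanishes on 1.
  set J : WithConv (MvPolynomial σ ℝ →ₗ[ℝ] A) := 1 - f with hJ
  have hJ1 : J (monomial 0 1) = 0 := by
    have h1 : (1 : WithConv (MvPolynomial σ ℝ →ₗ[ℝ] A)) (1 : MvPolynomial σ ℝ) = 1 := by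
      simp [hε]
    have h2 : J (1 : MvPolynomial σ ℝ) =
      (1 : WithConv (MvPolynomial σ ℝ →ₗ[ℝ] A)) (1 : MvPolynomial σ ℝ) - f 1 := rfl
    rw [show (monomial (0 : σ →₀ ℕ) (1 : ℝ)) = 1 from rfl, h2, h1, hf, sub_self]
  -- One factor J is split off and acts on the left leg. That leg is either 1, where J vanishes, or
  -- has weight at least δ, which leaves too little weight for J^k on the right leg.
  have hpow : ∀ (k : ℕ) (p : σ →₀ ℕ), Finsupp.weight wt p < k * δ → (J ^ k) (monomial p 1) = 0 := by
    intro k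
    induction k with
    | zero =>
      intro p hp
      have := weight_nonneg_of_le hδ h p
      simp at hp
      linarith
    | succ k ih =>
      intro p hp
      rw [pow_succ', LinearMap.convMul_apply]
      have key : ∀ x ∈ wtTensor wt wt (Finsupp.weight wt p),
          LinearMap.mul' ℝ A (TensorProduct.map J.ofConv (J ^ k).ofConv x) = 0 := by
        intro x hx
        induction hx using Submodule.span_induction with
        | mem x hx =>
          obtain ⟨q, r, hqr, rfl⟩ := hx
          rw [TensorProduct.map_tmul, LinearMap.mul'_apply]
          by_cases hq : q = 0
          · subst hq
            have : J.ofConv (monomial 0 1) = 0 := hJ1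
            rw [this, zero_mul]
          · have h1 := le_weight_of_ne_zero hδ h hq
            have h2 : (J ^ k).ofConv (monomial r 1) = 0 := by
              refine ih r ?_
              push_cast at hp
              linarith
            rw [h2, mul_zero]
        | zero => simp
        | add x y _ _ h h' => rw [map_add, map_add, h, h', add_zero]
        | smul t x _ h => rw [map_smul, map_smul, h, smul_zero]
      exact key _ (hΔ p)
  have hvan : ∀ (p r : σ →₀ ℕ) (k : ℕ), ⌈Finsupp.weight wt p / δ⌉₊ + 1 ≤ k →
      Finsupp.weight wt r ≤ Finsupp.weight wt p → (J ^ k) (monomial r 1) = 0 := by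
    intro p r k hk hr
    refine hpow k r (hr.trans_lt ?_)
    rw [← div_lt_iff₀ hδ]
    refine (Nat.le_ceil _).trans_lt ?_
    exact_mod_cast Nat.lt_of_succ_le hk
  let P : ℕ → WithConv (MvPolynomial σ ℝ →ₗ[ℝ] A) := fun K => ∑ k ∈ Finset.range K, J ^ k
  have hPsucc : ∀ K, P (K + 1) = P K + J ^ K := fun K => Finset.sum_range_succ _ _
  -- The number of terms depends on the weight of the monomial, since no single partial sum inverts
  -- f. Any longer partial sum has the same value there, by `hvan`.
  let g : MvPolynomial σ ℝ →ₗ[ℝ] A := (basisMonomials σ ℝ).constr ℝ fun p =>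
    P (⌈Finsupp.weight wt p / δ⌉₊ + 1) (monomial p 1)
  have hg0 : ∀ p, g (monomial p 1) = P (⌈Finsupp.weight wt p / δ⌉₊ + 1) (monomial p 1) := by
    intro p
    have : monomial p (1 : ℝ) = basisMonomials σ ℝ p := by simp
    rw [this, Module.Basis.constr_basis, ← this]
  have hg : ∀ (p r : σ →₀ ℕ), Finsupp.weight wt r ≤ Finsupp.weight wt p →
      g (monomial r 1) = P (⌈Finsupp.weight wt p / δ⌉₊ + 1) (monomial r 1) := by
    intro p r hr
    have hle : ⌈Finsupp.weight wt r / δ⌉₊ + 1 ≤ ⌈Finsupp.weight wt p / δ⌉₊ + 1 :=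
      Nat.add_le_add_right (Nat.ceil_mono (div_le_div_of_nonneg_right hr hδ.le)) 1
    rw [hg0]
    generalize ⌈Finsupp.weight wt p / δ⌉₊ + 1 = K at hle
    induction K, hle using Nat.le_induction with
    | base => rfl
    | succ K hK ih =>
      have h2 : P (K + 1) (monomial r 1) = P K (monomial r 1) + (J ^ K) (monomial r 1) := by
        rw [hPsucc]; rfl
      rw [h2, hvan r r K hK le_rfl, add_zero, ih]
  -- Both legs of the coproduct of a monomial weigh no more than the monomial, so that one partial
  -- sum replaces g on all of them and the identity for finite geometric sums applies.
  have key : ∀ (p : σ →₀ ℕ), ∀ x ∈ wtTensor wt wt (Finsupp.weight wt p),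
      TensorProduct.map f.ofConv g x =
        TensorProduct.map f.ofConv (P (⌈Finsupp.weight wt p / δ⌉₊ + 1)).ofConv x ∧
      TensorProduct.map g f.ofConv x =
        TensorProduct.map (P (⌈Finsupp.weight wt p / δ⌉₊ + 1)).ofConv f.ofConv x := by
    intro p x hx
    induction hx using Submodule.span_induction with
    | mem x hx =>
      obtain ⟨q, r, hqr, rfl⟩ := hx
      have h1 := weight_nonneg_of_le hδ h q
      have h2 := weight_nonneg_of_le hδ h r
      rw [TensorProduct.map_tmul, TensorProduct.map_tmul, TensorProduct.map_tmul,
        TensorProduct.map_tmul, hg p q (by linarith), hg p r (by linarith)]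
      exact ⟨rfl, rfl⟩
    | zero => simp
    | add x y _ _ h h' => simp only [map_add, h.1, h'.1, h.2, h'.2, and_self]
    | smul t x _ h => simp only [map_smul, h.1, h.2, and_self]
  have hfJ : f = 1 - J := by rw [hJ, sub_sub_cancel]
  have hone : ∀ p : σ →₀ ℕ, (1 - J ^ (⌈Finsupp.weight wt p / δ⌉₊ + 1) :
      WithConv (MvPolynomial σ ℝ →ₗ[ℝ] A)) (monomial p 1) =
      (1 : WithConv (MvPolynomial σ ℝ →ₗ[ℝ] A)) (monomial p 1) := by
    intro p
    have : ∀ G : WithConv (MvPolynomial σ ℝ →ₗ[ℝ] A), (1 - G) (monomial p 1) =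
      (1 : WithConv (MvPolynomial σ ℝ →ₗ[ℝ] A)) (monomial p 1) - G (monomial p 1) := fun _ => rfl
    rw [this, hvan p p _ le_rfl le_rfl, sub_zero]
  refine ⟨toConv g, ?_, ?_⟩
  · apply ofConv_injective
    refine (basisMonomials σ ℝ).ext fun p => ?_
    simp only [coe_basisMonomials]
    refine Eq.trans ?_ (hone p)
    rw [← mul_neg_geom_sum J, ← hfJ]
    exact congrArg (LinearMap.mul' ℝ A) (key p _ (hΔ p)).1
  · apply ofConv_injective
    refine (basisMonomials σ ℝ).ext fun p => ?_
    simp only [coe_basisMonomials]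
    refine Eq.trans ?_ (hone p)
    rw [← geom_sum_mul_neg J, ← hfJ]
    exact congrArg (LinearMap.mul' ℝ A) (key p _ (hΔ p)).2

end Series

/-- A polynomial bialgebra that is graded with generators of weight bounded below by `δ > 0` is a
Hopf algebra. -/
theorem exists_antipode
    (Δ : MvPolynomial σ ℝ →ₐ[ℝ] MvPolynomial σ ℝ ⊗[ℝ] MvPolynomial σ ℝ)
    {wt : σ → ℝ} {δ : ℝ} (hδ : 0 < δ) (h : ∀ s, δ ≤ wt s)
    (hΔ : ∀ s, Δ (X s) ∈ wtTensor wt wt (wt s))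
    (hassoc : TensorProduct.assoc ℝ (MvPolynomial σ ℝ) (MvPolynomial σ ℝ) (MvPolynomial σ ℝ) ∘ₗ Δ.toLinearMap.rTensor _ ∘ₗ Δ.toLinearMap =
      Δ.toLinearMap.lTensor _ ∘ₗ Δ.toLinearMap)
    (hr : (aug σ).toLinearMap.rTensor _ ∘ₗ Δ.toLinearMap = TensorProduct.mk ℝ ℝ _ 1)
    (hl : (aug σ).toLinearMap.lTensor _ ∘ₗ Δ.toLinearMap = (TensorProduct.mk ℝ _ ℝ).flip 1) :
    ∃ S, IsHopfAlgebra Δ.toLinearMap (aug σ).toLinearMap S := by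
  let _ : Coalgebra ℝ (MvPolynomial σ ℝ) :=
    { comul := Δ.toLinearMap
      counit := (aug σ).toLinearMap
      coassoc := hassoc
      rTensor_counit_comp_comul := hr
      lTensor_counit_comp_comul := hl }
  -- The antipode is the convolution inverse of the identity.
  obtain ⟨g, h1, h2⟩ := exists_convolution_inverse (A := MvPolynomial σ ℝ) rfl hδ h
    (map_monomial_mem_wtTensor Δ hΔ) (toConv LinearMap.id) rfl
  refine ⟨g.ofConv, map_one Δ, map_mul Δ, map_one (aug σ), map_mul (aug σ), hassoc, hr, hl, ?_, ?_⟩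
  · exact congrArg ofConv h2
  · exact congrArg ofConv h1

end Antipode

/-- A morphism of bialgebras between Hopf algebras commutes with the antipodes. -/
theorem IsHopfAlgebra.map_antipode {A B : Type} [CommRing A] [Algebra ℝ A] [CommRing B]
    [Algebra ℝ B] {Δ : A →ₗ[ℝ] A ⊗[ℝ] A} {ε S : _} {Δ' : B →ₗ[ℝ] B ⊗[ℝ] B} {ε' S' : _}
    (h : IsHopfAlgebra Δ ε S) (h' : IsHopfAlgebra Δ' ε' S') (f : A →ₐ[ℝ] B)
    (hf : Δ' ∘ₗ f.toLinearMap = TensorProduct.map f.toLinearMap f.toLinearMap ∘ₗ Δ)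
    (hε : ε' ∘ₗ f.toLinearMap = ε) : f.toLinearMap ∘ₗ S = S' ∘ₗ f.toLinearMap := by
  let _ := h.toHopfAlgebra
  have mulf : ∀ G G' : A →ₗ[ℝ] A, f.toLinearMap ∘ₗ LinearMap.mul' ℝ A ∘ₗ TensorProduct.map G G' =
      LinearMap.mul' ℝ B ∘ₗ
        TensorProduct.map (f.toLinearMap ∘ₗ G) (f.toLinearMap ∘ₗ G') := by
    intro G G'; ext a a'; simp
  -- The two candidates are a left and a right convolution inverse of f, and hence equal.
  have h1 : (WithConv.toConv (f.toLinearMap ∘ₗ S) * WithConv.toConv f.toLinearMap :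
      WithConv (A →ₗ[ℝ] B)) = 1 := by
    apply WithConv.ofConv_injective
    change LinearMap.mul' ℝ B ∘ₗ TensorProduct.map (f.toLinearMap ∘ₗ S) (f.toLinearMap) ∘ₗ Δ =
      Algebra.linearMap ℝ B ∘ₗ ε
    have := congrArg (fun G => f.toLinearMap ∘ₗ G) h.mul_antipode_rTensor_comul
    rw [← LinearMap.comp_assoc] at this ⊢
    simp only [LinearMap.rTensor] at this
    have e := mulf S LinearMap.id
    rw [LinearMap.comp_id] at e
    rw [← e, LinearMap.comp_assoc, LinearMap.comp_assoc]
    refine this.trans ?_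
    ext a
    simp
  have h2 : (WithConv.toConv f.toLinearMap * WithConv.toConv (S' ∘ₗ f.toLinearMap) :
      WithConv (A →ₗ[ℝ] B)) = 1 := by
    apply WithConv.ofConv_injective
    change LinearMap.mul' ℝ B ∘ₗ TensorProduct.map f.toLinearMap (S' ∘ₗ f.toLinearMap) ∘ₗ Δ =
      Algebra.linearMap ℝ B ∘ₗ ε
    have e : TensorProduct.map f.toLinearMap (S' ∘ₗ f.toLinearMap) =
        S'.lTensor B ∘ₗ TensorProduct.map f.toLinearMap f.toLinearMap := by
      ext a a'; simp
    rw [e, LinearMap.comp_assoc, ← hf, ← hε]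
    exact congrArg (fun G => G ∘ₗ f.toLinearMap) h'.mul_antipode_lTensor_comul
  exact congrArg WithConv.ofConv (left_inv_eq_right_inv h1 h2)

end

section

/-! ## Degrees of multi-indices -/

/-- `∑_n |n| γ(n)`. -/
def plen (w : Fin 2 → ℝ) : MI →+ ℝ := Finsupp.weight (Sum.elim (fun _ => 0) fun n => len w n.1)

theorem bra_eq_weight (γ : MI) :
    bra γ = Finsupp.weight (Sum.elim (fun k : ℕ => (k : ℤ)) fun _ => -1) γ := by
  rw [bra, Finsupp.weight_apply]
  exact Finsupp.sum_congr fun v _ => by rw [nsmul_eq_mul]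

theorem hom_eq (α : ℝ) (w : Fin 2 → ℝ) (γ : MI) : hom α w γ = α * (bra γ + 1) + plen w γ := by
  rw [hom, plen, Finsupp.weight_apply]
  congr 1
  exact Finsupp.sum_congr fun v _ => by rw [nsmul_eq_mul]

theorem bra_add (β γ : MI) : bra (β + γ) = bra β + bra γ := by simp [bra_eq_weight]

@[simp] theorem bra_zero : bra 0 = 0 := by simp [bra_eq_weight]

@[simp] theorem bra_single_inl (k : ℕ) : bra (Finsupp.single (Sum.inl k) 1) = k := by
  simp [bra_eq_weight, Finsupp.weight_single]

@[simp] theorem bra_single_inr (n : N2ne) : bra (Finsupp.single (Sum.inr n) 1) = -1 := by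
  simp [bra_eq_weight, Finsupp.weight_single]

@[simp] theorem plen_single_inl (w : Fin 2 → ℝ) (k : ℕ) :
    plen w (Finsupp.single (Sum.inl k) 1) = 0 := by
  simp [plen, Finsupp.weight_single]

@[simp] theorem plen_single_inr (w : Fin 2 → ℝ) (n : N2ne) :
    plen w (Finsupp.single (Sum.inr n) 1) = len w n.1 := by
  simp [plen, Finsupp.weight_single]

theorem len_add (w : Fin 2 → ℝ) (m n : N2) : len w (m + n) = len w m + len w n := by
  simp [len, mul_add, Finset.sum_add_distrib]

@[simp] theorem len_zero (w : Fin 2 → ℝ) : len w 0 = 0 := by simp [len]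

@[simp] theorem len_single (w : Fin 2 → ℝ) (i : Fin 2) : len w (Finsupp.single i 1) = w i := by
  simp [len, Finsupp.single_apply]

theorem len_nonneg {w : Fin 2 → ℝ} (hw : ∀ i, 0 < w i) (n : N2) : 0 ≤ len w n :=
  Finset.sum_nonneg fun i _ => mul_nonneg (hw i).le (Nat.cast_nonneg _)

theorem len_mono {w : Fin 2 → ℝ} (hw : ∀ i, 0 < w i) {m n : N2} (h : m ≤ n) :
    len w m ≤ len w n := by
  rw [← add_tsub_cancel_of_le h, len_add]
  linarith [len_nonneg hw (n - m)]

theorem len_tsub_le {w : Fin 2 → ℝ} (hw : ∀ i, 0 < w i) (m n : N2) : len w (m - n) ≤ len w m :=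
  len_mono hw tsub_le_self

theorem plen_nonneg {w : Fin 2 → ℝ} (hw : ∀ i, 0 < w i) (γ : MI) : 0 ≤ plen w γ := by
  rw [plen, Finsupp.weight_apply]
  refine Finset.sum_nonneg fun v _ => nsmul_nonneg ?_ _
  rcases v with k | n
  · exact le_rfl
  · exact len_nonneg hw _

theorem bra_ePoly (n : N2ne) : bra (ePoly n) = -1 := bra_single_inr n

theorem plen_ePoly (w : Fin 2 → ℝ) (n : N2ne) : plen w (ePoly n) = len w n.1 := plen_single_inr w n

theorem ePoly_injective : Function.Injective ePoly := fun m n h => by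
  have := Finsupp.single_left_injective one_ne_zero h
  exact Sum.inr_injective this

theorem finite_len_lt {w : Fin 2 → ℝ} (hw : ∀ i, 0 < w i) (c : ℝ) : {n : N2 | len w n < c}.Finite := by
  refine (Set.finite_Iic (Finsupp.equivFunOnFinite.symm fun i => ⌈c / w i⌉₊ : N2)).subset ?_
  intro n hn i
  have h1 : w i * (n i : ℝ) ≤ len w n :=
    Finset.single_le_sum (f := fun i => w i * (n i : ℝ))
      (fun j _ => mul_nonneg (hw j).le (Nat.cast_nonneg _)) (Finset.mem_univ i)
  have h2 : (n i : ℝ) ≤ c / w i := by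
    rw [le_div_iff₀ (hw i), mul_comm]
    exact h1.trans (le_of_lt hn)
  have h4 : (n i : ℝ) ≤ (⌈c / w i⌉₊ : ℝ) := h2.trans (Nat.le_ceil _)
  simpa using (by exact_mod_cast h4 : n i ≤ ⌈c / w i⌉₊)

/-! ## The derivations -/

theorem tilt_inl (n : N2) (k : ℕ) : tilt n (X (Sum.inl k)) =
    if n = 0 then ((k : ℝ) + 1) • X (Sum.inl (k + 1)) else 0 := by
  unfold tilt
  split_ifs with h
  · simp [tiltZero]
  · rw [pderiv_X_of_ne (by simp)]

theorem tilt_inr (n : N2) (m : N2ne) :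
    tilt n (X (Sum.inr m)) = if n = m.1 then 1 else 0 := by
  unfold tilt
  by_cases h : n = 0
  · rw [dif_pos h, if_neg (fun e : n = m.1 => m.2 (e ▸ h))]
    simp [tiltZero]
  · rw [dif_neg h]
    split_ifs with e
    · have : (⟨n, h⟩ : N2ne) = m := Subtype.ext e
      rw [this, pderiv_X_self]
    · rw [pderiv_X_of_ne]
      intro e'
      exact e (congrArg Subtype.val (Sum.inr_injective e')).symm

theorem tilt_raised (n m : N2) (i : Fin 2) :
    tilt n (raised m i) = if n = m + Finsupp.single i 1 then 1 else 0 := tilt_inr _ _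

theorem shift_inl (i : Fin 2) (k : ℕ) : shift i (X (Sum.inl k)) =
    raised 0 i * (((k : ℝ) + 1) • X (Sum.inl (k + 1))) := by
  simp [shift, tiltZero]

theorem shift_inr (i : Fin 2) (n : N2ne) :
    shift i (X (Sum.inr n)) = ((n.1 i : ℝ) + 1) • raised n.1 i := by
  simp [shift]

theorem shift_raised (i j : Fin 2) (n : N2) : shift i (raised n j) =
    ((((n + Finsupp.single j 1 : N2) i : ℕ) : ℝ) + 1) • raised (n + Finsupp.single j 1) i := shift_inr _ _

theorem tilt_comm (n n' : N2) (f : Poly) : tilt n (tilt n' f) = tilt n' (tilt n f) := by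
  have h : ⁅tilt n, tilt n'⁆ = 0 := by
    refine derivation_ext fun v => ?_
    rw [Derivation.commutator_apply, Derivation.zero_apply]
    rcases v with k | m
    · rw [tilt_inl, tilt_inl]
      split_ifs <;> simp [tilt_inl, *]
    · rw [tilt_inr, tilt_inr]
      split_ifs <;> simp
  have := DFunLike.congr_fun h f
  rwa [Derivation.commutator_apply, Derivation.zero_apply, sub_eq_zero] at this

/-- A commutator of derivations is a derivation, so the variables suffice. The only coefficient of
∂_i that D^(n) with n ≠ 0 detects is the factor z_n in n_i z_n D^(n-e_i). -/
theorem tilt_shift (n : N2) (i : Fin 2) (f : Poly) : tilt n (shift i f) =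
    shift i (tilt n f) + (n i : ℝ) • tilt (n - Finsupp.single i 1) f := by
  have h : ⁅tilt n, shift i⁆ = (n i : ℝ) • tilt (n - Finsupp.single i 1) := by
    refine derivation_ext fun v => ?_
    rw [Derivation.commutator_apply, Derivation.smul_apply]
    -- If n_i = 0, which includes n = 0, the factor n_i makes the truncated difference n - e_i
    -- irrelevant.
    by_cases hi : n i = 0
    · have hne : ∀ m : N2, n ≠ m + Finsupp.single i 1 := by
        rintro m rfl
        simp at hi
      rw [hi, Nat.cast_zero, zero_smul]
      rcases v with k | m
      · rw [tilt_inl, shift_inl, Derivation.leibniz, tilt_raised, Derivation.map_smul, tilt_inl,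
          if_neg (hne _)]
        split_ifs
        · rw [Derivation.map_smul, shift_inl]
          simp only [smul_eq_mul, smul_smul, mul_smul_comm]
          rw [mul_zero, add_zero, sub_self]
        · simp
      · rw [tilt_inr, shift_inr, Derivation.map_smul, tilt_raised, if_neg (hne _)]
        split_ifs <;> simp
    · have hn : n ≠ 0 := fun h => hi (by simp [h])
      have hs : n - Finsupp.single i 1 + Finsupp.single i 1 = n :=
        tsub_add_cancel_of_le (by
          rw [Finsupp.single_le_iff]; exact Nat.one_le_iff_ne_zero.2 hi)
      have he : ∀ m, n - Finsupp.single i 1 = m ↔ n = m + Finsupp.single i 1 := by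
        intro m
        constructor
        · rintro rfl; exact hs.symm
        · rintro rfl; simp
      rcases v with k | m
      · rw [tilt_inl, if_neg hn, map_zero, sub_zero, shift_inl, Derivation.leibniz, tilt_raised,
          Derivation.map_smul, tilt_inl, if_neg hn, tilt_inl]
        simp only [he]
        split_ifs with e
        · have : (n i : ℝ) = 1 := by rw [e]; simp
          simp [this]
        · simp
      · rw [tilt_inr, shift_inr, Derivation.map_smul, tilt_raised, tilt_inr]
        simp only [he]
        split_ifs with e e' e'
        · exact absurd (DFunLike.congr_fun (e'.symm.trans e) i) (by simp)
        · have : (n i : ℝ) = m.1 i + 1 := by rw [e]; simp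
          simp [this]
        · simp
        · simp
  have := DFunLike.congr_fun h f
  rw [Derivation.commutator_apply, Derivation.smul_apply] at this
  rw [← this]; abel

/-- Both orders raise an index by e_i + e_j, and for i ≠ j the numerical factors are symmetric in i
and j. -/
theorem shift_comm (i j : Fin 2) (f : Poly) : shift i (shift j f) = shift j (shift i f) := by
  have hr : ∀ (n : N2) (i j : Fin 2),
      raised (n + Finsupp.single j 1) i = raised (n + Finsupp.single i 1) j := by
    intro n i j
    unfold raised
    congr 3
    exact add_right_comm _ _ _
  have h : ⁅shift i, shift j⁆ = 0 := by
    refine derivation_ext fun v => ?_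
    rw [Derivation.commutator_apply, Derivation.zero_apply]
    by_cases hij : i = j
    · rw [hij, sub_self]
    rcases v with k | m
    · simp only [shift_inl, Derivation.leibniz, shift_raised, Derivation.map_smul, hr 0 i j]
      simp only [smul_eq_mul, Finsupp.coe_add, Pi.add_apply, Finsupp.single_apply, if_neg hij,
        if_neg (Ne.symm hij), Algebra.smul_def]
      simp
      ring
    · simp only [shift_inr, Derivation.map_smul, shift_raised, hr m.1 i j]
      simp [Ne.symm hij, hij, smul_smul, mul_comm ((m.1 i : ℝ) + 1)]
  have := DFunLike.congr_fun h f
  rwa [Derivation.commutator_apply, Derivation.zero_apply, sub_eq_zero] at this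

/-- The derivation `z_v ↦ c_v z^(m_v)` has nonzero matrix entries only where one factor `z_v` is
replaced by `z^(m_v)`. -/
theorem coeff_monomial_derivation {D : Derivation ℝ Poly Poly} {m : Var → MI} {c : Var → ℝ}
    (hD : ∀ v, D (X v) = monomial (m v) (c v)) {β γ : MI} (h : coeff β (D (mono γ)) ≠ 0) :
    ∃ v, γ v ≠ 0 ∧ c v ≠ 0 ∧ β + Finsupp.single v 1 = γ + m v := by
  have hD' : D = mkDerivation ℝ fun v => monomial (m v) (c v) := by
    refine derivation_ext fun v => ?_
    rw [hD, mkDerivation_X]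
  rw [hD', mono, mkDerivation_monomial, one_smul, Finsupp.sum, coeff_sum] at h
  obtain ⟨v, hv, hne⟩ := Finset.exists_ne_zero_of_sum_ne_zero h
  rw [smul_eq_mul, monomial_mul, coeff_monomial] at hne
  have hγ := Finsupp.mem_support_iff.1 hv
  split_ifs at hne with e
  · refine ⟨v, hγ, right_ne_zero_of_mul hne, ?_⟩
    rw [← e, add_right_comm, tsub_add_cancel_of_le]
    rw [Finsupp.single_le_iff]
    exact Nat.one_le_iff_ne_zero.2 hγ
  · exact absurd rfl hne

/-- The relation between β and γ is put in the form of an equality of sums, because subtraction of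
multi-indices is truncated. -/
theorem coeff_tilt_ne_zero {n : N2} {β γ : MI} (h : coeff β (tilt n (mono γ)) ≠ 0) :
    (n = 0 ∧ ∃ k, γ (Sum.inl k) ≠ 0 ∧
      β + Finsupp.single (Sum.inl k) 1 = γ + Finsupp.single (Sum.inl (k + 1)) 1) ∨
    ∃ hn : n ≠ 0, γ (Sum.inr ⟨n, hn⟩) ≠ 0 ∧ β + ePoly ⟨n, hn⟩ = γ := by
  have key := coeff_monomial_derivation (D := tilt n)
    (m := Sum.elim (fun k => Finsupp.single (Sum.inl (k + 1)) 1) fun _ => 0)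
    (c := Sum.elim (fun k => if n = 0 then (k : ℝ) + 1 else 0) fun m => if n = m.1 then 1 else 0)
    (by
      rintro (k | m)
      · rw [tilt_inl]
        split_ifs with h0
        · simp [h0, X, smul_monomial]
        · simp
      · rw [tilt_inr]
        by_cases h0 : n = m.1
        · simp [h0]
        · simp [h0]) h
  obtain ⟨k | m, h1, h2, h3⟩ := key
  · left
    simp only [Sum.elim_inl, ne_eq, ite_eq_right_iff, not_forall] at h2 h3
    exact ⟨h2.1, k, h1, h3⟩
  · right
    simp only [Sum.elim_inr, ne_eq, ite_eq_right_iff, one_ne_zero, imp_false, not_not,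
      add_zero] at h2 h3
    have hn : n ≠ 0 := fun e => m.2 (h2 ▸ e)
    have hm : m = ⟨n, hn⟩ := Subtype.ext h2.symm
    subst hm
    exact ⟨hn, h1, h3⟩

/-- The index `n + e_i ≠ 0`. -/
def raise (n : N2) (i : Fin 2) : N2ne := ⟨n + Finsupp.single i 1, add_single_ne_zero n i⟩

theorem raised_eq (n : N2) (i : Fin 2) : raised n i = monomial (ePoly (raise n i)) 1 := rfl

theorem coeff_shift_ne_zero {i : Fin 2} {β γ : MI} (h : coeff β (shift i (mono γ)) ≠ 0) :
    (∃ k, γ (Sum.inl k) ≠ 0 ∧ β + Finsupp.single (Sum.inl k) 1 =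
      γ + (ePoly (raise 0 i) + Finsupp.single (Sum.inl (k + 1)) 1)) ∨
    ∃ n : N2ne, γ (Sum.inr n) ≠ 0 ∧ β + ePoly n = γ + ePoly (raise n.1 i) := by
  have key := coeff_monomial_derivation (D := shift i)
    (m := Sum.elim (fun k => ePoly (raise 0 i) + Finsupp.single (Sum.inl (k + 1)) 1)
      fun n => ePoly (raise n.1 i))
    (c := Sum.elim (fun k => (k : ℝ) + 1) fun n => (n.1 i : ℝ) + 1)
    (by
      rintro (k | m)
      · rw [shift_inl, raised_eq, X, smul_monomial, monomial_mul]
        simp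
      · rw [shift_inr, raised_eq]
        simp [smul_monomial]) h
  obtain ⟨k | m, h1, h2, h3⟩ := key
  · exact Or.inl ⟨k, h1, h3⟩
  · exact Or.inr ⟨m, h1, h3⟩

theorem coeff_mono_mul {β γ : MI} {p : Poly} (h : coeff β (mono γ * p) ≠ 0) :
    ∃ δ, β = γ + δ ∧ coeff δ p ≠ 0 := by
  rw [mono, coeff_monomial_mul'] at h
  split_ifs at h with e
  · exact ⟨β - γ, (add_tsub_cancel_of_le e).symm, by simpa using h⟩
  · exact absurd rfl h

/-- D^(0) replaces a z_k by z_{k+1}, and D^(n) removes a z_n, which counts -1. Thus [·] grows by one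
in either case. -/
theorem coeff_tilt_degrees (w : Fin 2 → ℝ) {n : N2} {β γ : MI}
    (h : coeff β (tilt n (mono γ)) ≠ 0) :
    bra β = bra γ + 1 ∧ plen w β = plen w γ - len w n := by
  rcases coeff_tilt_ne_zero h with ⟨rfl, k, -, e⟩ | ⟨hn, -, e⟩
  · have h1 := congrArg bra e
    have h2 := congrArg (plen w) e
    simp only [bra_add, bra_single_inl, map_add, plen_single_inl, add_zero] at h1 h2
    push_cast at h1
    exact ⟨by linarith, by simp [h2]⟩
  · have h1 := congrArg bra e
    have h2 := congrArg (plen w) e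
    simp only [bra_add, bra_ePoly, map_add, plen_ePoly] at h1 h2
    exact ⟨by linarith, by linarith⟩

/-- In z_{e_i} D^(0) the new polynomial variable compensates the step from k to k + 1, and z_n ↦
z_{n+e_i} does not affect [·]. -/
theorem coeff_shift_degrees (w : Fin 2 → ℝ) {i : Fin 2} {β γ : MI}
    (h : coeff β (shift i (mono γ)) ≠ 0) :
    bra β = bra γ ∧ plen w β = plen w γ + w i := by
  rcases coeff_shift_ne_zero h with ⟨k, -, e⟩ | ⟨n, -, e⟩
  · have h1 := congrArg bra e
    have h2 := congrArg (plen w) e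
    simp only [bra_add, bra_single_inl, map_add, plen_single_inl, add_zero, bra_ePoly,
      plen_ePoly, raise, len_add, len_single, len_zero] at h1 h2
    push_cast at h1
    exact ⟨by linarith, by linarith⟩
  · have h1 := congrArg bra e
    have h2 := congrArg (plen w) e
    simp only [bra_add, map_add, bra_ePoly, plen_ePoly, raise, len_add, len_single] at h1 h2
    exact ⟨by linarith, by linarith⟩

theorem genOp_inl_apply (α : ℝ) (w : Fin 2 → ℝ) (p) (f : Poly) :
    genOp α w (Sum.inl p) f = mono p.1.1 * tilt p.1.2 f := rfl

theorem genOp_inr_apply (α : ℝ) (w : Fin 2 → ℝ) (i) (f : Poly) :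
    genOp α w (Sum.inr i) f = shift i f := rfl

/-- This bigrading lies behind the stability of admissibility and the vanishing of z^γ D^(n) on
polynomial symbols below. -/
theorem coeff_genOp_degrees {α : ℝ} {w : Fin 2 → ℝ} (v : LIdx α w) {β γ : MI}
    (h : coeff β (genOp α w v (mono γ)) ≠ 0) :
    bra β = bra γ + Sum.elim (fun p => bra p.1.1 + 1) (fun _ => 0) v ∧
      plen w β = plen w γ + Sum.elim (fun p => plen w p.1.1 - len w p.1.2) w v := by
  rcases v with p | i
  · rw [genOp_inl_apply] at h
    obtain ⟨δ, rfl, hδ⟩ := coeff_mono_mul h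
    obtain ⟨h1, h2⟩ := coeff_tilt_degrees w hδ
    simp only [bra_add, map_add, Sum.elim_inl]
    exact ⟨by linarith, by linarith⟩
  · rw [genOp_inr_apply] at h
    simpa using coeff_shift_degrees w h

end

section

/-! ## Row-finite operators and their transposes -/

theorem poly_linear_eq {V : Type*} [AddCommMonoid V] [Module ℝ V] (F : Poly →ₗ[ℝ] V) (p : Poly) :
    F p = ∑ β ∈ p.support, coeff β p • F (mono β) := by
  conv_lhs => rw [p.as_sum]
  rw [map_sum]
  refine Finset.sum_congr rfl fun β _ => ?_
  rw [← F.map_smul]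
  congr 1
  simp [mono, smul_monomial]

theorem poly_hom_ext {V : Type*} [AddCommMonoid V] [Module ℝ V] {F G : Poly →ₗ[ℝ] V}
    (h : ∀ γ, F (mono γ) = G (mono γ)) : F = G :=
  LinearMap.ext fun p => by rw [poly_linear_eq F, poly_linear_eq G]; simp only [h]

theorem exists_coeff_ne_zero {F : Module.End ℝ Poly} {p : Poly} {β : MI} (h : coeff β (F p) ≠ 0) :
    ∃ δ, coeff δ p ≠ 0 ∧ coeff β (F (mono δ)) ≠ 0 := by
  rw [poly_linear_eq F, coeff_sum] at h
  obtain ⟨δ, hδ, hne⟩ := Finset.exists_ne_zero_of_sum_ne_zero h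
  rw [coeff_smul, smul_eq_mul] at hne
  exact ⟨δ, left_ne_zero_of_mul hne, right_ne_zero_of_mul hne⟩

/-- The operators with finitely many nonzero entries in every row of their matrix. -/
def rowFinite : Subalgebra ℝ (Module.End ℝ Poly) where
  carrier := {D | ∀ β, {γ | coeff β (D (mono γ)) ≠ 0}.Finite}
  mul_mem' := by
    intro D D' h h' β
    refine ((h β).biUnion fun δ _ => h' δ).subset ?_
    intro γ hγ
    obtain ⟨δ, h1, h2⟩ := exists_coeff_ne_zero (F := D) (p := D' (mono γ)) hγ
    exact Set.mem_biUnion (x := δ) h2 h1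
  add_mem' := by
    intro D D' h h' β
    refine ((h β).union (h' β)).subset ?_
    intro γ hγ
    by_contra hc
    simp only [Set.mem_union, Set.mem_ofPred_eq, not_or, not_not] at hc
    apply hγ
    rw [LinearMap.add_apply, coeff_add, hc.1, hc.2, add_zero]
  algebraMap_mem' := by
    intro r β
    refine (Set.finite_singleton β).subset ?_
    intro γ hγ
    by_contra hc
    apply hγ
    rw [Module.algebraMap_end_apply, coeff_smul, mono, coeff_monomial, if_neg (by simpa using hc), smul_zero]

/-- Finite linear combinations of all multi-indices, dual to polynomials. -/
abbrev TT : Type := MI →₀ ℝ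

/-- The pairing of `TT` with polynomials. -/
def pr : TT →ₗ[ℝ] Poly →ₗ[ℝ] ℝ := Finsupp.linearCombination ℝ fun β => MvPolynomial.lcoeff ℝ β

@[simp] theorem pr_single (β : MI) (c : ℝ) (p : Poly) : pr (Finsupp.single β c) p = c * coeff β p := by
  simp [pr]

@[simp] theorem pr_mono (t : TT) (γ : MI) : pr t (mono γ) = t γ := by
  classical
  rw [pr, Finsupp.linearCombination_apply, Finsupp.sum, LinearMap.sum_apply]
  simp only [LinearMap.smul_apply, lcoeff_apply, mono, coeff_monomial, smul_eq_mul, mul_ite,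
    mul_one, mul_zero]
  rw [Finset.sum_ite_eq]
  split_ifs with h
  · rfl
  · exact (Finsupp.notMem_support_iff.1 h).symm

open Classical in
/-- The transpose of a row-finite operator. -/
def tr (D : Module.End ℝ Poly) : TT →ₗ[ℝ] TT :=
  Finsupp.linearCombination ℝ fun β =>
    if h : {γ | coeff β (D (mono γ)) ≠ 0}.Finite then
      Finsupp.ofSupportFinite (fun γ => coeff β (D (mono γ))) h else 0

theorem tr_single {D : Module.End ℝ Poly} (hD : D ∈ rowFinite) (β γ : MI) :
    tr D (Finsupp.single β 1) γ = coeff β (D (mono γ)) := by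
  rw [tr, Finsupp.linearCombination_single, one_smul, dif_pos (hD β)]
  rfl

/-- This adjointness characterizes the transpose, since polynomials separate the points of `TT`. The
algebraic rules for `tr`, with products reversed, are read off from it. -/
theorem pr_tr {D : Module.End ℝ Poly} (hD : D ∈ rowFinite) (t : TT) (p : Poly) :
    pr (tr D t) p = pr t (D p) := by
  have h : pr ∘ₗ tr D = (LinearMap.lcomp ℝ ℝ D) ∘ₗ pr := by
    refine Finsupp.lhom_ext' fun β => LinearMap.ext_ring ?_
    refine poly_hom_ext fun γ => ?_
    simp [tr_single hD]
  exact LinearMap.congr_fun (LinearMap.congr_fun h t) p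

theorem TT_ext {s t : TT} (h : ∀ p, pr s p = pr t p) : s = t := by
  ext γ
  simpa using h (mono γ)

theorem tr_mul {D D' : Module.End ℝ Poly} (h : D ∈ rowFinite) (h' : D' ∈ rowFinite) (t : TT) :
    tr (D * D') t = tr D' (tr D t) :=
  TT_ext fun p => by
    rw [pr_tr (mul_mem h h'), pr_tr h', pr_tr h]
    rfl

theorem tr_add {D D' : Module.End ℝ Poly} (h : D ∈ rowFinite) (h' : D' ∈ rowFinite) (t : TT) :
    tr (D + D') t = tr D t + tr D' t :=
  TT_ext fun p => by
    rw [pr_tr (add_mem h h'), map_add pr, LinearMap.add_apply, LinearMap.add_apply, pr_tr h',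
      pr_tr h, map_add]

theorem tr_sub {D D' : Module.End ℝ Poly} (h : D ∈ rowFinite) (h' : D' ∈ rowFinite) (t : TT) :
    tr (D - D') t = tr D t - tr D' t :=
  TT_ext fun p => by
    rw [pr_tr (sub_mem h h'), map_sub pr, LinearMap.sub_apply, LinearMap.sub_apply, pr_tr h',
      pr_tr h, map_sub]

theorem tr_smul {D : Module.End ℝ Poly} (h : D ∈ rowFinite) (c : ℝ) (t : TT) :
    tr (c • D) t = c • tr D t :=
  TT_ext fun p => by
    rw [pr_tr (Subalgebra.smul_mem _ h c), map_smul pr, LinearMap.smul_apply, LinearMap.smul_apply,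
      pr_tr h, map_smul]

theorem tr_one (t : TT) : tr 1 t = t :=
  TT_ext fun p => by rw [pr_tr (one_mem rowFinite)]; rfl

theorem finite_single_le (β : MI) : {v : Var | Finsupp.single v 1 ≤ β}.Finite := by
  refine β.support.finite_toSet.subset fun v hv => ?_
  have := hv v
  simp only [Finsupp.single_eq_same] at this
  exact Finsupp.mem_support_iff.2 (by omega)

/-- For n = 0 a row β is reached only by producing one of the finitely many z_{k+1} in β, and this
determines the column. For n ≠ 0 the only possible column is β + e_n. -/
theorem tilt_mem_rowFinite (n : N2) : (tilt n : Poly →ₗ[ℝ] Poly) ∈ rowFinite := by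
  intro β
  by_cases hn : n = 0
  · have hf : Set.Finite {k | Finsupp.single (Sum.inl (k + 1) : Var) 1 ≤ β} :=
      (finite_single_le β).preimage fun k _ k' _ h => by simpa using h
    refine (hf.image fun k => β + Finsupp.single (Sum.inl k) 1 -
      Finsupp.single (Sum.inl (k + 1)) 1).subset fun γ hγ => ?_
    rcases coeff_tilt_ne_zero hγ with ⟨-, k, hk, e⟩ | ⟨h, -⟩
    · refine ⟨k, ?_, (tsub_eq_of_eq_add e)⟩
      have hk' := DFunLike.congr_fun e (Sum.inl (k + 1))
      simp only [Finsupp.coe_add, Pi.add_apply, Finsupp.single_eq_same] at hk'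
      rw [Finsupp.single_eq_of_ne (by simp)] at hk'
      rw [Set.mem_ofPred_eq, Finsupp.single_le_iff]
      omega
    · exact absurd hn h
  · refine (Set.finite_singleton (β + ePoly ⟨n, hn⟩)).subset fun γ hγ => ?_
    rcases coeff_tilt_ne_zero hγ with ⟨h, -⟩ | ⟨h, -, e⟩
    · exact absurd h hn
    · exact e.symm

theorem raise_injective (i : Fin 2) : Function.Injective fun n => raise n i := fun m n h => by
  have := congrArg Subtype.val h
  simpa [raise] using this

/-- The variable that an operator creates survives in β, because the variable that it removes is a
different one. -/
theorem single_le_of_add_eq {u v : Var} {β γ δ : MI} (huv : u ≠ v)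
    (h : β + Finsupp.single u 1 = γ + (δ + Finsupp.single v 1)) : Finsupp.single v 1 ≤ β := by
  have hk := DFunLike.congr_fun h v
  simp only [Finsupp.coe_add, Pi.add_apply, Finsupp.single_eq_same] at hk
  rw [Finsupp.single_eq_of_ne (Ne.symm huv)] at hk
  rw [Finsupp.single_le_iff]
  omega

theorem raise_ne (n : N2ne) (i : Fin 2) : n ≠ raise n.1 i := fun h => by
  have := DFunLike.congr_fun (congrArg Subtype.val h) i
  simp [raise] at this

/-- Although ∂_i is an infinite sum over n, each summand creates a variable that must occur in β, so
only finitely many of them contribute to a given row. -/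
theorem shift_mem_rowFinite (i : Fin 2) : (shift i : Poly →ₗ[ℝ] Poly) ∈ rowFinite := by
  intro β
  have hf : Set.Finite {k | Finsupp.single (Sum.inl (k + 1) : Var) 1 ≤ β} :=
    (finite_single_le β).preimage fun k _ k' _ h => by simpa using h
  have hf' : Set.Finite {n : N2ne | ePoly (raise n.1 i) ≤ β} :=
    (finite_single_le β).preimage fun n _ n' _ h =>
      Subtype.ext (raise_injective i (by simpa using h))
  refine ((hf.image fun k => β + Finsupp.single (Sum.inl k) 1 -
    (ePoly (raise 0 i) + Finsupp.single (Sum.inl (k + 1)) 1)).union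
    (hf'.image fun n => β + ePoly n - ePoly (raise n.1 i))).subset fun γ hγ => ?_
  rcases coeff_shift_ne_zero hγ with ⟨k, -, e⟩ | ⟨n, -, e⟩
  · exact Or.inl ⟨k, single_le_of_add_eq (by simp) e, tsub_eq_of_eq_add e⟩
  · refine Or.inr ⟨n, ?_, tsub_eq_of_eq_add e⟩
    rw [← zero_add (ePoly (raise n.1 i))] at e
    exact single_le_of_add_eq (fun h => raise_ne n i (by simpa using h)) e

theorem mulLeft_mono_mem_rowFinite (γ : MI) : LinearMap.mulLeft ℝ (mono γ) ∈ rowFinite := by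
  intro β
  refine (Set.finite_singleton (β - γ)).subset fun δ hδ => ?_
  obtain ⟨δ', rfl, h⟩ := coeff_mono_mul (p := mono δ) hδ
  rw [mono, coeff_monomial] at h
  have : δ = δ' := by_contra fun hc => h (if_neg hc)
  simp [this]

theorem genOp_mem_rowFinite (α : ℝ) (w : Fin 2 → ℝ) (v : LIdx α w) : genOp α w v ∈ rowFinite := by
  rcases v with p | i
  · exact mul_mem (mulLeft_mono_mem_rowFinite p.1.1) (tilt_mem_rowFinite p.1.2)
  · exact shift_mem_rowFinite i

/-! ## Properties inherited by `L` and `U(L)` -/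

variable {α : ℝ} {w : Fin 2 → ℝ}

/-- A property of operators that holds for the generators and is stable under linear combinations
and commutators holds on `L`. -/
theorem L_induction {P : Module.End ℝ Poly → Prop} (hgen : ∀ v, P (genOp α w v)) (h0 : P 0)
    (hadd : ∀ D ∈ L α w, ∀ D' ∈ L α w, P D → P D' → P (D + D'))
    (hsmul : ∀ (c : ℝ), ∀ D ∈ L α w, P D → P (c • D))
    (hlie : ∀ D ∈ L α w, ∀ D' ∈ L α w, P D → P D' → P ⁅D, D'⁆) {D : Module.End ℝ Poly}
    (hD : D ∈ L α w) : P D := by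
  induction hD using LieSubalgebra.lieSpan_induction with
  | mem x hx => obtain ⟨v, rfl⟩ := hx; exact hgen v
  | zero => exact h0
  | add x y hx hy h h' => exact hadd x hx y hy h h'
  | smul c x hx h => exact hsmul c x hx h
  | lie x y hx hy h h' => exact hlie x hx y hy h h'

theorem L_le_rowFinite {D : Module.End ℝ Poly} (hD : D ∈ L α w) : D ∈ rowFinite := by
  refine L_induction (P := fun D => D ∈ rowFinite) (genOp_mem_rowFinite α w) (zero_mem _)
    (fun _ _ _ _ => add_mem) (fun c _ _ h => Subalgebra.smul_mem _ h c) (fun D _ D' _ h h' => ?_) hD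
  rw [LieRing.of_associative_ring_bracket]
  exact sub_mem (mul_mem h h') (mul_mem h' h)

/-- A subspace that is stable under the generators is stable under `L`. -/
theorem L_stable {V : Submodule ℝ Poly} (h : ∀ v, ∀ p ∈ V, genOp α w v p ∈ V)
    {D : Module.End ℝ Poly} (hD : D ∈ L α w) : ∀ p ∈ V, D p ∈ V := by
  refine L_induction (P := fun D => ∀ p ∈ V, D p ∈ V) h (fun p _ => V.zero_mem)
    (fun _ _ _ _ h h' p hp => V.add_mem (h p hp) (h' p hp))
    (fun c _ _ h p hp => V.smul_mem c (h p hp)) (fun D _ D' _ h h' p hp => ?_) hD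
  rw [LieRing.of_associative_ring_bracket]
  exact V.sub_mem (h _ (h' p hp)) (h' _ (h p hp))

theorem L_leibniz {D : Module.End ℝ Poly} (hD : D ∈ L α w) :
    ∀ p q, D (p * q) = p * D q + q * D p := by
  refine L_induction (P := fun D => ∀ p q, D (p * q) = p * D q + q * D p) ?_ ?_ ?_ ?_ ?_ hD
  · rintro (p | i) f g
    · exact Derivation.leibniz (mono p.1.1 • tilt p.1.2) f g
    · exact Derivation.leibniz (shift i) f g
  · simp
  · intro D _ D' _ h h' p q
    simp only [LinearMap.add_apply, h, h']
    ring
  · intro c D _ h p q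
    simp only [LinearMap.smul_apply, h, smul_add, mul_smul_comm]
  · intro D _ D' _ h h' p q
    simp only [LieRing.of_associative_ring_bracket, LinearMap.sub_apply, Module.End.mul_apply, h,
      h', map_add]
    ring

/-- A subalgebra is closed under commutators, hence the images of the generators of the Lie span
suffice. -/
theorem lieHom_mem_of_gen {A : Type*} [Ring A] [Algebra ℝ A] (φ : L α w →ₗ⁅ℝ⁆ A)
    (S : Subalgebra ℝ A) (h : ∀ v, φ (gen α w v) ∈ S) (D : L α w) : φ D ∈ S := by
  obtain ⟨D, hD⟩ := D
  refine LieSubalgebra.lieSpan_induction (R := ℝ) (s := Set.range (genOp α w))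
    (p := fun D hD => φ ⟨D, hD⟩ ∈ S) ?_ ?_ ?_ ?_ ?_ hD
  · rintro _ ⟨v, rfl⟩
    exact h v
  · have : φ ⟨0, (L α w).zero_mem⟩ = 0 := map_zero φ
    exact this ▸ S.zero_mem
  · intro x y hx hy h h'
    have : φ ⟨x + y, (L α w).add_mem hx hy⟩ = φ ⟨x, hx⟩ + φ ⟨y, hy⟩ :=
      map_add φ ⟨x, hx⟩ ⟨y, hy⟩
    exact this ▸ S.add_mem h h'
  · intro c x hx h
    have : φ ⟨c • x, (L α w).smul_mem c hx⟩ = c • φ ⟨x, hx⟩ := map_smul φ c ⟨x, hx⟩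
    exact this ▸ S.smul_mem h c
  · intro x y hx hy h h'
    have : φ ⟨⁅x, y⁆, (L α w).lie_mem hx hy⟩ = ⁅φ ⟨x, hx⟩, φ ⟨y, hy⟩⁆ :=
      LieHom.map_lie φ ⟨x, hx⟩ ⟨y, hy⟩
    have := this.trans (LieRing.of_associative_ring_bracket _ _)
    exact this ▸ S.sub_mem (S.mul_mem h h') (S.mul_mem h' h)

/-- Induction on the enveloping algebra by multiplication with generators from the left. -/
theorem U_induction {P : U α w → Prop} (h1 : P 1) (hadd : ∀ u v, P u → P v → P (u + v))
    (hsmul : ∀ (c : ℝ) u, P u → P (c • u))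
    (hmul : ∀ (v : LIdx α w) u, P u → P (emb α w (gen α w v) * u)) (u : U α w) : P u := by
  let V : Submodule ℝ (U α w) :=
    { carrier := {u | P u}
      add_mem' := fun {u v} => hadd u v
      zero_mem' := by have := hsmul 0 1 h1; rwa [zero_smul] at this
      smul_mem' := fun c u => hsmul c u }
  -- Stability under left multiplication defines a subalgebra, and it contains the image of L once
  -- it contains the generators.
  let S : Subalgebra ℝ (U α w) :=
    { carrier := {u | ∀ x ∈ V, u * x ∈ V}
      mul_mem' := fun {u v} h h' x hx => by rw [mul_assoc]; exact h _ (h' x hx)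
      add_mem' := fun {u v} h h' x hx => by rw [add_mul]; exact V.add_mem (h x hx) (h' x hx)
      algebraMap_mem' := fun r x hx => by
        rw [← Algebra.smul_def]; exact V.smul_mem r hx }
  have hemb : ∀ D : L α w, emb α w D ∈ S :=
    lieHom_mem_of_gen (emb α w) S fun v x hx => hmul v x hx
  let g : L α w →ₗ⁅ℝ⁆ S :=
    { toFun := fun D => ⟨emb α w D, hemb D⟩
      map_add' := fun D D' => Subtype.ext (map_add (emb α w) D D')
      map_smul' := fun c D => Subtype.ext (map_smul (emb α w) c D)
      map_lie' := fun {D D'} => Subtype.ext (LieHom.map_lie (emb α w) D D') }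
  -- The embedding of L factors through S, and by the universal property the resulting map U(L) → S
  -- → U(L) is the identity. Hence S is everything.
  have hid : S.val.comp (UniversalEnvelopingAlgebra.lift ℝ g) = AlgHom.id ℝ (U α w) := by
    apply UniversalEnvelopingAlgebra.hom_ext
    apply LieHom.ext
    intro D
    simp only [LieHom.coe_comp, Function.comp_apply, AlgHom.coe_toLieHom, AlgHom.comp_apply,
      UniversalEnvelopingAlgebra.lift_ι_apply]
    rfl
  have hu : u ∈ S := by
    have := DFunLike.congr_fun hid u
    rw [AlgHom.comp_apply, AlgHom.id_apply] at this
    rw [← this]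
    exact (UniversalEnvelopingAlgebra.lift ℝ g u).2
  have := hu 1 h1
  rwa [mul_one] at this

theorem rho_emb (D : L α w) : rho α w (emb α w D) = D :=
  UniversalEnvelopingAlgebra.lift_ι_apply ℝ (L α w).incl D

theorem rho_mem_rowFinite (u : U α w) : rho α w u ∈ rowFinite := by
  refine U_induction (P := fun u => rho α w u ∈ rowFinite) ?_ ?_ ?_ ?_ u
  · rw [map_one]; exact one_mem _
  · intro u v h h'; rw [map_add]; exact add_mem h h'
  · intro c u h; rw [map_smul]; exact Subalgebra.smul_mem _ h c
  · intro v u h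
    rw [map_mul, rho_emb]
    exact mul_mem (genOp_mem_rowFinite α w v) h

end

section

variable {α : ℝ} {w : Fin 2 → ℝ}

/-! ## Admissible polynomials and the elements `p D^(n)` of `L` -/

/-- The polynomials `p` all of whose monomials `z^γ` are admissible with `n`. -/
def admSub (α : ℝ) (w : Fin 2 → ℝ) (n : N2) : Submodule ℝ Poly where
  carrier := {p | ∀ β, coeff β p ≠ 0 → Admissible α w β n}
  add_mem' := by
    intro p q hp hq β h
    by_contra hc
    apply h
    rw [coeff_add, not_not.1 (mt (hp β) hc), not_not.1 (mt (hq β) hc), add_zero]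
  zero_mem' := fun β h => absurd (coeff_zero β) h
  smul_mem' := by
    intro c p hp β h
    rw [coeff_smul] at h
    exact hp β (right_ne_zero_of_mul h)

theorem mono_mem_admSub {γ : MI} {n : N2} (h : Admissible α w γ n) : mono γ ∈ admSub α w n := by
  intro β hβ
  rw [mono, coeff_monomial] at hβ
  have : γ = β := by_contra fun hc => hβ (if_neg hc)
  exact this ▸ h

theorem admSub_le (hw : ∀ i, 0 < w i) {m n : N2} (h : m ≤ n) : admSub α w n ≤ admSub α w m :=
  fun _ hp β hβ => ⟨(hp β hβ).1, (len_mono hw h).trans_lt (hp β hβ).2⟩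

/-- The operator z^γ' D^(n') raises the homogeneity by |γ'| - |n'| > 0, and ∂_i raises it by w_i >
0. Neither lowers [·]. -/
theorem admissible_of_coeff_genOp (hw : ∀ i, 0 < w i) (v : LIdx α w) {β γ : MI} {n : N2}
    (hγ : Admissible α w γ n) (h : coeff β (genOp α w v (mono γ)) ≠ 0) : Admissible α w β n := by
  obtain ⟨h1, h2⟩ := coeff_genOp_degrees v h
  obtain ⟨h3, h4⟩ := hγ
  rw [Admissible, hom_eq, h1, h2]
  rw [hom_eq] at h4
  rcases v with ⟨⟨γ', n'⟩, h5, h6⟩ | i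
  · rw [hom_eq] at h6
    simp only at h5 h6
    simp only [Sum.elim_inl, Int.cast_add, Int.cast_one]
    exact ⟨by linarith, by linarith⟩
  · simp only [Sum.elim_inr, add_zero]
    exact ⟨h3, by linarith [hw i]⟩

theorem L_admSub (hw : ∀ i, 0 < w i) {D : Module.End ℝ Poly} (hD : D ∈ L α w) {n : N2} :
    ∀ p ∈ admSub α w n, D p ∈ admSub α w n := by
  refine L_stable (V := admSub α w n) (fun v p hp => ?_) hD
  intro β hβ
  obtain ⟨γ, h1, h2⟩ := exists_coeff_ne_zero hβ
  exact admissible_of_coeff_genOp hw v (hp γ h1) h2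

/-- The operator `p D^(n)`. -/
def tiltMul (p : Poly) (n : N2) : Module.End ℝ Poly :=
  ((p • tilt n : Derivation ℝ Poly Poly) : Poly →ₗ[ℝ] Poly)

theorem tiltMul_apply (p : Poly) (n : N2) (f : Poly) : tiltMul p n f = p * tilt n f := rfl

theorem tiltMul_eq_sum (p : Poly) (n : N2) :
    tiltMul p n = ∑ γ ∈ p.support, coeff γ p • tiltMul (mono γ) n := by
  refine LinearMap.ext fun f => ?_
  rw [LinearMap.sum_apply]
  conv_lhs => rw [tiltMul_apply, p.as_sum, Finset.sum_mul]
  refine Finset.sum_congr rfl fun γ _ => ?_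
  rw [LinearMap.smul_apply, tiltMul_apply, ← smul_mul_assoc]
  simp [mono, smul_monomial]

theorem tiltMul_mem {p : Poly} {n : N2} (hp : p ∈ admSub α w n) : tiltMul p n ∈ L α w := by
  rw [tiltMul_eq_sum]
  refine (L α w).toSubmodule.sum_mem fun γ hγ => (L α w).smul_mem _ ?_
  exact (gen α w (Sum.inl ⟨(γ, n), hp γ (mem_support_iff.1 hγ)⟩)).2

theorem base_mono {γ : MI} {n : N2} (h : Admissible α w γ n) :
    base α w n (mono γ) = emb α w (gen α w (Sum.inl ⟨(γ, n), h⟩)) := by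
  have e : mono γ = MvPolynomial.basisMonomials Var ℝ γ := by simp [mono]
  rw [base, e, Module.Basis.constr_basis, dif_pos h]

/-- On admissible polynomials the default value 0 in `base` is never met, so that `base` really is p
↦ p D^(n) with values in L. -/
theorem base_eq {p : Poly} {n : N2} (hp : p ∈ admSub α w n) :
    base α w n p = emb α w ⟨tiltMul p n, tiltMul_mem hp⟩ := by
  have h : (⟨tiltMul p n, tiltMul_mem hp⟩ : L α w) = ∑ γ ∈ p.support.attach,
      coeff γ.1 p • gen α w (Sum.inl ⟨(γ.1, n), hp γ.1 (mem_support_iff.1 γ.2)⟩) := by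
    apply Subtype.ext
    refine (tiltMul_eq_sum p n).trans ?_
    rw [← Finset.sum_attach]
    refine Eq.trans ?_ (map_sum (L α w).toSubmodule.subtype _ _).symm
    rfl
  rw [h, map_sum, poly_linear_eq (base α w n), ← Finset.sum_attach]
  refine Finset.sum_congr rfl fun γ _ => ?_
  rw [map_smul, base_mono]

theorem emb_mul_sub (D D' : L α w) :
    emb α w D * emb α w D' - emb α w D' * emb α w D = emb α w ⁅D, D'⁆ := by
  rw [LieHom.map_lie, LieRing.of_associative_ring_bracket]

/-- The second-order terms cancel because D^(n) and D^(n') commute. -/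
theorem lie_tiltMul (p q : Poly) (n n' : N2) : ⁅tiltMul q n', tiltMul p n⁆ =
    tiltMul (tiltMul q n' p) n - tiltMul (tiltMul p n q) n' := by
  refine LinearMap.ext fun f => ?_
  rw [LieRing.of_associative_ring_bracket]
  simp only [LinearMap.sub_apply, Module.End.mul_apply, tiltMul_apply, Derivation.leibniz,
    smul_eq_mul]
  rw [tilt_comm n n']
  ring

theorem lie_shift_tiltMul (i : Fin 2) (p : Poly) (n : N2) :
    ⁅(shift i : Poly →ₗ[ℝ] Poly), tiltMul p n⁆ =
      tiltMul (shift i p) n - (n i : ℝ) • tiltMul p (n - Finsupp.single i 1) := by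
  refine LinearMap.ext fun f => ?_
  rw [LieRing.of_associative_ring_bracket]
  simp only [LinearMap.sub_apply, Module.End.mul_apply, tiltMul_apply, Derivation.leibniz,
    smul_eq_mul, LinearMap.smul_apply, Derivation.coeFn_coe]
  rw [tilt_shift n i f, mul_add, mul_smul_comm]
  ring

/-! ## The maps `u ↦ p u D^(n)` -/

/-- The map `p ↦ p u D^(n)`. -/
def sw (α : ℝ) (w : Fin 2 → ℝ) (n : N2) : U α w →ₗ[ℝ] Poly →ₗ[ℝ] U α w :=
  (LinearMap.applyₗ (base α w n)) ∘ₗ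
    (UniversalEnvelopingAlgebra.lift ℝ (homAct α w)).toLinearMap

theorem sw_one (n : N2) (p : Poly) : sw α w n 1 p = base α w n p := by
  rw [sw, LinearMap.comp_apply, AlgHom.toLinearMap_apply, map_one]
  rfl

theorem sw_emb_mul (n : N2) (D : L α w) (u : U α w) (p : Poly) :
    sw α w n (emb α w D * u) p =
      emb α w D * sw α w n u p - sw α w n u ((D : Module.End ℝ Poly) p) := by
  have : UniversalEnvelopingAlgebra.lift ℝ (homAct α w) (emb α w D) = homAct α w D :=
    UniversalEnvelopingAlgebra.lift_ι_apply ℝ (homAct α w) D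
  simp only [sw, LinearMap.comp_apply, AlgHom.toLinearMap_apply, map_mul, this]
  rfl

theorem sw_emb (n : N2) (D : L α w) (p : Poly) : sw α w n (emb α w D) p =
    emb α w D * base α w n p - base α w n ((D : Module.End ℝ Poly) p) := by
  have := sw_emb_mul n D 1 p
  rwa [mul_one, sw_one, sw_one] at this

theorem gen_coe (v : LIdx α w) : ((gen α w v : L α w) : Module.End ℝ Poly) = genOp α w v := rfl

/-- For u = 1 the claim is the formula for the bracket of p D^(n) and q D^(n'). Multiplication of u
with a generator from the left changes both sides by the same expression, which is symmetric in the
two pairs. -/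
theorem sw_comm (hw : ∀ i, 0 < w i) {n n' : N2} (u : U α w) : ∀ p ∈ admSub α w n,
    ∀ q ∈ admSub α w n', sw α w n (sw α w n' u q) p = sw α w n' (sw α w n u p) q := by
  refine U_induction (P := fun u => ∀ p ∈ admSub α w n, ∀ q ∈ admSub α w n',
    sw α w n (sw α w n' u q) p = sw α w n' (sw α w n u p) q) ?_ ?_ ?_ ?_ u
  · intro p hp q hq
    rw [sw_one, sw_one, base_eq hp, base_eq hq, sw_emb, sw_emb, base_eq hp, base_eq hq,
      base_eq (L_admSub hw (tiltMul_mem hp) q hq), base_eq (L_admSub hw (tiltMul_mem hq) p hp)]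
    have h := emb_mul_sub (α := α) (w := w) ⟨_, tiltMul_mem hq⟩ ⟨_, tiltMul_mem hp⟩
    have e : ⁅(⟨_, tiltMul_mem hq⟩ : L α w), (⟨_, tiltMul_mem hp⟩ : L α w)⁆ =
        ⟨_, tiltMul_mem (L_admSub hw (tiltMul_mem hq) p hp)⟩ -
          ⟨_, tiltMul_mem (L_admSub hw (tiltMul_mem hp) q hq)⟩ :=
      Subtype.ext (lie_tiltMul p q n n')
    rw [e, map_sub] at h
    rw [sub_eq_sub_iff_add_eq_add] at h ⊢
    rw [h, add_comm]
  · intro u v h h' p hp q hq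
    simp only [map_add, LinearMap.add_apply, h p hp q hq, h' p hp q hq]
  · intro c u h p hp q hq
    simp only [map_smul, LinearMap.smul_apply, h p hp q hq]
  · intro v u h p hp q hq
    have hv := (gen α w v).2
    simp only [sw_emb_mul, map_sub, LinearMap.sub_apply, h p hp q hq,
      h _ (L_admSub hw hv p hp) q hq, h p hp _ (L_admSub hw hv q hq)]
    abel

/-- This is [D^(n), ∂_i] = n_i D^(n-e_i) inside the sandwich. It serves to move ∂_i from the outside
to the inside. -/
theorem sw_mul_shift (hw : ∀ i, 0 < w i) (n : N2) (i : Fin 2) (u : U α w) :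
    ∀ p ∈ admSub α w n, sw α w n (u * emb α w (gen α w (Sum.inr i))) p =
      sw α w n u p * emb α w (gen α w (Sum.inr i)) -
        (n i : ℝ) • sw α w (n - Finsupp.single i 1) u p := by
  refine U_induction (P := fun u => ∀ p ∈ admSub α w n,
    sw α w n (u * emb α w (gen α w (Sum.inr i))) p =
      sw α w n u p * emb α w (gen α w (Sum.inr i)) -
        (n i : ℝ) • sw α w (n - Finsupp.single i 1) u p) ?_ ?_ ?_ ?_ u
  · intro p hp
    have hp' := admSub_le hw (m := n - Finsupp.single i 1) tsub_le_self hp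
    have hs := L_admSub hw (gen α w (Sum.inr i)).2 p hp
    rw [one_mul, sw_one, sw_one, sw_emb, base_eq hp, base_eq hp', base_eq hs]
    have h := emb_mul_sub (gen α w (Sum.inr i)) ⟨_, tiltMul_mem hp⟩
    have e : ⁅gen α w (Sum.inr i), (⟨_, tiltMul_mem hp⟩ : L α w)⁆ =
        ⟨_, tiltMul_mem hs⟩ - (n i : ℝ) • ⟨_, tiltMul_mem hp'⟩ :=
      Subtype.ext (lie_shift_tiltMul i p n)
    rw [e, map_sub, map_smul] at h
    rw [sub_eq_iff_eq_add] at h ⊢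
    rw [h]
    abel
  · intro u v h h' p hp
    simp only [map_add, LinearMap.add_apply, add_mul, h p hp, h' p hp, smul_add]
    abel
  · intro c u h p hp
    simp only [map_smul, LinearMap.smul_apply, smul_mul_assoc, h p hp, smul_sub]
    rw [smul_comm c (n i : ℝ)]
  · intro v u h p hp
    have hv := L_admSub hw (gen α w v).2 p hp
    simp only [mul_assoc, sw_emb_mul, h p hp, h _ hv, mul_sub, sub_mul, smul_sub,
      mul_smul_comm]
    abel

/-- By the Leibniz rule D(p g) = p D g + (D p) g, and the term subtracted in the recursion removes
(D p) g. Under ρ the sandwich thus becomes an honest product of operators. -/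
theorem rho_sw (hw : ∀ i, 0 < w i) (n : N2) (u : U α w) :
    ∀ p ∈ admSub α w n, ∀ f, rho α w (sw α w n u p) f = p * rho α w u (tilt n f) := by
  refine U_induction (P := fun u => ∀ p ∈ admSub α w n, ∀ f,
    rho α w (sw α w n u p) f = p * rho α w u (tilt n f)) ?_ ?_ ?_ ?_ u
  · intro p hp f
    rw [sw_one, base_eq hp, rho_emb, map_one]
    rfl
  · intro u v h h' p hp f
    simp only [map_add, LinearMap.add_apply, h p hp, h' p hp, mul_add]
  · intro c u h p hp f
    simp only [map_smul, LinearMap.smul_apply, h p hp, mul_smul_comm]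
  · intro v u h p hp f
    rw [sw_emb_mul, map_sub, map_mul, map_mul, rho_emb, LinearMap.sub_apply, Module.End.mul_apply,
      Module.End.mul_apply, h p hp, h _ (L_admSub hw (gen α w v).2 p hp),
      L_leibniz (gen α w v).2, mul_comm _ ((gen α w v : Module.End ℝ Poly) p), add_sub_cancel_right]

/-! ## The elements `D_(J,m)` span the enveloping algebra -/

/-- The admissible pairs. -/
abbrev AIdx (α : ℝ) (w : Fin 2 → ℝ) : Type := {p : MI × N2 // Admissible α w p.1 p.2}

/-- The element `∂₁^m₁ ∂₂^m₂`. -/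
def shiftPow (α : ℝ) (w : Fin 2 → ℝ) (m : N2) : U α w :=
  emb α w (gen α w (Sum.inr 0)) ^ m 0 * emb α w (gen α w (Sum.inr 1)) ^ m 1

theorem sandwichList_cons (a : AIdx α w) (l : List (AIdx α w)) (u : U α w) :
    sandwichList α w (a :: l) u = sw α w a.1.2 (sandwichList α w l u) (mono a.1.1) := rfl

theorem sandwichList_perm (hw : ∀ i, 0 < w i) {l l' : List (AIdx α w)} (h : l.Perm l') (u : U α w) :
    sandwichList α w l u = sandwichList α w l' u := by
  induction h with
  | nil => rfl
  | cons a _ ih => rw [sandwichList_cons, sandwichList_cons, ih]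
  | swap a b l =>
    simp only [sandwichList_cons]
    exact sw_comm hw _ _ (mono_mem_admSub b.2) _ (mono_mem_admSub a.2)
  | trans _ _ h h' => exact h.trans h'

theorem shift_gen_comm (i j : Fin 2) : Commute (emb α w (gen α w (Sum.inr i)))
    (emb α w (gen α w (Sum.inr j))) := by
  have e : ⁅gen α w (Sum.inr i), gen α w (Sum.inr j)⁆ = 0 := by
    apply Subtype.ext
    refine LinearMap.ext fun f => ?_
    change (shift i (shift j f)) - (shift j (shift i f)) = 0
    rw [shift_comm, sub_self]
  have h := emb_mul_sub (gen α w (Sum.inr i)) (gen α w (Sum.inr j))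
  rw [e, map_zero, sub_eq_zero] at h
  exact h

theorem shiftPow_add_single (m : N2) (i : Fin 2) : shiftPow α w (m + Finsupp.single i 1) =
    shiftPow α w m * emb α w (gen α w (Sum.inr i)) := by
  fin_cases i
  · simp [shiftPow, pow_succ, mul_assoc]
    rw [((shift_gen_comm 0 1).pow_right _).eq]
  · simp [shiftPow, pow_succ, mul_assoc]

theorem shiftPow_add_single' (m : N2) (i : Fin 2) : shiftPow α w (m + Finsupp.single i 1) =
    emb α w (gen α w (Sum.inr i)) * shiftPow α w m := by
  rw [shiftPow_add_single]
  exact (((shift_gen_comm 0 i).pow_left _).mul_left ((shift_gen_comm 1 i).pow_left _)).eq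

theorem shiftPow_zero : shiftPow α w 0 = 1 := by simp [shiftPow]

/-- Induction on `ℕ₀²`. -/
theorem N2_induction {P : N2 → Prop} (h0 : P 0) (h : ∀ m i, P m → P (m + Finsupp.single i 1))
    (m : N2) : P m := by
  induction m using Finsupp.induction_linear with
  | zero => exact h0
  | single i k =>
    induction k with
    | zero => simpa using h0
    | succ k ih => rw [Finsupp.single_add]; exact h _ _ ih
  | add f g hf hg =>
    clear hg
    revert f
    induction g using Finsupp.induction with
    | zero => intro f hf; simpa using hf
    | single_add i k g _ hk ih =>
      clear hk
      intro f hf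
      rw [← add_assoc]
      apply ih
      clear ih
      induction k with
      | zero => simpa using hf
      | succ k ih => rw [Finsupp.single_add, ← add_assoc]; exact h _ _ (ih)

/-- The span of the elements `z^γ₁ ⋯ z^γₖ ∂^m D^(nₖ) ⋯ D^(n₁)`. -/
def orderedSpan (α : ℝ) (w : Fin 2 → ℝ) : Submodule ℝ (U α w) :=
  Submodule.span ℝ (Set.range fun x : List (AIdx α w) × N2 =>
    sandwichList α w x.1 (shiftPow α w x.2))

theorem sandwichList_mem (l : List (AIdx α w)) (m : N2) :
    sandwichList α w l (shiftPow α w m) ∈ orderedSpan α w :=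
  Submodule.subset_span ⟨(l, m), rfl⟩

theorem sw_mono_mem_orderedSpan (a : AIdx α w) {u : U α w} (hu : u ∈ orderedSpan α w) :
    sw α w a.1.2 u (mono a.1.1) ∈ orderedSpan α w := by
  induction hu using Submodule.span_induction with
  | mem u hu => obtain ⟨⟨l, m⟩, rfl⟩ := hu; exact sandwichList_mem (a :: l) m
  | zero => rw [map_zero]; exact Submodule.zero_mem _
  | add u v _ _ h h' => rw [map_add]; exact Submodule.add_mem _ h h'
  | smul c u _ h => rw [map_smul]; exact Submodule.smul_mem _ c h

theorem sw_mem_orderedSpan {n : N2} {p : Poly} (hp : p ∈ admSub α w n) {u : U α w}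
    (hu : u ∈ orderedSpan α w) : sw α w n u p ∈ orderedSpan α w := by
  rw [poly_linear_eq]
  exact Submodule.sum_mem _ fun γ hγ => Submodule.smul_mem _ _
    (sw_mono_mem_orderedSpan ⟨(γ, n), hp γ (mem_support_iff.1 hγ)⟩ hu)

/-- Moving D^(n) to the right of the ∂_i keeps γ and only lowers n, so all pairs that arise remain
admissible. -/
theorem gen_mul_shiftPow_mem (hw : ∀ i, 0 < w i) (a : AIdx α w) (m : N2) :
    emb α w (gen α w (Sum.inl a)) * shiftPow α w m ∈
      Submodule.span ℝ (Set.range fun x : {n : N2 // Admissible α w a.1.1 n} × N2 =>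
        sw α w x.1.1 (shiftPow α w x.2) (mono a.1.1)) := by
  induction m using N2_induction with
  | h0 =>
    refine Submodule.subset_span ⟨(⟨a.1.2, a.2⟩, 0), ?_⟩
    change sw α w a.1.2 (shiftPow α w 0) (mono a.1.1) = _
    rw [shiftPow_zero, mul_one, sw_one, base_mono a.2]
  | h m i ih =>
    rw [shiftPow_add_single, ← mul_assoc]
    generalize emb α w (gen α w (Sum.inl a)) * shiftPow α w m = x at ih
    induction ih using Submodule.span_induction with
    | mem u hu =>
      obtain ⟨⟨⟨n, hn⟩, m⟩, rfl⟩ := hu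
      have h := sw_mul_shift hw n i (shiftPow α w m) _ (mono_mem_admSub hn)
      rw [← shiftPow_add_single, eq_sub_iff_add_eq] at h
      change sw α w n (shiftPow α w m) (mono a.1.1) * _ ∈ _
      rw [← h]
      refine Submodule.add_mem _ (Submodule.subset_span ⟨(⟨n, hn⟩, _), rfl⟩)
        (Submodule.smul_mem _ _ (Submodule.subset_span ⟨(⟨n - Finsupp.single i 1, ?_⟩, _), rfl⟩))
      exact ⟨hn.1, (len_tsub_le hw _ _).trans_lt hn.2⟩
    | zero => rw [zero_mul]; exact Submodule.zero_mem _
    | add u v _ _ h h' => rw [add_mul]; exact Submodule.add_mem _ h h'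
    | smul c u _ h => rw [smul_mul_assoc]; exact Submodule.smul_mem _ c h

/-- The recursion is solved for the product: D (z^γ u D^(n)) = z^γ (D u) D^(n) + (D z^γ) u D^(n). In
both terms the list inside is shorter, which allows induction. -/
theorem gen_mul_sandwichList_mem (hw : ∀ i, 0 < w i) (v : LIdx α w) (l : List (AIdx α w)) (m : N2) :
    emb α w (gen α w v) * sandwichList α w l (shiftPow α w m) ∈ orderedSpan α w := by
  induction l with
  | nil =>
    change emb α w (gen α w v) * shiftPow α w m ∈ orderedSpan α w
    rcases v with a | i
    · refine Submodule.span_le.2 ?_ (gen_mul_shiftPow_mem hw a m)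
      rintro _ ⟨⟨⟨n, hn⟩, m⟩, rfl⟩
      exact sandwichList_mem [⟨(a.1.1, n), hn⟩] m
    · rw [← shiftPow_add_single']
      exact sandwichList_mem [] _
  | cons a l ih =>
    have h := sw_emb_mul a.1.2 (gen α w v) (sandwichList α w l (shiftPow α w m)) (mono a.1.1)
    rw [eq_sub_iff_add_eq] at h
    rw [sandwichList_cons, ← h]
    exact Submodule.add_mem _ (sw_mem_orderedSpan (mono_mem_admSub a.2) ih)
      (sw_mem_orderedSpan (L_admSub hw (gen α w v).2 _ (mono_mem_admSub a.2))
        (sandwichList_mem l m))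

theorem orderedSpan_eq_top (hw : ∀ i, 0 < w i) : orderedSpan α w = ⊤ := by
  refine eq_top_iff.2 fun u _ => ?_
  refine U_induction (P := fun u => u ∈ orderedSpan α w) ?_ (fun _ _ => Submodule.add_mem _)
    (fun c _ => Submodule.smul_mem _ c) (fun v u hu => ?_) u
  · have := sandwichList_mem (α := α) (w := w) [] 0
    rwa [shiftPow_zero] at this
  · induction hu using Submodule.span_induction with
    | mem u hu => obtain ⟨⟨l, m⟩, rfl⟩ := hu; exact gen_mul_sandwichList_mem hw v l m
    | zero => rw [mul_zero]; exact Submodule.zero_mem _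
    | add u v _ _ h h' => rw [mul_add]; exact Submodule.add_mem _ h h'
    | smul c u _ h => rw [mul_smul_comm]; exact Submodule.smul_mem _ c h

/-- The parts `J` and `m` of an index `(J, m)`. -/
def partJ (p : PIdx α w) : AIdx α w →₀ ℕ := p.comapDomain Sum.inl Sum.inl_injective.injOn

/-- The part `m` of an index `(J, m)`. -/
def partM (p : PIdx α w) : N2 := p.comapDomain Sum.inr Sum.inr_injective.injOn

theorem DD_eq (p : PIdx α w) : DD α w p = (p.prod fun _ e => (e.factorial : ℝ))⁻¹ •
    sandwichList α w (Finsupp.toMultiset (partJ p)).toList (shiftPow α w (partM p)) := rfl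

theorem prod_factorial_ne_zero {ι : Type} (p : ι →₀ ℕ) :
    (p.prod fun _ e => (e.factorial : ℝ)) ≠ 0 :=
  Finset.prod_ne_zero_iff.2 fun _ _ => Nat.cast_ne_zero.2 (Nat.factorial_ne_zero _)

theorem span_DD (hw : ∀ i, 0 < w i) : Submodule.span ℝ (Set.range (DD α w)) = ⊤ := by
  classical
  rw [eq_top_iff, ← orderedSpan_eq_top hw, orderedSpan, Submodule.span_le]
  rintro _ ⟨⟨l, m⟩, rfl⟩
  let p : PIdx α w := Finsupp.sumElim (Multiset.toFinsupp (l : Multiset (AIdx α w))) m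
  have h1 : partJ p = Multiset.toFinsupp (l : Multiset (AIdx α w)) := by
    ext a; simp [partJ, p]
  have h2 : partM p = m := by
    ext i; simp [partM, p]
  have h := DD_eq p
  rw [h1, h2, Multiset.toFinsupp_toMultiset, eq_inv_smul_iff₀ (prod_factorial_ne_zero p)] at h
  have h3 : sandwichList α w l (shiftPow α w m) =
      sandwichList α w (l : Multiset (AIdx α w)).toList (shiftPow α w m) :=
    sandwichList_perm hw (Multiset.coe_eq_coe.1 (Multiset.coe_toList _).symm) _
  change sandwichList α w l (shiftPow α w m) ∈ _
  rw [h3, ← h]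
  exact Submodule.smul_mem _ _ (Submodule.subset_span ⟨p, rfl⟩)

end

section

variable {α : ℝ} {w : Fin 2 → ℝ}

/-! ## The component of an operator along `D^(0)` -/

/-- The polynomial `c` with `D z_k = (k + 1) z_{k+1} c`, for `D ∈ L`. -/
def tiltPart (D : Module.End ℝ Poly) : Poly :=
  (D (X (Sum.inl 0))).divMonomial (Finsupp.single (Sum.inl 1) 1)

theorem coeff_tiltPart (D : Module.End ℝ Poly) (β : MI) :
    coeff β (tiltPart D) = coeff (Finsupp.single (Sum.inl 1) 1 + β) (D (X (Sum.inl 0))) :=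
  coeff_divMonomial _ _ _

theorem tiltPart_add (D D' : Module.End ℝ Poly) : tiltPart (D + D') = tiltPart D + tiltPart D' := by
  ext β; simp [coeff_tiltPart]

theorem tiltPart_smul (c : ℝ) (D : Module.End ℝ Poly) : tiltPart (c • D) = c • tiltPart D := by
  ext β; simp [coeff_tiltPart]

theorem tiltPart_eq {D : Module.End ℝ Poly} {c : Poly}
    (h : D (X (Sum.inl 0)) = X (Sum.inl 1) * c) : tiltPart D = c := by
  rw [tiltPart, h, X_mul_divMonomial]

/-- On the variables z_k every generator is a multiple of D^(0), with a factor that does not depend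
on k. -/
theorem L_apply_inl {D : Module.End ℝ Poly} (hD : D ∈ L α w) (k : ℕ) :
    D (X (Sum.inl k)) = ((k : ℝ) + 1) • (X (Sum.inl (k + 1)) * tiltPart D) := by
  have key : ∃ c, ∀ k : ℕ, D (X (Sum.inl k)) = ((k : ℝ) + 1) • (X (Sum.inl (k + 1)) * c) := by
    refine L_induction
      (P := fun D => ∃ c, ∀ k : ℕ, D (X (Sum.inl k)) = ((k : ℝ) + 1) • (X (Sum.inl (k + 1)) * c))
      ?_ ⟨0, by simp⟩ ?_ ?_ ?_ hD
    · rintro (p | i)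
      · refine ⟨if p.1.2 = 0 then mono p.1.1 else 0, fun k => ?_⟩
        rw [genOp_inl_apply, tilt_inl]
        split_ifs
        · rw [mul_smul_comm, mul_comm]
        · simp
      · refine ⟨raised 0 i, fun k => ?_⟩
        rw [genOp_inr_apply, shift_inl, mul_smul_comm, mul_comm]
    · rintro D _ D' _ ⟨c, hc⟩ ⟨c', hc'⟩
      exact ⟨c + c', fun k => by rw [LinearMap.add_apply, hc, hc', mul_add, smul_add]⟩
    · rintro t D _ ⟨c, hc⟩
      refine ⟨t • c, fun k => ?_⟩
      rw [LinearMap.smul_apply, hc, mul_smul_comm, smul_comm]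
    · rintro D h D' h' ⟨c, hc⟩ ⟨c', hc'⟩
      -- The terms with z_{k+2} c c' occur in both orders and cancel.
      refine ⟨D c' - D' c, fun k => ?_⟩
      rw [LieRing.of_associative_ring_bracket, LinearMap.sub_apply, Module.End.mul_apply,
        Module.End.mul_apply, hc, hc', map_smul, map_smul, L_leibniz h, L_leibniz h', hc, hc']
      simp only [Algebra.smul_def]
      ring
  obtain ⟨c, hc⟩ := key
  have h0 : tiltPart D = c := tiltPart_eq (by simpa using hc 0)
  rw [h0]
  exact hc k

/-- This cocycle identity is what makes the constants in `rval` compatible with brackets. -/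
theorem tiltPart_lie {D D' : Module.End ℝ Poly} (h : D ∈ L α w) (h' : D' ∈ L α w) :
    tiltPart ⁅D, D'⁆ = D (tiltPart D') - D' (tiltPart D) := by
  refine tiltPart_eq ?_
  have e : ∀ {D : Module.End ℝ Poly}, D ∈ L α w →
      D (X (Sum.inl 0)) = X (Sum.inl 1) * tiltPart D := fun h => by simpa using L_apply_inl h 0
  rw [LieRing.of_associative_ring_bracket, LinearMap.sub_apply, Module.End.mul_apply,
    Module.End.mul_apply, e h, e h', L_leibniz h, L_leibniz h', L_apply_inl h, L_apply_inl h']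
  simp only [Algebra.smul_def]
  ring

theorem tiltPart_tiltMul (p : Poly) (n : N2) : tiltPart (tiltMul p n) = if n = 0 then p else 0 := by
  refine tiltPart_eq ?_
  rw [tiltMul_apply, tilt_inl]
  split_ifs <;> simp [mul_comm]

theorem tiltPart_shift (i : Fin 2) : tiltPart (genOp α w (Sum.inr i)) = raised 0 i := by
  refine tiltPart_eq ?_
  rw [genOp_inr_apply, shift_inl]
  simp [mul_comm]

theorem genOp_inl_eq (p : AIdx α w) : genOp α w (Sum.inl p) = tiltMul (mono p.1.1) p.1.2 := rfl

/-! ## The elements of `T⁺` that represent `𝒥_n z_β / n!` -/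

/-- The polynomials `binom(m, n) X^(m - n)` in `T⁺`. -/
def xp (α : ℝ) (w : Fin 2 → ℝ) (m n : N2) : TPlus α w :=
  ((((m 0).choose (n 0) : ℕ) : TPlus α w) * X (Sum.inr 0) ^ (m 0 - n 0)) *
    ((((m 1).choose (n 1) : ℕ) : TPlus α w) * X (Sum.inr 1) ^ (m 1 - n 1))

open Classical in
/-- The elements `𝒥_n z_β / n!`, where `𝒥_n z_(e_m) / n! = binom(m, n) X^(m - n)`. -/
def xx (α : ℝ) (w : Fin 2 → ℝ) (n : N2) (β : MI) : TPlus α w :=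
  if h : Admissible α w β n then X (Sum.inl ⟨(β, n), h⟩)
  else if h : ∃ m : N2ne, β = ePoly m then xp α w h.choose.1 n else 0

theorem not_admissible_ePoly (m : N2ne) (n : N2) : ¬ Admissible α w (ePoly m) n := fun h => by
  have := h.1
  rw [bra_ePoly] at this
  omega

theorem xx_admissible {n : N2} {β : MI} (h : Admissible α w β n) :
    xx α w n β = X (Sum.inl ⟨(β, n), h⟩) := dif_pos h

theorem xx_ePoly (n : N2) (m : N2ne) : xx α w n (ePoly m) = xp α w m.1 n := by
  have h : ∃ m' : N2ne, ePoly m = ePoly m' := ⟨m, rfl⟩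
  rw [xx, dif_neg (not_admissible_ePoly m n), dif_pos h, ← ePoly_injective h.choose_spec]

theorem xx_of_not {n : N2} {β : MI} (h : ¬ Admissible α w β n) (h' : ∀ m, β ≠ ePoly m) :
    xx α w n β = 0 := by
  rw [xx, dif_neg h, dif_neg (by push Not; exact h')]

theorem xx_ne_zero {n : N2} {β : MI} (h : xx α w n β ≠ 0) :
    Admissible α w β n ∨ ∃ m, β = ePoly m := by
  by_contra hc
  push Not at hc
  exact h (xx_of_not hc.1 hc.2)

theorem xp_eq_zero {m n : N2} (h : ¬ n ≤ m) : xp α w m n = 0 := by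
  by_contra hc
  apply h
  have h1 : (m 0).choose (n 0) ≠ 0 := fun e => hc (by simp [xp, e])
  have h2 : (m 1).choose (n 1) ≠ 0 := fun e => hc (by simp [xp, e])
  intro i
  fin_cases i
  · by_contra hlt; exact h1 (Nat.choose_eq_zero_of_lt (not_le.1 hlt))
  · by_contra hlt; exact h2 (Nat.choose_eq_zero_of_lt (not_le.1 hlt))

theorem xp_zero (n : N2) : xp α w 0 n = if n = 0 then 1 else 0 := by
  split_ifs with h
  · subst h; simp [xp]
  · exact xp_eq_zero fun hn => h (le_antisymm hn (zero_le))

theorem xp_single (i : Fin 2) : xp α w (Finsupp.single i 1) 0 = X (Sum.inr i) := by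
  fin_cases i <;> simp [xp, Finsupp.single_apply]

/-- The linear extension of `xx`. -/
def xxL (α : ℝ) (w : Fin 2 → ℝ) (n : N2) : TT →ₗ[ℝ] TPlus α w := Finsupp.linearCombination ℝ (xx α w n)

@[simp] theorem xxL_single (n : N2) (β : MI) : xxL α w n (Finsupp.single β 1) = xx α w n β := by
  simp [xxL]

theorem xxL_eq_zero {n : N2} {t : TT} (h : ∀ γ, t γ ≠ 0 → xx α w n γ = 0) : xxL α w n t = 0 := by
  rw [xxL, Finsupp.linearCombination_apply]
  exact Finset.sum_eq_zero fun γ hγ => by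
    simp only [h γ (Finsupp.mem_support_iff.1 hγ), smul_zero]

/-! ## The action of `L` on `T⁺` by derivations -/

/-- The generators of `T⁺` are of the form `𝒥_n z_β / n!` with this `n`. -/
def genN (v : LIdx α w) : N2 := Sum.elim (fun p => p.1.2) (fun _ => 0) v

/-- The generators of `T⁺` are of the form `𝒥_n z_β / n!` with this `β`. -/
def genB (v : LIdx α w) : MI := Sum.elim (fun p => p.1.1) (fun i => ePoly (raise 0 i)) v

/-- Since X_i = 𝒥_0 z_{e_m} with m = e_i, all generators of T⁺ are instances of the same symbol, and
one formula defines the derivations on all of them. -/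
theorem X_eq_xx (v : LIdx α w) : (X v : TPlus α w) = xx α w (genN v) (genB v) := by
  rcases v with p | i
  · exact (xx_admissible p.2).symm
  · change X (Sum.inr i) = xx α w 0 (ePoly (raise 0 i))
    have : (raise 0 i).1 = Finsupp.single i 1 := zero_add _
    rw [xx_ePoly, this, xp_single]

/-- The value `∑_γ D_β^γ 𝒥_n z_γ / n!`, plus the contribution of the tilt by constants. -/
def rval (α : ℝ) (w : Fin 2 → ℝ) (D : Module.End ℝ Poly) (n : N2) (t : TT) : TPlus α w :=
  xxL α w n (tr D t) + algebraMap ℝ _ (if n = 0 then pr t (tiltPart D) else 0)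

/-- The derivation of `T⁺` that is dual to the left multiplication with `D` in `U(L)`. -/
def rder (α : ℝ) (w : Fin 2 → ℝ) (D : Module.End ℝ Poly) : Derivation ℝ (TPlus α w) (TPlus α w) :=
  mkDerivation ℝ fun v => rval α w D (genN v) (Finsupp.single (genB v) 1)

theorem rder_X (D : Module.End ℝ Poly) (v : LIdx α w) :
    rder α w D (X v) = rval α w D (genN v) (Finsupp.single (genB v) 1) := mkDerivation_X _ _ _

theorem rval_single_eq_zero {D : Module.End ℝ Poly} (hD : D ∈ rowFinite) {n : N2} {β : MI}
    (h : ∀ γ, coeff β (D (mono γ)) ≠ 0 → xx α w n γ = 0) (h0 : n = 0 → coeff β (tiltPart D) = 0) :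
    rval α w D n (Finsupp.single β 1) = 0 := by
  rw [rval, xxL_eq_zero, zero_add]
  · split_ifs with hn
    · rw [pr_single, h0 hn]; simp
    · simp
  · intro γ hγ
    rw [tr_single hD] at hγ
    exact h γ hγ

/-- A column γ with nonzero symbol has [γ] ≥ -1, and z^γ' D^(n') with [γ'] ≥ 0 raises this to at
least 0. It therefore has no entry in the row e_m, where [e_m] = -1. -/
theorem rval_tilt_ePoly (p : AIdx α w) (n : N2) (m : N2ne) :
    rval α w (genOp α w (Sum.inl p)) n (Finsupp.single (ePoly m) 1) = 0 := by
  have hp := p.2.1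
  refine rval_single_eq_zero (genOp_mem_rowFinite α w _) (fun γ hγ => ?_) fun _ => ?_
  · by_contra hc
    have h1 := (coeff_genOp_degrees _ hγ).1
    rw [bra_ePoly, Sum.elim_inl] at h1
    rcases xx_ne_zero hc with h | ⟨m', rfl⟩
    · have := h.1
      omega
    · rw [bra_ePoly] at h1
      omega
  · rw [genOp_inl_eq, tiltPart_tiltMul]
    split_ifs
    · rw [mono, coeff_monomial, if_neg]
      intro e
      rw [e, bra_ePoly] at hp
      omega
    · exact coeff_zero _

theorem mono_ePoly (m : N2ne) : mono (ePoly m) = X (Sum.inr m) := rfl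

theorem coeff_raised (n : N2) (i : Fin 2) (β : MI) :
    coeff β (raised n i) = if ePoly (raise n i) = β then 1 else 0 := by
  classical
  rw [raised_eq, coeff_monomial]

theorem tr_shift_ePoly {i : Fin 2} {m : N2ne} {γ : MI}
    (h : coeff (ePoly m) (genOp α w (Sum.inr i) (mono γ)) ≠ 0) :
    ∃ n : N2ne, γ = ePoly n ∧ m = raise n.1 i := by
  have h' : coeff (ePoly m) (shift i (mono γ)) ≠ 0 := h
  rcases coeff_shift_ne_zero h' with ⟨k, -, e⟩ | ⟨n, hn, e⟩
  · exfalso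
    have := single_le_of_add_eq (by simp) e (Sum.inl (k + 1))
    simp [ePoly] at this
  · have h1 : ePoly (raise n.1 i) ≤ ePoly m := by
      rw [← zero_add (ePoly (raise n.1 i))] at e
      exact single_le_of_add_eq (fun h => raise_ne n i (by simpa using h)) e
    have h2 := h1 (Sum.inr (raise n.1 i))
    simp only [ePoly, Finsupp.single_eq_same] at h2
    have h3 : m = raise n.1 i := by
      by_contra hc
      rw [Finsupp.single_eq_of_ne (by simpa using Ne.symm hc)] at h2
      omega
    subst h3
    rw [add_comm] at e
    exact ⟨n, (add_right_cancel e).symm, rfl⟩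

theorem exists_eq_raise {i : Fin 2} {m : N2ne} (hm : m.1 i ≠ 0) : ∃ m', m = raise m' i :=
  ⟨m.1 - Finsupp.single i 1, Subtype.ext (tsub_add_cancel_of_le (by
    rw [Finsupp.single_le_iff]; exact Nat.one_le_iff_ne_zero.2 hm)).symm⟩

theorem tr_shift_single_ePoly (i : Fin 2) (m : N2ne) :
    tr (genOp α w (Sum.inr i)) (Finsupp.single (ePoly m) 1) =
      if h : m.1 - Finsupp.single i 1 ≠ 0 then (m.1 i : ℝ) • Finsupp.single (ePoly ⟨_, h⟩) 1
      else 0 := by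
  classical
  have hrow := genOp_mem_rowFinite α w (Sum.inr i)
  ext γ
  rw [tr_single hrow]
  by_cases hm : m.1 i = 0
  · simp only [hm, Nat.cast_zero, zero_smul, dite_eq_ite, ite_self, Finsupp.coe_zero, Pi.zero_apply]
    by_contra hγ
    obtain ⟨n', -, rfl⟩ := tr_shift_ePoly hγ
    simp [raise] at hm
  · obtain ⟨m', rfl⟩ := exists_eq_raise hm
    have e : (raise m' i).1 - Finsupp.single i 1 = m' := add_tsub_cancel_right _ _
    simp only [e]
    split_ifs with h0
    · rw [Finsupp.smul_apply]
      by_cases hγ : γ = ePoly ⟨m', h0⟩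
      · subst hγ
        rw [mono_ePoly, genOp_inr_apply, shift_inr, coeff_smul, coeff_raised, if_pos rfl,
          Finsupp.single_eq_same]
        simp [raise]
      · rw [Finsupp.single_eq_of_ne hγ, smul_zero]
        by_contra hc
        obtain ⟨n', rfl, e⟩ := tr_shift_ePoly hc
        exact hγ (congrArg ePoly (Subtype.ext (raise_injective i e).symm))
    · by_contra hγ
      obtain ⟨n', -, e⟩ := tr_shift_ePoly hγ
      rw [not_not] at h0
      exact n'.2 ((raise_injective i e).symm.trans h0)

/-- The transpose misses the case m = e_i, as there is no variable z_0. The constant from `tiltPart`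
restores it, so that ∂_i differentiates the polynomials binom(m,n) X^(m-n). -/
theorem rval_shift_ePoly (i : Fin 2) (n : N2) (m : N2ne) :
    rval α w (genOp α w (Sum.inr i)) n (Finsupp.single (ePoly m) 1) =
      (m.1 i : ℝ) • xp α w (m.1 - Finsupp.single i 1) n := by
  classical
  rw [rval, tr_shift_single_ePoly, tiltPart_shift, pr_single, coeff_raised]
  split_ifs with h1 h2 h3 h4 h5
  · have := congrArg Subtype.val (ePoly_injective h3)
    exact absurd (by rw [← this]; exact add_tsub_cancel_right _ _) h1
  · rw [map_smul, xxL_single, xx_ePoly]; simp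
  · rw [map_smul, xxL_single, xx_ePoly]; simp
  · rw [not_not] at h1
    obtain rfl := ePoly_injective h5
    rw [h1, h4, xp_zero]
    simp [raise]
  · rw [not_not] at h1
    rw [h1, xp_zero, if_pos h4]
    by_cases hm : m.1 i = 0
    · simp [hm]
    · obtain ⟨m', rfl⟩ := exists_eq_raise hm
      have e : (raise m' i).1 - Finsupp.single i 1 = m' := add_tsub_cancel_right _ _
      rw [e] at h1
      exact absurd (by rw [h1]) h5
  · rw [not_not] at h1
    rw [h1, xp_zero, if_neg h4]
    simp

theorem rder_X_inr (i j : Fin 2) :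
    rder α w (genOp α w (Sum.inr i)) (X (Sum.inr j)) = if i = j then 1 else 0 := by
  rw [rder_X]
  change rval α w _ 0 (Finsupp.single (ePoly (raise 0 j)) 1) = _
  rw [rval_shift_ePoly]
  split_ifs with h
  · subst h
    simp [raise, xp_zero]
  · simp [raise, Finsupp.single_apply, Ne.symm h]

theorem choose_mul_sub (m n : ℕ) : m.choose n * (m - n) = m * (m - 1).choose n := by
  rcases m with _ | k
  · simp
  · rw [← Nat.choose_mul_succ_eq, Nat.add_sub_cancel, mul_comm]

/-- The factor from differentiation is absorbed by binom(m_i, n_i)(m_i - n_i) = m_i binom(m_i - 1,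
n_i), which also holds when the differences are truncated. -/
theorem rder_xp (i : Fin 2) (m n : N2) : rder α w (genOp α w (Sum.inr i)) (xp α w m n) =
    (m i : ℝ) • xp α w (m - Finsupp.single i 1) n := by
  have h : ∀ a b : ℕ, ((a.choose b : TPlus α w) * ((a - b : ℕ) : TPlus α w)) =
      (a : TPlus α w) * ((a - 1).choose b : TPlus α w) := by
    intro a b
    exact_mod_cast congrArg (Nat.cast (R := TPlus α w)) (choose_mul_sub a b)
  have hs : ∀ x : TPlus α w, (m i : ℝ) • x = (m i : TPlus α w) * x := by
    intro x
    rw [Algebra.smul_def]; simp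
  have h1 : ∀ a b : ℕ, a - b - 1 = a - 1 - b := fun a b => by omega
  rw [hs]
  unfold xp
  fin_cases i
  · simp only [Fin.zero_eta, Fin.isValue, Derivation.leibniz, Derivation.leibniz_pow, rder_X_inr,
      Derivation.map_natCast,
      smul_eq_mul, nsmul_eq_mul, mul_zero, add_zero, zero_ne_one, if_false, zero_add, if_true,
      mul_one, Finsupp.coe_tsub, Pi.sub_apply, Finsupp.single_eq_same, h1]
    rw [Finsupp.single_eq_of_ne (show (1 : Fin 2) ≠ 0 by decide), Nat.sub_zero]
    rw [← mul_assoc ((m 0).choose (n 0) : TPlus α w), h]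
    ring
  · simp only [Fin.mk_one, Fin.isValue, Derivation.leibniz, Derivation.leibniz_pow, rder_X_inr,
      Derivation.map_natCast,
      smul_eq_mul, nsmul_eq_mul, mul_zero, add_zero, one_ne_zero, if_false, zero_add, if_true,
      mul_one, Finsupp.coe_tsub, Pi.sub_apply, Finsupp.single_eq_same, h1]
    rw [Finsupp.single_eq_of_ne (show (0 : Fin 2) ≠ 1 by decide), Nat.sub_zero]
    rw [← mul_assoc ((m 1).choose (n 1) : TPlus α w), h]
    ring

/-- Beyond the generators two cases need an argument. For β = e_m the polynomials are differentiated
explicitly. If the symbol vanishes by convention, no entry of the row β may meet a nonvanishing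
symbol, since otherwise β would be admissible or some e_m. -/
theorem rder_genOp_xx (hw : ∀ i, 0 < w i) (v : LIdx α w) (n : N2) (β : MI) :
    rder α w (genOp α w v) (xx α w n β) = rval α w (genOp α w v) n (Finsupp.single β 1) := by
  by_cases h : Admissible α w β n
  · rw [xx_admissible h, rder_X]; rfl
  by_cases h' : ∃ m, β = ePoly m
  · obtain ⟨m, rfl⟩ := h'
    rw [xx_ePoly]
    rcases v with p | i
    · rw [rval_tilt_ePoly]
      have h0 : ∀ j, rder α w (genOp α w (Sum.inl p)) (X (Sum.inr j)) = 0 := fun j => by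
        rw [rder_X]
        exact rval_tilt_ePoly p 0 _
      have hd : ∀ (k : ℕ), rder α w (genOp α w (Sum.inl p)) (k : TPlus α w) = 0 :=
        fun k => Derivation.map_natCast _ k
      simp [xp, Derivation.leibniz, Derivation.leibniz_pow, h0, hd]
    · rw [rder_xp, rval_shift_ePoly]
  · push Not at h'
    rw [xx_of_not h h', map_zero, rval_single_eq_zero (genOp_mem_rowFinite α w v)]
    · intro γ hγ
      by_contra hc
      rcases xx_ne_zero hc with hadm | ⟨m, rfl⟩
      · exact h (admissible_of_coeff_genOp hw v hadm hγ)
      · rw [xx_ePoly] at hc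
        have hnm : n ≤ m.1 := by_contra fun e => hc (xp_eq_zero e)
        rw [mono_ePoly] at hγ
        rcases v with p | i
        · rw [genOp_inl_apply, tilt_inr] at hγ
          split_ifs at hγ with e
          · rw [mul_one, mono, coeff_monomial] at hγ
            have e' : p.1.1 = β := by_contra fun hc => hγ (if_neg hc)
            exact h (e' ▸ ⟨p.2.1, (len_mono hw (e ▸ hnm)).trans_lt p.2.2⟩)
          · simp at hγ
        · rw [genOp_inr_apply, shift_inr, coeff_smul, coeff_raised] at hγ
          split_ifs at hγ with e
          · exact h' _ e.symm
          · simp at hγ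
    · rintro rfl
      by_contra hc
      rcases v with p | i
      · rw [genOp_inl_eq, tiltPart_tiltMul] at hc
        split_ifs at hc with e
        · rw [mono, coeff_monomial] at hc
          have e' : p.1.1 = β := by_contra fun hc' => hc (if_neg hc')
          exact h (e' ▸ e ▸ p.2)
        · simp at hc
      · rw [tiltPart_shift, coeff_raised] at hc
        split_ifs at hc with e
        · exact h' _ e.symm
        · simp at hc

theorem rval_add {D D' : Module.End ℝ Poly} (h : D ∈ rowFinite) (h' : D' ∈ rowFinite) (n : N2)
    (t : TT) : rval α w (D + D') n t = rval α w D n t + rval α w D' n t := by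
  simp only [rval, tr_add h h', tiltPart_add, map_add]
  split_ifs <;> simp <;> abel

theorem rval_smul {D : Module.End ℝ Poly} (h : D ∈ rowFinite) (c : ℝ) (n : N2)
    (t : TT) : rval α w (c • D) n t = c • rval α w D n t := by
  simp only [rval, tr_smul h, tiltPart_smul, map_smul, smul_add]
  split_ifs <;> simp [Algebra.smul_def]

theorem rder_add {D D' : Module.End ℝ Poly} (h : D ∈ rowFinite) (h' : D' ∈ rowFinite) :
    rder α w (D + D') = rder α w D + rder α w D' :=
  derivation_ext fun v => by simp only [rder_X, Derivation.add_apply, rval_add h h']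

theorem rder_smul {D : Module.End ℝ Poly} (h : D ∈ rowFinite) (c : ℝ) :
    rder α w (c • D) = c • rder α w D :=
  derivation_ext fun v => by simp only [rder_X, Derivation.smul_apply, rval_smul h c]

theorem rval_add_right (D : Module.End ℝ Poly) (n : N2) (s t : TT) :
    rval α w D n (s + t) = rval α w D n s + rval α w D n t := by
  simp only [rval, map_add, LinearMap.add_apply]
  split_ifs <;> simp <;> abel

theorem rval_smul_right (D : Module.End ℝ Poly) (n : N2) (c : ℝ) (t : TT) :
    rval α w D n (c • t) = c • rval α w D n t := by
  simp only [rval, map_smul, LinearMap.smul_apply, smul_add]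
  split_ifs <;> simp [Algebra.smul_def]

theorem rder_rval {D D' : Module.End ℝ Poly} (hD : D ∈ rowFinite) (hD' : D' ∈ rowFinite) {n : N2}
    {t : TT} (h' : ∀ t, rder α w D' (xxL α w n t) = rval α w D' n t) :
    rder α w D' (rval α w D n t) = xxL α w n (tr (D * D') t) +
      algebraMap ℝ _ (if n = 0 then pr t (D (tiltPart D')) else 0) := by
  rw [rval, map_add, h', Derivation.map_algebraMap, add_zero, rval, tr_mul hD hD', pr_tr hD]

/-- Transposition reverses products, hence the bracket on the right has the opposite order. The
constants are matched by the cocycle identity. -/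
theorem rval_lie {D D' : Module.End ℝ Poly} (hD : D ∈ L α w) (hD' : D' ∈ L α w) {n : N2}
    {t : TT} (h : ∀ t, rder α w D (xxL α w n t) = rval α w D n t)
    (h' : ∀ t, rder α w D' (xxL α w n t) = rval α w D' n t) :
    rval α w ⁅D, D'⁆ n t = ⁅rder α w D', rder α w D⁆ (xxL α w n t) := by
  have r := L_le_rowFinite hD
  have r' := L_le_rowFinite hD'
  rw [Derivation.commutator_apply, h, h', rder_rval r r' h', rder_rval r' r h, rval,
    tiltPart_lie hD hD', LieRing.of_associative_ring_bracket, tr_sub (mul_mem r r') (mul_mem r' r),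
    map_sub]
  split_ifs
  · rw [map_sub, map_sub]; abel
  · simp

/-- The operators of `L` act on all `𝒥_n z_β` by the formula that defines their action on the
generators. -/
theorem rder_xxL (hw : ∀ i, 0 < w i) {D : Module.End ℝ Poly} (hD : D ∈ L α w) :
    ∀ n t, rder α w D (xxL α w n t) = rval α w D n t := by
  refine L_induction (P := fun D => ∀ n t, rder α w D (xxL α w n t) = rval α w D n t)
    ?_ ?_ ?_ ?_ ?_ hD
  · intro v n t
    induction t using Finsupp.induction_linear with
    | zero => simp [rval]
    | add s t hs ht => rw [map_add, map_add, hs, ht, rval_add_right]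
    | single β c =>
      rw [← mul_one c, ← smul_eq_mul, ← Finsupp.smul_single, map_smul, Derivation.map_smul,
        xxL_single, rder_genOp_xx hw, rval_smul_right]
  · intro n t
    have : rder α w 0 = 0 := by
      have := rder_smul (α := α) (w := w) (zero_mem rowFinite) 0
      rwa [zero_smul, zero_smul] at this
    have h2 := rval_smul (α := α) (w := w) (zero_mem rowFinite) 0 n t
    rw [zero_smul, zero_smul] at h2
    rw [this, h2, Derivation.zero_apply]
  · intro D hD D' hD' h h' n t
    rw [rder_add (L_le_rowFinite hD) (L_le_rowFinite hD'),
      rval_add (L_le_rowFinite hD) (L_le_rowFinite hD'), Derivation.add_apply, h, h']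
  · intro c D hD h n t
    rw [rder_smul (L_le_rowFinite hD), rval_smul (L_le_rowFinite hD), Derivation.smul_apply, h]
  · intro D hD D' hD' h h' n t
    -- Both sides are derivations and agree on the generators. Evaluating this identity at arbitrary
    -- symbols then yields the claim for the bracket.
    have e : rder α w ⁅D, D'⁆ = ⁅rder α w D', rder α w D⁆ := by
      refine derivation_ext fun v => ?_
      rw [rder_X, rval_lie hD hD' (h _) (h' _), xxL_single, ← X_eq_xx]
    rw [e, rval_lie hD hD' (h _) (h' _)]

theorem rder_lie (hw : ∀ i, 0 < w i) {D D' : Module.End ℝ Poly} (hD : D ∈ L α w) (hD' : D' ∈ L α w) :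
    rder α w ⁅D, D'⁆ = ⁅rder α w D', rder α w D⁆ := by
  refine derivation_ext fun v => ?_
  rw [rder_X, rval_lie hD hD' (rder_xxL hw hD _) (rder_xxL hw hD' _), xxL_single, ← X_eq_xx]

end

section

variable {α : ℝ} {w : Fin 2 → ℝ}

/-! ## The pairing of `T⁺` with `U(L)` -/

/-- The action of `L` on the dual of `T⁺`. -/
def dualAct (α : ℝ) (w : Fin 2 → ℝ) (hw : ∀ i, 0 < w i) :
    L α w →ₗ⁅ℝ⁆ Module.End ℝ (Module.Dual ℝ (TPlus α w)) where
  toFun D := LinearMap.lcomp ℝ ℝ (rder α w D : TPlus α w →ₗ[ℝ] TPlus α w)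
  map_add' D D' := by
    ext ℓ f
    simp [rder_add (L_le_rowFinite D.2) (L_le_rowFinite D'.2)]
  map_smul' c D := by
    ext ℓ f
    simp [rder_smul (L_le_rowFinite D.2)]
  map_lie' {D D'} := by
    refine LinearMap.ext fun ℓ => LinearMap.ext fun f => ?_
    change ℓ (rder α w ⁅(D : Module.End ℝ Poly), (D' : Module.End ℝ Poly)⁆ f) = _
    rw [rder_lie hw D.2 D'.2, Derivation.commutator_apply, map_sub]
    rfl

/-- The pairing of `U(L)` with `T⁺`. -/
def pair (α : ℝ) (w : Fin 2 → ℝ) (hw : ∀ i, 0 < w i) : U α w →ₗ[ℝ] Module.Dual ℝ (TPlus α w) :=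
  (LinearMap.applyₗ (aug (LIdx α w)).toLinearMap) ∘ₗ
    (UniversalEnvelopingAlgebra.lift ℝ (dualAct α w hw)).toLinearMap

variable (hw : ∀ i, 0 < w i)

theorem pair_one (f : TPlus α w) : pair α w hw 1 f = aug _ f := by
  rw [pair, LinearMap.comp_apply, AlgHom.toLinearMap_apply, map_one]
  rfl

/-- Dualizing undoes the reversal of brackets by `rder`, so that U(L) acts on functionals and the
pairing is the orbit of the augmentation. This identity and `pair_one` determine it. -/
theorem pair_emb_mul (D : L α w) (u : U α w) (f : TPlus α w) :
    pair α w hw (emb α w D * u) f = pair α w hw u (rder α w D f) := by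
  have : UniversalEnvelopingAlgebra.lift ℝ (dualAct α w hw) (emb α w D) = dualAct α w hw D :=
    UniversalEnvelopingAlgebra.lift_ι_apply ℝ (dualAct α w hw) D
  simp only [pair, LinearMap.comp_apply, AlgHom.toLinearMap_apply, map_mul, this]
  rfl

theorem pair_emb (D : L α w) (f : TPlus α w) :
    pair α w hw (emb α w D) f = aug _ (rder α w D f) := by
  have := pair_emb_mul hw D 1 f
  rwa [mul_one, pair_one] at this

/-! ### The transpose of the maps `u ↦ p u D^(n)` -/

open Classical in
/-- The derivation `∑_γ p_γ ∂ / ∂ Z^(e_(γ, n))` of `T⁺`. -/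
def dX (α : ℝ) (w : Fin 2 → ℝ) (n : N2) : Poly →ₗ[ℝ] Derivation ℝ (TPlus α w) (TPlus α w) :=
  (basisMonomials Var ℝ).constr ℝ fun γ =>
    if h : Admissible α w γ n then pderiv (Sum.inl ⟨(γ, n), h⟩) else 0

theorem dX_mono {γ : MI} {n : N2} (h : Admissible α w γ n) :
    dX α w n (mono γ) = pderiv (Sum.inl ⟨(γ, n), h⟩) := by
  have e : mono γ = MvPolynomial.basisMonomials Var ℝ γ := by simp [mono]
  rw [dX, e, Module.Basis.constr_basis, dif_pos h]

theorem admSub_induction {n : N2} {P : Poly → Prop} (h0 : P 0) (hadd : ∀ p q, P p → P q → P (p + q))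
    (hsmul : ∀ (c : ℝ) p, P p → P (c • p)) (hmono : ∀ γ, Admissible α w γ n → P (mono γ)) {p : Poly}
    (hp : p ∈ admSub α w n) : P p := by
  rw [p.as_sum]
  refine Finset.sum_induction _ P hadd h0 fun γ hγ => ?_
  have : monomial γ (coeff γ p) = coeff γ p • mono γ := by simp [mono, smul_monomial]
  rw [this]
  exact hsmul _ _ (hmono γ (hp γ (mem_support_iff.1 hγ)))

theorem pderiv_inl_xp (a : AIdx α w) (m n : N2) : pderiv (Sum.inl a) (xp α w m n) = 0 := by
  simp [xp, Derivation.leibniz, Derivation.leibniz_pow, pderiv_X_of_ne]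

theorem pderiv_xx {γ : MI} {n : N2} (h : Admissible α w γ n) (n' : N2) (β : MI) :
    pderiv (Sum.inl ⟨(γ, n), h⟩) (xx α w n' β) = if n = n' ∧ γ = β then 1 else 0 := by
  classical
  by_cases h1 : Admissible α w β n'
  · rw [xx_admissible h1, pderiv_X, Pi.single_apply]
    refine if_congr ?_ rfl rfl
    simp only [Sum.inl.injEq, Subtype.mk.injEq, Prod.mk.injEq]
    exact ⟨fun h => ⟨h.2.symm, h.1.symm⟩, fun h => ⟨h.2.symm, h.1.symm⟩⟩
  · rw [if_neg (fun e : n = n' ∧ γ = β => h1 (e.1 ▸ e.2 ▸ h))]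
    by_cases h2 : ∃ m, β = ePoly m
    · obtain ⟨m, rfl⟩ := h2
      rw [xx_ePoly, pderiv_inl_xp]
    · push Not at h2
      rw [xx_of_not h1 h2, map_zero]

/-- Each symbol is a generator with admissible index, a polynomial in X, or zero, so its derivative
is a constant. -/
theorem dX_xxL {n : N2} {p : Poly} (hp : p ∈ admSub α w n) (n' : N2) (t : TT) :
    dX α w n p (xxL α w n' t) = algebraMap ℝ _ (if n = n' then pr t p else 0) := by
  classical
  refine admSub_induction (P := fun p => dX α w n p (xxL α w n' t) =
    algebraMap ℝ _ (if n = n' then pr t p else 0)) ?_ ?_ ?_ (fun γ hγ => ?_) hp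
  · simp
  · intro p q h h'
    rw [map_add, Derivation.add_apply, h, h', ← map_add]
    split_ifs <;> simp
  · intro c p h
    rw [map_smul, Derivation.smul_apply, h, Algebra.smul_def, ← map_mul]
    split_ifs <;> simp
  · rw [dX_mono hγ]
    induction t using Finsupp.induction_linear with
    | zero => simp
    | add s t hs ht => rw [map_add, map_add, hs, ht, ← map_add]; split_ifs <;> simp
    | single β c =>
      rw [← mul_one c, ← smul_eq_mul, ← Finsupp.smul_single, map_smul, Derivation.map_smul,
        xxL_single, pderiv_xx]
      by_cases e : n = n'
      · by_cases e' : γ = β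
        · simp [e, e', Algebra.smul_def]
        · simp [e, e', Finsupp.single_eq_of_ne e']
      · simp [e]

theorem dX_X {n : N2} {p : Poly} (hp : p ∈ admSub α w n) (v : LIdx α w) :
    dX α w n p (X v) =
      algebraMap ℝ _ (if n = genN v then pr (Finsupp.single (genB v) 1) p else 0) := by
  rw [X_eq_xx, ← xxL_single, dX_xxL hp]

include hw in
-- This is the dual form of the recursion for z^γ D u D^(n). The commutator is again a derivation,
-- and on generators the constants drop out and the adjointness of `tr` remains.
theorem dX_rder {D : Module.End ℝ Poly} (hD : D ∈ L α w) {n : N2} {p : Poly}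
    (hp : p ∈ admSub α w n) (f : TPlus α w) :
    dX α w n p (rder α w D f) = rder α w D (dX α w n p f) + dX α w n (D p) f := by
  have h : ⁅dX α w n p, rder α w D⁆ = dX α w n (D p) := by
    refine derivation_ext fun v => ?_
    rw [Derivation.commutator_apply, dX_X hp, Derivation.map_algebraMap, sub_zero, rder_X, rval,
      map_add, Derivation.map_algebraMap, add_zero, dX_xxL hp, dX_X (L_admSub hw hD p hp),
      pr_tr (L_le_rowFinite hD)]
  rw [← h, Derivation.commutator_apply]
  abel

theorem aug_derivation_ext {σ : Type} {D D' : Derivation ℝ (MvPolynomial σ ℝ) (MvPolynomial σ ℝ)}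
    (h : ∀ v, aug σ (D (X v)) = aug σ (D' (X v))) (f : MvPolynomial σ ℝ) :
    aug σ (D f) = aug σ (D' f) := by
  induction f using MvPolynomial.induction_on with
  | C a => simp
  | add p q hp hq => simp only [map_add, hp, hq]
  | mul_X p v hp => simp only [Derivation.leibniz, smul_eq_mul, map_add, map_mul, hp, h v]

theorem aug_xp (m n : N2) : aug _ (xp α w m n) = if m = n then 1 else 0 := by
  have h : ∀ a b : ℕ, ((a.choose b : ℕ) : ℝ) * 0 ^ (a - b) = if a = b then 1 else 0 := by
    intro a b
    rcases lt_trichotomy a b with h | h | h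
    · rw [Nat.choose_eq_zero_of_lt h, if_neg h.ne]; simp
    · simp [h]
    · rw [zero_pow (by omega), if_neg h.ne']; simp
  simp only [xp, map_mul, map_pow, aeval_X, map_natCast, h]
  by_cases e : m = n
  · simp [e]
  · rw [if_neg e]
    by_cases h0 : m 0 = n 0
    · have h1 : m 1 ≠ n 1 := fun h1 => e (Finsupp.ext fun i => by fin_cases i <;> assumption)
      simp [h1]
    · simp [h0]

theorem aug_xx (n : N2) (β : MI) : aug _ (xx α w n β) = if ∃ h : n ≠ 0, β = ePoly ⟨n, h⟩ then 1 else 0 := by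
  by_cases h1 : Admissible α w β n
  · rw [xx_admissible h1, aeval_X, if_neg]
    rintro ⟨h, rfl⟩
    exact not_admissible_ePoly _ _ h1
  · by_cases h2 : ∃ m, β = ePoly m
    · obtain ⟨m, rfl⟩ := h2
      rw [xx_ePoly, aug_xp]
      refine if_congr ?_ rfl rfl
      constructor
      · rintro rfl; exact ⟨m.2, rfl⟩
      · rintro ⟨h, e⟩
        exact congrArg Subtype.val (ePoly_injective e)
    · rw [xx_of_not h1 (by push Not at h2; exact h2), map_zero, if_neg]
      rintro ⟨h, rfl⟩
      exact h2 ⟨_, rfl⟩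

theorem aug_xxL_of_ne {n : N2} (h : n ≠ 0) (t : TT) :
    aug _ (xxL α w n t) = t (ePoly ⟨n, h⟩) := by
  classical
  induction t using Finsupp.induction_linear with
  | zero => simp
  | add s t hs ht => rw [map_add, map_add, hs, ht]; rfl
  | single β c =>
    rw [← mul_one c, ← smul_eq_mul, ← Finsupp.smul_single, map_smul, map_smul, xxL_single, aug_xx,
      Finsupp.smul_apply, Finsupp.single_apply]
    congr 1
    exact if_congr ⟨fun ⟨_, e⟩ => e, fun e => ⟨h, e⟩⟩ rfl rfl

theorem aug_xxL_zero (t : TT) : aug _ (xxL α w 0 t) = 0 := by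
  induction t using Finsupp.induction_linear with
  | zero => simp
  | add s t hs ht => rw [map_add, map_add, hs, ht, add_zero]
  | single β c =>
    rw [← mul_one c, ← smul_eq_mul, ← Finsupp.smul_single, map_smul, map_smul, xxL_single, aug_xx,
      if_neg (fun ⟨h, _⟩ => h rfl), smul_zero]

/-- The two contributions complement each other: generators with index 0 are detected through
`tiltPart`, and those with index n' ≠ 0 through the column e_{n'}, where the symbol equals 1. -/
theorem aug_rder_tiltMul {n : N2} {p : Poly} (hp : p ∈ admSub α w n) (f : TPlus α w) :
    aug _ (rder α w (tiltMul p n) f) = aug _ (dX α w n p f) := by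
  have hr := L_le_rowFinite (tiltMul_mem hp)
  refine aug_derivation_ext (fun v => ?_) f
  rw [dX_X hp, rder_X, rval, map_add, AlgHom.commutes, AlgHom.commutes]
  simp only [Algebra.algebraMap_self, RingHom.id_apply]
  by_cases h : genN v = 0
  · rw [h, aug_xxL_zero, if_pos rfl, tiltPart_tiltMul, zero_add]
    split_ifs <;> simp
  · rw [if_neg h, aug_xxL_of_ne h, add_zero, tr_single hr, mono_ePoly, tiltMul_apply, tilt_inr]
    split_ifs <;> simp

/-- Both sides obey the same recursion in u, by `sw_emb_mul` and `dX_rder`. -/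
theorem pair_sw (n : N2) (u : U α w) : ∀ p ∈ admSub α w n, ∀ f,
    pair α w hw (sw α w n u p) f = pair α w hw u (dX α w n p f) := by
  refine U_induction (P := fun u => ∀ p ∈ admSub α w n, ∀ f,
    pair α w hw (sw α w n u p) f = pair α w hw u (dX α w n p f)) ?_ ?_ ?_ ?_ u
  · intro p hp f
    rw [sw_one, base_eq hp, pair_emb, pair_one]
    exact aug_rder_tiltMul hp f
  · intro u v h h' p hp f
    simp only [map_add, LinearMap.add_apply, h p hp, h' p hp]
  · intro c u h p hp f
    simp only [map_smul, LinearMap.smul_apply, h p hp]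
  · intro v u h p hp f
    have hD := (gen α w v).2
    rw [sw_emb_mul, map_sub, LinearMap.sub_apply, pair_emb_mul, h p hp, h _ (L_admSub hw hD p hp),
      pair_emb_mul, dX_rder hw hD hp, map_add, add_sub_cancel_right]

theorem pair_sandwichList_cons (a : AIdx α w) (l : List (AIdx α w)) (u : U α w) (f : TPlus α w) :
    pair α w hw (sandwichList α w (a :: l) u) f =
      pair α w hw (sandwichList α w l u) (pderiv (Sum.inl a) f) := by
  rw [sandwichList_cons, pair_sw hw _ _ _ (mono_mem_admSub a.2), dX_mono a.2]

/-! ### The elements `D_(J,m)` are dual to the basis `Z^(J,m)` -/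

/-- The polynomials without monomials in `X_1, X_2` only. -/
def inlIdeal (α : ℝ) (w : Fin 2 → ℝ) : Ideal (TPlus α w) where
  carrier := {f | ∀ p : PIdx α w, (∀ a, p (Sum.inl a) = 0) → coeff p f = 0}
  add_mem' {f g} hf hg p hp := by rw [coeff_add, hf p hp, hg p hp, add_zero]
  zero_mem' p _ := coeff_zero p
  smul_mem' c f hf p hp := by
    classical
    rw [smul_eq_mul, coeff_mul]
    refine Finset.sum_eq_zero fun x hx => ?_
    have h := Finset.HasAntidiagonal.mem_antidiagonal.1 hx
    rw [hf x.2 (fun a => ?_), mul_zero]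
    have := hp a
    rw [← h, Finsupp.add_apply] at this
    omega

theorem X_mem_inlIdeal (a : AIdx α w) : (X (Sum.inl a) : TPlus α w) ∈ inlIdeal α w := by
  classical
  intro p hp
  rw [coeff_X, if_neg]
  rintro rfl
  simpa using hp a

/-- The transpose of ∂_i creates no polynomial symbol here, because the column e_m has entries only
in the rows e_{m+e_i}. -/
theorem rder_shift_inl_mem (i : Fin 2) (a : AIdx α w) :
    rder α w (genOp α w (Sum.inr i)) (X (Sum.inl a)) ∈ inlIdeal α w := by
  have hne : ∀ m, a.1.1 ≠ ePoly m := fun m e => not_admissible_ePoly m a.1.2 (e ▸ a.2)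
  rw [rder_X]
  change rval α w _ a.1.2 (Finsupp.single a.1.1 1) ∈ _
  have hz : pr (Finsupp.single a.1.1 1) (tiltPart (genOp α w (Sum.inr i))) = 0 := by
    rw [tiltPart_shift, pr_single, coeff_raised, if_neg (fun e => hne _ e.symm), mul_zero]
  rw [rval, hz, ite_self, map_zero, add_zero, xxL, Finsupp.linearCombination_apply]
  refine Ideal.sum_mem _ fun γ hγ => Submodule.smul_of_tower_mem _ _ ?_
  rw [Finsupp.mem_support_iff, tr_single (genOp_mem_rowFinite α w _)] at hγ
  by_cases h : Admissible α w γ a.1.2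
  · rw [xx_admissible h]
    exact X_mem_inlIdeal _
  · by_cases h' : ∃ m, γ = ePoly m
    · obtain ⟨m, rfl⟩ := h'
      exfalso
      apply hγ
      rw [mono_ePoly, genOp_inr_apply, shift_inr, coeff_smul, coeff_raised,
        if_neg (fun e => hne _ e.symm), smul_zero]
    · rw [xx_of_not h (by push Not at h'; exact h')]
      exact Submodule.zero_mem _

/-- Modulo the ideal `inlIdeal` the derivation belonging to ∂_i is ∂/∂X_i, and the ideal is
invisible to coefficients of pure powers of X. -/
theorem coeff_rder_shift (i : Fin 2) (f : TPlus α w) {p : PIdx α w} (hp : ∀ a, p (Sum.inl a) = 0) :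
    coeff p (rder α w (genOp α w (Sum.inr i)) f) =
      coeff (p + Finsupp.single (Sum.inr i) 1) f * (p (Sum.inr i) + 1) := by
  classical
  have h : (rder α w (genOp α w (Sum.inr i)) - pderiv (Sum.inr i) :
      Derivation ℝ (TPlus α w) (TPlus α w)) f ∈ inlIdeal α w := by
    induction f using MvPolynomial.induction_on with
    | C a => rw [← algebraMap_eq, Derivation.map_algebraMap]; exact Submodule.zero_mem _
    | add p q hp hq => rw [map_add]; exact Submodule.add_mem _ hp hq
    | mul_X p v hp =>
      rw [Derivation.leibniz, smul_eq_mul, smul_eq_mul]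
      refine Ideal.add_mem _ (Ideal.mul_mem_left _ _ ?_) (Ideal.mul_mem_left _ _ hp)
      rw [Derivation.sub_apply]
      rcases v with a | j
      · rw [pderiv_X_of_ne (by simp), sub_zero]
        exact rder_shift_inl_mem i a
      · rw [rder_X_inr, pderiv_X]
        by_cases e : i = j
        · subst e; simp
        · rw [if_neg e, Pi.single_eq_of_ne (by simpa using fun h => e h.symm), sub_zero]
          exact Submodule.zero_mem _
  have := h p hp
  rw [Derivation.sub_apply, coeff_sub, sub_eq_zero] at this
  rw [this, coeff_pderiv]

/-- The multi-index over the index set of `L` with given parts. -/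
def joinIdx (J : AIdx α w →₀ ℕ) (m : N2) : PIdx α w := Finsupp.sumElim J m

theorem joinIdx_add_inr (J : AIdx α w →₀ ℕ) (m : N2) (i : Fin 2) :
    joinIdx J (m + Finsupp.single i 1) = joinIdx J m + Finsupp.single (Sum.inr i) 1 := by
  classical
  ext v
  rcases v with a | j <;> simp [joinIdx, Finsupp.single_apply]

theorem joinIdx_add_inl (J : AIdx α w →₀ ℕ) (m : N2) (a : AIdx α w) :
    joinIdx (Finsupp.single a 1 + J) m = joinIdx J m + Finsupp.single (Sum.inl a) 1 := by
  classical
  ext v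
  rcases v with a | j <;> simp [joinIdx, Finsupp.single_apply, add_comm]

theorem joinIdx_part (p : PIdx α w) : joinIdx (partJ p) (partM p) = p := by
  ext v
  rcases v with a | j <;> rfl

theorem prod_factorial_add_single {ι : Type} (p : ι →₀ ℕ) (v : ι) :
    ((p + Finsupp.single v 1).prod fun _ e => (e.factorial : ℝ)) =
      (p.prod fun _ e => (e.factorial : ℝ)) * (p v + 1) := by
  classical
  have h0 : ∀ i : ι, ((0 : ℕ).factorial : ℝ) = 1 := fun _ => by simp
  have e1 := Finsupp.prod_of_support_subset (p + Finsupp.single v 1 : ι →₀ ℕ) (s := insert v p.support)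
    (fun i hi => by
      rw [Finsupp.mem_support_iff, Finsupp.add_apply] at hi
      by_cases h : i = v
      · simp [h]
      · rw [Finsupp.single_eq_of_ne h, add_zero] at hi
        simp [hi]) (fun _ e => (e.factorial : ℝ)) fun i _ => h0 i
  have e2 := Finsupp.prod_of_support_subset p (s := insert v p.support)
    (Finset.subset_insert _ _) (fun _ e => (e.factorial : ℝ)) fun i _ => h0 i
  rw [e1, e2, ← Finset.mul_prod_erase _ _ (Finset.mem_insert_self v _),
    ← Finset.mul_prod_erase _ _ (Finset.mem_insert_self v _)]
  have e3 : ∏ i ∈ (insert v p.support).erase v, (((p + Finsupp.single v 1 : ι →₀ ℕ) i).factorial : ℝ) =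
      ∏ i ∈ (insert v p.support).erase v, ((p i).factorial : ℝ) :=
    Finset.prod_congr rfl fun i hi => by
      rw [Finsupp.add_apply, Finsupp.single_eq_of_ne (Finset.ne_of_mem_erase hi), add_zero]
  rw [e3, Finsupp.add_apply, Finsupp.single_eq_same, Nat.factorial_succ]
  push_cast
  ring

theorem pair_shiftPow (m : N2) : ∀ f, pair α w hw (shiftPow α w m) f =
    ((joinIdx 0 m : PIdx α w).prod fun _ e => (e.factorial : ℝ)) * coeff (joinIdx 0 m) f := by
  induction m using N2_induction with
  | h0 =>
    intro f
    have e : (joinIdx 0 0 : PIdx α w) = 0 := by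
      ext v; rcases v with a | j <;> rfl
    rw [shiftPow_zero, pair_one, e, Finsupp.prod_zero_index, one_mul]
    exact aeval_zero' _ |>.trans (by simp [constantCoeff_eq])
  | h m i ih =>
    intro f
    rw [shiftPow_add_single', pair_emb_mul, gen_coe, ih, coeff_rder_shift _ _ (fun a => rfl),
      joinIdx_add_inr, prod_factorial_add_single]
    ring

open Classical in
theorem pair_sandwichList (m : N2) (l : List (AIdx α w)) : ∀ f,
    pair α w hw (sandwichList α w l (shiftPow α w m)) f =
      ((joinIdx (Multiset.toFinsupp (l : Multiset (AIdx α w))) m).prod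
        fun _ e => (e.factorial : ℝ)) *
        coeff (joinIdx (Multiset.toFinsupp (l : Multiset (AIdx α w))) m) f := by
  induction l with
  | nil =>
    intro f
    have : Multiset.toFinsupp ((([] : List (AIdx α w)) : Multiset (AIdx α w))) = 0 := by simp
    rw [this]
    exact pair_shiftPow hw m f
  | cons a l ih =>
    intro f
    rw [pair_sandwichList_cons, ih, ← Multiset.cons_coe, ← Multiset.singleton_add, map_add,
      Multiset.toFinsupp_singleton, joinIdx_add_inl, coeff_pderiv, prod_factorial_add_single]
    ring

/-- Pairing with an ordered product takes iterated partial derivatives at 0, and the normalization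
1/(J! m!) turns them into coefficients. Linear independence and all later dualities rest on this. -/
theorem pair_DD (p : PIdx α w) (f : TPlus α w) : pair α w hw (DD α w p) f = coeff p f := by
  classical
  rw [DD_eq, map_smul, LinearMap.smul_apply, pair_sandwichList, Multiset.coe_toList,
    Finsupp.toMultiset_toFinsupp, joinIdx_part, smul_eq_mul, inv_mul_cancel_left₀]
  exact prod_factorial_ne_zero p

/-- The basis of `U(L)` formed by the `D_(J,m)`. -/
def DDbasis (α : ℝ) (w : Fin 2 → ℝ) (hw : ∀ i, 0 < w i) : Module.Basis (PIdx α w) ℝ (U α w) :=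
  Module.Basis.mk (v := DD α w) (by
    classical
    refine linearIndependent_iff'.2 fun s c h q hq => ?_
    have := congrArg (fun u => pair α w hw u (ZZ α w q)) h
    simp only [map_sum, map_smul, LinearMap.sum_apply, LinearMap.smul_apply, pair_DD, ZZ,
      coeff_monomial, map_zero, LinearMap.zero_apply] at this
    simpa [hq] using this) (span_DD hw).ge

theorem DDbasis_apply (p : PIdx α w) : DDbasis α w hw p = DD α w p := by
  rw [DDbasis, Module.Basis.mk_apply]

theorem DDbasis_repr (u : U α w) (p : PIdx α w) :
    (DDbasis α w hw).repr u p = pair α w hw u (ZZ α w p) := by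
  classical
  have : (Finsupp.lapply p ∘ₗ (DDbasis α w hw).repr.toLinearMap) =
      (LinearMap.applyₗ (ZZ α w p)) ∘ₗ pair α w hw := by
    refine (DDbasis α w hw).ext fun q => ?_
    simp only [LinearMap.comp_apply, LinearEquiv.coe_coe, Module.Basis.repr_self,
      Finsupp.lapply_apply, LinearMap.applyₗ_apply_apply]
    rw [DDbasis_apply, pair_DD, ZZ, coeff_monomial, Finsupp.single_apply]
    exact if_congr eq_comm rfl rfl
  exact LinearMap.congr_fun this u

/-! ### Tensors with left leg in T⁺ and their pairings -/

/-- Pairing of the first factor with an element of `U(L)`. -/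
def pairL (α : ℝ) (w : Fin 2 → ℝ) (hw : ∀ i, 0 < w i) (W : Type) [AddCommGroup W] [Module ℝ W]
    (u : U α w) : TPlus α w ⊗[ℝ] W →ₗ[ℝ] W :=
  (TensorProduct.lid ℝ W).toLinearMap ∘ₗ (pair α w hw u).rTensor W

theorem pairL_tmul {W : Type} [AddCommGroup W] [Module ℝ W] (u : U α w) (f : TPlus α w) (x : W) :
    pairL α w hw W u (f ⊗ₜ x) = pair α w hw u f • x := rfl

theorem eq_sum_pairL {W : Type} [AddCommGroup W] [Module ℝ W] (t : TPlus α w ⊗[ℝ] W) :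
    ∃ s : Finset (PIdx α w), t = ∑ p ∈ s, ZZ α w p ⊗ₜ[ℝ] pairL α w hw W (DD α w p) t ∧
      ∀ p ∉ s, pairL α w hw W (DD α w p) t = 0 := by
  classical
  -- The expansion is claimed for all larger index sets as well, so that the expansions of two
  -- summands can be taken over a common one.
  have key : ∃ s : Finset (PIdx α w), ∀ s', s ⊆ s' →
      t = ∑ p ∈ s', ZZ α w p ⊗ₜ[ℝ] pairL α w hw W (DD α w p) t ∧
      ∀ p ∉ s, pairL α w hw W (DD α w p) t = 0 := by
    induction t using TensorProduct.induction_on with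
    | zero => exact ⟨∅, fun s' _ => ⟨by simp, by simp⟩⟩
    | tmul f x =>
      refine ⟨f.support, fun s' hs => ⟨?_, fun p hp => ?_⟩⟩
      · simp only [pairL_tmul, pair_DD, ← TensorProduct.smul_tmul, ← TensorProduct.sum_tmul]
        congr 1
        conv_lhs => rw [f.as_sum]
        refine Finset.sum_subset_zero_on_sdiff hs (fun p hp => ?_) (fun p hp => ?_)
        · rw [notMem_support_iff.1 (Finset.mem_sdiff.1 hp).2, zero_smul]
        · simp [ZZ, smul_monomial]
      · rw [pairL_tmul, pair_DD, notMem_support_iff.1 hp, zero_smul]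
    | add t t' ht ht' =>
      obtain ⟨s, hs⟩ := ht
      obtain ⟨s', hs'⟩ := ht'
      refine ⟨s ∪ s', fun s'' h => ⟨?_, fun p hp => ?_⟩⟩
      · conv_lhs => rw [(hs s'' (Finset.union_subset_left h)).1,
          (hs' s'' (Finset.union_subset_right h)).1]
        simp only [map_add, TensorProduct.tmul_add, Finset.sum_add_distrib]
      · rw [Finset.notMem_union] at hp
        rw [map_add, (hs s subset_rfl).2 p hp.1, (hs' s' subset_rfl).2 p hp.2, add_zero]
  obtain ⟨s, hs⟩ := key
  exact ⟨s, hs s subset_rfl⟩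

theorem pairL_ext {W : Type} [AddCommGroup W] [Module ℝ W] {t t' : TPlus α w ⊗[ℝ] W}
    (h : ∀ u, pairL α w hw W u t = pairL α w hw W u t') : t = t' := by
  obtain ⟨s, hs, -⟩ := eq_sum_pairL hw (t - t')
  rw [← sub_eq_zero, hs]
  refine Finset.sum_eq_zero fun p _ => ?_
  rw [map_sub, h, sub_self, TensorProduct.tmul_zero]

theorem pairL_emb_mul {W : Type} [AddCommGroup W] [Module ℝ W] (D : L α w) (u : U α w)
    (t : TPlus α w ⊗[ℝ] W) : pairL α w hw W (emb α w D * u) t =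
      pairL α w hw W u ((rder α w D : TPlus α w →ₗ[ℝ] TPlus α w).rTensor W t) := by
  induction t using TensorProduct.induction_on with
  | zero => simp
  | tmul f x => rw [pairL_tmul, pair_emb_mul, LinearMap.rTensor_tmul, pairL_tmul]; rfl
  | add t t' ht ht' => rw [map_add, ht, ht', map_add, map_add]

end

section

variable {α : ℝ} {w : Fin 2 → ℝ}

/-! ## Finiteness and homogeneity of `Δ` -/

/-- The additive degree of multi-indices that is raised by all the generators of `L`. -/
def dg (α : ℝ) (w : Fin 2 → ℝ) (γ : MI) : ℝ := (α + 1) * bra γ + plen w γ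

theorem dg_add (β γ : MI) : dg α w (β + γ) = dg α w β + dg α w γ := by
  rw [dg, bra_add, map_add]
  push_cast
  simp only [dg]
  ring

/-- The weights of the generators of `T⁺`. -/
def wtP (α : ℝ) (w : Fin 2 → ℝ) : LIdx α w → ℝ :=
  Sum.elim (fun a => hom (α + 1) w a.1.1 - len w a.1.2) w

/-- A lower bound for the weights. -/
def minWt (w : Fin 2 → ℝ) : ℝ := min 1 (min (w 0) (w 1))

theorem minWt_pos (hw : ∀ i, 0 < w i) : 0 < minWt w := lt_min one_pos (lt_min (hw 0) (hw 1))

theorem minWt_le (w : Fin 2 → ℝ) (i : Fin 2) : minWt w ≤ w i := by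
  fin_cases i
  · exact (min_le_right _ _).trans (min_le_left _ _)
  · exact (min_le_right _ _).trans (min_le_right _ _)

theorem hom_succ (γ : MI) : hom (α + 1) w γ = hom α w γ + (bra γ + 1) := by
  rw [hom_eq, hom_eq]; ring

/-- Admissibility only says that |γ| - |n| is positive. Passing from α to α + 1 adds [γ] + 1 ≥ 1,
which gives a uniform lower bound. -/
theorem minWt_le_wtP (v : LIdx α w) : minWt w ≤ wtP α w v := by
  rcases v with a | i
  · refine (min_le_left _ _).trans ?_
    change 1 ≤ hom (α + 1) w a.1.1 - len w a.1.2
    have h1 := a.2.2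
    have h2 : (0 : ℝ) ≤ bra a.1.1 := by exact_mod_cast a.2.1
    rw [hom_succ]
    linarith
  · exact minWt_le w i

theorem dg_tilt {n : N2} {β γ : MI} (h : coeff β (tilt n (mono γ)) ≠ 0) :
    dg α w β = dg α w γ + (α + 1) - len w n := by
  obtain ⟨h1, h2⟩ := coeff_tilt_degrees w h
  rw [dg, dg, h1, h2]
  push_cast
  ring

theorem dg_shift {i : Fin 2} {β γ : MI} (h : coeff β (shift i (mono γ)) ≠ 0) :
    dg α w β = dg α w γ + w i := by
  obtain ⟨h1, h2⟩ := coeff_shift_degrees w h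
  rw [dg, dg, h1, h2]
  ring

theorem dg_shiftPow (m : N2) : ∀ β γ, coeff β (rho α w (shiftPow α w m) (mono γ)) ≠ 0 →
    dg α w β = dg α w γ + Finsupp.weight (wtP α w) (joinIdx 0 m) := by
  induction m using N2_induction with
  | h0 =>
    intro β γ h
    have e : (joinIdx 0 0 : PIdx α w) = 0 := by
      ext v; rcases v with a | j <;> rfl
    rw [shiftPow_zero, map_one, Module.End.one_apply, mono, coeff_monomial] at h
    have : γ = β := by_contra fun hc => h (if_neg hc)
    rw [this, e, map_zero, add_zero]
  | h m i ih =>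
    intro β γ h
    rw [shiftPow_add_single', map_mul, rho_emb, gen_coe, Module.End.mul_apply] at h
    obtain ⟨δ, h1, h2⟩ := exists_coeff_ne_zero h
    rw [dg_shift h2, ih _ _ h1, joinIdx_add_inr, map_add, Finsupp.weight_single, one_smul]
    simp only [wtP, Sum.elim_inr]
    ring

variable (hw : ∀ i, 0 < w i)

include hw in
theorem rho_sandwichList_cons (a : AIdx α w) (l : List (AIdx α w)) (u : U α w) (f : Poly) :
    rho α w (sandwichList α w (a :: l) u) f =
      mono a.1.1 * rho α w (sandwichList α w l u) (tilt a.1.2 f) := by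
  rw [sandwichList_cons, rho_sw hw _ _ _ (mono_mem_admSub a.2)]

open Classical in
include hw in
theorem dg_sandwichList (m : N2) (l : List (AIdx α w)) : ∀ β γ,
    coeff β (rho α w (sandwichList α w l (shiftPow α w m)) (mono γ)) ≠ 0 →
    dg α w β = dg α w γ +
      Finsupp.weight (wtP α w) (joinIdx (Multiset.toFinsupp (l : Multiset (AIdx α w))) m) := by
  induction l with
  | nil =>
    have : Multiset.toFinsupp ((([] : List (AIdx α w)) : Multiset (AIdx α w))) = 0 := by simp
    rw [this]
    exact dg_shiftPow m
  | cons a l ih =>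
    intro β γ h
    rw [rho_sandwichList_cons hw] at h
    obtain ⟨δ, rfl, h1⟩ := coeff_mono_mul h
    obtain ⟨ε, h2, h3⟩ := exists_coeff_ne_zero h1
    rw [dg_add, ih _ _ h3, dg_tilt h2, ← Multiset.cons_coe, ← Multiset.singleton_add, map_add,
      Multiset.toFinsupp_singleton, joinIdx_add_inl, map_add, Finsupp.weight_single, one_smul]
    simp only [wtP, Sum.elim_inl, hom_eq, dg]
    ring

include hw in
theorem dg_deltaCoeff {β γ : MI} {p : PIdx α w} (h : deltaCoeff α w β γ p ≠ 0) :
    dg α w β = dg α w γ + Finsupp.weight (wtP α w) p := by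
  classical
  rw [deltaCoeff, DD_eq, map_smul, LinearMap.smul_apply, coeff_smul, smul_eq_mul] at h
  rw [dg_sandwichList hw _ _ _ _ (right_ne_zero_of_mul h), Multiset.coe_toList,
    Finsupp.toMultiset_toFinsupp, joinIdx_part]

include hw in
-- The factors commute, so any of them may be taken outermost. Then z^γ' multiplies the whole result
-- and must divide z^β.
theorem le_of_deltaCoeff_ne_zero {β γ : MI} {p : PIdx α w} (h : deltaCoeff α w β γ p ≠ 0)
    {a : AIdx α w} (ha : p (Sum.inl a) ≠ 0) : a.1.1 ≤ β := by
  classical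
  rw [deltaCoeff, DD_eq, map_smul, LinearMap.smul_apply, coeff_smul, smul_eq_mul] at h
  have h' := right_ne_zero_of_mul h
  have hm : a ∈ (Finsupp.toMultiset (partJ p)).toList := by
    rw [Multiset.mem_toList, Finsupp.mem_toMultiset, Finsupp.mem_support_iff]
    exact ha
  rw [sandwichList_perm hw (List.perm_cons_erase hm), rho_sandwichList_cons hw] at h'
  obtain ⟨δ, rfl, -⟩ := coeff_mono_mul h'
  exact le_self_add

theorem finite_of_degree_le {ι : Type} {s : Set ι} (hs : s.Finite) (N : ℕ) :
    {p : ι →₀ ℕ | (∀ i, p i ≠ 0 → i ∈ s) ∧ p.degree ≤ N}.Finite := by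
  classical
  refine (Set.finite_Iic (∑ i ∈ hs.toFinset, Finsupp.single i N : ι →₀ ℕ)).subset ?_
  rintro p ⟨h1, h2⟩ i
  by_cases hi : p i = 0
  · rw [hi]; exact Nat.zero_le _
  · have h3 : p i ≤ N := (Finsupp.le_degree i p).trans h2
    rw [Finsupp.finsetSum_apply, Finset.sum_eq_single i (fun j _ hj => Finsupp.single_eq_of_ne' hj)
      (fun hc => absurd (hs.mem_toFinset.2 (h1 i hi)) hc), Finsupp.single_eq_same]
    exact h3

theorem neg_le_dg (hα : 0 < α) (hw : ∀ i, 0 < w i) (γ : TIdx) : -(α + 1) ≤ dg α w γ.1 := by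
  have h1 := plen_nonneg hw γ.1
  have h2 : (-1 : ℝ) ≤ bra γ.1 := by
    rcases γ.2 with h | ⟨n, h⟩
    · have : (0 : ℝ) ≤ bra γ.1 := by exact_mod_cast h
      linarith
    · rw [h, bra_ePoly]; norm_num
  rw [dg]
  nlinarith

/-- The multi-indices occurring in J lie below β, and admissibility bounds the accompanying n. The
length of (J,m) is at most its weight divided by `minWt`, and the weight is bounded because `dg` is
at least -(α+1) on the index set of T. For each (J,m), row-finiteness limits γ. -/
theorem finite_deltaCoeff (hα : 0 < α) (hw : ∀ i, 0 < w i) (β : MI) :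
    {q : PIdx α w × TIdx | deltaCoeff α w β q.2.1 q.1 ≠ 0}.Finite := by
  set N : ℕ := ⌈(dg α w β + (α + 1)) / minWt w⌉₊
  have hs : {v : LIdx α w | ∀ a, v = Sum.inl a → a.1.1 ≤ β}.Finite := by
    have h1 : {a : AIdx α w | a.1.1 ≤ β}.Finite := by
      have : (⋃ γ ∈ Set.Iic β, (fun n => (γ, n)) '' {n : N2 | len w n < hom α w γ}).Finite :=
        (Set.finite_Iic β).biUnion fun γ _ => (finite_len_lt hw _).image _
      refine (this.preimage (Subtype.val_injective.injOn)).subset fun a ha => ?_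
      exact Set.mem_biUnion (show a.1.1 ∈ Set.Iic β from ha) ⟨a.1.2, a.2.2, rfl⟩
    refine ((h1.image Sum.inl).union (Set.finite_range Sum.inr)).subset fun v hv => ?_
    rcases v with a | i
    · exact Or.inl ⟨a, hv a rfl, rfl⟩
    · exact Or.inr ⟨i, rfl⟩
  have hp := finite_of_degree_le hs N
  refine (hp.biUnion (t := fun p => (fun γ => (p, γ)) ''
    {γ : TIdx | coeff β (rho α w (DD α w p) (mono γ.1)) ≠ 0}) fun p _ =>
    ((rho_mem_rowFinite (DD α w p) β).preimage Subtype.val_injective.injOn).image _).subset ?_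
  rintro ⟨p, γ⟩ hq
  have hq' : deltaCoeff α w β γ.1 p ≠ 0 := hq
  refine Set.mem_biUnion (x := p) ⟨fun v hv a e => ?_, ?_⟩ ⟨γ, hq', rfl⟩
  · subst e
    exact le_of_deltaCoeff_ne_zero hw hq' hv
  · have h1 := dg_deltaCoeff hw hq'
    have h2 := degree_mul_le_weight minWt_le_wtP p
    have h3 := neg_le_dg hα hw γ
    have h4 : (p.degree : ℝ) ≤ (dg α w β + (α + 1)) / minWt w := by
      rw [le_div_iff₀ (minWt_pos hw)]
      linarith
    exact_mod_cast h4.trans (Nat.le_ceil _)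

/-! ## The extension of `Δ` to all multi-indices -/

/-- The coproduct `Δ`, extended to all multi-indices. -/
def DeltaExt (α : ℝ) (w : Fin 2 → ℝ) : TT →ₗ[ℝ] TPlus α w ⊗[ℝ] T :=
  Finsupp.linearCombination ℝ fun β =>
    ∑ᶠ q : PIdx α w × TIdx,
      deltaCoeff α w β q.2.1 q.1 • (ZZ α w q.1 ⊗ₜ[ℝ] (Finsupp.single q.2 1 : T))

theorem Delta_single (β : TIdx) :
    Delta α w (Finsupp.single β 1) = DeltaExt α w (Finsupp.single β.1 1) := by
  rw [Delta, DeltaExt, Finsupp.linearCombination_single, Finsupp.linearCombination_single]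

/-- The restriction to the index set of `T`. -/
def res : TT →ₗ[ℝ] T := Finsupp.lcomapDomain Subtype.val Subtype.val_injective

theorem res_apply (t : TT) (γ : TIdx) : res t γ = t γ.1 := rfl

theorem DeltaExt_single (hα : 0 < α) (hw : ∀ i, 0 < w i) (β : MI) :
    DeltaExt α w (Finsupp.single β 1) = ∑ q ∈ (finite_deltaCoeff hα hw β).toFinset,
      deltaCoeff α w β q.2.1 q.1 • (ZZ α w q.1 ⊗ₜ[ℝ] (Finsupp.single q.2 1 : T)) := by
  rw [DeltaExt, Finsupp.linearCombination_single, one_smul]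
  refine finsum_eq_sum_of_support_subset _ fun q hq => ?_
  rw [Finset.mem_coe, Set.Finite.mem_toFinset]
  intro h
  exact hq (by simp only [h, zero_smul])

theorem U_hom_ext (hw : ∀ i, 0 < w i) {V : Type*} [AddCommMonoid V] [Module ℝ V]
    {F G : U α w →ₗ[ℝ] V} (h : ∀ p, F (DD α w p) = G (DD α w p)) : F = G :=
  (DDbasis α w hw).ext fun p => by rw [DDbasis_apply, h]

theorem pairL_DeltaExt_DD (hα : 0 < α) (β : MI) (p : PIdx α w) :
    pairL α w hw T (DD α w p) (DeltaExt α w (Finsupp.single β 1)) =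
      res (tr (rho α w (DD α w p)) (Finsupp.single β 1)) := by
  classical
  ext γ
  rw [res_apply, tr_single (rho_mem_rowFinite _), DeltaExt_single hα hw, map_sum,
    Finsupp.finsetSum_apply]
  simp only [map_smul, pairL_tmul, pair_DD, ZZ, coeff_monomial, Finsupp.smul_apply,
    Finsupp.single_apply, smul_eq_mul]
  rw [Finset.sum_eq_single (p, γ)]
  · simp [deltaCoeff]
  · rintro ⟨q, δ⟩ - hne
    by_cases h1 : q = p
    · by_cases h2 : δ = γ
      · exact absurd (by rw [h1, h2]) hne
      · simp [h2]
    · simp [h1]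
  · intro h
    rw [Set.Finite.mem_toFinset, Set.mem_ofPred_eq, not_not] at h
    simp only [h, zero_mul]

/-- The transposes of the operators `ρ u`. -/
def trRho (α : ℝ) (w : Fin 2 → ℝ) (t : TT) : U α w →ₗ[ℝ] TT where
  toFun u := tr (rho α w u) t
  map_add' u v := by rw [map_add, tr_add (rho_mem_rowFinite u) (rho_mem_rowFinite v)]
  map_smul' c u := by rw [map_smul, tr_smul (rho_mem_rowFinite u)]; rfl

/-- The pairings of a fixed tensor with the elements of `U(L)`. -/
def pairR (α : ℝ) (w : Fin 2 → ℝ) (hw : ∀ i, 0 < w i) {W : Type} [AddCommGroup W] [Module ℝ W]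
    (t : TPlus α w ⊗[ℝ] W) : U α w →ₗ[ℝ] W where
  toFun u := pairL α w hw W u t
  map_add' u v := by simp [pairL, LinearMap.rTensor_add]
  map_smul' c u := by simp [pairL, LinearMap.rTensor_smul]

/-- By linearity it is enough to take u in the basis, where both sides consist of the same matrix
entries. In this sense Δ is dual to the action ρ. -/
theorem pairL_DeltaExt (hα : 0 < α) (u : U α w) (t : TT) :
    pairL α w hw T u (DeltaExt α w t) = res (tr (rho α w u) t) := by
  induction t using Finsupp.induction_linear with
  | zero => simp
  | add s t hs ht => simp only [map_add, hs, ht]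
  | single β c =>
    rw [← mul_one c, ← smul_eq_mul, ← Finsupp.smul_single]
    simp only [map_smul]
    congr 1
    have : pairR α w hw (DeltaExt α w (Finsupp.single β 1)) =
        res ∘ₗ trRho α w (Finsupp.single β 1) :=
      U_hom_ext hw fun p => pairL_DeltaExt_DD hw hα β p
    exact LinearMap.congr_fun this u

include hw in
-- After pairing with u, the left side belongs to the product D u, and the transpose of ρ(D u)
-- applies the transpose of D first.
theorem rder_DeltaExt (hα : 0 < α) {D : Module.End ℝ Poly} (hD : D ∈ L α w) (t : TT) :
    (rder α w D : TPlus α w →ₗ[ℝ] TPlus α w).rTensor T (DeltaExt α w t) =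
      DeltaExt α w (tr D t) := by
  refine pairL_ext hw fun u => ?_
  have := pairL_emb_mul hw ⟨D, hD⟩ u (DeltaExt α w t)
  rw [← this, pairL_DeltaExt hw hα, pairL_DeltaExt hw hα, map_mul, rho_emb,
    tr_mul (L_le_rowFinite hD) (rho_mem_rowFinite u)]

/-! ### Intertwiners and the polynomial components of Δ -/

/-- Maps which intertwine the transposes with the derivations of `T⁺` are determined by their
composition with the counit. -/
theorem intertwiner_ext {W : Type} [AddCommGroup W] [Module ℝ W]
    {F G : TT →ₗ[ℝ] TPlus α w ⊗[ℝ] W}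
    (hF : ∀ v t, (rder α w (genOp α w v) : TPlus α w →ₗ[ℝ] TPlus α w).rTensor W (F t) =
      F (tr (genOp α w v) t))
    (hG : ∀ v t, (rder α w (genOp α w v) : TPlus α w →ₗ[ℝ] TPlus α w).rTensor W (G t) =
      G (tr (genOp α w v) t))
    (h : ∀ t, pairL α w hw W 1 (F t) = pairL α w hw W 1 (G t)) : F = G := by
  refine LinearMap.ext fun t => pairL_ext hw fun u => ?_
  refine U_induction (P := fun u => ∀ t, pairL α w hw W u (F t) = pairL α w hw W u (G t))
    h ?_ ?_ ?_ u t
  · intro u v hu hv t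
    have := congrArg₂ (· + ·) (hu t) (hv t)
    simpa only [pairL, LinearMap.comp_apply, map_add, LinearMap.rTensor_add,
      LinearMap.add_apply] using this
  · intro c u hu t
    have := congrArg (c • ·) (hu t)
    simpa only [pairL, LinearMap.comp_apply, map_smul, LinearMap.rTensor_smul,
      LinearMap.smul_apply] using this
  · intro v u hu t
    rw [pairL_emb_mul, pairL_emb_mul, gen_coe, hF, hG, hu]

theorem pairL_one_DeltaExt (hα : 0 < α) (t : TT) :
    pairL α w hw T 1 (DeltaExt α w t) = res t := by
  rw [pairL_DeltaExt hw hα, map_one, tr_one]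

/-- The index `e_m` of `T`. -/
def polyIdx (m : N2ne) : TIdx := ⟨ePoly m, Or.inr ⟨m, rfl⟩⟩

theorem pairL_lTensor {W W' : Type} [AddCommGroup W] [Module ℝ W] [AddCommGroup W'] [Module ℝ W']
    (g : W →ₗ[ℝ] W') (u : U α w) (t : TPlus α w ⊗[ℝ] W) :
    pairL α w hw W' u (g.lTensor (TPlus α w) t) = g (pairL α w hw W u t) := by
  induction t using TensorProduct.induction_on with
  | zero => simp
  | tmul f x => rw [LinearMap.lTensor_tmul, pairL_tmul, pairL_tmul, map_smul]
  | add t t' ht ht' => simp only [map_add, ht, ht']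

theorem rTensor_lTensor {A B V W : Type} [AddCommGroup A] [Module ℝ A] [AddCommGroup B] [Module ℝ B]
    [AddCommGroup V] [Module ℝ V] [AddCommGroup W] [Module ℝ W] (f : A →ₗ[ℝ] B) (g : V →ₗ[ℝ] W)
    (t : A ⊗[ℝ] V) : f.rTensor W (g.lTensor A t) = g.lTensor B (f.rTensor V t) := by
  induction t using TensorProduct.induction_on with
  | zero => simp
  | tmul f x => rfl
  | add t t' ht ht' => simp only [map_add, ht, ht']

include hw in
/-- The component of `Δ z_β` along `z_(e_m)` is `xx m β`. -/
theorem DeltaExt_polyIdx (hα : 0 < α) (m : N2ne) (t : TT) :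
    (Finsupp.lapply (polyIdx m) : T →ₗ[ℝ] ℝ).lTensor (TPlus α w) (DeltaExt α w t) =
      xxL α w m.1 t ⊗ₜ[ℝ] (1 : ℝ) := by
  have := intertwiner_ext hw
    (F := (Finsupp.lapply (polyIdx m) : T →ₗ[ℝ] ℝ).lTensor (TPlus α w) ∘ₗ DeltaExt α w)
    (G := (TensorProduct.mk ℝ (TPlus α w) ℝ).flip 1 ∘ₗ xxL α w m.1) ?_ ?_ ?_
  · exact LinearMap.congr_fun this t
  · intro v t
    rw [LinearMap.comp_apply, rTensor_lTensor]
    exact congrArg _ (rder_DeltaExt hw hα (gen α w v).2 t)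
  · intro v t
    simp only [LinearMap.comp_apply, LinearMap.flip_apply, TensorProduct.mk_apply,
      LinearMap.rTensor_tmul]
    congr 1
    have := rder_xxL hw (gen α w v).2 m.1 t
    rw [rval, if_neg m.2, map_zero, add_zero] at this
    exact this
  · intro t
    simp only [LinearMap.comp_apply, LinearMap.flip_apply, TensorProduct.mk_apply]
    rw [pairL_lTensor, pairL_one_DeltaExt hw hα, pairL_tmul, pair_one, aug_xxL_of_ne m.2,
      smul_eq_mul, mul_one]
    rfl

end

section

variable {α : ℝ} {w : Fin 2 → ℝ}

/-! ## The coproduct of `T⁺` -/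

section Derivations

variable {A B : Type} [CommRing A] [Algebra ℝ A] [CommRing B] [Algebra ℝ B]

/-- The derivation `D ⊗ id` of `A ⊗ B`. -/
def derR (D : Derivation ℝ A A) (B : Type) [CommRing B] [Algebra ℝ B] :
    Derivation ℝ (A ⊗[ℝ] B) (A ⊗[ℝ] B) :=
  Derivation.mk' ((D : A →ₗ[ℝ] A).rTensor B) fun x y => by
    induction x using TensorProduct.induction_on with
    | zero => simp
    | add x x' hx hx' => rw [add_mul, map_add, hx, hx', map_add]; simp only [smul_add, add_smul]; abel
    | tmul a b =>
      induction y using TensorProduct.induction_on with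
      | zero => simp
      | add y y' hy hy' =>
        rw [mul_add, map_add, hy, hy', map_add]; simp only [smul_add, add_smul]; abel
      | tmul a' b' =>
        simp only [smul_eq_mul, Algebra.TensorProduct.tmul_mul_tmul, LinearMap.rTensor_tmul,
          Derivation.coeFn_coe, Derivation.leibniz, TensorProduct.add_tmul]
        rw [mul_comm b' b]

theorem derR_apply (D : Derivation ℝ A A) (x : A ⊗[ℝ] B) :
    derR D B x = (D : A →ₗ[ℝ] A).rTensor B x := rfl

/-- The elements on which a homomorphism intertwines two derivations. -/
def intertwined (φ : A →ₐ[ℝ] B) (d : Derivation ℝ A A) (d' : Derivation ℝ B B) : Subalgebra ℝ A where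
  carrier := {f | d' (φ f) = φ (d f)}
  mul_mem' {f g} hf hg := by
    change d' (φ (f * g)) = φ (d (f * g))
    have hf' : d' (φ f) = φ (d f) := hf
    have hg' : d' (φ g) = φ (d g) := hg
    simp only [map_mul, Derivation.leibniz, map_add, smul_eq_mul, hf', hg']
  add_mem' {f g} hf hg := by
    change d' (φ (f + g)) = φ (d (f + g))
    have hf' : d' (φ f) = φ (d f) := hf
    have hg' : d' (φ g) = φ (d g) := hg
    simp only [map_add, hf', hg']
  algebraMap_mem' r := by
    change d' (φ (algebraMap ℝ A r)) = φ (d (algebraMap ℝ A r))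
    rw [AlgHom.commutes, Derivation.map_algebraMap, Derivation.map_algebraMap, map_zero]

end Derivations

theorem genOp_mem_L (v : LIdx α w) : genOp α w v ∈ L α w := (gen α w v).2

theorem xp_eq (m n : N2) : xp α w m n =
    ((((m 0).choose (n 0) * (m 1).choose (n 1) : ℕ)) : ℝ) • monomial (joinIdx 0 (m - n)) 1 := by
  have e : (monomial (joinIdx 0 (m - n) : PIdx α w) (1 : ℝ) : TPlus α w) =
      X (Sum.inr 0) ^ (m 0 - n 0) * X (Sum.inr 1) ^ (m 1 - n 1) := by
    have e1 : (joinIdx 0 (m - n) : PIdx α w) = Finsupp.single (Sum.inr 0) (m 0 - n 0) +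
        Finsupp.single (Sum.inr 1) (m 1 - n 1) := by
      classical
      ext v
      rcases v with a | j
      · simp [joinIdx]
      · fin_cases j <;> simp [joinIdx, Finsupp.single_apply]
    rw [e1, X_pow_eq_monomial, X_pow_eq_monomial, monomial_mul, one_mul]
  rw [e, xp, Algebra.smul_def, map_natCast]
  push_cast
  ring

theorem xp_ne_zero {m n : N2} (h : n ≤ m) : xp α w m n ≠ 0 := by
  rw [xp_eq]
  refine smul_ne_zero (Nat.cast_ne_zero.2 (mul_ne_zero ?_ ?_)) (by simp)
  · exact (Nat.choose_pos (h 0)).ne'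
  · exact (Nat.choose_pos (h 1)).ne'

/-- Nonvanishing of 𝒥_n z_γ passes from a column to every row that it meets. Conversely, rows with
vanishing symbols only meet such columns, which keeps the convention 𝒥_n z_β = 0 consistent with the
coproduct. -/
theorem xx_ne_zero_of_coeff (hw : ∀ i, 0 < w i) (v : LIdx α w) {n : N2} {β γ : MI}
    (h : coeff β (genOp α w v (mono γ)) ≠ 0) (hγ : xx α w n γ ≠ 0) : xx α w n β ≠ 0 := by
  have hadm : ∀ {β}, Admissible α w β n → xx α w n β ≠ 0 := fun h' => by
    rw [xx_admissible h']; exact X_ne_zero _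
  rcases xx_ne_zero hγ with h' | ⟨m, rfl⟩
  · exact hadm (admissible_of_coeff_genOp hw v h' h)
  · rw [xx_ePoly] at hγ
    have hm : n ≤ m.1 := by_contra fun hc => hγ (xp_eq_zero hc)
    rcases v with a | i
    · rw [genOp_inl_apply, mono_ePoly, tilt_inr] at h
      split_ifs at h with e
      · rw [mul_one, mono, coeff_monomial] at h
        have : a.1.1 = β := by_contra fun hc => h (if_neg hc)
        subst this
        exact hadm ⟨a.2.1, (len_mono hw (hm.trans e.ge)).trans_lt a.2.2⟩
      · simp at h
    · rw [genOp_inr_apply, mono_ePoly, shift_inr, coeff_smul, coeff_raised] at h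
      have : ePoly (raise m.1 i) = β := by_contra fun hc => h (by rw [if_neg hc, smul_zero])
      rw [← this, xx_ePoly]
      exact xp_ne_zero (hm.trans le_self_add)

variable (hw : ∀ i, 0 < w i)

include hw in
theorem xxL_tr_eq_zero {n : N2} (u : U α w) : ∀ {t : TT}, (∀ γ, t γ ≠ 0 → xx α w n γ = 0) →
    xxL α w n (tr (rho α w u) t) = 0 := by
  refine U_induction (P := fun u => ∀ {t : TT}, (∀ γ, t γ ≠ 0 → xx α w n γ = 0) →
    xxL α w n (tr (rho α w u) t) = 0) ?_ ?_ ?_ ?_ u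
  · intro t h
    rw [map_one, tr_one]
    exact xxL_eq_zero h
  · intro u v hu hv t h
    rw [map_add, tr_add (rho_mem_rowFinite u) (rho_mem_rowFinite v), map_add, hu h, hv h, add_zero]
  · intro c u hu t h
    rw [map_smul, tr_smul (rho_mem_rowFinite u), map_smul, hu h, smul_zero]
  · intro v u hu t h
    have hr := genOp_mem_rowFinite α w v
    rw [map_mul, rho_emb, gen_coe, tr_mul hr (rho_mem_rowFinite u)]
    refine hu fun γ hγ => by_contra fun hc => ?_
    have e : tr (genOp α w v) t γ = pr t (genOp α w v (mono γ)) := by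
      rw [← pr_tr hr, pr_mono]
    rw [e, pr, Finsupp.linearCombination_apply, Finsupp.sum, LinearMap.sum_apply] at hγ
    obtain ⟨β, hβ, hne⟩ := Finset.exists_ne_zero_of_sum_ne_zero hγ
    rw [LinearMap.smul_apply, lcoeff_apply, smul_eq_mul] at hne
    exact xx_ne_zero_of_coeff hw v (right_ne_zero_of_mul hne) hc
      (h β (Finsupp.mem_support_iff.1 hβ))

/-- The restriction of `xxL` to `T`. -/
def xxT (α : ℝ) (w : Fin 2 → ℝ) (n : N2) : T →ₗ[ℝ] TPlus α w :=
  Finsupp.linearCombination ℝ fun γ : TIdx => xx α w n γ.1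

theorem xxT_res (n : N2) (t : TT) : xxT α w n (res t) = xxL α w n t := by
  induction t using Finsupp.induction_linear with
  | zero => simp
  | add s t hs ht => simp only [map_add, hs, ht]
  | single β c =>
    rw [← mul_one c, ← smul_eq_mul, ← Finsupp.smul_single]
    simp only [map_smul]
    congr 1
    rw [xxL_single]
    by_cases hβ : 0 ≤ bra β ∨ ∃ n : N2ne, β = ePoly n
    · have : res (Finsupp.single β 1) = Finsupp.single (⟨β, hβ⟩ : TIdx) 1 := by
        classical
        ext γ
        rw [res_apply, Finsupp.single_apply, Finsupp.single_apply]
        exact if_congr ⟨fun h => Subtype.ext h, fun h => congrArg Subtype.val h⟩ rfl rfl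
      rw [this, xxT, Finsupp.linearCombination_single, one_smul]
    · have : res (Finsupp.single β 1) = 0 := by
        ext γ
        rw [res_apply, Finsupp.single_eq_of_ne (fun h : γ.1 = β => hβ (h ▸ γ.2))]
        rfl
      rw [this, map_zero]
      by_contra hc
      exact hβ ((xx_ne_zero (Ne.symm hc)).imp (fun h => h.1) id)

/-- The part `(id ⊗ 𝒥_n) Δ` of the coproduct. -/
def copT (α : ℝ) (w : Fin 2 → ℝ) (n : N2) : TT →ₗ[ℝ] TPlus α w ⊗[ℝ] TPlus α w :=
  (xxT α w n).lTensor (TPlus α w) ∘ₗ DeltaExt α w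

theorem pairL_copT (hα : 0 < α) (n : N2) (u : U α w) (t : TT) :
    pairL α w hw _ u (copT α w n t) = xxL α w n (tr (rho α w u) t) := by
  rw [copT, LinearMap.comp_apply, pairL_lTensor, pairL_DeltaExt hw hα, xxT_res]

include hw in
theorem copT_eq_zero (hα : 0 < α) {n : N2} {t : TT} (h : ∀ γ, t γ ≠ 0 → xx α w n γ = 0) :
    copT α w n t = 0 := by
  refine pairL_ext hw fun u => ?_
  rw [pairL_copT hw hα, xxL_tr_eq_zero hw u h, map_zero]

/-- The coproduct of `𝒥_n z_β / n!`. -/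
def cop (α : ℝ) (w : Fin 2 → ℝ) (n : N2) (t : TT) : TPlus α w ⊗[ℝ] TPlus α w :=
  copT α w n t + if n = 0 then xxL α w 0 t ⊗ₜ[ℝ] 1 else 0

theorem cop_add (n : N2) (s t : TT) : cop α w n (s + t) = cop α w n s + cop α w n t := by
  simp only [cop, map_add, TensorProduct.add_tmul]
  split_ifs <;> abel

theorem cop_smul (n : N2) (c : ℝ) (t : TT) : cop α w n (c • t) = c • cop α w n t := by
  simp only [cop, map_smul, smul_add, ← TensorProduct.smul_tmul']
  split_ifs <;> simp

include hw in
-- The summand of `cop` for n = 0 stands in for a basis vector z_{e_0}, which T does not have. It is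
-- differentiated separately.
theorem derR_cop (hα : 0 < α) {D : Module.End ℝ Poly} (hD : D ∈ L α w) (n : N2) (t : TT) :
    derR (rder α w D) (TPlus α w) (cop α w n t) =
      copT α w n (tr D t) + if n = 0 then rval α w D 0 t ⊗ₜ[ℝ] 1 else 0 := by
  rw [cop, map_add]
  congr 1
  · rw [copT, LinearMap.comp_apply, LinearMap.comp_apply, derR_apply, rTensor_lTensor]
    exact congrArg _ (rder_DeltaExt hw hα hD t)
  · split_ifs
    · rw [derR_apply, LinearMap.rTensor_tmul]
      exact congrArg (· ⊗ₜ[ℝ] 1) (rder_xxL hw hD 0 t)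
    · exact map_zero _

theorem pairL_one_cop (hα : 0 < α) (n : N2) (t : TT) :
    pairL α w hw _ 1 (cop α w n t) = xxL α w n t := by
  rw [cop, map_add, pairL_copT hw hα, map_one, tr_one]
  split_ifs
  · rw [pairL_tmul, pair_one, aug_xxL_zero, zero_smul, add_zero]
  · rw [map_zero, add_zero]

/-- The coproduct of `T⁺`, defined by its values on the generators. -/
def comulT (α : ℝ) (w : Fin 2 → ℝ) : TPlus α w →ₐ[ℝ] TPlus α w ⊗[ℝ] TPlus α w :=
  aeval fun v => cop α w (genN v) (Finsupp.single (genB v) 1)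

theorem comulT_X (v : LIdx α w) :
    comulT α w (X v) = cop α w (genN v) (Finsupp.single (genB v) 1) := aeval_X _ _

/-- The algebra homomorphism `ε ⊗ id`. -/
def augL (α : ℝ) (w : Fin 2 → ℝ) : TPlus α w ⊗[ℝ] TPlus α w →ₐ[ℝ] TPlus α w :=
  Algebra.TensorProduct.lift ((Algebra.ofId ℝ _).comp (aug (LIdx α w))) (AlgHom.id ℝ _)
    fun _ _ => Commute.all _ _

theorem augL_apply (t : TPlus α w ⊗[ℝ] TPlus α w) : augL α w t = pairL α w hw _ 1 t := by
  induction t using TensorProduct.induction_on with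
  | zero => simp
  | tmul f x => rw [pairL_tmul, pair_one, Algebra.smul_def]; rfl
  | add t t' ht ht' => simp only [map_add, ht, ht']

theorem pairL_one_comulT (hα : 0 < α) (f : TPlus α w) :
    pairL α w hw _ 1 (comulT α w f) = f := by
  have : (augL α w).comp (comulT α w) = AlgHom.id ℝ _ := by
    refine algHom_ext fun v => ?_
    rw [AlgHom.comp_apply, comulT_X, augL_apply hw, pairL_one_cop hw hα, xxL_single, ← X_eq_xx]
    rfl
  rw [← augL_apply]
  exact AlgHom.congr_fun this f

include hw in
theorem rder_xp_inl (a : AIdx α w) (m : N2ne) (n : N2) :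
    rder α w (genOp α w (Sum.inl a)) (xp α w m.1 n) = 0 := by
  rw [← xx_ePoly, rder_genOp_xx hw, rval_tilt_ePoly]

include hw in
theorem copT_tr_tilt (hα : 0 < α) (a : AIdx α w) (m : N2ne) (n : N2) :
    copT α w n (tr (genOp α w (Sum.inl a)) (Finsupp.single (ePoly m) 1)) = 0 := by
  refine copT_eq_zero hw hα fun γ hγ => by_contra fun hc => ?_
  rw [tr_single (genOp_mem_rowFinite α w _)] at hγ
  have hp := a.2.1
  have h1 := (coeff_genOp_degrees _ hγ).1
  rw [bra_ePoly, Sum.elim_inl] at h1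
  rcases xx_ne_zero hc with h | ⟨m', rfl⟩
  · have := h.1
    omega
  · rw [bra_ePoly] at h1
    omega

include hw in
theorem comulT_X_inr_intertwined (hα : 0 < α) (v : LIdx α w) (j : Fin 2) :
    (X (Sum.inr j) : TPlus α w) ∈ intertwined (comulT α w) (rder α w (genOp α w v))
      (derR (rder α w (genOp α w v)) (TPlus α w)) := by
  change derR (rder α w (genOp α w v)) _ (comulT α w (X (Sum.inr j))) = comulT α w (rder α w _ _)
  rw [comulT_X]
  change derR _ _ (cop α w 0 (Finsupp.single (ePoly (raise 0 j)) 1)) = _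
  rw [derR_cop hw hα (genOp_mem_L v), if_pos rfl]
  rcases v with a | i
  · rw [copT_tr_tilt hw hα, rval_tilt_ePoly, TensorProduct.zero_tmul, add_zero]
    have : (X (Sum.inr j) : TPlus α w) = xp α w (raise 0 j).1 0 := by
      rw [raise, ← xp_single]; simp
    rw [this, rder_xp_inl hw, map_zero]
  · rw [tr_shift_single_ePoly, rder_X_inr, rval_shift_ePoly]
    by_cases h : i = j
    · subst h
      simp [raise, xp_zero, Algebra.TensorProduct.one_def]
    · have h0 : (raise 0 j).1 i = 0 := by simp [raise, Finsupp.single_apply, Ne.symm h]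
      simp [h0, h]

include hw in
theorem xp_intertwined (hα : 0 < α) (v : LIdx α w) (m n : N2) :
    xp α w m n ∈ intertwined (comulT α w) (rder α w (genOp α w v))
      (derR (rder α w (genOp α w v)) (TPlus α w)) :=
  mul_mem (mul_mem (natCast_mem _ _) (pow_mem (comulT_X_inr_intertwined hw hα v 0) _))
    (mul_mem (natCast_mem _ _) (pow_mem (comulT_X_inr_intertwined hw hα v 1) _))

theorem pairL_add_left {W : Type} [AddCommGroup W] [Module ℝ W] (u v : U α w)
    (t : TPlus α w ⊗[ℝ] W) :
    pairL α w hw W (u + v) t = pairL α w hw W u t + pairL α w hw W v t :=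
  (pairR α w hw t).map_add u v

theorem pairL_smul_left {W : Type} [AddCommGroup W] [Module ℝ W] (c : ℝ) (u : U α w)
    (t : TPlus α w ⊗[ℝ] W) :
    pairL α w hw W (c • u) t = c • pairL α w hw W u t :=
  (pairR α w hw t).map_smul c u

include hw in
-- Pairing with U(L) replaces an expansion of the binomials. The z^γ D^(n') annihilate both sides,
-- and ∂_i lowers m by e_i, hence the induction on u has to run over all m at once. At m = e_i it
-- ends in constants.
theorem comulT_xp (hα : 0 < α) (n : N2) (m : N2ne) :
    comulT α w (xp α w m.1 n) = cop α w n (Finsupp.single (ePoly m) 1) := by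
  refine pairL_ext hw fun u => ?_
  refine U_induction (P := fun u => ∀ m : N2ne, pairL α w hw _ u (comulT α w (xp α w m.1 n)) =
    pairL α w hw _ u (cop α w n (Finsupp.single (ePoly m) 1))) ?_ ?_ ?_ ?_ u m
  · intro m
    rw [pairL_one_comulT hw hα, pairL_one_cop hw hα, xxL_single, xx_ePoly]
  · intro u v hu hv m
    rw [pairL_add_left, pairL_add_left, hu, hv]
  · intro c u hu m
    rw [pairL_smul_left, pairL_smul_left, hu]
  · intro v u hu m
    have h : derR (rder α w (genOp α w v)) _ (comulT α w (xp α w m.1 n)) =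
      comulT α w (rder α w _ _) := xp_intertwined hw hα v m.1 n
    have h' := derR_cop hw hα (gen α w v).2 n (Finsupp.single (ePoly m) 1)
    rw [pairL_emb_mul, pairL_emb_mul, ← derR_apply, ← derR_apply, h', gen_coe, h]
    rcases v with a | i
    · rw [copT_tr_tilt hw hα, rval_tilt_ePoly, rder_xp_inl hw]
      simp
    · rw [rder_xp, tr_shift_single_ePoly, rval_shift_ePoly]
      split_ifs with h1 h2 h2
      · rw [map_smul, map_smul, hu ⟨_, h1⟩, cop, map_smul, if_pos h2, h2, xxL_single, xx_ePoly,
          map_add, map_add, smul_add, map_smul, ← TensorProduct.smul_tmul', map_smul]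
      · rw [map_smul, map_smul, hu ⟨_, h1⟩, cop, map_smul, if_neg h2, add_zero, add_zero, map_smul]
      · rw [not_not] at h1
        rw [h1, xp_zero, if_pos h2, map_smul, map_one, map_zero, zero_add, xp_zero, if_pos rfl,
          ← TensorProduct.smul_tmul']
        rfl
      · rw [not_not] at h1
        rw [h1, xp_zero, if_neg h2]
        simp

include hw in
-- The defining formula on generators extends to all symbols. This is needed because the derivations
-- lead from generators to arbitrary symbols.
theorem comulT_xxL (hα : 0 < α) (n : N2) (t : TT) : comulT α w (xxL α w n t) = cop α w n t := by
  induction t using Finsupp.induction_linear with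
  | zero => simp [cop]
  | add s t hs ht => rw [map_add, map_add, hs, ht, cop_add]
  | single β c =>
    rw [← mul_one c, ← smul_eq_mul, ← Finsupp.smul_single, map_smul, map_smul, cop_smul, xxL_single]
    congr 1
    by_cases h : Admissible α w β n
    · rw [xx_admissible h, comulT_X]
      rfl
    · by_cases h' : ∃ m, β = ePoly m
      · obtain ⟨m, rfl⟩ := h'
        rw [xx_ePoly, comulT_xp hw hα]
      · have h0 := xx_of_not h (by push Not at h'; exact h')
        rw [h0, map_zero, cop, copT_eq_zero hw hα, zero_add, xxL_single]
        · split_ifs with hn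
          · subst hn; rw [h0, TensorProduct.zero_tmul]
          · rfl
        · intro γ hγ
          have : β = γ := by_contra fun hc => hγ (Finsupp.single_eq_of_ne' hc)
          rw [← this, h0]

include hw in
-- The elements on which the intertwining relation holds form a subalgebra, so generators suffice.
-- There the relation reduces to `comulT_xxL` and `derR_cop`.
theorem derR_comulT (hα : 0 < α) (v : LIdx α w) (f : TPlus α w) :
    derR (rder α w (genOp α w v)) _ (comulT α w f) = comulT α w (rder α w (genOp α w v) f) := by
  have h : intertwined (comulT α w) (rder α w (genOp α w v))
      (derR (rder α w (genOp α w v)) (TPlus α w)) = ⊤ := by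
    rw [eq_top_iff, ← adjoin_range_X, Algebra.adjoin_le_iff]
    rintro _ ⟨v', rfl⟩
    change derR _ _ (comulT α w _) = comulT α w _
    have hR : ∀ n t, comulT α w (rval α w (genOp α w v) n t) = cop α w n (tr (genOp α w v) t) +
        algebraMap ℝ _ (if n = 0 then pr t (tiltPart (genOp α w v)) else 0) := fun n t => by
      rw [rval, map_add, comulT_xxL hw hα, AlgHom.commutes]
    rw [comulT_X, derR_cop hw hα (genOp_mem_L v), rder_X, hR, cop, add_assoc]
    congr 1
    split_ifs with h0
    · rw [rval, if_pos rfl, TensorProduct.add_tmul]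
      rfl
    · simp
  exact (h ▸ Algebra.mem_top : f ∈ intertwined (comulT α w) (rder α w (genOp α w v))
      (derR (rder α w (genOp α w v)) (TPlus α w)))

/-- A generator at the left of u acts as a derivation, either on f or on the left leg of its
coproduct, and `derR_comulT` identifies the two. So `comulT` is dual to the product. -/
theorem pair_pairL_comulT (hα : 0 < α) (u v : U α w) : ∀ f,
    pair α w hw v (pairL α w hw _ u (comulT α w f)) = pair α w hw (u * v) f := by
  refine U_induction (P := fun u => ∀ f,
    pair α w hw v (pairL α w hw _ u (comulT α w f)) = pair α w hw (u * v) f) ?_ ?_ ?_ ?_ u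
  · intro f
    rw [pairL_one_comulT hw hα, one_mul]
  · intro u u' hu hu' f
    rw [pairL_add_left, map_add, hu, hu', add_mul, map_add, LinearMap.add_apply]
  · intro c u hu f
    rw [pairL_smul_left, map_smul, hu, smul_mul_assoc, map_smul, LinearMap.smul_apply]
  · intro a u hu f
    rw [pairL_emb_mul, ← derR_apply, mul_assoc, pair_emb_mul, gen_coe, derR_comulT hw hα, hu]

theorem pair_ext {f g : TPlus α w} (h : ∀ u, pair α w hw u f = pair α w hw u g) : f = g := by
  ext p
  rw [← pair_DD hw, h, pair_DD]

/-- Tested against three elements of U(L), this is the associativity of their product. -/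
theorem comulT_coassoc (hα : 0 < α) (hw : ∀ i, 0 < w i) :
    TensorProduct.assoc ℝ (TPlus α w) (TPlus α w) (TPlus α w) ∘ₗ
      (comulT α w).toLinearMap.rTensor _ ∘ₗ (comulT α w).toLinearMap =
      (comulT α w).toLinearMap.lTensor _ ∘ₗ (comulT α w).toLinearMap := by
  refine LinearMap.ext fun f => pairL_ext hw fun u => pairL_ext hw fun v => pair_ext hw fun x => ?_
  have key : ∀ t : TPlus α w ⊗[ℝ] TPlus α w, pairL α w hw _ v (pairL α w hw _ u
      (TensorProduct.assoc ℝ (TPlus α w) (TPlus α w) (TPlus α w)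
        ((comulT α w).toLinearMap.rTensor _ t))) = pairL α w hw _ (u * v) t := by
    intro t
    induction t using TensorProduct.induction_on with
    | zero => simp
    | add t t' ht ht' => simp only [map_add, ht, ht']
    | tmul f g =>
      rw [LinearMap.rTensor_tmul, pairL_tmul, ← pair_pairL_comulT hw hα, AlgHom.toLinearMap_apply]
      generalize comulT α w f = s
      induction s using TensorProduct.induction_on with
      | zero => simp
      | add t t' ht ht' => simp only [map_add, ht, ht', TensorProduct.add_tmul, add_smul]
      | tmul a b =>
        rw [TensorProduct.assoc_tmul, pairL_tmul, map_smul, pairL_tmul, pairL_tmul, map_smul,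
          smul_smul, smul_eq_mul]
  simp only [LinearMap.comp_apply, LinearEquiv.coe_coe]
  rw [key, pairL_lTensor, AlgHom.toLinearMap_apply, AlgHom.toLinearMap_apply,
    pair_pairL_comulT hw hα, pair_pairL_comulT hw hα, pair_pairL_comulT hw hα, mul_assoc]

theorem comulT_counit_left (hα : 0 < α) (hw : ∀ i, 0 < w i) :
    (aug (LIdx α w)).toLinearMap.rTensor _ ∘ₗ (comulT α w).toLinearMap =
      TensorProduct.mk ℝ ℝ _ 1 := by
  refine LinearMap.ext fun f => (TensorProduct.lid ℝ (TPlus α w)).injective ?_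
  have h : (aug (LIdx α w)).toLinearMap = pair α w hw 1 :=
    LinearMap.ext fun f => (pair_one hw f).symm
  rw [h]
  refine (pairL_one_comulT hw hα f).trans ?_
  simp

theorem comulT_counit_right (hα : 0 < α) (hw : ∀ i, 0 < w i) :
    (aug (LIdx α w)).toLinearMap.lTensor _ ∘ₗ (comulT α w).toLinearMap =
      (TensorProduct.mk ℝ _ ℝ).flip 1 := by
  refine LinearMap.ext fun f => pairL_ext hw fun u => ?_
  rw [LinearMap.comp_apply, pairL_lTensor, AlgHom.toLinearMap_apply, AlgHom.toLinearMap_apply,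
    ← pair_one hw, pair_pairL_comulT hw hα, mul_one, LinearMap.flip_apply,
    TensorProduct.mk_apply, pairL_tmul, smul_eq_mul, mul_one]

/-! ### Identification with the dual of the product of `U(L)` -/

theorem DDbasis_repr_mul (hα : 0 < α) (p q r : PIdx α w) :
    (DDbasis α w hw).repr (DDbasis α w hw q * DDbasis α w hw r) p =
      coeff r (pairL α w hw _ (DD α w q) (comulT α w (ZZ α w p))) := by
  rw [DDbasis_repr, DDbasis_apply, DDbasis_apply, ← pair_pairL_comulT hw hα, pair_DD]

/-- The structure constants are the coefficients of `comulT` of a monomial, which is one element of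
the algebraic tensor product and hence a finite sum. -/
theorem finite_DDbasis_repr_mul (hα : 0 < α) (p : PIdx α w) :
    {q : PIdx α w × PIdx α w |
      (DDbasis α w hw).repr (DDbasis α w hw q.1 * DDbasis α w hw q.2) p ≠ 0}.Finite := by
  obtain ⟨s, -, hs⟩ := eq_sum_pairL hw (comulT α w (ZZ α w p))
  refine (s.finite_toSet.biUnion (t := fun q => (fun r => (q, r)) ''
    ((pairL α w hw _ (DD α w q) (comulT α w (ZZ α w p))).support : Set (PIdx α w)))
    fun q _ => (Finset.finite_toSet _).image _).subset ?_
  rintro ⟨q, r⟩ h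
  rw [Set.mem_ofPred_eq, DDbasis_repr_mul hw hα] at h
  refine Set.mem_biUnion (x := q) ?_ ⟨r, mem_support_iff.2 h, rfl⟩
  by_contra hc
  rw [hs q hc] at h
  exact h (coeff_zero r)

/-- Both maps have the same pairings with all products of basis elements. In particular, the dual of
the product of U(L) is multiplicative. -/
theorem DeltaPlus_eq_comulT (hα : 0 < α) (hw : ∀ i, 0 < w i) :
    DeltaPlus α w (DDbasis α w hw) = (comulT α w).toLinearMap := by
  classical
  refine (basisMonomials (LIdx α w) ℝ).ext fun p => ?_
  rw [DeltaPlus, Module.Basis.constr_basis, coe_basisMonomials]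
  change _ = comulT α w (ZZ α w p)
  rw [finsum_eq_sum_of_support_subset (s := (finite_DDbasis_repr_mul hw hα p).toFinset)]
  · refine pairL_ext hw fun u => ?_
    have : pairR α w hw (∑ q ∈ (finite_DDbasis_repr_mul hw hα p).toFinset,
        (DDbasis α w hw).repr (DDbasis α w hw q.1 * DDbasis α w hw q.2) p •
          (ZZ α w q.1 ⊗ₜ[ℝ] ZZ α w q.2)) = pairR α w hw (comulT α w (ZZ α w p)) := by
      refine U_hom_ext hw fun r => ?_
      change pairL α w hw _ _ _ = pairL α w hw _ _ _
      ext s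
      rw [map_sum, coeff_sum, ← DDbasis_repr_mul hw hα]
      simp only [map_smul, pairL_tmul, pair_DD, ZZ, coeff_monomial, coeff_smul, smul_eq_mul]
      rw [Finset.sum_eq_single (r, s)]
      · simp
      · rintro ⟨q, δ⟩ - hne
        by_cases h1 : q = r
        · by_cases h2 : δ = s
          · exact absurd (by rw [h1, h2]) hne
          · simp [h2]
        · simp [h1]
      · intro h
        rw [Set.Finite.mem_toFinset, Set.mem_ofPred_eq, not_not] at h
        simp only [h, zero_mul]
    exact LinearMap.congr_fun this u
  · intro q hq
    rw [Finset.mem_coe, Set.Finite.mem_toFinset]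
    intro h
    exact hq (by simp only [h, zero_smul])

/-! ### Homogeneity and the antipode -/

theorem weight_joinIdx_zero (k : N2) :
    Finsupp.weight (wtP α w) (joinIdx 0 k : PIdx α w) = len w k := by
  induction k using N2_induction with
  | h0 =>
    have e : (joinIdx 0 0 : PIdx α w) = 0 := by
      ext v; rcases v with a | j <;> rfl
    rw [e, map_zero, len_zero]
  | h m i ih =>
    rw [joinIdx_add_inr, map_add, ih, Finsupp.weight_single, len_add, len_single, one_smul]
    rfl

/-- The weight of the symbol is that of z_γ minus |n|, for generators and for the polynomials
attached to e_m alike. For vanishing symbols nothing is claimed. -/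
theorem tmul_xx_mem (q : PIdx α w) (n : N2) (γ : MI) : ZZ α w q ⊗ₜ[ℝ] xx α w n γ ∈
    wtTensor (wtP α w) (wtP α w)
      (Finsupp.weight (wtP α w) q + (dg α w γ + (α + 1) - len w n)) := by
  by_cases h : Admissible α w γ n
  · rw [xx_admissible h]
    refine tmul_mem_wtTensor ?_
    rw [Finsupp.weight_single, one_smul, wtP, Sum.elim_inl, hom_eq, dg]
    ring
  · by_cases h' : ∃ m, γ = ePoly m
    · obtain ⟨m, rfl⟩ := h'
      rw [xx_ePoly]
      by_cases hn : n ≤ m.1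
      · rw [xp_eq, TensorProduct.tmul_smul]
        refine Submodule.smul_mem _ _ (tmul_mem_wtTensor ?_)
        have : len w m.1 = len w (m.1 - n) + len w n := by
          rw [← len_add, tsub_add_cancel_of_le hn]
        rw [weight_joinIdx_zero, dg, bra_ePoly, plen_ePoly, this]
        push_cast
        ring
      · rw [xp_eq_zero hn, TensorProduct.tmul_zero]
        exact Submodule.zero_mem _
    · rw [xx_of_not h (by push Not at h'; exact h'), TensorProduct.tmul_zero]
      exact Submodule.zero_mem _

include hw in
theorem cop_mem (hα : 0 < α) (n : N2) (β : MI) : cop α w n (Finsupp.single β 1) ∈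
    wtTensor (wtP α w) (wtP α w) (dg α w β + (α + 1) - len w n) := by
  refine Submodule.add_mem _ ?_ ?_
  · rw [copT, LinearMap.comp_apply, DeltaExt_single hα hw, map_sum]
    refine Submodule.sum_mem _ fun q hq => ?_
    rw [Set.Finite.mem_toFinset] at hq
    rw [map_smul, LinearMap.lTensor_tmul, xxT, Finsupp.linearCombination_single, one_smul]
    refine Submodule.smul_mem _ _ ?_
    have h := tmul_xx_mem q.1 n q.2.1
    rw [dg_deltaCoeff hw hq]
    convert h using 2
    ring
  · split_ifs with hn
    · subst hn
      have h := tmul_xx_mem (α := α) (w := w) 0 0 β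
      rw [map_zero, zero_add] at h
      -- The total weight does not change when the legs are exchanged, so that x ⊗ 1 is handled by 1
      -- ⊗ x.
      have hc : ∀ x ∈ wtTensor (wtP α w) (wtP α w) (dg α w β + (α + 1) - len w 0),
          TensorProduct.comm ℝ _ _ x ∈
            wtTensor (wtP α w) (wtP α w) (dg α w β + (α + 1) - len w 0) := by
        intro x hx
        induction hx using Submodule.span_induction with
        | mem x hx =>
          obtain ⟨q, r, hqr, rfl⟩ := hx
          exact tmul_mem_wtTensor (by rw [add_comm, hqr])
        | zero => rw [map_zero]; exact Submodule.zero_mem _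
        | add x y _ _ hx hy => rw [map_add]; exact Submodule.add_mem _ hx hy
        | smul c x _ hx => rw [map_smul]; exact Submodule.smul_mem _ _ hx
      have := hc _ h
      rw [TensorProduct.comm_tmul] at this
      rw [xxL_single]
      exact this
    · exact Submodule.zero_mem _

theorem exists_antipode_TPlus (hα : 0 < α) (hw : ∀ i, 0 < w i) :
    ∃ S, IsHopfAlgebra (comulT α w).toLinearMap (epsPlus α w) S := by
  refine exists_antipode (comulT α w) (minWt_pos hw) minWt_le_wtP (fun v => ?_)
    (comulT_coassoc hα hw) (comulT_counit_left hα hw) (comulT_counit_right hα hw)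
  rw [comulT_X]
  have h := cop_mem hw hα (genN v) (genB v)
  convert h using 2
  rcases v with a | i
  · change hom (α + 1) w a.1.1 - len w a.1.2 = dg α w a.1.1 + (α + 1) - len w a.1.2
    rw [hom_eq, dg]
    ring
  · change w i = dg α w (ePoly (raise 0 i)) + (α + 1) - len w 0
    have h' : len w (raise 0 i).1 = w i := by
      change len w (0 + Finsupp.single i 1) = _
      rw [zero_add, len_single]
    rw [dg, bra_ePoly, plen_ePoly, h', len_zero]
    push_cast
    ring

end

section

variable {α : ℝ} {w : Fin 2 → ℝ}

/-! ## Rooted trees -/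

theorem RTree.mk_node_perm {A : Type} (a : A) {l l' : List (PTree A)} (h : l.Perm l') :
    RTree.mk (.node a l) = RTree.mk (.node a l') := Quot.sound (.perm a h)

theorem RTree.mk_node_child {A : Type} (a : A) (l₁ l₂ : List (PTree A)) {t t' : PTree A}
    (h : RTree.mk t = RTree.mk t') :
    RTree.mk (.node a (l₁ ++ t :: l₂)) = RTree.mk (.node a (l₁ ++ t' :: l₂)) :=
  congrArg (Quot.lift (fun t => RTree.mk (.node a (l₁ ++ t :: l₂)))
    fun _ _ h => Quot.sound (.child a l₁ l₂ h)) h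

/-- The children are replaced by equivalent ones one at a time, and l₁ collects those already
treated. -/
theorem RTree.mk_node_append {A : Type} (a : A) {l l' : List (PTree A)}
    (h : l.map RTree.mk = l'.map RTree.mk) (l₁ : List (PTree A)) :
    RTree.mk (.node a (l₁ ++ l)) = RTree.mk (.node a (l₁ ++ l')) := by
  induction l generalizing l' l₁ with
  | nil => rw [List.map_nil, eq_comm, List.map_eq_nil_iff] at h; rw [h]
  | cons t l ih =>
    rcases l' with _ | ⟨t', l'⟩
    · simp at h
    · rw [List.map_cons, List.map_cons, List.cons.injEq] at h
      rw [RTree.mk_node_child a l₁ l h.1]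
      have := ih h.2 (l₁ ++ [t'])
      simpa using this

theorem RTree.mk_node {A : Type} (a : A) (l : List (PTree A)) :
    RTree.mk (.node a l) = RTree.node a (l.map RTree.mk : Multiset (RTree A)) := by
  have h : ((l.map RTree.mk : Multiset (RTree A)).toList).Perm (l.map RTree.mk) :=
    Multiset.coe_eq_coe.1 (Multiset.coe_toList _)
  have h' : ((l.map RTree.mk).map RTree.out).map RTree.mk = l.map RTree.mk := by
    rw [List.map_map]
    conv_rhs => rw [← List.map_id (l.map RTree.mk)]
    exact List.map_congr_left fun τ _ => Quot.out_eq τ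
  rw [RTree.node, RTree.mk_node_perm a (h.map RTree.out)]
  exact (RTree.mk_node_append a h' []).symm

/-- The induction runs over the size of planar representatives, because the size does not come with
the quotient. -/
theorem RTree.induction {A : Type} {P : RTree A → Prop}
    (h : ∀ a s, (∀ τ ∈ s, P τ) → P (RTree.node a s)) (τ : RTree A) : P τ := by
  have key : ∀ n, ∀ t : PTree A, sizeOf t < n → P (RTree.mk t) := by
    intro n
    induction n with
    | zero => intro t ht; omega
    | succ n ih =>
      rintro ⟨a, l⟩ ht
      rw [RTree.mk_node]
      refine h a _ fun τ hτ => ?_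
      rw [Multiset.mem_coe, List.mem_map] at hτ
      obtain ⟨t, htl, rfl⟩ := hτ
      refine ih t ?_
      have := List.sizeOf_lt_of_mem htl
      simp only [PTree.node.sizeOf_spec] at ht
      omega
  induction τ using Quot.ind with
  | mk t => exact key _ t (Nat.lt_succ_self _)

/-! ## Monomials and trees -/

section Monomials

variable {P : Type}

/-- The polynomial symbols of a monomial. -/
def polyPart (m : Mon P) : P →₀ ℕ := m.comapDomain Sym.poly Sym.poly_injective.injOn

/-- The planted trees of a monomial. -/
def intPart (m : Mon P) : Multiset (RTree (P →₀ ℕ)) :=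
  Finsupp.toMultiset (m.comapDomain Sym.int Sym.int_injective.injOn)

/-- The monomial with given parts. -/
def mkMon (k : ℕ) (a : P →₀ ℕ) (s : Multiset (RTree (P →₀ ℕ))) : Mon P :=
  Finsupp.single Sym.noise k + Finsupp.mapDomain Sym.poly a +
    (s.map fun τ => Finsupp.single (Sym.int τ) 1).sum

theorem sum_single_int (q : RTree (P →₀ ℕ) →₀ ℕ) :
    ((Finsupp.toMultiset q).map fun τ => (Finsupp.single (Sym.int τ) 1 : Mon P)).sum =
      Finsupp.mapDomain Sym.int q := by
  induction q using Finsupp.induction_linear with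
  | zero => simp
  | add p q hp hq => rw [map_add, Multiset.map_add, Multiset.sum_add, hp, hq, Finsupp.mapDomain_add]
  | single τ k =>
    rw [Finsupp.toMultiset_single, Multiset.map_nsmul, Multiset.sum_nsmul, Multiset.map_singleton,
      Multiset.sum_singleton, Finsupp.mapDomain_single, Finsupp.smul_single, nsmul_one, Nat.cast_id]

theorem mkMon_parts (m : Mon P) : mkMon (m Sym.noise) (polyPart m) (intPart m) = m := by
  rw [mkMon, intPart, sum_single_int]
  ext s
  simp only [Finsupp.add_apply]
  rcases s with _ | i | τ
  · rw [Finsupp.single_eq_same, Finsupp.mapDomain_of_notMem_range _ _ (by rintro ⟨τ, h⟩; cases h),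
      Finsupp.mapDomain_of_notMem_range _ _ (by rintro ⟨τ, h⟩; cases h), add_zero, add_zero]
  · rw [Finsupp.single_eq_of_ne (by simp), Finsupp.mapDomain_apply Sym.poly_injective,
      Finsupp.mapDomain_of_notMem_range _ _ (by rintro ⟨τ, h⟩; cases h), add_zero, zero_add]
    rfl
  · rw [Finsupp.single_eq_of_ne (by simp), Finsupp.mapDomain_apply Sym.int_injective,
      Finsupp.mapDomain_of_notMem_range _ _ (by rintro ⟨τ, h⟩; cases h), add_zero, zero_add]
    rfl

theorem sum_single_int' (s : Multiset (RTree (P →₀ ℕ))) :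
    ∃ q, s = Finsupp.toMultiset q ∧
      (s.map fun τ => (Finsupp.single (Sym.int τ) 1 : Mon P)).sum = Finsupp.mapDomain Sym.int q := by
  classical
  refine ⟨s.toFinsupp, by simp, ?_⟩
  rw [← sum_single_int, Multiset.toFinsupp_toMultiset]

theorem mkMon_noise (k : ℕ) (a : P →₀ ℕ) (s : Multiset (RTree (P →₀ ℕ))) :
    mkMon k a s Sym.noise = k := by
  obtain ⟨q, -, e⟩ := sum_single_int' s
  rw [mkMon, e]
  simp only [Finsupp.add_apply]
  rw [Finsupp.single_eq_same, Finsupp.mapDomain_of_notMem_range _ _ (by rintro ⟨τ, h⟩; cases h),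
      Finsupp.mapDomain_of_notMem_range _ _ (by rintro ⟨τ, h⟩; cases h), add_zero, add_zero]

theorem polyPart_mkMon (k : ℕ) (a : P →₀ ℕ) (s : Multiset (RTree (P →₀ ℕ))) :
    polyPart (mkMon k a s) = a := by
  obtain ⟨q, -, e⟩ := sum_single_int' s
  ext i
  rw [mkMon, e, polyPart, Finsupp.comapDomain_apply]
  simp only [Finsupp.add_apply]
  rw [Finsupp.single_eq_of_ne (by simp), Finsupp.mapDomain_apply Sym.poly_injective,
      Finsupp.mapDomain_of_notMem_range _ _ (by rintro ⟨τ, h⟩; cases h), add_zero, zero_add]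

theorem intPart_mkMon (k : ℕ) (a : P →₀ ℕ) (s : Multiset (RTree (P →₀ ℕ))) :
    intPart (mkMon k a s) = s := by
  obtain ⟨q, rfl, e⟩ := sum_single_int' s
  rw [intPart, mkMon, e]
  congr 1
  ext τ
  rw [Finsupp.comapDomain_apply]
  simp only [Finsupp.add_apply]
  rw [Finsupp.single_eq_of_ne (by simp), Finsupp.mapDomain_apply Sym.int_injective,
      Finsupp.mapDomain_of_notMem_range _ _ (by rintro ⟨τ, h⟩; cases h), add_zero, zero_add]

theorem toTree_mkMon (k : ℕ) (a : P →₀ ℕ) (s : Multiset (RTree (P →₀ ℕ))) :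
    toTree (mkMon k a s) = RTree.node a s := by
  change RTree.node (polyPart _) (intPart _) = _
  rw [polyPart_mkMon, intPart_mkMon]

theorem monomial_mkMon (k : ℕ) (a : P →₀ ℕ) (s : Multiset (RTree (P →₀ ℕ))) :
    (monomial (mkMon k a s) 1 : Alg P) = X Sym.noise ^ k * (a.prod fun i e => X (Sym.poly i) ^ e) *
      (s.map fun τ => X (Sym.int τ)).prod := by
  have h1 : (monomial (Finsupp.mapDomain Sym.poly a) 1 : Alg P) =
      a.prod fun i e => X (Sym.poly i) ^ e := by
    rw [monomial_eq, Finsupp.prod_mapDomain_index_inj Sym.poly_injective, C_1, one_mul]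
  have h2 : (monomial (s.map fun τ => (Finsupp.single (Sym.int τ) 1 : Mon P)).sum 1 : Alg P) =
      (s.map fun τ => X (Sym.int τ)).prod := by
    induction s using Multiset.induction_on with
    | empty => simp
    | cons τ s ih =>
      rw [Multiset.map_cons, Multiset.map_cons, Multiset.sum_cons, Multiset.prod_cons, ← ih, X,
        monomial_mul, one_mul]
  rw [mkMon, ← one_mul (1 : ℝ), ← monomial_mul, h2, ← one_mul (1 : ℝ), ← monomial_mul, h1,
    X_pow_eq_monomial]

theorem integ_monomial (m : Mon P) : integ (monomial m 1) =
    if m Sym.noise = 1 then (X (Sym.int (toTree m)) : Alg P) else 0 := by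
  have e : (monomial m 1 : Alg P) = basisMonomials (Sym P) ℝ m := by simp
  rw [e, integ, Module.Basis.constr_basis]

/-- The linear combinations of the trees. -/
def treeSpan (P : Type) : Submodule ℝ (Alg P) :=
  Submodule.span ℝ ((fun m => monomial m (1 : ℝ)) '' {m : Mon P | m Sym.noise = 1})

/-- The algebra generated by the polynomial symbols and the planted trees. -/
def noiseFree (P : Type) : Submodule ℝ (Alg P) :=
  Submodule.span ℝ ((fun m => monomial m (1 : ℝ)) '' {m : Mon P | m Sym.noise = 0})

theorem mul_noise_mem_treeSpan {x : Alg P} (hx : x ∈ noiseFree P) :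
    x * X Sym.noise ∈ treeSpan P := by
  induction hx using Submodule.span_induction with
  | mem x hx =>
    obtain ⟨m, hm, rfl⟩ := hx
    refine Submodule.subset_span ⟨m + Finsupp.single Sym.noise 1, ?_, ?_⟩
    · rw [Set.mem_ofPred_eq] at hm ⊢
      rw [Finsupp.add_apply, hm, Finsupp.single_eq_same]
    · simp [X, monomial_mul]
  | zero => rw [zero_mul]; exact Submodule.zero_mem _
  | add x y _ _ hx hy => rw [add_mul]; exact Submodule.add_mem _ hx hy
  | smul c x _ hx => rw [smul_mul_assoc]; exact Submodule.smul_mem _ c hx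

theorem one_mem_noiseFree : (1 : Alg P) ∈ noiseFree P := Submodule.subset_span ⟨0, rfl, rfl⟩

theorem X_poly_mem_noiseFree (i : P) : (X (Sym.poly i) : Alg P) ∈ noiseFree P :=
  Submodule.subset_span ⟨Finsupp.single (Sym.poly i) 1, Finsupp.single_eq_of_ne (by simp), rfl⟩

theorem X_int_mem_noiseFree (τ) : (X (Sym.int τ) : Alg P) ∈ noiseFree P :=
  Submodule.subset_span ⟨Finsupp.single (Sym.int τ) 1, Finsupp.single_eq_of_ne (by simp), rfl⟩

theorem mul_mem_noiseFree {x y : Alg P} (hx : x ∈ noiseFree P) (hy : y ∈ noiseFree P) :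
    x * y ∈ noiseFree P := by
  induction hx using Submodule.span_induction with
  | mem x hx =>
    obtain ⟨m, hm, rfl⟩ := hx
    induction hy using Submodule.span_induction with
    | mem y hy =>
      obtain ⟨m', hm', rfl⟩ := hy
      refine Submodule.subset_span ⟨m + m', ?_, ?_⟩
      · rw [Set.mem_ofPred_eq] at hm hm' ⊢
        rw [Finsupp.add_apply, hm, hm']
      · simp [monomial_mul]
    | zero => rw [mul_zero]; exact Submodule.zero_mem _
    | add x y _ _ hx hy => rw [mul_add]; exact Submodule.add_mem _ hx hy
    | smul c x _ hx => rw [mul_smul_comm]; exact Submodule.smul_mem _ c hx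
  | zero => rw [zero_mul]; exact Submodule.zero_mem _
  | add x y _ _ hx hy => rw [add_mul]; exact Submodule.add_mem _ hx hy
  | smul c x _ hx => rw [smul_mul_assoc]; exact Submodule.smul_mem _ c hx

theorem integ_mem_noiseFree (x : Alg P) : integ x ∈ noiseFree P := by
  rw [x.as_sum, map_sum]
  refine Submodule.sum_mem _ fun m _ => ?_
  rw [← mul_one (coeff m x), ← smul_eq_mul, ← smul_monomial, map_smul, integ_monomial]
  refine Submodule.smul_mem _ _ ?_
  split_ifs
  · exact X_int_mem_noiseFree _
  · exact Submodule.zero_mem _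

end Monomials

theorem xPow_eq_prod (a : N2) : xPow a = a.prod fun i e => X (Sym.poly i) ^ e := by
  rw [Finsupp.prod_fintype _ _ (by simp)]
  rfl

theorem treePoly_eq (a : N2) (s : Multiset (RTree N2)) :
    treePoly a s = monomial (mkMon 1 a s) 1 := by
  rw [monomial_mkMon, pow_one, treePoly, xPow_eq_prod]

theorem monomial_eq_treePoly {m : Mon (Fin 2)} (h : IsTree m) :
    (monomial m 1 : Alg (Fin 2)) = treePoly (polyPart m) (intPart m) := by
  have h' : m Sym.noise = 1 := h
  rw [treePoly_eq, ← h', mkMon_parts]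

theorem xPow_eq_monomial (a : N2) : xPow a = monomial (mkMon 0 a 0) 1 := by
  rw [monomial_mkMon, xPow_eq_prod, pow_zero, one_mul, Multiset.map_zero, Multiset.prod_zero, mul_one]

theorem isPolynomial_mkMon (a : N2) : IsPolynomial (mkMon 0 a 0) := by
  refine ⟨mkMon_noise _ _ _, fun τ => ?_⟩
  rw [mkMon, Multiset.map_zero, Multiset.sum_zero, add_zero, Finsupp.single_zero, zero_add]
  exact Finsupp.mapDomain_of_notMem_range _ _ (by rintro ⟨τ, h⟩; cases h)

theorem eq_mkMon_of_isPolynomial {m : Mon (Fin 2)} (h : IsPolynomial m) :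
    m = mkMon 0 (polyPart m) 0 := by
  have h0 : intPart m = 0 := by
    rw [intPart]
    have : (m.comapDomain Sym.int Sym.int_injective.injOn : RTree N2 →₀ ℕ) = 0 := by
      ext τ; exact h.2 τ
    rw [this, map_zero]
  conv_lhs => rw [← mkMon_parts m, h0, h.1]

/-! ### Homogeneities -/

theorem monHom_eq_weight (m : Mon (Fin 2)) : monHom α w m = Finsupp.weight (symHom α w) m := by
  rw [monHom, Finsupp.weight_apply]
  exact Finsupp.sum_congr fun v _ => by rw [nsmul_eq_mul]

theorem treeHom_node (a : N2) (s : Multiset (RTree N2)) : treeHom α w (RTree.node a s) =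
    α - 2 + len w a + (s.map fun τ => treeHom α w τ + 2).sum := by
  rw [treeHom, RTree.para_node, Multiset.map_map]
  rfl

theorem monHom_mkMon (k : ℕ) (a : N2) (s : Multiset (RTree N2)) : monHom α w (mkMon k a s) =
    k * (α - 2) + len w a + (s.map fun τ => treeHom α w τ + 2).sum := by
  have h1 : Finsupp.weight (symHom α w) (Finsupp.mapDomain Sym.poly a) = len w a := by
    induction a using N2_induction with
    | h0 => simp
    | h m i ih =>
      rw [Finsupp.mapDomain_add, map_add, ih, len_add, len_single, Finsupp.mapDomain_single,
        Finsupp.weight_single, one_smul]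
      rfl
  have h2 : Finsupp.weight (symHom α w)
      (s.map fun τ => (Finsupp.single (Sym.int τ) 1 : Mon (Fin 2))).sum =
        (s.map fun τ => treeHom α w τ + 2).sum := by
    rw [map_multiset_sum, Multiset.map_map]
    congr 1
    refine Multiset.map_congr rfl fun τ _ => ?_
    rw [Function.comp_apply, Finsupp.weight_single, one_smul]
    rfl
  rw [monHom_eq_weight, mkMon, map_add, map_add, h1, h2, Finsupp.weight_single, nsmul_eq_mul]
  rfl

theorem treeHom_toTree {m : Mon (Fin 2)} (h : IsTree m) : treeHom α w (toTree m) = monHom α w m := by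
  have h' : m Sym.noise = 1 := h
  rw [← mkMon_parts m, toTree_mkMon, treeHom_node, monHom_mkMon, h']
  push_cast
  ring

/-- Every node carries a noise of homogeneity α - 2, and a tree has at least its root. -/
theorem treeHom_succ_le (τ : RTree N2) : treeHom α w τ + 1 ≤ treeHom (α + 1) w τ := by
  refine RTree.induction (P := fun τ => treeHom α w τ + 1 ≤ treeHom (α + 1) w τ) ?_ τ
  intro a s ih
  rw [treeHom_node, treeHom_node]
  have : (s.map fun τ => treeHom α w τ + 2).sum ≤ (s.map fun τ => treeHom (α + 1) w τ + 2).sum :=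
    Multiset.sum_map_le_sum_map _ _ fun τ hτ => by linarith [ih τ hτ]
  linarith

theorem monHom_succ_le {m : Mon (Fin 2)} (h : IsTree m ∨ IsPlanted m) :
    monHom α w m + 1 ≤ monHom (α + 1) w m := by
  rcases h with h | ⟨τ, rfl⟩
  · rw [← treeHom_toTree h, ← treeHom_toTree h]
    exact treeHom_succ_le _
  · rw [monHom_eq_weight, monHom_eq_weight, Finsupp.weight_single, Finsupp.weight_single, one_smul,
      one_smul]
    have := treeHom_succ_le (α := α) (w := w) τ
    change treeHom α w τ + 2 + 1 ≤ treeHom (α + 1) w τ + 2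
    linarith

/-! ## Locally finite sums of linear maps -/

section LocallyFinite

variable {ι V W W' : Type} [AddCommGroup V] [Module ℝ V] [AddCommGroup W] [Module ℝ W]
  [AddCommGroup W'] [Module ℝ W']

/-- The sum of a family of linear maps that is finite on every vector. -/
def lfSum (F : ι → V →ₗ[ℝ] W) (h : ∀ x, {i | F i x ≠ 0}.Finite) : V →ₗ[ℝ] W where
  toFun x := ∑ᶠ i, F i x
  map_add' x y := by
    simp only [map_add]
    exact finsum_add_distrib (h x) (h y)
  map_smul' c x := by
    simp only [map_smul, RingHom.id_apply]
    exact (smul_finsum' c (h x)).symm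

theorem map_finsum_linear (G : W →ₗ[ℝ] W') {f : ι → W} (h : {i | f i ≠ 0}.Finite) :
    G (∑ᶠ i, f i) = ∑ᶠ i, G (f i) := G.toAddMonoidHom.map_finsum h

theorem finite_lTensor_ne_zero {A : Type} [AddCommGroup A] [Module ℝ A] {F : ι → V →ₗ[ℝ] W}
    (h : ∀ x, {i | F i x ≠ 0}.Finite) (t : A ⊗[ℝ] V) : {i | (F i).lTensor A t ≠ 0}.Finite := by
  induction t using TensorProduct.induction_on with
  | zero => simp
  | tmul a x =>
    refine (h x).subset fun i hi hc => hi ?_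
    rw [LinearMap.lTensor_tmul, hc, TensorProduct.tmul_zero]
  | add t t' ht ht' =>
    refine (ht.union ht').subset fun i hi => ?_
    by_contra hc
    simp only [Set.mem_union, Set.mem_ofPred_eq, not_or, not_not] at hc
    exact hi (by rw [map_add, hc.1, hc.2, add_zero])

theorem lfSum_lTensor {A : Type} [AddCommGroup A] [Module ℝ A] (F : ι → V →ₗ[ℝ] W)
    (h : ∀ x, {i | F i x ≠ 0}.Finite) (t : A ⊗[ℝ] V) :
    (lfSum F h).lTensor A t = ∑ᶠ i, (F i).lTensor A t := by
  induction t using TensorProduct.induction_on with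
  | zero => simp
  | tmul a x =>
    simp only [LinearMap.lTensor_tmul]
    exact map_finsum_linear (TensorProduct.mk ℝ A W a) (h x)
  | add t t' ht ht' =>
    simp only [map_add]
    rw [ht, ht', finsum_add_distrib (finite_lTensor_ne_zero h t) (finite_lTensor_ne_zero h t')]

theorem finsum_antidiagonal {W : Type} [AddCommGroup W] (G : N2 → N2 → W) (h : {p : N2 × N2 | G p.1 p.2 ≠ 0}.Finite) :
    ∑ᶠ n, ∑ᶠ k, G n k = ∑ᶠ m, ∑ p ∈ Finset.HasAntidiagonal.antidiagonal m, G p.1 p.2 := by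
  classical
  have h1 := finsum_curry (fun p : N2 × N2 => G p.1 p.2) h
  rw [← h1, finsum_eq_sum_of_support_subset (s := h.toFinset.image fun p => p.1 + p.2),
    finsum_eq_sum_of_support_subset (s := (h.toFinset.image fun p => p.1 + p.2).biUnion
      fun m => Finset.HasAntidiagonal.antidiagonal m), Finset.sum_biUnion]
  · intro m _ m' _ hne
    rw [Function.onFun, Finset.disjoint_left]
    intro p hp hp'
    rw [Finset.HasAntidiagonal.mem_antidiagonal] at hp hp'
    exact hne (hp.symm.trans hp')
  · intro p hp
    rw [Finset.mem_coe, Finset.mem_biUnion]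
    exact ⟨p.1 + p.2, Finset.mem_image.2 ⟨p, h.mem_toFinset.2 hp, rfl⟩,
      Finset.HasAntidiagonal.mem_antidiagonal.2 rfl⟩
  · intro m hm
    obtain ⟨p, hp, hne⟩ := Finset.exists_ne_zero_of_sum_ne_zero hm
    rw [Finset.mem_coe, Finset.mem_image]
    exact ⟨p, h.mem_toFinset.2 hne, Finset.HasAntidiagonal.mem_antidiagonal.1 hp⟩

end LocallyFinite

end

section

variable {α : ℝ} {w : Fin 2 → ℝ}

/-! ## Tensors with values in a subspace -/

section TenSub

variable {E : Type} [AddCommGroup E] [Module ℝ E]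

/-- The tensors with second factor in the subspace `V`. -/
def tenSub (A : Type) [AddCommGroup A] [Module ℝ A] (V : Submodule ℝ E) : Submodule ℝ (A ⊗[ℝ] E) :=
  LinearMap.range (V.subtype.lTensor A)

variable {A : Type} [AddCommGroup A] [Module ℝ A]

theorem tmul_mem_tenSub {V : Submodule ℝ E} (a : A) {x : E} (hx : x ∈ V) :
    a ⊗ₜ[ℝ] x ∈ tenSub A V := ⟨a ⊗ₜ ⟨x, hx⟩, rfl⟩

theorem tenSub_induction {V : Submodule ℝ E} {p : A ⊗[ℝ] E → Prop} (h0 : p 0)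
    (hadd : ∀ s t, p s → p t → p (s + t)) (htmul : ∀ a, ∀ x ∈ V, p (a ⊗ₜ[ℝ] x)) {t : A ⊗[ℝ] E}
    (ht : t ∈ tenSub A V) : p t := by
  obtain ⟨t, rfl⟩ := ht
  induction t using TensorProduct.induction_on with
  | zero => rwa [map_zero]
  | tmul a x => exact htmul a x x.2
  | add s t hs ht => rw [map_add]; exact hadd _ _ hs ht

theorem tenSub_eqOn {V : Submodule ℝ E} {W : Type*} [AddCommGroup W] [Module ℝ W]
    {F G : A ⊗[ℝ] E →ₗ[ℝ] W} (h : ∀ a, ∀ x ∈ V, F (a ⊗ₜ[ℝ] x) = G (a ⊗ₜ[ℝ] x)) {t : A ⊗[ℝ] E}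
    (ht : t ∈ tenSub A V) : F t = G t :=
  tenSub_induction (p := fun t => F t = G t) (by simp)
    (fun s t hs ht => by rw [map_add, map_add, hs, ht]) h ht

theorem tenSub_mono {V V' : Submodule ℝ E} (h : V ≤ V') : tenSub A V ≤ tenSub A V' := fun _ ht =>
  tenSub_induction (p := fun t => t ∈ tenSub A V') (Submodule.zero_mem _)
    (fun _ _ => Submodule.add_mem _) (fun a _ hx => tmul_mem_tenSub a (h hx)) ht

theorem lTensor_mem_tenSub {E' : Type} [AddCommGroup E'] [Module ℝ E'] {V : Submodule ℝ E'}
    {f : E →ₗ[ℝ] E'} (h : ∀ x, f x ∈ V) (t : A ⊗[ℝ] E) : f.lTensor A t ∈ tenSub A V := by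
  induction t using TensorProduct.induction_on with
  | zero => rw [map_zero]; exact Submodule.zero_mem _
  | tmul a x => exact tmul_mem_tenSub a (h x)
  | add s t hs ht => rw [map_add]; exact Submodule.add_mem _ hs ht

theorem mul_mem_tenSub {A B : Type} [CommRing A] [Algebra ℝ A] [CommRing B] [Algebra ℝ B]
    {V V' V'' : Submodule ℝ B} (h : ∀ x ∈ V, ∀ y ∈ V', x * y ∈ V'') {s t : A ⊗[ℝ] B}
    (hs : s ∈ tenSub A V) (ht : t ∈ tenSub A V') : s * t ∈ tenSub A V'' := by
  refine tenSub_induction (p := fun s => s * t ∈ tenSub A V'') ?_ ?_ (fun a x hx => ?_) hs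
  · rw [zero_mul]; exact Submodule.zero_mem _
  · intro s s' h h'; rw [add_mul]; exact Submodule.add_mem _ h h'
  · refine tenSub_induction (p := fun t => (a ⊗ₜ[ℝ] x) * t ∈ tenSub A V'') ?_ ?_
      (fun b y hy => ?_) ht
    · rw [mul_zero]; exact Submodule.zero_mem _
    · intro s s' h h'; rw [mul_add]; exact Submodule.add_mem _ h h'
    · rw [Algebra.TensorProduct.tmul_mul_tmul]
      exact tmul_mem_tenSub _ (h x hx y hy)

theorem finsum_mem_submodule {ι : Type} {V : Submodule ℝ E} {f : ι → E} (h : ∀ i, f i ∈ V) :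
    ∑ᶠ i, f i ∈ V :=
  finsum_induction (· ∈ V) (Submodule.zero_mem _) (fun _ _ => Submodule.add_mem _) h

end TenSub

/-! ## Jets -/

section Jets

variable {C : Type} [CommRing C] [Algebra ℝ C]

/-- The divided powers `y^k / k!`. -/
def dpow (y : Fin 2 → C) (k : N2) : C := (fact k : ℝ)⁻¹ • ∏ i, y i ^ k i

theorem dpow_zero (y : Fin 2 → C) : dpow y 0 = 1 := by simp [dpow, fact]

theorem map_dpow {C' : Type} [CommRing C'] [Algebra ℝ C'] (f : C →ₐ[ℝ] C') (y : Fin 2 → C) (k : N2) :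
    f (dpow y k) = dpow (fun i => f (y i)) k := by
  simp [dpow, map_smul, map_prod]

theorem add_pow_div_factorial (y z : C) (n : ℕ) : (n.factorial : ℝ)⁻¹ • (y + z) ^ n =
    ∑ p ∈ Finset.HasAntidiagonal.antidiagonal n,
      ((p.1.factorial : ℝ)⁻¹ • y ^ p.1) * ((p.2.factorial : ℝ)⁻¹ • z ^ p.2) := by
  rw [(Commute.all y z).add_pow', Finset.smul_sum]
  refine Finset.sum_congr rfl fun p hp => ?_
  rw [Finset.HasAntidiagonal.mem_antidiagonal] at hp
  subst hp
  rw [smul_mul_smul_comm, ← Nat.cast_smul_eq_nsmul ℝ, smul_smul]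
  congr 1
  rw [Nat.cast_add_choose]
  have h1 : ((p.1 + p.2).factorial : ℝ) ≠ 0 := Nat.cast_ne_zero.2 (Nat.factorial_ne_zero _)
  have h2 : (p.1.factorial : ℝ) ≠ 0 := Nat.cast_ne_zero.2 (Nat.factorial_ne_zero _)
  have h3 : (p.2.factorial : ℝ) ≠ 0 := Nat.cast_ne_zero.2 (Nat.factorial_ne_zero _)
  field_simp

theorem dpow_eq (y : Fin 2 → C) (k : N2) : dpow y k =
    (((k 0).factorial : ℝ)⁻¹ • y 0 ^ k 0) * (((k 1).factorial : ℝ)⁻¹ • y 1 ^ k 1) := by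
  rw [dpow, fact, Fin.prod_univ_two, Fin.prod_univ_two, smul_mul_smul_comm, Nat.cast_mul, mul_inv]

/-- The element of `ℕ₀²` with given components. -/
def mkN2 (a b : ℕ) : N2 := Finsupp.single 0 a + Finsupp.single 1 b

@[simp] theorem mkN2_zero (a b : ℕ) : mkN2 a b 0 = a := by simp [mkN2]

@[simp] theorem mkN2_one (a b : ℕ) : mkN2 a b 1 = b := by simp [mkN2]

theorem N2_ext {m n : N2} (h0 : m 0 = n 0) (h1 : m 1 = n 1) : m = n :=
  Finsupp.ext fun i => by fin_cases i <;> assumption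

/-- For divided powers the binomial theorem has no coefficients. This accounts for all factorials in
the coassociativity of jets. -/
theorem dpow_add (y z : Fin 2 → C) (m : N2) : dpow (fun i => y i + z i) m =
    ∑ p ∈ Finset.HasAntidiagonal.antidiagonal m, dpow y p.1 * dpow z p.2 := by
  rw [dpow_eq, add_pow_div_factorial, add_pow_div_factorial, Finset.sum_mul_sum,
    ← Finset.sum_product']
  refine (Finset.sum_nbij' (fun p => ((p.1 0, p.2 0), (p.1 1, p.2 1)))
    (fun q => (mkN2 q.1.1 q.2.1, mkN2 q.1.2 q.2.2)) ?_ ?_ ?_ ?_ ?_).symm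
  · intro p hp
    rw [Finset.HasAntidiagonal.mem_antidiagonal] at hp
    rw [Finset.mem_product, Finset.HasAntidiagonal.mem_antidiagonal,
      Finset.HasAntidiagonal.mem_antidiagonal, ← hp]
    exact ⟨rfl, rfl⟩
  · intro q hq
    rw [Finset.mem_product, Finset.HasAntidiagonal.mem_antidiagonal,
      Finset.HasAntidiagonal.mem_antidiagonal] at hq
    rw [Finset.HasAntidiagonal.mem_antidiagonal]
    refine N2_ext ?_ ?_
    · rw [Finsupp.add_apply]; simpa using hq.1
    · rw [Finsupp.add_apply]; simpa using hq.2
  · rintro ⟨p, q⟩ -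
    exact Prod.ext (N2_ext (by simp) (by simp)) (N2_ext (by simp) (by simp))
  · rintro ⟨⟨a, b⟩, c, d⟩ -
    simp
  · intro p _
    simp only [dpow_eq]
    ring

theorem JH_monomial (n : N2) (m : Mon (Fin 2)) : JH α w n (monomial m 1) =
    open Classical in if h : (IsTree m ∨ IsPlanted m) ∧ len w n < monHom α w m + 2 then
      X (Sum.inl ⟨(n, m), h⟩) else 0 := by
  have e : (monomial m 1 : Alg (Fin 2)) = basisMonomials _ ℝ m := by simp
  rw [e, JH, Module.Basis.constr_basis]

/-- The terms `𝒥_{n+k} x ⊗ y^k / k!` of a jet. -/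
def jetTerm (α : ℝ) (w : Fin 2 → ℝ) (y : Fin 2 → C) (n k : N2) :
    Alg (Fin 2) →ₗ[ℝ] THPlus α w ⊗[ℝ] C :=
  (TensorProduct.mk ℝ (THPlus α w) C).flip (dpow y k) ∘ₗ JH α w (n + k)

theorem jetTerm_apply (y : Fin 2 → C) (n k : N2) (x : Alg (Fin 2)) :
    jetTerm α w y n k x = JH α w (n + k) x ⊗ₜ[ℝ] dpow y k := rfl

theorem finite_jetTerm (hw : ∀ i, 0 < w i) (y : Fin 2 → C) (n : N2) (x : Alg (Fin 2)) :
    {k | jetTerm α w y n k x ≠ 0}.Finite := by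
  refine (finite_JH_ne_zero α w hw n x).subset fun k hk hc => hk ?_
  rw [jetTerm_apply, hc, TensorProduct.zero_tmul]

/-- The jet `∑_k 𝒥_{n+k} x ⊗ y^k / k!`. -/
def jet (α : ℝ) (w : Fin 2 → ℝ) (hw : ∀ i, 0 < w i) (y : Fin 2 → C) (n : N2) :
    Alg (Fin 2) →ₗ[ℝ] THPlus α w ⊗[ℝ] C :=
  lfSum (jetTerm α w y n) (finite_jetTerm hw y n)

theorem jet_apply (hw : ∀ i, 0 < w i) (y : Fin 2 → C) (n : N2) (x : Alg (Fin 2)) :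
    jet α w hw y n x = ∑ᶠ k, JH α w (n + k) x ⊗ₜ[ℝ] dpow y k := rfl

end Jets

/-- The polynomial symbols. -/
def polX (i : Fin 2) : Alg (Fin 2) := X (Sym.poly i)

/-- The polynomial symbols in `T_H⁺`. -/
def polXP (α : ℝ) (w : Fin 2 → ℝ) (i : Fin 2) : THPlus α w := X (Sum.inr i)

theorem jetSum_eq (hw : ∀ i, 0 < w i) (n : N2) (x : Alg (Fin 2)) :
    jetSum α w n x = jet α w hw polX n x := rfl

/-! ## The comodule `Δ_H` -/

theorem DeltaH_noise : DeltaH α w (X Sym.noise) = 1 ⊗ₜ[ℝ] X Sym.noise := by simp [DeltaH]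

theorem DeltaH_poly (i : Fin 2) : DeltaH α w (X (Sym.poly i)) = deltaX α w i := by simp [DeltaH]

/-- The restriction to trees is essential: planted trees are mapped to 0 by `integ`, but not by 𝒥_n
in general. -/
theorem DeltaH_integ (hw : ∀ i, 0 < w i) {x : Alg (Fin 2)} (hx : x ∈ treeSpan (Fin 2)) :
    DeltaH α w (integ x) = integ.lTensor (THPlus α w) (DeltaH α w x) + jet α w hw polX 0 x := by
  induction hx using Submodule.span_induction with
  | mem x hx =>
    obtain ⟨m, hm, rfl⟩ := hx
    have e := monomial_eq_treePoly (m := m) hm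
    simp only [e]
    rw [integ_treePoly, DeltaH_int, jetSum_eq hw]
  | zero => simp
  | add x y _ _ hx hy => simp only [map_add, hx, hy]; abel
  | smul c x _ hx => simp only [map_smul, hx, smul_add]

/-- The linear combinations of polynomials. -/
def polySpan : Submodule ℝ (Alg (Fin 2)) := Submodule.span ℝ (Set.range xPow)

theorem dpow_polX_mem (k : N2) : dpow polX k ∈ polySpan :=
  Submodule.smul_mem _ _ (Submodule.subset_span ⟨k, rfl⟩)

theorem xPow_add (a b : N2) : xPow (a + b) = xPow a * xPow b := by
  simp [xPow, pow_add, Finset.prod_mul_distrib]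

theorem mul_mem_polySpan {x y : Alg (Fin 2)} (hx : x ∈ polySpan) (hy : y ∈ polySpan) :
    x * y ∈ polySpan := by
  induction hx using Submodule.span_induction with
  | mem x hx =>
    obtain ⟨a, rfl⟩ := hx
    induction hy using Submodule.span_induction with
    | mem y hy =>
      obtain ⟨b, rfl⟩ := hy
      exact Submodule.subset_span ⟨a + b, xPow_add a b⟩
    | zero => rw [mul_zero]; exact Submodule.zero_mem _
    | add x y _ _ hx hy => rw [mul_add]; exact Submodule.add_mem _ hx hy
    | smul c x _ hx => rw [mul_smul_comm]; exact Submodule.smul_mem _ c hx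
  | zero => rw [zero_mul]; exact Submodule.zero_mem _
  | add x y _ _ hx hy => rw [add_mul]; exact Submodule.add_mem _ hx hy
  | smul c x _ hx => rw [smul_mul_assoc]; exact Submodule.smul_mem _ c hx

theorem xPow_zero : xPow 0 = 1 := by simp [xPow]

theorem xPow_single (i : Fin 2) : xPow (Finsupp.single i 1) = X (Sym.poly i) := by
  fin_cases i <;> simp [xPow]

theorem DeltaH_xPow_mem (a : N2) : DeltaH α w (xPow a) ∈ tenSub (THPlus α w) polySpan := by
  have h1 : (1 : Alg (Fin 2)) ∈ polySpan := Submodule.subset_span ⟨0, xPow_zero⟩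
  induction a using N2_induction with
  | h0 =>
    rw [xPow_zero, map_one]
    exact tmul_mem_tenSub 1 h1
  | h m i ih =>
    rw [xPow_add, map_mul, xPow_single, DeltaH_poly]
    refine mul_mem_tenSub (fun x hx y hy => mul_mem_polySpan hx hy) ih (Submodule.add_mem _ ?_ ?_)
    · exact tmul_mem_tenSub _ (Submodule.subset_span ⟨_, xPow_single i⟩)
    · exact tmul_mem_tenSub _ h1

/-- Whatever Δ_H τ is, the right legs of Δ_H ℐ τ are integrated elements or powers of X. No
induction hypothesis is needed, only the form of a tree. -/
theorem DeltaH_int_mem (hw : ∀ i, 0 < w i) {V : Submodule ℝ (Alg (Fin 2))}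
    (hV : ∀ τ, X (Sym.int τ) ∈ V) (hV' : polySpan ≤ V) (τ : RTree N2) :
    DeltaH α w (X (Sym.int τ)) ∈ tenSub (THPlus α w) V := by
  have hi : ∀ x : Alg (Fin 2), integ x ∈ V := by
    intro x
    rw [x.as_sum, map_sum]
    refine Submodule.sum_mem _ fun m _ => ?_
    rw [← mul_one (coeff m x), ← smul_eq_mul, ← smul_monomial, map_smul, integ_monomial]
    refine Submodule.smul_mem _ _ ?_
    split_ifs
    · exact hV _
    · exact Submodule.zero_mem _
  refine RTree.induction (P := fun τ => DeltaH α w (X (Sym.int τ)) ∈ tenSub (THPlus α w) V)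
    (fun a s _ => ?_) τ
  rw [DeltaH_int, jetSum_eq hw, jet_apply]
  refine Submodule.add_mem _ (lTensor_mem_tenSub hi _) (finsum_mem_submodule fun k => ?_)
  exact tmul_mem_tenSub _ (hV' (dpow_polX_mem k))

theorem polySpan_le_noiseFree : polySpan ≤ noiseFree (Fin 2) := by
  rw [polySpan, Submodule.span_le]
  rintro _ ⟨a, rfl⟩
  rw [xPow_eq_monomial]
  exact Submodule.subset_span ⟨_, mkMon_noise _ _ _, rfl⟩

theorem DeltaH_noiseFree (hw : ∀ i, 0 < w i) {x : Alg (Fin 2)} (hx : x ∈ noiseFree (Fin 2)) :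
    DeltaH α w x ∈ tenSub (THPlus α w) (noiseFree (Fin 2)) := by
  have hone : (1 : THPlus α w ⊗[ℝ] Alg (Fin 2)) ∈ tenSub (THPlus α w) (noiseFree (Fin 2)) :=
    tmul_mem_tenSub 1 one_mem_noiseFree
  have hmul : ∀ s t : THPlus α w ⊗[ℝ] Alg (Fin 2), s ∈ tenSub (THPlus α w) (noiseFree (Fin 2)) →
      t ∈ tenSub (THPlus α w) (noiseFree (Fin 2)) →
      s * t ∈ tenSub (THPlus α w) (noiseFree (Fin 2)) := fun s t =>
    mul_mem_tenSub fun x hx y hy => mul_mem_noiseFree hx hy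
  induction hx using Submodule.span_induction with
  | mem x hx =>
    obtain ⟨m, hm, rfl⟩ := hx
    simp only [monomial_eq, C_1, one_mul]
    rw [Finsupp.prod, map_prod]
    refine Finset.prod_induction _ (· ∈ tenSub (THPlus α w) (noiseFree (Fin 2))) hmul hone
      fun s hs => ?_
    rw [map_pow]
    have hX : DeltaH α w (X s) ∈ tenSub (THPlus α w) (noiseFree (Fin 2)) := by
      rcases s with _ | i | τ
      · exact absurd hm (Finsupp.mem_support_iff.1 hs)
      · rw [DeltaH_poly]
        exact Submodule.add_mem _ (tmul_mem_tenSub _ (X_poly_mem_noiseFree i))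
          (tmul_mem_tenSub _ one_mem_noiseFree)
      · exact DeltaH_int_mem hw X_int_mem_noiseFree polySpan_le_noiseFree τ
    induction m s with
    | zero => rwa [pow_zero]
    | succ k ih => rw [pow_succ]; exact hmul _ _ ih hX
  | zero => rw [map_zero]; exact Submodule.zero_mem _
  | add x y _ _ hx hy => rw [map_add]; exact Submodule.add_mem _ hx hy
  | smul c x _ hx => rw [map_smul]; exact Submodule.smul_mem _ c hx

theorem treePoly_factor (a : N2) (s : Multiset (RTree N2)) :
    ∃ y ∈ noiseFree (Fin 2), treePoly a s = y * X Sym.noise := by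
  refine ⟨monomial (mkMon 0 a s) 1, Submodule.subset_span ⟨_, mkMon_noise _ _ _, rfl⟩, ?_⟩
  rw [treePoly_eq, monomial_mkMon, monomial_mkMon]
  ring

/-- A tree is its noise times a noise-free element. The noise contributes 1 ⊗ Ξ, and the other
factor stays noise-free. -/
theorem DeltaH_treeSpan (hw : ∀ i, 0 < w i) {x : Alg (Fin 2)} (hx : x ∈ treeSpan (Fin 2)) :
    DeltaH α w x ∈ tenSub (THPlus α w) (treeSpan (Fin 2)) := by
  induction hx using Submodule.span_induction with
  | mem x hx =>
    obtain ⟨m, hm, rfl⟩ := hx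
    have e := monomial_eq_treePoly (m := m) hm
    simp only [e]
    obtain ⟨y, hy, e⟩ := treePoly_factor (polyPart m) (intPart m)
    rw [e, map_mul, DeltaH_noise]
    have hX : (X Sym.noise : Alg (Fin 2)) ∈ Submodule.span ℝ {X Sym.noise} :=
      Submodule.mem_span_singleton_self _
    refine mul_mem_tenSub (V' := Submodule.span ℝ {X Sym.noise}) (fun x hx y hy => ?_)
      (DeltaH_noiseFree hw hy) (tmul_mem_tenSub 1 hX)
    obtain ⟨c, rfl⟩ := Submodule.mem_span_singleton.1 hy
    rw [mul_smul_comm]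
    exact Submodule.smul_mem _ c (mul_noise_mem_treeSpan hx)
  | zero => rw [map_zero]; exact Submodule.zero_mem _
  | add x y _ _ hx hy => rw [map_add]; exact Submodule.add_mem _ hx hy
  | smul c x _ hx => rw [map_smul]; exact Submodule.smul_mem _ c hx

theorem treeSpan_le_TH : treeSpan (Fin 2) ≤ TH :=
  Submodule.span_mono (Set.image_mono fun _ h => Or.inl h)

theorem polySpan_le_TH : polySpan ≤ TH := by
  rw [polySpan, Submodule.span_le]
  rintro _ ⟨a, rfl⟩
  rw [xPow_eq_monomial]
  exact Submodule.subset_span ⟨_, Or.inr (Or.inr (isPolynomial_mkMon a)), rfl⟩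

theorem X_int_mem_TH (τ : RTree N2) : (X (Sym.int τ) : Alg (Fin 2)) ∈ TH :=
  Submodule.subset_span ⟨_, Or.inr (Or.inl ⟨τ, rfl⟩), rfl⟩

theorem TH_induction {p : Alg (Fin 2) → Prop} (htree : ∀ m, IsTree m → p (monomial m 1))
    (hint : ∀ τ, p (X (Sym.int τ))) (hpoly : ∀ a, p (xPow a)) (h0 : p 0)
    (hadd : ∀ x y, p x → p y → p (x + y)) (hsmul : ∀ (c : ℝ) x, p x → p (c • x)) {x : Alg (Fin 2)}
    (hx : x ∈ TH) : p x := by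
  induction hx using Submodule.span_induction with
  | mem x hx =>
    obtain ⟨m, hm | ⟨τ, rfl⟩ | hm, rfl⟩ := hx
    · exact htree m hm
    · exact hint τ
    · rw [eq_mkMon_of_isPolynomial hm]
      simp only [← xPow_eq_monomial]
      exact hpoly _
  | zero => exact h0
  | add x y _ _ hx hy => exact hadd x y hx hy
  | smul c x _ hx => exact hsmul c x hx

theorem DeltaH_TH (hw : ∀ i, 0 < w i) {x : Alg (Fin 2)} (hx : x ∈ TH) :
    DeltaH α w x ∈ tenSub (THPlus α w) TH := by
  refine TH_induction (p := fun x => DeltaH α w x ∈ tenSub (THPlus α w) TH)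
    (fun m hm => ?_) (fun τ => ?_) (fun a => ?_) ?_ ?_ ?_ hx
  · exact tenSub_mono treeSpan_le_TH (DeltaH_treeSpan hw (Submodule.subset_span ⟨m, hm, rfl⟩))
  · exact DeltaH_int_mem hw X_int_mem_TH polySpan_le_TH τ
  · exact tenSub_mono polySpan_le_TH (DeltaH_xPow_mem a)
  · rw [map_zero]; exact Submodule.zero_mem _
  · intro x y hx hy; rw [map_add]; exact Submodule.add_mem _ hx hy
  · intro c x hx; rw [map_smul]; exact Submodule.smul_mem _ c hx

/-! ### Homogeneity -/

/-- The weights of the generators of `T_H⁺`, for the homogeneity with parameter `a`. -/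
def wtH (a α : ℝ) (w : Fin 2 → ℝ) : JIdx α w ⊕ Fin 2 → ℝ :=
  Sum.elim (fun p => monHom a w p.1.2 + 2 - len w p.1.1) w

theorem dpow_X {σ : Type} (j : Fin 2 → σ) (k : N2) : dpow (fun i => (X (j i) : MvPolynomial σ ℝ)) k =
    (fact k : ℝ)⁻¹ • monomial (∑ i, Finsupp.single (j i) (k i)) 1 := by
  rw [dpow, monomial_sum_one]
  simp [X_pow_eq_monomial]

/-- The parameter a of the weights is independent of α, which selects the generators. Below, a = α
serves to discard vanishing 𝒥_n τ, and a = α + 1 gives the lower bound for the antipode. -/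
theorem JH_tmul_mem {σ : Type} (v : σ → ℝ) (a : ℝ) (n : N2) (m : Mon (Fin 2)) (q : σ →₀ ℕ) {c : ℝ}
    (hc : monHom a w m + 2 - len w n + Finsupp.weight v q = c) :
    JH α w n (monomial m 1) ⊗ₜ[ℝ] monomial q (1 : ℝ) ∈ wtTensor (wtH a α w) v c := by
  rw [JH_monomial]
  split_ifs with h
  · refine tmul_mem_wtTensor ?_
    rw [Finsupp.weight_single, one_smul, ← hc]
    rfl
  · rw [TensorProduct.zero_tmul]
    exact Submodule.zero_mem _

theorem jet_mem_wtTensor (hw : ∀ i, 0 < w i) {σ : Type} {v : σ → ℝ} {j : Fin 2 → σ}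
    (hj : ∀ i, v (j i) = w i) (a : ℝ) (n : N2) (m : Mon (Fin 2)) :
    jet α w hw (fun i => (X (j i) : MvPolynomial σ ℝ)) n (monomial m 1) ∈
      wtTensor (wtH a α w) v (monHom a w m + 2 - len w n) := by
  rw [jet_apply]
  refine finsum_mem_submodule fun k => ?_
  rw [dpow_X, TensorProduct.tmul_smul]
  refine Submodule.smul_mem _ _ (JH_tmul_mem v a _ m _ ?_)
  have : Finsupp.weight v (∑ i, Finsupp.single (j i) (k i)) = len w k := by
    rw [map_sum, len]
    refine Finset.sum_congr rfl fun i _ => ?_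
    rw [Finsupp.weight_single, hj, nsmul_eq_mul, mul_comm]
  rw [this, len_add]
  ring

theorem integ_lTensor_mem {a c : ℝ} {t : THPlus α w ⊗[ℝ] Alg (Fin 2)}
    (ht : t ∈ wtTensor (wtH a α w) (symHom a w) c) :
    integ.lTensor (THPlus α w) t ∈ wtTensor (wtH a α w) (symHom a w) (c + 2) := by
  induction ht using Submodule.span_induction with
  | mem t ht =>
    obtain ⟨q, r, hqr, rfl⟩ := ht
    rw [LinearMap.lTensor_tmul, integ_monomial]
    split_ifs with h
    · refine tmul_mem_wtTensor ?_
      rw [Finsupp.weight_single, one_smul, ← hqr, ← monHom_eq_weight, ← treeHom_toTree h]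
      exact (add_assoc _ _ _).symm
    · rw [TensorProduct.tmul_zero]
      exact Submodule.zero_mem _
  | zero => rw [map_zero]; exact Submodule.zero_mem _
  | add x y _ _ hx hy => rw [map_add]; exact Submodule.add_mem _ hx hy
  | smul c x _ hx => rw [map_smul]; exact Submodule.smul_mem _ c hx

theorem JH_lTensor_mem {a c : ℝ} (n : N2) {t : THPlus α w ⊗[ℝ] Alg (Fin 2)}
    (ht : t ∈ wtTensor (wtH a α w) (symHom a w) c) :
    (JH α w n).lTensor (THPlus α w) t ∈ wtTensor (wtH a α w) (wtH a α w) (c + 2 - len w n) := by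
  induction ht using Submodule.span_induction with
  | mem t ht =>
    obtain ⟨q, r, hqr, rfl⟩ := ht
    rw [LinearMap.lTensor_tmul, JH_monomial]
    split_ifs with h
    · refine tmul_mem_wtTensor ?_
      rw [Finsupp.weight_single, one_smul, ← hqr, ← monHom_eq_weight]
      change _ + (monHom a w r + 2 - len w n) = _
      ring
    · rw [TensorProduct.tmul_zero]
      exact Submodule.zero_mem _
  | zero => rw [map_zero]; exact Submodule.zero_mem _
  | add x y _ _ hx hy => rw [map_add]; exact Submodule.add_mem _ hx hy
  | smul c x _ hx => rw [map_smul]; exact Submodule.smul_mem _ c hx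

theorem DeltaH_X_mem (hw : ∀ i, 0 < w i) (a : ℝ) (s : Sym (Fin 2)) :
    DeltaH α w (X s) ∈ wtTensor (wtH a α w) (symHom a w) (symHom a w s) := by
  have hone : (1 : THPlus α w ⊗[ℝ] Alg (Fin 2)) ∈ wtTensor (wtH a α w) (symHom a w) 0 :=
    one_mem_wtTensor
  have hnoise : DeltaH α w (X Sym.noise) ∈ wtTensor (wtH a α w) (symHom a w) (a - 2) := by
    rw [DeltaH_noise]
    refine tmul_mem_wtTensor (q := 0) ?_
    rw [map_zero, zero_add, Finsupp.weight_single, one_smul]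
    rfl
  have hpoly : ∀ i, DeltaH α w (X (Sym.poly i)) ∈ wtTensor (wtH a α w) (symHom a w) (w i) := by
    intro i
    rw [DeltaH_poly]
    refine Submodule.add_mem _ (tmul_mem_wtTensor (q := 0) ?_) (tmul_mem_wtTensor (r := 0) ?_)
    · rw [map_zero, zero_add, Finsupp.weight_single, one_smul]
      rfl
    · rw [map_zero, add_zero, Finsupp.weight_single, one_smul]
      rfl
  rcases s with _ | i | τ
  · exact hnoise
  · exact hpoly i
  · refine RTree.induction (P := fun τ => DeltaH α w (X (Sym.int τ)) ∈
      wtTensor (wtH a α w) (symHom a w) (treeHom a w τ + 2)) (fun b s ih => ?_) τ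
    have hx : DeltaH α w (treePoly b s) ∈
        wtTensor (wtH a α w) (symHom a w) (treeHom a w (RTree.node b s)) := by
      rw [treePoly, map_mul, map_mul, treeHom_node]
      refine mul_mem_wtTensor rfl (mul_mem_wtTensor rfl hnoise ?_) ?_
      · rw [xPow, map_prod]
        refine prod_mem_wtTensor _ _ _ fun i _ => ?_
        rw [map_pow, mul_comm, ← nsmul_eq_mul]
        exact pow_mem_wtTensor (hpoly i) _
      · clear hnoise hpoly
        induction s using Multiset.induction_on with
        | empty => simpa using hone
        | cons τ s ih' =>
          rw [Multiset.map_cons, Multiset.map_cons, Multiset.prod_cons, Multiset.sum_cons, map_mul]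
          exact mul_mem_wtTensor rfl (ih τ (Multiset.mem_cons_self _ _))
            (ih' fun τ hτ => ih τ (Multiset.mem_cons_of_mem hτ))
    rw [DeltaH_int, jetSum_eq hw]
    refine Submodule.add_mem _ (integ_lTensor_mem hx) ?_
    have h := jet_mem_wtTensor (α := α) hw (v := symHom a w) (j := Sym.poly) (fun i => rfl) a 0
      (mkMon 1 b s)
    rw [← treePoly_eq, len_zero, sub_zero, ← treeHom_toTree (mkMon_noise _ _ _), toTree_mkMon] at h
    exact h

theorem DeltaH_monomial_mem (hw : ∀ i, 0 < w i) (a : ℝ) (m : Mon (Fin 2)) :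
    DeltaH α w (monomial m 1) ∈ wtTensor (wtH a α w) (symHom a w) (monHom a w m) := by
  rw [monHom_eq_weight]
  exact map_monomial_mem_wtTensor (DeltaH α w) (DeltaH_X_mem hw a) m

/-! ## The coproduct `Δ_H⁺` -/

theorem JH_polySpan (n : N2) {x : Alg (Fin 2)} (hx : x ∈ polySpan) : JH α w n x = 0 := by
  induction hx using Submodule.span_induction with
  | mem x hx =>
    obtain ⟨a, rfl⟩ := hx
    rw [xPow_eq_monomial, JH_monomial, dif_neg]
    rintro ⟨h | ⟨τ, h⟩, -⟩
    · rw [IsTree, mkMon_noise] at h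
      omega
    · have := (isPolynomial_mkMon a).2 τ
      rw [h, Finsupp.single_eq_same] at this
      omega
  | zero => rw [map_zero]
  | add x y _ _ hx hy => rw [map_add, hx, hy, add_zero]
  | smul c x _ hx => rw [map_smul, hx, smul_zero]

theorem wtH_pos (hw : ∀ i, 0 < w i) (s : JIdx α w ⊕ Fin 2) : 0 < wtH α α w s := by
  rcases s with p | i
  · have := p.2.2
    change 0 < monHom α w p.1.2 + 2 - len w p.1.1
    linarith
  · exact hw i

theorem minWt_le_wtH (s : JIdx α w ⊕ Fin 2) : minWt w ≤ wtH (α + 1) α w s := by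
  rcases s with p | i
  · refine (min_le_left _ _).trans ?_
    have h1 := p.2.2
    have h2 := monHom_succ_le (α := α) (w := w) p.2.1
    change 1 ≤ monHom (α + 1) w p.1.2 + 2 - len w p.1.1
    linarith
  · exact minWt_le w i

theorem DeltaHPlus_inr (i : Fin 2) : DeltaHPlus α w (X (Sum.inr i)) =
    1 ⊗ₜ[ℝ] X (Sum.inr i) + X (Sum.inr i) ⊗ₜ[ℝ] 1 := by simp [DeltaHPlus]

/-- Only the case in which 𝒥_n τ vanishes by convention requires an argument. The right legs of Δ_H
τ are then no more homogeneous than τ, since the weights on the left are nonnegative, and the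
indices n + k in the jet are no shorter than n. Hence all terms vanish. -/
theorem DeltaHPlus_JH_monomial (hw : ∀ i, 0 < w i) (n : N2) {m : Mon (Fin 2)}
    (hm : IsTree m ∨ IsPlanted m) : DeltaHPlus α w (JH α w n (monomial m 1)) =
      (JH α w n).lTensor (THPlus α w) (DeltaH α w (monomial m 1)) +
        jet α w hw (polXP α w) n (monomial m 1) := by
  by_cases h : len w n < monHom α w m + 2
  · rw [JH_monomial, dif_pos ⟨hm, h⟩, DeltaHPlus, aeval_X, Sum.elim_inl]
    rfl
  · rw [JH_monomial, dif_neg (fun hc => h hc.2), map_zero,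
      lTensor_eq_zero_of_mem_wtTensor _ (fun s => (wtH_pos hw s).le) (fun r hr => ?_)
        (DeltaH_monomial_mem hw α m), zero_add, jet_apply]
    · rw [finsum_eq_zero_of_forall_eq_zero]
      intro k
      rw [JH_monomial, dif_neg, TensorProduct.zero_tmul]
      rintro ⟨-, hc⟩
      rw [len_add] at hc
      have := len_nonneg hw k
      linarith
    · rw [JH_monomial, dif_neg]
      rintro ⟨-, hc⟩
      rw [monHom_eq_weight] at hc
      linarith

theorem DeltaHPlus_JH (hw : ∀ i, 0 < w i) (n : N2) {x : Alg (Fin 2)} (hx : x ∈ TH) :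
    DeltaHPlus α w (JH α w n x) =
      (JH α w n).lTensor (THPlus α w) (DeltaH α w x) + jet α w hw (polXP α w) n x := by
  refine TH_induction (p := fun x => DeltaHPlus α w (JH α w n x) =
      (JH α w n).lTensor (THPlus α w) (DeltaH α w x) + jet α w hw (polXP α w) n x)
    (fun m hm => ?_) (fun τ => ?_) (fun a => ?_) ?_ ?_ ?_ hx
  · exact DeltaHPlus_JH_monomial hw n (Or.inl hm)
  · exact DeltaHPlus_JH_monomial hw n (Or.inr ⟨τ, rfl⟩)
  · have hp : xPow a ∈ polySpan := Submodule.subset_span ⟨a, rfl⟩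
    rw [JH_polySpan n hp, map_zero, jet_apply]
    have h1 : (JH α w n).lTensor (THPlus α w) (DeltaH α w (xPow a)) = 0 :=
      tenSub_eqOn (G := 0) (fun b x hx => by
        rw [LinearMap.lTensor_tmul, JH_polySpan n hx, TensorProduct.tmul_zero]; rfl)
        (DeltaH_xPow_mem a)
    rw [h1, zero_add, finsum_eq_zero_of_forall_eq_zero]
    intro k
    rw [JH_polySpan _ hp, TensorProduct.zero_tmul]
  · simp
  · intro x y hx hy; simp only [map_add, hx, hy]; abel
  · intro c x hx; simp only [map_smul, hx, smul_add]

end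

section

variable {α : ℝ} {w : Fin 2 → ℝ}

/-! ## The Hopf algebra `T_H⁺` -/

section Coaction

variable {C : Type} [CommRing C] [Algebra ℝ C]

/-- The elements for which the coaction is compatible with `Δ_H⁺`. -/
def coassocSub (δ : C →ₐ[ℝ] THPlus α w ⊗[ℝ] C) : Subalgebra ℝ C :=
  AlgHom.equalizer
    ((Algebra.TensorProduct.assoc ℝ ℝ ℝ (THPlus α w) (THPlus α w) C).toAlgHom.comp
      ((Algebra.TensorProduct.map (DeltaHPlus α w) (AlgHom.id ℝ C)).comp δ))
    ((Algebra.TensorProduct.map (AlgHom.id ℝ (THPlus α w)) δ).comp δ)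

theorem mem_coassocSub {δ : C →ₐ[ℝ] THPlus α w ⊗[ℝ] C} {x : C} : x ∈ coassocSub δ ↔
    TensorProduct.assoc ℝ (THPlus α w) (THPlus α w) C
      ((DeltaHPlus α w).toLinearMap.rTensor C (δ x)) = δ.toLinearMap.lTensor _ (δ x) := Iff.rfl

theorem coaction_dpow {δ : C →ₐ[ℝ] THPlus α w ⊗[ℝ] C} {y : Fin 2 → C}
    (hy : ∀ i, δ (y i) = 1 ⊗ₜ[ℝ] y i + polXP α w i ⊗ₜ[ℝ] 1) (m : N2) :
    δ (dpow y m) = ∑ p ∈ Finset.HasAntidiagonal.antidiagonal m,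
      dpow (polXP α w) p.2 ⊗ₜ[ℝ] dpow y p.1 := by
  rw [map_dpow]
  simp only [hy]
  rw [dpow_add]
  refine Finset.sum_congr rfl fun p _ => ?_
  have h1 := map_dpow (Algebra.TensorProduct.includeRight : C →ₐ[ℝ] THPlus α w ⊗[ℝ] C) y p.1
  have h2 := map_dpow (Algebra.TensorProduct.includeLeft : THPlus α w →ₐ[ℝ] THPlus α w ⊗[ℝ] C)
    (polXP α w) p.2
  simp only [Algebra.TensorProduct.includeRight_apply,
    Algebra.TensorProduct.includeLeft_apply] at h1 h2
  rw [← h1, ← h2, Algebra.TensorProduct.tmul_mul_tmul, one_mul, mul_one]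

theorem finite_add_mem {s : Set N2} (hs : s.Finite) : {p : N2 × N2 | p.1 + p.2 ∈ s}.Finite := by
  classical
  refine (hs.biUnion fun m _ => Finset.finite_toSet (Finset.HasAntidiagonal.antidiagonal m)).subset
    fun p hp => ?_
  exact Set.mem_biUnion (x := p.1 + p.2) hp (Finset.mem_coe.2
    (Finset.HasAntidiagonal.mem_antidiagonal.2 rfl))

theorem assoc_tmul_lTensor {A V W : Type} [AddCommGroup A] [Module ℝ A] [AddCommGroup V] [Module ℝ V]
    [AddCommGroup W] [Module ℝ W] (f : V →ₗ[ℝ] A) (c : W) (t : A ⊗[ℝ] V) :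
    TensorProduct.assoc ℝ A A W (f.lTensor A t ⊗ₜ[ℝ] c) =
      ((TensorProduct.mk ℝ A W).flip c ∘ₗ f).lTensor A t := by
  induction t using TensorProduct.induction_on with
  | zero => simp
  | tmul a x => rfl
  | add s t hs ht => simp only [map_add, TensorProduct.add_tmul, hs, ht]

theorem assoc_rTensor_lTensor {A V W : Type} [AddCommGroup A] [Module ℝ A] [AddCommGroup V]
    [Module ℝ V] [AddCommGroup W] [Module ℝ W] (g : A →ₗ[ℝ] A ⊗[ℝ] A) (f : V →ₗ[ℝ] W)
    (t : A ⊗[ℝ] V) : TensorProduct.assoc ℝ A A W (g.rTensor W (f.lTensor A t)) =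
      (f.lTensor A).lTensor A (TensorProduct.assoc ℝ A A V (g.rTensor V t)) := by
  induction t using TensorProduct.induction_on with
  | zero => simp
  | tmul a x =>
    rw [LinearMap.lTensor_tmul, LinearMap.rTensor_tmul, LinearMap.rTensor_tmul]
    induction g a using TensorProduct.induction_on with
    | zero => simp
    | tmul b c => rfl
    | add s t hs ht => simp only [map_add, TensorProduct.add_tmul, hs, ht]
  | add s t hs ht => simp only [map_add, hs, ht]

/-- The abstract form covers both I = ℐ with n = 0 and I = 𝒥_n with values in T_H⁺. Either side of
coassociativity for I x splits into three parts: I applied to coassociativity for x, the jet of the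
right leg of Δ_H x, and the double jet ∑ 𝒥_{n+k+l} x ⊗ y^l/l! ⊗ y^k/k!, with the polynomial symbols
of T_H⁺ in the middle leg. -/
theorem mem_coassocSub_of_jet (hw : ∀ i, 0 < w i) {δ : C →ₐ[ℝ] THPlus α w ⊗[ℝ] C} {y : Fin 2 → C}
    (hy : ∀ i, δ (y i) = 1 ⊗ₜ[ℝ] y i + polXP α w i ⊗ₜ[ℝ] 1) {I : Alg (Fin 2) →ₗ[ℝ] C} {n : N2}
    {V : Submodule ℝ (Alg (Fin 2))} (hVT : V ≤ TH)
    (hI : ∀ x ∈ V, δ (I x) = I.lTensor (THPlus α w) (DeltaH α w x) + jet α w hw y n x)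
    {x : Alg (Fin 2)} (hx : x ∈ V) (hxV : DeltaH α w x ∈ tenSub (THPlus α w) V)
    (h : x ∈ coassocSub (DeltaH α w)) : I x ∈ coassocSub δ := by
  rw [mem_coassocSub] at h ⊢
  have hfin : {m | JH α w (n + m) x ≠ 0}.Finite := finite_JH_ne_zero α w hw n x
  have hl : TensorProduct.assoc ℝ (THPlus α w) (THPlus α w) C
      ((DeltaHPlus α w).toLinearMap.rTensor C (jet α w hw y n x)) =
      (jet α w hw y n).lTensor _ (DeltaH α w x) +
        ∑ᶠ k, ∑ᶠ l, JH α w (n + (k + l)) x ⊗ₜ[ℝ] (dpow (polXP α w) l ⊗ₜ[ℝ] dpow y k) := by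
    have e : ∀ k, TensorProduct.assoc ℝ (THPlus α w) (THPlus α w) C
        ((DeltaHPlus α w).toLinearMap.rTensor C (JH α w (n + k) x ⊗ₜ[ℝ] dpow y k)) =
        (jetTerm α w y n k).lTensor _ (DeltaH α w x) +
        ∑ᶠ l, JH α w (n + (k + l)) x ⊗ₜ[ℝ] (dpow (polXP α w) l ⊗ₜ[ℝ] dpow y k) := by
      intro k
      rw [LinearMap.rTensor_tmul, AlgHom.toLinearMap_apply, DeltaHPlus_JH hw _ (hVT hx),
        TensorProduct.add_tmul, map_add, assoc_tmul_lTensor]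
      congr 1
      have := map_finsum_linear ((TensorProduct.assoc ℝ (THPlus α w) (THPlus α w) C).toLinearMap ∘ₗ
        (TensorProduct.mk ℝ (THPlus α w ⊗[ℝ] THPlus α w) C).flip (dpow y k))
        (finite_jetTerm hw (polXP α w) (n + k) x)
      refine this.trans (finsum_congr fun l => ?_)
      rw [← add_assoc]
      rfl
    have := map_finsum_linear ((TensorProduct.assoc ℝ (THPlus α w) (THPlus α w) C).toLinearMap ∘ₗ
        (DeltaHPlus α w).toLinearMap.rTensor C) (finite_jetTerm hw y n x)
    refine this.trans ((finsum_congr e).trans ?_)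
    rw [finsum_add_distrib (finite_lTensor_ne_zero (finite_jetTerm hw y n) _), jet, lfSum_lTensor]
    refine (finite_add_mem hfin).image Prod.fst |>.subset fun k hk => ?_
    obtain ⟨l, hl⟩ := not_forall.1 fun h => hk (finsum_eq_zero_of_forall_eq_zero h)
    refine ⟨(k, l), fun hc => hl ?_, rfl⟩
    rw [hc, TensorProduct.zero_tmul]
  -- The binomial theorem for the coaction on y^m/m! turns a single jet into the double jet, ordered
  -- by m = k + l.
  have hr : δ.toLinearMap.lTensor (THPlus α w) (jet α w hw y n x) =
      ∑ᶠ k, ∑ᶠ l, JH α w (n + (k + l)) x ⊗ₜ[ℝ] (dpow (polXP α w) l ⊗ₜ[ℝ] dpow y k) := by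
    rw [finsum_antidiagonal]
    · have := map_finsum_linear (δ.toLinearMap.lTensor (THPlus α w)) (finite_jetTerm hw y n x)
      refine this.trans (finsum_congr fun m => ?_)
      rw [jetTerm_apply, LinearMap.lTensor_tmul, AlgHom.toLinearMap_apply, coaction_dpow hy,
        TensorProduct.tmul_sum]
      refine Finset.sum_congr rfl fun p hp => ?_
      rw [Finset.HasAntidiagonal.mem_antidiagonal.1 hp]
    · refine (finite_add_mem hfin).subset fun p hp hc => hp ?_
      rw [hc, TensorProduct.zero_tmul]
  -- The formula for δ ∘ I is available on V only, which is why the right legs of Δ_H x are required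
  -- to lie in V.
  have hV : δ.toLinearMap.lTensor (THPlus α w) (I.lTensor (THPlus α w) (DeltaH α w x)) =
      (I.lTensor (THPlus α w)).lTensor (THPlus α w)
        ((DeltaH α w).toLinearMap.lTensor (THPlus α w) (DeltaH α w x)) +
      (jet α w hw y n).lTensor (THPlus α w) (DeltaH α w x) := by
    refine tenSub_eqOn (F := δ.toLinearMap.lTensor (THPlus α w) ∘ₗ I.lTensor (THPlus α w))
      (G := (I.lTensor (THPlus α w)).lTensor (THPlus α w) ∘ₗ
        (DeltaH α w).toLinearMap.lTensor (THPlus α w) + (jet α w hw y n).lTensor (THPlus α w))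
      (fun a x hx => ?_) hxV
    rw [LinearMap.add_apply, LinearMap.comp_apply, LinearMap.comp_apply, LinearMap.lTensor_tmul,
      LinearMap.lTensor_tmul, LinearMap.lTensor_tmul, LinearMap.lTensor_tmul, LinearMap.lTensor_tmul,
      ← TensorProduct.tmul_add, AlgHom.toLinearMap_apply, hI x hx]
    rfl
  rw [hI x hx, map_add, map_add, map_add, hl, hr, hV, assoc_rTensor_lTensor, h, add_assoc]

theorem mem_coassocSub_of_primitive {δ : C →ₐ[ℝ] THPlus α w ⊗[ℝ] C} {y : C} {i : Fin 2}
    (hy : δ y = 1 ⊗ₜ[ℝ] y + X (Sum.inr i) ⊗ₜ[ℝ] 1) : y ∈ coassocSub δ := by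
  rw [mem_coassocSub, hy]
  simp only [map_add, LinearMap.rTensor_tmul, LinearMap.lTensor_tmul, AlgHom.toLinearMap_apply,
    map_one, hy, DeltaHPlus_inr, TensorProduct.add_tmul, TensorProduct.tmul_add,
    TensorProduct.assoc_tmul, Algebra.TensorProduct.one_def]
  abel

end Coaction

theorem treePoly_mem_subalgebra {S : Subalgebra ℝ (Alg (Fin 2))} (hn : X Sym.noise ∈ S)
    (hp : ∀ i, X (Sym.poly i) ∈ S) (a : N2) {s : Multiset (RTree N2)}
    (hs : ∀ τ ∈ s, X (Sym.int τ) ∈ S) : treePoly a s ∈ S := by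
  refine mul_mem (mul_mem hn (prod_mem fun i _ => pow_mem (hp i) _)) (multiset_prod_mem _ fun x hx => ?_)
  obtain ⟨τ, hτ, rfl⟩ := Multiset.mem_map.1 hx
  exact hs τ hτ

/-- Induction on trees: once the branches lie in S, so does their product with the root, and only
the passage through ℐ remains. -/
theorem subalgebra_eq_top {S : Subalgebra ℝ (Alg (Fin 2))} (hn : X Sym.noise ∈ S)
    (hp : ∀ i, X (Sym.poly i) ∈ S) (hint : ∀ a s, treePoly a s ∈ S → integ (treePoly a s) ∈ S)
    (x : Alg (Fin 2)) : x ∈ S := by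
  have hX : ∀ τ, X (Sym.int τ) ∈ S := fun τ => by
    refine RTree.induction (P := fun τ => X (Sym.int τ) ∈ S) (fun a s ih => ?_) τ
    rw [← integ_treePoly]
    exact hint a s (treePoly_mem_subalgebra hn hp a ih)
  have : S = ⊤ := by
    rw [eq_top_iff, ← adjoin_range_X, Algebra.adjoin_le_iff]
    rintro _ ⟨s, rfl⟩
    rcases s with _ | i | τ
    · exact hn
    · exact hp i
    · exact hX τ
  rw [this]
  exact Algebra.mem_top

theorem treePoly_mem_treeSpan (a : N2) (s : Multiset (RTree N2)) :
    treePoly a s ∈ treeSpan (Fin 2) := by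
  rw [treePoly_eq]
  exact Submodule.subset_span ⟨_, mkMon_noise _ _ _, rfl⟩

theorem DeltaH_polX (i : Fin 2) :
    DeltaH α w (polX i) = 1 ⊗ₜ[ℝ] polX i + polXP α w i ⊗ₜ[ℝ] 1 := DeltaH_poly i

theorem DeltaH_coassoc (hw : ∀ i, 0 < w i) (x : Alg (Fin 2)) : x ∈ coassocSub (DeltaH α w) := by
  refine subalgebra_eq_top ?_ (fun i => mem_coassocSub_of_primitive (DeltaH_poly i))
    (fun a s h => ?_) x
  · rw [mem_coassocSub, DeltaH_noise, LinearMap.rTensor_tmul, LinearMap.lTensor_tmul,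
      AlgHom.toLinearMap_apply, AlgHom.toLinearMap_apply, map_one, DeltaH_noise]
    rfl
  · have hx := treePoly_mem_treeSpan a s
    exact mem_coassocSub_of_jet hw DeltaH_polX treeSpan_le_TH (fun x hx => DeltaH_integ hw hx) hx
      (DeltaH_treeSpan hw hx) h

theorem THPlus_subalgebra_eq_top {S : Subalgebra ℝ (THPlus α w)} (hp : ∀ i, X (Sum.inr i) ∈ S)
    (hJ : ∀ n, ∀ x ∈ TH, JH α w n x ∈ S) (f : THPlus α w) : f ∈ S := by
  have : S = ⊤ := by
    rw [eq_top_iff, ← adjoin_range_X, Algebra.adjoin_le_iff]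
    rintro _ ⟨p | i, rfl⟩
    · have h : (monomial p.1.2 1 : Alg (Fin 2)) ∈ TH :=
        Submodule.subset_span ⟨p.1.2, p.2.1.imp id Or.inl, rfl⟩
      have := hJ p.1.1 _ h
      rw [JH_monomial, dif_pos p.2] at this
      exact this
    · exact hp i
  rw [this]
  exact Algebra.mem_top

theorem DeltaHPlus_coassoc (hw : ∀ i, 0 < w i) (f : THPlus α w) :
    f ∈ coassocSub (DeltaHPlus α w) :=
  THPlus_subalgebra_eq_top (fun i => mem_coassocSub_of_primitive (DeltaHPlus_inr i))
    (fun n _ hx => mem_coassocSub_of_jet hw DeltaHPlus_inr le_rfl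
      (fun _ hx => DeltaHPlus_JH hw n hx) hx (DeltaH_TH hw hx) (DeltaH_coassoc hw _)) f

/-! ### Counits -/

theorem aug_JH (n : N2) (x : Alg (Fin 2)) : aug _ (JH α w n x) = 0 := by
  rw [x.as_sum, map_sum, map_sum]
  refine Finset.sum_eq_zero fun m _ => ?_
  rw [← mul_one (coeff m x), ← smul_eq_mul, ← smul_monomial, map_smul, map_smul, JH_monomial]
  split_ifs
  · rw [aeval_X, smul_zero]
  · rw [map_zero, smul_zero]

section Counit

variable {C : Type} [CommRing C] [Algebra ℝ C]

/-- The algebra homomorphism `ε ⊗ id`. -/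
def augLeft (σ : Type) (C : Type) [CommRing C] [Algebra ℝ C] : MvPolynomial σ ℝ ⊗[ℝ] C →ₐ[ℝ] C :=
  Algebra.TensorProduct.lift ((Algebra.ofId ℝ _).comp (aug σ)) (AlgHom.id ℝ _)
    fun _ _ => Commute.all _ _

theorem augLeft_tmul {σ : Type} (f : MvPolynomial σ ℝ) (x : C) :
    augLeft σ C (f ⊗ₜ[ℝ] x) = aug σ f • x := by
  rw [Algebra.smul_def]
  rfl

theorem augLeft_jet (hw : ∀ i, 0 < w i) (y : Fin 2 → C) (n : N2) (x : Alg (Fin 2)) :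
    augLeft _ C (jet α w hw y n x) = 0 := by
  have := map_finsum_linear (augLeft _ C).toLinearMap (finite_jetTerm (α := α) hw y n x)
  refine this.trans (finsum_eq_zero_of_forall_eq_zero fun k => ?_)
  rw [jetTerm_apply, AlgHom.toLinearMap_apply, augLeft_tmul, aug_JH, zero_smul]

theorem augLeft_lTensor {σ : Type} (I : Alg (Fin 2) →ₗ[ℝ] C) (t : MvPolynomial σ ℝ ⊗[ℝ] Alg (Fin 2)) :
    augLeft σ C (I.lTensor _ t) = I (augLeft σ _ t) := by
  induction t using TensorProduct.induction_on with
  | zero => simp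
  | tmul a x => rw [LinearMap.lTensor_tmul, augLeft_tmul, augLeft_tmul, map_smul]
  | add s t hs ht => simp only [map_add, hs, ht]

end Counit

theorem augLeft_DeltaH (hw : ∀ i, 0 < w i) (x : Alg (Fin 2)) : augLeft _ _ (DeltaH α w x) = x := by
  have h := subalgebra_eq_top
    (S := AlgHom.equalizer ((augLeft _ _).comp (DeltaH α w)) (AlgHom.id ℝ _)) ?_ ?_ ?_ x
  · exact h
  · change augLeft _ _ (DeltaH α w _) = _
    rw [DeltaH_noise, augLeft_tmul, map_one, one_smul]
    rfl
  · intro i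
    change augLeft _ _ (DeltaH α w _) = _
    rw [DeltaH_poly, deltaX, map_add, augLeft_tmul, augLeft_tmul, map_one, one_smul, aeval_X,
      zero_smul, add_zero]
    rfl
  · intro a s h
    have h' : augLeft _ _ (DeltaH α w (treePoly a s)) = treePoly a s := h
    change augLeft _ _ (DeltaH α w _) = _
    rw [DeltaH_integ hw (treePoly_mem_treeSpan a s), map_add, augLeft_jet, augLeft_lTensor, h',
      add_zero]
    rfl

theorem augLeft_DeltaHPlus (hw : ∀ i, 0 < w i) (f : THPlus α w) :
    augLeft _ _ (DeltaHPlus α w f) = f := by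
  have h := THPlus_subalgebra_eq_top
    (S := AlgHom.equalizer ((augLeft _ _).comp (DeltaHPlus α w)) (AlgHom.id ℝ _)) ?_ ?_ f
  · exact h
  · intro i
    change augLeft _ _ (DeltaHPlus α w _) = _
    rw [DeltaHPlus_inr, map_add, augLeft_tmul, augLeft_tmul, map_one, one_smul, aeval_X,
      zero_smul, add_zero]
    rfl
  · intro n x hx
    change augLeft _ _ (DeltaHPlus α w _) = _
    rw [DeltaHPlus_JH hw n hx, map_add, augLeft_jet, augLeft_lTensor, augLeft_DeltaH hw, add_zero]
    rfl

/-- The algebra homomorphism `id ⊗ ε`. -/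
def augRight (σ : Type) (C : Type) [CommRing C] [Algebra ℝ C] : C ⊗[ℝ] MvPolynomial σ ℝ →ₐ[ℝ] C :=
  Algebra.TensorProduct.lift (AlgHom.id ℝ _) ((Algebra.ofId ℝ _).comp (aug σ))
    fun _ _ => Commute.all _ _

theorem augRight_tmul {σ C : Type} [CommRing C] [Algebra ℝ C] (f : MvPolynomial σ ℝ) (x : C) :
    augRight σ C (x ⊗ₜ[ℝ] f) = aug σ f • x := by
  rw [Algebra.smul_def, mul_comm]
  rfl

theorem aug_dpow (k : N2) : aug _ (dpow (polXP α w) k) = if k = 0 then 1 else 0 := by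
  split_ifs with h
  · rw [h, dpow_zero, map_one]
  · obtain ⟨i, hi⟩ := Finsupp.ne_iff.1 h
    rw [map_dpow, dpow, Finset.prod_eq_zero (Finset.mem_univ i), smul_zero]
    rw [polXP, aeval_X]
    exact zero_pow hi

theorem augRight_DeltaHPlus (hw : ∀ i, 0 < w i) (f : THPlus α w) :
    augRight _ _ (DeltaHPlus α w f) = f := by
  have h := THPlus_subalgebra_eq_top
    (S := AlgHom.equalizer ((augRight _ _).comp (DeltaHPlus α w)) (AlgHom.id ℝ _)) ?_ ?_ f
  · exact h
  · intro i
    change augRight _ _ (DeltaHPlus α w _) = _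
    rw [DeltaHPlus_inr, map_add, augRight_tmul, augRight_tmul, map_one, one_smul, aeval_X,
      zero_smul, zero_add]
    rfl
  · intro n x hx
    change augRight _ _ (DeltaHPlus α w _) = JH α w n x
    have h1 : ∀ t : THPlus α w ⊗[ℝ] Alg (Fin 2),
        augRight _ _ ((JH α w n).lTensor (THPlus α w) t) = 0 := by
      intro t
      induction t using TensorProduct.induction_on with
      | zero => simp
      | tmul a x => rw [LinearMap.lTensor_tmul, augRight_tmul, aug_JH, zero_smul]
      | add s t hs ht => simp only [map_add, hs, ht, add_zero]
    have h2 := map_finsum_linear (augRight _ _).toLinearMap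
      (finite_jetTerm (α := α) hw (polXP α w) n x)
    rw [DeltaHPlus_JH hw n hx, map_add, h1, zero_add]
    refine h2.trans ((finsum_eq_single _ 0 fun k hk => ?_).trans ?_)
    · rw [jetTerm_apply, AlgHom.toLinearMap_apply, augRight_tmul, aug_dpow, if_neg hk, zero_smul]
    · rw [jetTerm_apply, AlgHom.toLinearMap_apply, augRight_tmul, aug_dpow, if_pos rfl, one_smul,
        add_zero]

theorem lid_rTensor_aug {σ C : Type} [CommRing C] [Algebra ℝ C] (t : MvPolynomial σ ℝ ⊗[ℝ] C) :
    TensorProduct.lid ℝ C ((aug σ).toLinearMap.rTensor C t) = augLeft σ C t := by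
  induction t using TensorProduct.induction_on with
  | zero => simp
  | tmul a x => rw [augLeft_tmul]; rfl
  | add s t hs ht => simp only [map_add, hs, ht]

theorem rid_lTensor_aug {σ C : Type} [CommRing C] [Algebra ℝ C] (t : C ⊗[ℝ] MvPolynomial σ ℝ) :
    TensorProduct.rid ℝ C ((aug σ).toLinearMap.lTensor C t) = augRight σ C t := by
  induction t using TensorProduct.induction_on with
  | zero => simp
  | tmul a x => rw [augRight_tmul]; rfl
  | add s t hs ht => simp only [map_add, hs, ht]

theorem exists_antipode_THPlus (hw : ∀ i, 0 < w i) :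
    ∃ S, IsHopfAlgebra (DeltaHPlus α w).toLinearMap (epsHPlus α w) S := by
  refine exists_antipode (DeltaHPlus α w) (minWt_pos hw) minWt_le_wtH (fun s => ?_)
    (LinearMap.ext fun f => DeltaHPlus_coassoc hw f) (LinearMap.ext fun f => ?_)
    (LinearMap.ext fun f => ?_)
  · rcases s with p | i
    · have hp := DeltaHPlus_JH_monomial (α := α) hw p.1.1 p.2.1
      rw [JH_monomial, dif_pos p.2] at hp
      have e : X (Sum.inl p) = (X (Sum.inl ⟨(p.1.1, p.1.2), p.2⟩) : THPlus α w) := rfl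
      rw [e, hp]
      exact Submodule.add_mem _ (JH_lTensor_mem _ (DeltaH_monomial_mem hw _ _))
        (jet_mem_wtTensor hw (v := wtH (α + 1) α w) (j := Sum.inr) (fun i => rfl) _ _ _)
    · rw [DeltaHPlus_inr]
      refine Submodule.add_mem _ (tmul_mem_wtTensor (q := 0) ?_) (tmul_mem_wtTensor (r := 0) ?_)
      · rw [map_zero, zero_add, Finsupp.weight_single, one_smul]
      · rw [map_zero, add_zero, Finsupp.weight_single, one_smul]
  · refine (TensorProduct.lid ℝ _).injective ?_
    rw [LinearMap.comp_apply, lid_rTensor_aug, AlgHom.toLinearMap_apply, augLeft_DeltaHPlus hw]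
    simp
  · refine (TensorProduct.rid ℝ _).injective ?_
    rw [LinearMap.comp_apply, rid_lTensor_aug, AlgHom.toLinearMap_apply, augRight_DeltaHPlus hw]
    simp

end

section

variable {α : ℝ} {w : Fin 2 → ℝ}

/-! ## The recursion of the dictionary -/

section Recursion

variable {B B' : Type} [CommRing B] [CommRing B']

/-- The right hand side `∑_k ∑_{e_k + β₁ + ⋯ + βₖ = β} F(β₁) ⋯ F(βₖ) ξ` of the recursion. -/
def recM (F : MI → B) (ξ : B) (β : MI) : B :=
  ∑ v ∈ β.support, Sum.elim (fun k => ∑ b ∈ Finset.piAntidiag (Finset.univ : Finset (Fin k))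
    (β - Finsupp.single v 1), (∏ i, F (b i)) * ξ) (fun _ => 0) v

theorem map_recM (f : B →+* B') (F : MI → B) (ξ : B) (β : MI) :
    f (recM F ξ β) = recM (fun γ => f (F γ)) (f ξ) β := by
  rw [recM, recM, map_sum]
  refine Finset.sum_congr rfl fun v _ => ?_
  rcases v with k | n
  · simp only [Sum.elim_inl, map_sum, map_mul, map_prod]
  · simp only [Sum.elim_inr, map_zero]

theorem recM_congr {F G : MI → B} (ξ : B) {β : MI}
    (h : ∀ γ, γ.degree < β.degree → F γ = G γ) : recM F ξ β = recM G ξ β := by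
  refine Finset.sum_congr rfl fun v hv => ?_
  rcases v with k | n
  · refine Finset.sum_congr rfl fun b hb => ?_
    congr 1
    exact Finset.prod_congr rfl fun i _ => h _ (degree_lt_of_mem hv hb i)
  · rfl

theorem recM_induction {F : MI → B} {ξ : B} {β : MI} {p : B → Prop} (h0 : p 0)
    (hadd : ∀ x y, p x → p y → p (x + y))
    (h : ∀ (k : ℕ) (b : Fin k → MI), Finsupp.single (Sum.inl k) 1 + ∑ i, b i = β →
      (∀ i, (b i).degree < β.degree) → p ((∏ i, F (b i)) * ξ)) : p (recM F ξ β) := by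
  refine Finset.sum_induction _ p hadd h0 fun v hv => ?_
  rcases v with k | n
  · refine Finset.sum_induction _ p hadd h0 fun b hb => h k b ?_ fun i => degree_lt_of_mem hv hb i
    rw [(Finset.mem_piAntidiag.1 hb).1, add_tsub_cancel_of_le]
    rw [Finsupp.single_le_iff]
    exact Nat.one_le_iff_ne_zero.2 (Finsupp.mem_support_iff.1 hv)
  · exact h0

end Recursion

theorem dictMinus_eq_recM (β : MI) : dictMinus β = recM dict (X Sym.noise) β := dictMinus_eq β

theorem dict_ePoly (m : N2ne) : dict (ePoly m) = X (Sym.poly m) := by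
  have h : ∃ n : N2ne, ePoly m = ePoly n := ⟨m, rfl⟩
  rw [dict, dif_pos h, ← ePoly_injective h.choose_spec]

theorem dict_of_ne {β : MI} (h : ∀ m, β ≠ ePoly m) : dict β = integ (dictMinus β) := by
  rw [dict, dif_neg (by push Not; exact h)]

theorem dict_mem_noiseFree (β : MI) : dict β ∈ noiseFree N2ne := by
  by_cases h : ∃ m, β = ePoly m
  · obtain ⟨m, rfl⟩ := h
    rw [dict_ePoly]
    exact X_poly_mem_noiseFree m
  · rw [dict_of_ne (by push Not at h; exact h)]
    exact integ_mem_noiseFree _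

theorem prod_mem_noiseFree {P ι : Type} (s : Finset ι) {f : ι → Alg P}
    (h : ∀ i ∈ s, f i ∈ noiseFree P) : ∏ i ∈ s, f i ∈ noiseFree P :=
  Finset.prod_induction f (· ∈ noiseFree P) (fun _ _ => mul_mem_noiseFree) one_mem_noiseFree h

theorem recM_mem_treeSpan {P : Type} {F : MI → Alg P} (h : ∀ β, F β ∈ noiseFree P) (β : MI) :
    recM F (X Sym.noise) β ∈ treeSpan P :=
  recM_induction (p := (· ∈ treeSpan P)) (Submodule.zero_mem _) (fun _ _ => Submodule.add_mem _)
    fun _ _ _ _ => mul_noise_mem_treeSpan (prod_mem_noiseFree _ fun _ _ => h _)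

theorem contractTree_node (a : N2ne →₀ ℕ) (s : Multiset (RTree (N2ne →₀ ℕ))) :
    contractTree (RTree.node a s) =
      RTree.node (a.sum fun n e => e • n.1) (s.map contractTree) := by
  rw [contractTree, RTree.para_node, Multiset.map_map]
  rfl

theorem contract_noise : contract (X Sym.noise) = X Sym.noise := by simp [contract]

theorem contract_poly (n : N2ne) : contract (X (Sym.poly n)) = xPow n.1 := by simp [contract]

theorem contract_int (τ : RTree (N2ne →₀ ℕ)) :
    contract (X (Sym.int τ)) = X (Sym.int (contractTree τ)) := by simp [contract]

theorem xPow_nsmul (e : ℕ) (a : N2) : xPow (e • a) = xPow a ^ e := by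
  induction e with
  | zero => rw [zero_smul, pow_zero, xPow_zero]
  | succ e ih => rw [succ_nsmul, xPow_add, ih, pow_succ]

theorem contract_mkMon (a : N2ne →₀ ℕ) (s : Multiset (RTree (N2ne →₀ ℕ))) :
    contract (monomial (mkMon 1 a s) 1) =
      treePoly (a.sum fun n e => e • n.1) (s.map contractTree) := by
  have h : ∀ t : Finset N2ne, xPow (∑ n ∈ t, a n • n.1) = ∏ n ∈ t, xPow n.1 ^ a n := by
    classical
    intro t
    induction t using Finset.induction_on with
    | empty => exact xPow_zero
    | insert n t hn ih => rw [Finset.sum_insert hn, Finset.prod_insert hn, xPow_add, ih, xPow_nsmul]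
  rw [monomial_mkMon, pow_one, map_mul, map_mul, contract_noise, treePoly, Finsupp.sum, h,
    Finsupp.prod, map_prod, map_multiset_prod, Multiset.map_map, Multiset.map_map]
  congr 2
  · refine Finset.prod_congr rfl fun n _ => ?_
    rw [map_pow, contract_poly]
  · refine Multiset.map_congr rfl fun τ _ => ?_
    rw [Function.comp_apply, contract_int]
    rfl

/-- The contraction acts node by node and hence passes through ℐ, so the contracted dictionary
inherits the recursion. -/
theorem contract_integ {x : Alg N2ne} (hx : x ∈ treeSpan N2ne) :
    contract (integ x) = integ (contract x) := by
  induction hx using Submodule.span_induction with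
  | mem x hx =>
    obtain ⟨m, hm, rfl⟩ := hx
    have hm' : m Sym.noise = 1 := hm
    have e : m = mkMon 1 (polyPart m) (intPart m) := by rw [← hm', mkMon_parts]
    rw [integ_monomial, if_pos hm', contract_int, e, toTree_mkMon, contractTree_node,
      contract_mkMon, integ_treePoly]
  | zero => simp
  | add x y _ _ hx hy => simp only [map_add, hx, hy]
  | smul c x _ hx => simp only [map_smul, hx]

/-! ### The contracted dictionary and its support -/

/-- The dictionary `φ_- = 𝒬 φ̊_-` on all multi-indices. -/
def phiM (β : MI) : Alg (Fin 2) := contract (dictMinus β)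

/-- The companion `𝒬 φ̊` of the dictionary. -/
def phiI (β : MI) : Alg (Fin 2) := contract (dict β)

theorem phiMinus_single (β : TIdx) : phiMinus (Finsupp.single β 1) = phiM β.1 := by
  rw [phiMinus, Finsupp.linearCombination_single, one_smul]
  rfl

theorem phiM_eq (β : MI) : phiM β = recM phiI (X Sym.noise) β := by
  rw [phiM, dictMinus_eq_recM]
  have := map_recM (contract : Alg N2ne →+* Alg (Fin 2)) dict (X Sym.noise) β
  refine this.trans ?_
  rw [RingHom.coe_coe, contract_noise]
  rfl

theorem phiI_ePoly (m : N2ne) : phiI (ePoly m) = xPow m.1 := by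
  rw [phiI, dict_ePoly, contract_poly]

theorem phiI_of_ne {β : MI} (h : ∀ m, β ≠ ePoly m) : phiI β = integ (phiM β) := by
  rw [phiI, dict_of_ne h, contract_integ]
  · rfl
  · rw [dictMinus_eq_recM]
    exact recM_mem_treeSpan dict_mem_noiseFree β

theorem phiI_mem_noiseFree (β : MI) : phiI β ∈ noiseFree (Fin 2) := by
  by_cases h : ∃ m, β = ePoly m
  · obtain ⟨m, rfl⟩ := h
    rw [phiI_ePoly]
    exact polySpan_le_noiseFree (Submodule.subset_span ⟨_, rfl⟩)
  · rw [phiI_of_ne (by push Not at h; exact h)]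
    exact integ_mem_noiseFree _

theorem phiM_mem_treeSpan (β : MI) : phiM β ∈ treeSpan (Fin 2) := by
  rw [phiM_eq]
  exact recM_mem_treeSpan phiI_mem_noiseFree β

theorem phiMinus_mem_TH (t : T) : phiMinus t ∈ TH := by
  rw [phiMinus, Finsupp.linearCombination_apply]
  exact Submodule.sum_mem _ fun β _ => Submodule.smul_mem _ _
    (treeSpan_le_TH (phiM_mem_treeSpan β.1))

theorem bra_sum {ι : Type} (s : Finset ι) (b : ι → MI) : bra (∑ i ∈ s, b i) = ∑ i ∈ s, bra (b i) := by
  classical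
  induction s using Finset.induction_on with
  | empty => exact bra_zero
  | insert i s hi ih => rw [Finset.sum_insert hi, Finset.sum_insert hi, bra_add, ih]

/-- In e_k + β_1 + ⋯ + β_k the first term contributes k to [β], and each of the k others at least
-1, the value -1 being due to polynomial factors. Hence the restriction to the index set of T loses
nothing. -/
theorem bra_nonneg_of_phiM_ne_zero {β : MI} : phiM β ≠ 0 → 0 ≤ bra β := by
  induction h : β.degree using Nat.strong_induction_on generalizing β with
  | _ N ih =>
    subst h
    rw [phiM_eq]
    refine recM_induction (p := fun x => x ≠ 0 → 0 ≤ bra β) (fun h => absurd rfl h) ?_ ?_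
    · intro x y hx hy hxy
      by_cases h : x = 0
      · refine hy fun hc => hxy ?_
        rw [h, hc, add_zero]
      · exact hx h
    · intro k b hb hdeg hne
      have h1 : ∀ i, -1 ≤ bra (b i) := by
        intro i
        have hi : phiI (b i) ≠ 0 := fun hc =>
          hne (by rw [Finset.prod_eq_zero (Finset.mem_univ i) hc, zero_mul])
        by_cases h : ∃ m, b i = ePoly m
        · obtain ⟨m, hm⟩ := h
          rw [hm, bra_ePoly]
        · rw [phiI_of_ne (by push Not at h; exact h)] at hi
          have := ih _ (hdeg i) rfl (fun hc : phiM (b i) = 0 => hi (by rw [hc, map_zero]))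
          omega
      rw [← hb, bra_add, bra_single_inl, bra_sum]
      have h2 : ∑ _i : Fin k, (-1 : ℤ) ≤ ∑ i, bra (b i) := Finset.sum_le_sum fun i _ => h1 i
      simp at h2
      omega

theorem phiM_ePoly (m : N2ne) : phiM (ePoly m) = 0 := by
  by_contra h
  have := bra_nonneg_of_phiM_ne_zero h
  rw [bra_ePoly] at this
  omega

/-! ### Homogeneity of the dictionary -/

/-- The elements of the algebra of given homogeneity. -/
def homSpan (α : ℝ) (w : Fin 2 → ℝ) (c : ℝ) : Submodule ℝ (Alg (Fin 2)) :=
  Submodule.span ℝ ((fun m => monomial m (1 : ℝ)) '' {m : Mon (Fin 2) | monHom α w m = c})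

theorem mul_mem_homSpan {c d e : ℝ} (h : c + d = e) {x y : Alg (Fin 2)} (hx : x ∈ homSpan α w c)
    (hy : y ∈ homSpan α w d) : x * y ∈ homSpan α w e := by
  induction hx using Submodule.span_induction with
  | mem x hx =>
    obtain ⟨m, hm, rfl⟩ := hx
    induction hy using Submodule.span_induction with
    | mem y hy =>
      obtain ⟨m', hm', rfl⟩ := hy
      refine Submodule.subset_span ⟨m + m', ?_, ?_⟩
      · rw [Set.mem_ofPred_eq, monHom_eq_weight] at hm hm' ⊢
        rw [map_add, hm, hm', h]
      · simp [monomial_mul]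
    | zero => rw [mul_zero]; exact Submodule.zero_mem _
    | add x y _ _ hx hy => rw [mul_add]; exact Submodule.add_mem _ hx hy
    | smul c x _ hx => rw [mul_smul_comm]; exact Submodule.smul_mem _ c hx
  | zero => rw [zero_mul]; exact Submodule.zero_mem _
  | add x y _ _ hx hy => rw [add_mul]; exact Submodule.add_mem _ hx hy
  | smul c x _ hx => rw [smul_mul_assoc]; exact Submodule.smul_mem _ c hx

theorem prod_mem_homSpan {ι : Type} (s : Finset ι) {f : ι → Alg (Fin 2)} {c : ι → ℝ}
    (h : ∀ i ∈ s, f i ∈ homSpan α w (c i)) : ∏ i ∈ s, f i ∈ homSpan α w (∑ i ∈ s, c i) := by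
  classical
  induction s using Finset.induction_on with
  | empty => exact Submodule.subset_span ⟨0, by simp [monHom], rfl⟩
  | insert i s hi ih =>
    rw [Finset.prod_insert hi, Finset.sum_insert hi]
    exact mul_mem_homSpan rfl (h i (Finset.mem_insert_self i s))
      (ih fun j hj => h j (Finset.mem_insert_of_mem hj))

theorem X_mem_homSpan (s : Sym (Fin 2)) : X s ∈ homSpan α w (symHom α w s) :=
  Submodule.subset_span ⟨Finsupp.single s 1, by
    rw [Set.mem_ofPred_eq, monHom_eq_weight, Finsupp.weight_single, one_smul], rfl⟩

theorem integ_mem_homSpan {c : ℝ} {x : Alg (Fin 2)} (hx : x ∈ homSpan α w c) :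
    integ x ∈ homSpan α w (c + 2) := by
  induction hx using Submodule.span_induction with
  | mem x hx =>
    obtain ⟨m, hm, rfl⟩ := hx
    simp only [integ_monomial]
    split_ifs with h
    · have := X_mem_homSpan (α := α) (w := w) (Sym.int (toTree m))
      rw [Set.mem_ofPred_eq, ← treeHom_toTree h] at hm
      rw [← hm]
      exact this
    · exact Submodule.zero_mem _
  | zero => rw [map_zero]; exact Submodule.zero_mem _
  | add x y _ _ hx hy => rw [map_add]; exact Submodule.add_mem _ hx hy
  | smul c x _ hx => rw [map_smul]; exact Submodule.smul_mem _ c hx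

/-- With k factors, [β] + 1 = 1 + ∑ ([β_i] + 1), so |β| = α + ∑ |β_i|. This is the homogeneity of
the tree up to the -2 of the noise, which ℐ compensates in each factor. -/
theorem phiM_mem_homSpan (β : MI) : phiM β ∈ homSpan α w (hom α w β - 2) := by
  induction h : β.degree using Nat.strong_induction_on generalizing β with
  | _ N ih =>
    subst h
    rw [phiM_eq]
    refine recM_induction (p := (· ∈ homSpan α w (hom α w β - 2))) (Submodule.zero_mem _)
      (fun _ _ => Submodule.add_mem _) fun k b hb hdeg => ?_
    have h1 : ∀ i, phiI (b i) ∈ homSpan α w (hom α w (b i)) := by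
      intro i
      by_cases h : ∃ m, b i = ePoly m
      · obtain ⟨m, hm⟩ := h
        rw [hm, phiI_ePoly, xPow_eq_monomial]
        refine Submodule.subset_span ⟨_, ?_, rfl⟩
        rw [Set.mem_ofPred_eq, monHom_mkMon, hom_eq, bra_ePoly, plen_ePoly]
        simp
      · rw [phiI_of_ne (by push Not at h; exact h)]
        have := integ_mem_homSpan (ih _ (hdeg i) (b i) rfl)
        rwa [sub_add_cancel] at this
    refine mul_mem_homSpan ?_ (prod_mem_homSpan _ fun i _ => h1 i) (X_mem_homSpan Sym.noise)
    have h2 : hom α w β = α * (((k : ℕ) : ℝ) + ∑ i, (bra (b i) : ℝ) + 1) + ∑ i, plen w (b i) := by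
      rw [hom_eq, ← hb, bra_add, bra_single_inl, bra_sum, map_add, map_sum, plen_single_inl]
      push_cast
      ring
    simp only [hom_eq, mul_add, mul_one, Finset.sum_add_distrib, Finset.sum_const, Finset.card_univ,
      Fintype.card_fin, nsmul_eq_mul, symHom, ← Finset.mul_sum] at h2 ⊢
    linarith

theorem JH_phiM_eq_zero {n : N2} {β : MI} (h : ¬ len w n < hom α w β) : JH α w n (phiM β) = 0 := by
  have key : ∀ x ∈ homSpan α w (hom α w β - 2), JH α w n x = 0 := by
    intro x hx
    induction hx using Submodule.span_induction with
    | mem x hx =>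
      obtain ⟨m, hm, rfl⟩ := hx
      simp only [JH_monomial]
      rw [dif_neg]
      rintro ⟨-, hc⟩
      rw [Set.mem_ofPred_eq] at hm
      rw [hm, sub_add_cancel] at hc
      exact h hc
    | zero => rw [map_zero]
    | add x y _ _ hx hy => rw [map_add, hx, hy, add_zero]
    | smul c x _ hx => rw [map_smul, hx, smul_zero]
  exact key _ (phiM_mem_homSpan β)

/-! ### The values of Φ on the symbols 𝒥_n z_β / n! -/

/-- Outside the admissible pairs both sides vanish: either the homogeneity of φ_- z_β is too small
for 𝒥_n, or [β] < 0 and φ_- z_β = 0. -/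
theorem Phi_xx {β : MI} (h : ∀ m, β ≠ ePoly m) (n : N2) :
    Phi α w (xx α w n β) = (fact n : ℝ)⁻¹ • JH α w n (phiM β) := by
  by_cases hadm : Admissible α w β n
  · rw [xx_admissible hadm, Phi, aeval_X, Sum.elim_inl, phiMinus_single]
  · rw [xx_of_not hadm h, map_zero]
    by_cases hb : 0 ≤ bra β
    · rw [JH_phiM_eq_zero (fun hc => hadm ⟨hb, hc⟩), smul_zero]
    · have : phiM β = 0 := by_contra fun hc => hb (bra_nonneg_of_phiM_ne_zero hc)
      rw [this, map_zero, smul_zero]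

theorem fact_add (n k : N2) :
    (((n + k) 0).choose (n 0) * ((n + k) 1).choose (n 1) : ℕ) * (fact k * fact n) = fact (n + k) := by
  simp only [fact, Fin.prod_univ_two, Finsupp.add_apply]
  have h0 := Nat.add_choose_mul_factorial_mul_factorial (n 0) (k 0)
  have h1 := Nat.add_choose_mul_factorial_mul_factorial (n 1) (k 1)
  rw [← Nat.choose_symm_add] at h0 h1
  rw [← h0, ← h1]
  ring

theorem fact_ne_zero (n : N2) : (fact n : ℝ) ≠ 0 :=
  Nat.cast_ne_zero.2 (Finset.prod_ne_zero_iff.2 fun _ _ => Nat.factorial_ne_zero _)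

theorem Phi_inr (i : Fin 2) : Phi α w (X (Sum.inr i)) = polXP α w i := by
  rw [Phi, aeval_X]
  rfl

theorem Phi_xp (n k : N2) : Phi α w (xp α w (n + k) n) =
    ((fact (n + k) : ℝ) * (fact n : ℝ)⁻¹) • dpow (polXP α w) k := by
  have e : ∀ i, (n + k) i - n i = k i := fun i => by rw [Finsupp.add_apply]; omega
  rw [xp, e, e]
  simp only [map_mul, map_pow, map_natCast, Phi_inr, dpow, Fin.prod_univ_two, smul_smul]
  rw [← fact_add, Algebra.smul_def]
  have h1 := fact_ne_zero n
  have h2 := fact_ne_zero k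
  have : ((((n + k) 0).choose (n 0) * ((n + k) 1).choose (n 1) * (fact k * fact n) : ℕ) : ℝ) *
      (fact n : ℝ)⁻¹ * (fact k : ℝ)⁻¹ = ((((n + k) 0).choose (n 0) * ((n + k) 1).choose (n 1) : ℕ) : ℝ) := by
    push_cast
    field_simp
  rw [this, map_natCast]
  push_cast
  ring

end

section

variable {α : ℝ} {w : Fin 2 → ℝ}

/-! ## Power series and the transposed operators -/

/-- The coproduct on `TT` dual to the multiplication of polynomials. -/
def dupl : TT →ₗ[ℝ] TT ⊗[ℝ] TT := Finsupp.linearCombination ℝ fun γ =>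
  ∑ p ∈ Finset.HasAntidiagonal.antidiagonal γ, Finsupp.single p.1 (1 : ℝ) ⊗ₜ[ℝ] Finsupp.single p.2 (1 : ℝ)

theorem dupl_apply (t : TT) (a b : MI) : finsuppTensorFinsupp' ℝ MI MI (dupl t) (a, b) = t (a + b) := by
  classical
  induction t using Finsupp.induction_linear with
  | zero => simp
  | add s t hs ht => simp only [map_add, Finsupp.add_apply, hs, ht]
  | single γ c =>
    rw [dupl, Finsupp.linearCombination_single, map_smul, map_sum, Finsupp.smul_apply,
      Finsupp.finsetSum_apply, Finsupp.single_apply]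
    have h : ∀ p ∈ Finset.HasAntidiagonal.antidiagonal γ,
        finsuppTensorFinsupp' ℝ MI MI (Finsupp.single p.1 (1 : ℝ) ⊗ₜ[ℝ] Finsupp.single p.2 (1 : ℝ)) (a, b)
          = if p = (a, b) then 1 else 0 := by
      intro p _
      rw [finsuppTensorFinsupp'_single_tmul_single, Finsupp.single_apply, mul_one]
    rw [Finset.sum_congr rfl h, smul_eq_mul]
    split_ifs with hγ
    · refine (congrArg (c * ·) (Finset.sum_eq_single_of_mem (a, b)
        (Finset.HasAntidiagonal.mem_antidiagonal.2 hγ.symm) fun p _ hp => if_neg hp)).trans ?_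
      simp
    · refine (congrArg (c * ·) (Finset.sum_eq_zero fun p hp => if_neg fun e : p = (a, b) => ?_)).trans
        (mul_zero c)
      have := Finset.HasAntidiagonal.mem_antidiagonal.1 hp
      rw [e] at this
      exact hγ this.symm

/-- This transposes the Leibniz rule: the transpose of a derivation is a coderivation. -/
theorem dupl_tr {D : Module.End ℝ Poly} (hr : D ∈ rowFinite)
    (hD : ∀ p q, D (p * q) = p * D q + q * D p) (β : MI) :
    dupl (tr D (Finsupp.single β 1)) = ∑ p ∈ Finset.HasAntidiagonal.antidiagonal β,
      (Finsupp.single p.1 (1 : ℝ) ⊗ₜ[ℝ] tr D (Finsupp.single p.2 1) +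
        tr D (Finsupp.single p.1 1) ⊗ₜ[ℝ] Finsupp.single p.2 (1 : ℝ)) := by
  classical
  refine (finsuppTensorFinsupp' ℝ MI MI).injective (Finsupp.ext fun ⟨a, b⟩ => ?_)
  have e : mono (a + b) = mono a * mono b := by simp [mono, monomial_mul]
  rw [dupl_apply, tr_single hr, e, hD, coeff_add, coeff_mul, mul_comm (mono b), coeff_mul,
    ← Finset.sum_add_distrib, map_sum, Finsupp.finsetSum_apply]
  refine Finset.sum_congr rfl fun p _ => ?_
  rw [map_add, Finsupp.add_apply, finsuppTensorFinsupp'_apply_apply, finsuppTensorFinsupp'_apply_apply,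
    tr_single hr, tr_single hr, mono, mono, coeff_monomial, coeff_monomial, Finsupp.single_apply,
    Finsupp.single_apply]
  simp only [eq_comm]

section Series

variable {B : Type} [CommRing B] [Algebra ℝ B]

/-- The linear map with the coefficients of a power series. -/
def lin (F : MvPowerSeries Var B) : TT →ₗ[ℝ] B :=
  Finsupp.linearCombination ℝ fun β => MvPowerSeries.coeff β F

theorem lin_single (F : MvPowerSeries Var B) (β : MI) :
    lin F (Finsupp.single β 1) = MvPowerSeries.coeff β F := by
  rw [lin, Finsupp.linearCombination_single, one_smul]

theorem lin_add (F G : MvPowerSeries Var B) (t : TT) : lin (F + G) t = lin F t + lin G t := by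
  simp only [lin, Finsupp.linearCombination_apply, map_add, smul_add, Finsupp.sum_add]

theorem coeff_real_smul (c : ℝ) (F : MvPowerSeries Var B) (β : MI) :
    MvPowerSeries.coeff β (c • F) = c • MvPowerSeries.coeff β F := rfl

theorem lin_smul (c : ℝ) (F : MvPowerSeries Var B) (t : TT) : lin (c • F) t = c • lin F t := by
  simp only [lin, Finsupp.linearCombination_apply, coeff_real_smul, Finsupp.smul_sum, smul_comm c]

theorem lin_mul (F G : MvPowerSeries Var B) (t : TT) :
    lin (F * G) t = LinearMap.mul' ℝ B (TensorProduct.map (lin F) (lin G) (dupl t)) := by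
  classical
  induction t using Finsupp.induction_linear with
  | zero => simp
  | add s t hs ht => simp only [map_add, hs, ht]
  | single γ c =>
    rw [lin, Finsupp.linearCombination_single, dupl, Finsupp.linearCombination_single, map_smul,
      map_smul, MvPowerSeries.coeff_mul, map_sum, map_sum]
    congr 1
    refine Finset.sum_congr rfl fun p _ => ?_
    rw [TensorProduct.map_tmul, lin_single, lin_single, LinearMap.mul'_apply]

/-- The derivation of power series that combines a derivation of the coefficients with the
transposed of a differential operator in the variables. -/
def seriesDer (d : Derivation ℝ B B) {D : Module.End ℝ Poly} (hr : D ∈ rowFinite)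
    (hD : ∀ p q, D (p * q) = p * D q + q * D p) :
    Derivation ℝ (MvPowerSeries Var B) (MvPowerSeries Var B) :=
  Derivation.mk'
    { toFun := fun F β => d (MvPowerSeries.coeff β F) - lin F (tr D (Finsupp.single β 1))
      map_add' := fun F G => funext fun β => by
        change _ = (d _ - lin F _) + (d _ - lin G _)
        rw [map_add, lin_add, map_add]
        abel
      map_smul' := fun c F => funext fun β => by
        change _ = c • (d _ - lin F _)
        rw [coeff_real_smul, lin_smul, Derivation.map_smul, smul_sub] }
    fun F G => by
      classical
      refine MvPowerSeries.ext fun β => ?_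
      change d (MvPowerSeries.coeff β (F * G)) - lin (F * G) (tr D (Finsupp.single β 1)) = _
      rw [lin_mul, dupl_tr hr hD, map_sum, map_sum, MvPowerSeries.coeff_mul, map_sum,
        ← Finset.sum_sub_distrib, smul_eq_mul, smul_eq_mul, map_add, mul_comm G,
        MvPowerSeries.coeff_mul, MvPowerSeries.coeff_mul, ← Finset.sum_add_distrib]
      refine Finset.sum_congr rfl fun p _ => ?_
      rw [map_add, map_add, TensorProduct.map_tmul, TensorProduct.map_tmul, LinearMap.mul'_apply,
        LinearMap.mul'_apply, lin_single, lin_single, Derivation.leibniz, smul_eq_mul, smul_eq_mul]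
      change _ = _ * (d _ - lin G _) + (d _ - lin F _) * _
      ring

theorem coeff_seriesDer (d : Derivation ℝ B B) {D : Module.End ℝ Poly} (hr : D ∈ rowFinite)
    (hD : ∀ p q, D (p * q) = p * D q + q * D p) (F : MvPowerSeries Var B) (β : MI) :
    MvPowerSeries.coeff β (seriesDer d hr hD F) =
      d (MvPowerSeries.coeff β F) - lin F (tr D (Finsupp.single β 1)) := rfl

/-- Polynomials as power series with coefficients in `B`. -/
def polySeries (B : Type) [CommRing B] [Algebra ℝ B] : Poly →ₐ[ℝ] MvPowerSeries Var B :=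
  aeval fun v => MvPowerSeries.X v

theorem polySeries_X (v : Var) : polySeries B (X v) = MvPowerSeries.X v := aeval_X _ _

theorem polySeries_mono (γ : MI) : polySeries B (mono γ) = MvPowerSeries.monomial γ 1 := by
  induction γ using Finsupp.induction_linear with
  | zero => 
    have : mono 0 = 1 := rfl
    rw [this, map_one]; rfl
  | add s t hs ht =>
    have e : mono (s + t) = mono s * mono t := by simp [mono, monomial_mul]
    rw [e, map_mul, hs, ht, MvPowerSeries.monomial_mul_monomial, one_mul]
  | single v n =>
    have e : mono (Finsupp.single v n) = X v ^ n := by rw [mono, X_pow_eq_monomial]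
    rw [e, map_pow, polySeries_X, MvPowerSeries.X_pow_eq]

theorem coeff_polySeries (p : Poly) (β : MI) :
    MvPowerSeries.coeff β (polySeries B p) = algebraMap ℝ B (coeff β p) := by
  classical
  have key := poly_linear_eq (polySeries B).toLinearMap p
  rw [AlgHom.toLinearMap_apply] at key
  rw [key, map_sum]
  simp only [coeff_real_smul, AlgHom.toLinearMap_apply, polySeries_mono, MvPowerSeries.coeff_monomial]
  simp only [smul_ite, smul_zero, Finset.sum_ite_eq, Algebra.algebraMap_eq_smul_one]
  split_ifs with h
  · rfl
  · rw [notMem_support_iff.1 h, zero_smul]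

theorem lin_polySeries (p : Poly) (t : TT) : lin (polySeries B p) t = algebraMap ℝ B (pr t p) := by
  induction t using Finsupp.induction_linear with
  | zero => simp
  | add s t hs ht => rw [map_add, map_add, hs, ht, LinearMap.add_apply, map_add]
  | single γ c =>
    rw [lin, Finsupp.linearCombination_single, coeff_polySeries, pr_single, map_mul, Algebra.smul_def]

/-- The coefficients are scalars and are killed by d. What remains is the transpose of the transpose
of D, that is D, with the sign from the definition. -/
theorem seriesDer_polySeries (d : Derivation ℝ B B) {D : Module.End ℝ Poly} (hr : D ∈ rowFinite)
    (hD : ∀ p q, D (p * q) = p * D q + q * D p) (p : Poly) :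
    seriesDer d hr hD (polySeries B p) = -polySeries B (D p) := by
  refine MvPowerSeries.ext fun β => ?_
  rw [coeff_seriesDer, coeff_polySeries, Derivation.map_algebraMap, lin_polySeries, pr_tr hr,
    pr_single, one_mul, zero_sub, map_neg, coeff_polySeries]

theorem seriesDer_C (d : Derivation ℝ B B) {D : Module.End ℝ Poly} (hr : D ∈ rowFinite)
    (hD : ∀ p q, D (p * q) = p * D q + q * D p) {b : B} (hb : d b = 0) :
    seriesDer d hr hD (MvPowerSeries.C b) = 0 := by
  classical
  refine MvPowerSeries.ext fun β => ?_
  have h1 : D 1 = 0 := by simpa using hD 1 1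
  have h2 : lin (MvPowerSeries.C b) (tr D (Finsupp.single β 1)) = 0 := by
    rw [lin, Finsupp.linearCombination_apply]
    refine Finset.sum_eq_zero fun γ _ => ?_
    simp only [MvPowerSeries.coeff_C]
    split_ifs with h
    · have : mono 0 = 1 := rfl
      rw [h, tr_single hr, this, h1, coeff_zero, zero_smul]
    · rw [smul_zero]
  rw [coeff_seriesDer, h2, MvPowerSeries.coeff_C, map_zero, sub_zero]
  split_ifs
  · exact hb
  · exact map_zero d

/-- The partial sums of `∑_k z_k F^k ξ`. -/
def partSeries (F : MvPowerSeries Var B) (ξ : B) (K : ℕ) : MvPowerSeries Var B :=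
  ∑ k ∈ Finset.range K, polySeries B (X (Sum.inl k)) * F ^ k * MvPowerSeries.C ξ

/-- With c for `tiltPart D`, the derivative of z_k contributes -(k+1) z_{k+1} c F^k and that of F^k
contributes k z_k F^(k-1) c. Consecutive terms cancel, and the remainder contains z_K. For K = 0 the
factor K makes the truncated exponent harmless. -/
theorem seriesDer_partSeries (d : Derivation ℝ B B) {D : Module.End ℝ Poly} (hD : D ∈ L α w)
    {F : MvPowerSeries Var B} {ξ : B} (hξ : d ξ = 0)
    (hF : seriesDer d (L_le_rowFinite hD) (L_leibniz hD) F = polySeries B (tiltPart D)) (K : ℕ) :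
    seriesDer d (L_le_rowFinite hD) (L_leibniz hD) (partSeries F ξ K) = polySeries B (X (Sum.inl K)) *
      (-(K : MvPowerSeries Var B) * (F ^ (K - 1) * polySeries B (tiltPart D) * MvPowerSeries.C ξ)) := by
  induction K with
  | zero => simp [partSeries]
  | succ K ih =>
    rw [partSeries, Finset.sum_range_succ, map_add]
    change seriesDer _ _ _ (partSeries F ξ K) + _ = _
    have hc : polySeries B (((K : ℝ) + 1) • (X (Sum.inl (K + 1)) * tiltPart D)) =
        ((K : MvPowerSeries Var B) + 1) * (polySeries B (X (Sum.inl (K + 1))) *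
          polySeries B (tiltPart D)) := by
      rw [map_smul, map_mul, Algebra.smul_def, map_add, map_one, map_natCast]
    rw [ih, Derivation.leibniz, Derivation.leibniz, seriesDer_C d _ _ hξ, seriesDer_polySeries,
      L_apply_inl hD, hc, Derivation.leibniz_pow, hF]
    simp only [smul_eq_mul, nsmul_eq_mul, Nat.cast_add, Nat.cast_one, Nat.add_sub_cancel]
    ring

omit [Algebra ℝ B] in
theorem coeff_pow_eq (F : MvPowerSeries Var B) (k : ℕ) (β : MI) :
    MvPowerSeries.coeff β (F ^ k) = ∑ b ∈ Finset.piAntidiag (Finset.univ : Finset (Fin k)) β,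
      ∏ i, MvPowerSeries.coeff (b i) F := by
  classical
  have e : F ^ k = ∏ _i : Fin k, F := by simp
  rw [e, MvPowerSeries.coeff_prod]
  refine Finset.sum_nbij' (fun l => ⇑l) (fun b => Finsupp.equivFunOnFinite.symm b) ?_ ?_ ?_ ?_ ?_
  · intro l hl
    simpa using (Finset.mem_finsuppAntidiag.1 hl).1
  · intro b hb
    simpa [Finset.mem_finsuppAntidiag] using hb
  · intro l _
    exact Finsupp.ext fun _ => rfl
  · intro b _
    rfl
  · intro l _
    rfl

theorem coeff_partSeries (F : MvPowerSeries Var B) (ξ : B) {K : ℕ} {β : MI}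
    (hK : ∀ k, β (Sum.inl k) ≠ 0 → k < K) :
    MvPowerSeries.coeff β (partSeries F ξ K) = recM (fun γ => MvPowerSeries.coeff γ F) ξ β := by
  classical
  rw [partSeries, map_sum, recM]
  have h : ∀ k, MvPowerSeries.coeff β (polySeries B (X (Sum.inl k)) * F ^ k * MvPowerSeries.C ξ) =
      if β (Sum.inl k) ≠ 0 then ∑ b ∈ Finset.piAntidiag (Finset.univ : Finset (Fin k))
        (β - Finsupp.single (Sum.inl k) 1), (∏ i, MvPowerSeries.coeff (b i) F) * ξ else 0 := by
    intro k
    rw [MvPowerSeries.coeff_mul_C, polySeries_X, MvPowerSeries.X, MvPowerSeries.coeff_monomial_mul,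
      one_mul, coeff_pow_eq, ← Finset.sum_mul]
    have : (Finsupp.single (Sum.inl k) 1 ≤ β) ↔ β (Sum.inl k) ≠ 0 := by
      rw [Finsupp.single_le_iff, Nat.one_le_iff_ne_zero]
    simp only [this, ite_mul, zero_mul]
  rw [Finset.sum_congr rfl fun k _ => h k, ← Finset.sum_filter]
  refine Finset.sum_of_injOn Sum.inl Sum.inl_injective.injOn ?_ ?_ ?_
  · intro k hk
    exact Finsupp.mem_support_iff.2 (Finset.mem_filter.1 hk).2
  · rintro (k | n) hv hk
    · have hv' := Finsupp.mem_support_iff.1 hv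
      exact absurd ⟨k, Finset.mem_filter.2 ⟨Finset.mem_range.2 (hK k hv'), hv'⟩, rfl⟩ hk
    · rfl
  · intro k _
    rfl

theorem coeff_X_inl_mul_eq_zero {K : ℕ} {β : MI} (hK : ∀ k, β (Sum.inl k) ≠ 0 → k < K)
    (G : MvPowerSeries Var B) : MvPowerSeries.coeff β (polySeries B (X (Sum.inl K)) * G) = 0 := by
  classical
  rw [polySeries_X, MvPowerSeries.X, MvPowerSeries.coeff_monomial_mul, if_neg]
  rw [Finsupp.single_le_iff, Nat.one_le_iff_ne_zero]
  exact fun h => lt_irrefl _ (hK K h)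

/-- A bound for the indices `k` of the variables `z_k` in finitely many multi-indices. -/
theorem exists_inl_bound (s : Finset MI) : ∃ K, ∀ β ∈ s, ∀ k, β (Sum.inl k) ≠ 0 → k < K := by
  classical
  have hf : {k : ℕ | ∃ β ∈ s, β (Sum.inl k) ≠ 0}.Finite := by
    refine ((s.biUnion fun β => β.support).finite_toSet.preimage
      (f := (Sum.inl : ℕ → Var)) Sum.inl_injective.injOn).subset ?_
    rintro k ⟨β, hβ, hk⟩
    exact Finset.mem_coe.2 (Finset.mem_biUnion.2 ⟨β, hβ, Finsupp.mem_support_iff.2 hk⟩)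
  obtain ⟨K, hK⟩ := hf.bddAbove
  exact ⟨K + 1, fun β hβ k hk => Nat.lt_succ_of_le (hK ⟨β, hβ, hk⟩)⟩

/-- If `d F = D F + c` then `∑_k z_k F^k ξ` is a solution of `d R = D R`. -/
theorem der_recM (d : Derivation ℝ B B) {D : Module.End ℝ Poly} (hD : D ∈ L α w)
    {Θ : TT →ₗ[ℝ] B} {ξ : B} (hξ : d ξ = 0)
    (hΘ : ∀ t, d (Θ t) = Θ (tr D t) + algebraMap ℝ B (pr t (tiltPart D))) (β : MI) :
    d (recM (fun γ => Θ (Finsupp.single γ 1)) ξ β) =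
      Finsupp.linearCombination ℝ (recM (fun γ => Θ (Finsupp.single γ 1)) ξ)
        (tr D (Finsupp.single β 1)) := by
  classical
  -- F is the generating series of the values of Θ on basis vectors.
  let F : MvPowerSeries Var B := fun γ => Θ (Finsupp.single γ 1)
  have hcF : ∀ γ, MvPowerSeries.coeff γ F = Θ (Finsupp.single γ 1) := fun γ => rfl
  have hlin : lin F = Θ := Finsupp.lhom_ext' fun γ => LinearMap.ext_ring (by
    change lin F (Finsupp.single γ 1) = Θ (Finsupp.single γ 1)
    rw [lin_single, hcF])
  have hF : seriesDer d (L_le_rowFinite hD) (L_leibniz hD) F = polySeries B (tiltPart D) := by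
    refine MvPowerSeries.ext fun γ => ?_
    rw [coeff_seriesDer, hcF, hΘ, hlin, add_sub_cancel_left, coeff_polySeries, pr_single, one_mul]
  -- K is chosen beyond all z_k that occur in β and in its row. Then the remainder has no
  -- coefficient at β, and the partial sum agrees with the full series wherever it is evaluated.
  obtain ⟨K, hK⟩ := exists_inl_bound (insert β (tr D (Finsupp.single β 1)).support)
  have h := congrArg (MvPowerSeries.coeff β) (seriesDer_partSeries d hD hξ hF K)
  rw [coeff_X_inl_mul_eq_zero (hK β (Finset.mem_insert_self _ _)), coeff_seriesDer, sub_eq_zero,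
    coeff_partSeries F ξ (hK β (Finset.mem_insert_self _ _))] at h
  refine h.trans ?_
  rw [lin, Finsupp.linearCombination_apply, Finsupp.linearCombination_apply]
  refine Finset.sum_congr rfl fun γ hγ => ?_
  simp only [coeff_partSeries F ξ (hK γ (Finset.mem_insert_of_mem hγ)), hcF]

end Series

end

section

variable {α : ℝ} {w : Fin 2 → ℝ}

/-! ## The coaction of the detailed dictionary -/

theorem finite_xx_ne_zero (hw : ∀ i, 0 < w i) (β : MI) : {n | xx α w n β ≠ 0}.Finite := by
  by_cases h : ∃ m, β = ePoly m
  · obtain ⟨m, rfl⟩ := h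
    refine (Set.finite_Iic m.1).subset fun n hn => by_contra fun hc => hn ?_
    rw [xx_ePoly, xp_eq_zero hc]
  · refine (finite_len_lt hw (hom α w β)).subset fun n hn => ?_
    rcases xx_ne_zero hn with h' | h'
    · exact h'.2
    · exact absurd h' h

theorem finite_xxL_ne_zero (hw : ∀ i, 0 < w i) (t : TT) : {n | xxL α w n t ≠ 0}.Finite := by
  refine (t.support.finite_toSet.biUnion fun β _ => finite_xx_ne_zero (α := α) hw β).subset
    fun n hn => ?_
  by_contra hc
  refine hn (xxL_eq_zero fun γ hγ => by_contra fun h => hc ?_)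
  exact Set.mem_biUnion (Finset.mem_coe.2 (Finsupp.mem_support_iff.2 hγ)) h

/-- The map `t ↦ xxL n t ⊗ X^n`. -/
def polyTerm (α : ℝ) (w : Fin 2 → ℝ) (n : N2) : TT →ₗ[ℝ] TPlus α w ⊗[ℝ] Alg (Fin 2) :=
  (TensorProduct.mk ℝ (TPlus α w) (Alg (Fin 2))).flip (xPow n) ∘ₗ xxL α w n

theorem polyTerm_apply (n : N2) (t : TT) : polyTerm α w n t = xxL α w n t ⊗ₜ[ℝ] xPow n := rfl

theorem finite_polyTerm (hw : ∀ i, 0 < w i) (t : TT) : {n | polyTerm α w n t ≠ 0}.Finite :=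
  (finite_xxL_ne_zero hw t).subset fun n hn hc => hn (by
    rw [polyTerm_apply, hc, TensorProduct.zero_tmul])

/-- The map `(id ⊗ φ_-) Δ`. -/
def coactM (α : ℝ) (w : Fin 2 → ℝ) : TT →ₗ[ℝ] TPlus α w ⊗[ℝ] Alg (Fin 2) :=
  phiMinus.lTensor (TPlus α w) ∘ₗ DeltaExt α w

/-- The map `(id ⊗ ℐ φ_-) Δ z_β + ∑_n (𝒥_n z_β / n!) ⊗ X^n`. -/
def coactI (α : ℝ) (w : Fin 2 → ℝ) (hw : ∀ i, 0 < w i) : TT →ₗ[ℝ] TPlus α w ⊗[ℝ] Alg (Fin 2) :=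
  integ.lTensor (TPlus α w) ∘ₗ coactM α w + lfSum (polyTerm α w) (finite_polyTerm hw)

theorem coactI_apply (hw : ∀ i, 0 < w i) (t : TT) : coactI α w hw t =
    integ.lTensor (TPlus α w) (coactM α w t) + ∑ᶠ n, xxL α w n t ⊗ₜ[ℝ] xPow n := rfl

theorem map_coactI {W : Type} [AddCommGroup W] [Module ℝ W] (hw : ∀ i, 0 < w i)
    (G : TPlus α w ⊗[ℝ] Alg (Fin 2) →ₗ[ℝ] W) (t : TT) : G (coactI α w hw t) =
      G (integ.lTensor (TPlus α w) (coactM α w t)) + ∑ᶠ n, G (xxL α w n t ⊗ₜ[ℝ] xPow n) := by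
  rw [coactI_apply, map_add]
  exact congrArg _ (map_finsum_linear G (finite_polyTerm hw t))

theorem rder_coactM (hw : ∀ i, 0 < w i) (hα : 0 < α) {D : Module.End ℝ Poly} (hD : D ∈ L α w) (t : TT) :
    (rder α w D : TPlus α w →ₗ[ℝ] TPlus α w).rTensor (Alg (Fin 2)) (coactM α w t) =
      coactM α w (tr D t) := by
  rw [coactM, LinearMap.comp_apply, rTensor_lTensor, rder_DeltaExt hw hα hD]
  rfl

/-- The constant comes from the term n = 0, where X^0 = 1. It is the inhomogeneity that `der_recM`
requires. -/
theorem rder_coactI (hw : ∀ i, 0 < w i) (hα : 0 < α) {D : Module.End ℝ Poly} (hD : D ∈ L α w) (t : TT) :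
    (rder α w D : TPlus α w →ₗ[ℝ] TPlus α w).rTensor (Alg (Fin 2)) (coactI α w hw t) =
      coactI α w hw (tr D t) + algebraMap ℝ _ (pr t (tiltPart D)) := by
  rw [map_coactI, rTensor_lTensor, rder_coactM hw hα hD, coactI_apply, add_assoc]
  congr 1
  have h : ∀ n, (rder α w D : TPlus α w →ₗ[ℝ] TPlus α w).rTensor (Alg (Fin 2))
      (xxL α w n t ⊗ₜ[ℝ] xPow n) = xxL α w n (tr D t) ⊗ₜ[ℝ] xPow n +
        if n = 0 then algebraMap ℝ (TPlus α w ⊗[ℝ] Alg (Fin 2)) (pr t (tiltPart D)) else 0 := by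
    intro n
    rw [LinearMap.rTensor_tmul, Derivation.coeFn_coe, rder_xxL hw hD, rval, TensorProduct.add_tmul]
    congr 1
    split_ifs with hn
    · rw [hn, xPow_zero]
      rfl
    · rw [map_zero, TensorProduct.zero_tmul]
  refine (finsum_congr h).trans ((finsum_add_distrib (finite_polyTerm hw (tr D t))
    ((Set.finite_singleton (0 : N2)).subset fun n hn => by_contra fun hc => hn (if_neg hc))).trans ?_)
  refine congrArg _ ((finsum_eq_single _ 0 fun n hn => if_neg hn).trans (if_pos rfl))

theorem pairL_one_eq_augLeft (hw : ∀ i, 0 < w i) {C : Type} [CommRing C] [Algebra ℝ C]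
    (t : TPlus α w ⊗[ℝ] C) : pairL α w hw C 1 t = augLeft _ C t := by
  induction t using TensorProduct.induction_on with
  | zero => simp
  | tmul f x => rw [pairL_tmul, pair_one, augLeft_tmul]
  | add t t' ht ht' => simp only [map_add, ht, ht']

theorem augLeft_coactM (hw : ∀ i, 0 < w i) (hα : 0 < α) (β : MI) :
    augLeft _ _ (coactM α w (Finsupp.single β 1)) = phiM β := by
  classical
  rw [← pairL_one_eq_augLeft hw, coactM, LinearMap.comp_apply, pairL_lTensor,
    pairL_one_DeltaExt hw hα]
  by_cases h : 0 ≤ bra β ∨ ∃ n, β = ePoly n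
  · have : res (Finsupp.single β 1) = Finsupp.single (⟨β, h⟩ : TIdx) 1 := by
      refine Finsupp.ext fun γ => ?_
      rw [res_apply, Finsupp.single_apply, Finsupp.single_apply]
      simp only [Subtype.ext_iff]
    rw [this, phiMinus_single]
  · have : res (Finsupp.single β 1) = 0 := by
      refine Finsupp.ext fun γ => ?_
      rw [res_apply, Finsupp.single_apply, if_neg, Finsupp.zero_apply]
      rintro rfl
      exact h γ.2
    rw [this, map_zero]
    by_contra hc
    exact h (Or.inl (bra_nonneg_of_phiM_ne_zero (Ne.symm hc)))

theorem augLeft_coactI (hw : ∀ i, 0 < w i) (hα : 0 < α) (β : MI) :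
    augLeft _ _ (coactI α w hw (Finsupp.single β 1)) = phiI β := by
  have e := map_coactI (α := α) hw (augLeft _ (Alg (Fin 2))).toLinearMap (Finsupp.single β 1)
  refine e.trans ?_
  rw [AlgHom.toLinearMap_apply, augLeft_lTensor, augLeft_coactM hw hα]
  simp only [AlgHom.toLinearMap_apply, augLeft_tmul, xxL_single, aug_xx]
  by_cases h : ∃ m, β = ePoly m
  · obtain ⟨m, rfl⟩ := h
    rw [phiI_ePoly, phiM_ePoly, map_zero, zero_add, finsum_eq_single _ m.1, if_pos ⟨m.2, rfl⟩, one_smul]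
    intro n hn
    rw [if_neg, zero_smul]
    rintro ⟨h0, h1⟩
    exact hn (congrArg Subtype.val (ePoly_injective h1)).symm
  · rw [finsum_eq_zero_of_forall_eq_zero, add_zero, phiI_of_ne (by push Not at h; exact h)]
    intro n
    rw [if_neg, zero_smul]
    rintro ⟨h0, h1⟩
    exact h ⟨_, h1⟩

/-- Both sides intertwine the transposes with the derivations of T⁺, the right side by `der_recM`.
Their images under the counit agree by the recursion of φ_-, and `intertwiner_ext` gives equality.
-/
theorem coactM_single (hw : ∀ i, 0 < w i) (hα : 0 < α) (β : MI) :
    coactM α w (Finsupp.single β 1) =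
      recM (fun γ => coactI α w hw (Finsupp.single γ 1)) (1 ⊗ₜ[ℝ] X Sym.noise) β := by
  have key := intertwiner_ext hw (F := coactM α w) (G := Finsupp.linearCombination ℝ
    (recM (fun γ => coactI α w hw (Finsupp.single γ 1)) (1 ⊗ₜ[ℝ] X Sym.noise)))
    (fun v t => rder_coactM hw hα (genOp_mem_L v) t) (fun v t => ?_) fun t => ?_
  · rw [key, Finsupp.linearCombination_single, one_smul]
  · induction t using Finsupp.induction_linear with
    | zero => simp
    | add s t hs ht => simp only [map_add, hs, ht]
    | single β c =>
      have h := der_recM (derR (rder α w (genOp α w v)) (Alg (Fin 2))) (genOp_mem_L v)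
        (Θ := coactI α w hw) (ξ := 1 ⊗ₜ[ℝ] X Sym.noise)
        (by rw [derR_apply, LinearMap.rTensor_tmul, Derivation.coeFn_coe, Derivation.map_one_eq_zero,
          TensorProduct.zero_tmul])
        (fun t => rder_coactI hw hα (genOp_mem_L v) t) β
      rw [derR_apply] at h
      rw [← mul_one c, ← smul_eq_mul, ← Finsupp.smul_single, map_smul, map_smul, map_smul, map_smul,
        Finsupp.linearCombination_single, one_smul, h]
  · induction t using Finsupp.induction_linear with
    | zero => simp
    | add s t hs ht => simp only [map_add, hs, ht]
    | single β c =>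
      have h := map_recM (augLeft (LIdx α w) (Alg (Fin 2)) : TPlus α w ⊗[ℝ] Alg (Fin 2) →+* Alg (Fin 2))
        (fun γ => coactI α w hw (Finsupp.single γ 1)) (1 ⊗ₜ[ℝ] X Sym.noise) β
      simp only [RingHom.coe_coe, augLeft_tmul, map_one, one_smul, augLeft_coactI hw hα] at h
      rw [← mul_one c, ← smul_eq_mul, ← Finsupp.smul_single, map_smul, map_smul, map_smul, map_smul,
        Finsupp.linearCombination_single, one_smul, pairL_one_eq_augLeft, pairL_one_eq_augLeft,
        augLeft_coactM hw hα, phiM_eq, h]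

/-! ### The dictionary as a morphism of comodules -/

/-- The algebra homomorphism `Φ ⊗ id`. -/
def PhiL (α : ℝ) (w : Fin 2 → ℝ) (C : Type) [CommRing C] [Algebra ℝ C] :
    TPlus α w ⊗[ℝ] C →ₐ[ℝ] THPlus α w ⊗[ℝ] C :=
  Algebra.TensorProduct.map (Phi α w) (AlgHom.id ℝ C)

theorem PhiL_tmul {C : Type} [CommRing C] [Algebra ℝ C] (f : TPlus α w) (x : C) :
    PhiL α w C (f ⊗ₜ[ℝ] x) = Phi α w f ⊗ₜ[ℝ] x := rfl

theorem PhiL_lTensor {C C' : Type} [CommRing C] [Algebra ℝ C] [CommRing C'] [Algebra ℝ C']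
    (g : C →ₗ[ℝ] C') (t : TPlus α w ⊗[ℝ] C) :
    PhiL α w C' (g.lTensor _ t) = g.lTensor _ (PhiL α w C t) := by
  induction t using TensorProduct.induction_on with
  | zero => simp
  | tmul f x => rfl
  | add t t' ht ht' => simp only [map_add, ht, ht']

/-- Sums over the summands `n` of `m`. -/
theorem finsum_eq_sum_antidiagonal {W : Type} [AddCommMonoid W] (m : N2) {G : N2 → W}
    (h : ∀ n, ¬ n ≤ m → G n = 0) :
    ∑ᶠ n, G n = ∑ p ∈ Finset.HasAntidiagonal.antidiagonal m, G p.1 := by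
  classical
  rw [finsum_eq_sum_of_support_subset (s := (Finset.HasAntidiagonal.antidiagonal m).image Prod.fst),
    Finset.sum_image]
  · intro p hp q hq e
    have hp' := Finset.HasAntidiagonal.mem_antidiagonal.1 hp
    have hq' := Finset.HasAntidiagonal.mem_antidiagonal.1 hq
    refine Prod.ext e ?_
    rw [← hq', e] at hp'
    exact add_left_cancel hp'
  · intro n hn
    have hn' : n ≤ m := by_contra fun hc => hn (h n hc)
    exact Finset.mem_coe.2 (Finset.mem_image.2
      ⟨(n, m - n), Finset.HasAntidiagonal.mem_antidiagonal.2 (add_tsub_cancel_of_le hn'), rfl⟩)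

theorem xPow_eq_dpow (n : N2) : xPow n = (fact n : ℝ) • dpow polX n := by
  rw [dpow, smul_smul, mul_inv_cancel₀ (fact_ne_zero n), one_smul]
  rfl

theorem DeltaH_xPow (m : N2) :
    DeltaH α w (xPow m) = ∑ᶠ n, Phi α w (xp α w m n) ⊗ₜ[ℝ] xPow n := by
  rw [finsum_eq_sum_antidiagonal m fun n hn => by rw [xp_eq_zero hn, map_zero, TensorProduct.zero_tmul],
    xPow_eq_dpow, map_smul, coaction_dpow DeltaH_polX, Finset.smul_sum]
  refine Finset.sum_congr rfl fun p hp => ?_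
  rw [← Finset.HasAntidiagonal.mem_antidiagonal.1 hp, Phi_xp, xPow_eq_dpow, TensorProduct.tmul_smul,
    ← TensorProduct.smul_tmul', smul_smul, mul_comm, mul_assoc, inv_mul_cancel₀ (fact_ne_zero _), mul_one]

/-- Algebra morphisms preserve the recursion, so the companions of shorter multi-indices are to be
compared. For e_m this is the binomial theorem. Otherwise the formula for Δ_H ℐ applies, with the
induction hypothesis for the integrated part and `Phi_xx` for the jet. -/
theorem DeltaH_phiM_single (hw : ∀ i, 0 < w i) (hα : 0 < α) (β : MI) :
    DeltaH α w (phiM β) = PhiL α w _ (coactM α w (Finsupp.single β 1)) := by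
  induction h : β.degree using Nat.strong_induction_on generalizing β with
  | _ N ih =>
    subst h
    have h1 := map_recM (DeltaH α w : Alg (Fin 2) →+* THPlus α w ⊗[ℝ] Alg (Fin 2)) phiI (X Sym.noise) β
    have h2 := map_recM (PhiL α w (Alg (Fin 2)) :
      TPlus α w ⊗[ℝ] Alg (Fin 2) →+* THPlus α w ⊗[ℝ] Alg (Fin 2))
      (fun γ => coactI α w hw (Finsupp.single γ 1)) (1 ⊗ₜ[ℝ] X Sym.noise) β
    rw [RingHom.coe_coe, DeltaH_noise] at h1
    rw [RingHom.coe_coe, PhiL_tmul, map_one] at h2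
    rw [phiM_eq, h1, coactM_single hw hα, h2]
    refine recM_congr _ fun γ hγ => ?_
    have e := map_coactI (α := α) hw (PhiL α w (Alg (Fin 2))).toLinearMap (Finsupp.single γ 1)
    refine Eq.trans ?_ e.symm
    simp only [AlgHom.toLinearMap_apply, RingHom.coe_coe, PhiL_lTensor, ← ih _ hγ γ rfl, PhiL_tmul,
      xxL_single]
    by_cases hm : ∃ m, γ = ePoly m
    · obtain ⟨m, rfl⟩ := hm
      simp only [phiM_ePoly, map_zero, zero_add, phiI_ePoly, DeltaH_xPow, xx_ePoly]
    · push Not at hm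
      rw [phiI_of_ne hm, DeltaH_integ hw (phiM_mem_treeSpan γ), jet_apply]
      congr 1
      refine finsum_congr fun n => ?_
      rw [Phi_xx hm, zero_add, TensorProduct.smul_tmul, dpow]
      rfl

theorem DeltaH_phiMinus (hw : ∀ i, 0 < w i) (hα : 0 < α) : (DeltaH α w).toLinearMap ∘ₗ phiMinus =
    TensorProduct.map (Phi α w).toLinearMap phiMinus ∘ₗ Delta α w := by
  refine Finsupp.lhom_ext' fun β => LinearMap.ext_ring ?_
  change DeltaH α w (phiMinus (Finsupp.single β 1)) =
    TensorProduct.map (Phi α w).toLinearMap phiMinus (Delta α w (Finsupp.single β 1))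
  rw [phiMinus_single, DeltaH_phiM_single hw hα, Delta_single, coactM, LinearMap.comp_apply]
  generalize DeltaExt α w (Finsupp.single β.1 1) = t
  induction t using TensorProduct.induction_on with
  | zero => simp
  | tmul f x => rfl
  | add t t' ht ht' => simp only [map_add, ht, ht']

end

section

variable {α : ℝ} {w : Fin 2 → ℝ}

/-! ## The morphism of Hopf algebras -/

open Classical in
/-- The contribution of `z_(e_m)` to `Φ ∘ xxT n`. -/
def polyPhi (α : ℝ) (w : Fin 2 → ℝ) (n m : N2) : T →ₗ[ℝ] THPlus α w :=
  if h : m ≠ 0 then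
    LinearMap.toSpanSingleton ℝ _ (Phi α w (xp α w m n)) ∘ₗ Finsupp.lapply (polyIdx ⟨m, h⟩)
  else 0

theorem polyPhi_of_ne (n : N2) {m : N2} (h : m ≠ 0) (t : T) :
    polyPhi α w n m t = t (polyIdx ⟨m, h⟩) • Phi α w (xp α w m n) := by
  rw [polyPhi, dif_pos h]
  rfl

theorem polyPhi_zero (n : N2) : polyPhi α w n 0 = 0 := dif_neg fun h => h rfl

theorem polyIdx_injective : Function.Injective polyIdx := fun _ _ h =>
  ePoly_injective (congrArg Subtype.val h)

theorem finite_polyPhi (n : N2) (t : T) : {m | polyPhi α w n m t ≠ 0}.Finite := by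
  refine ((t.support.finite_toSet.preimage polyIdx_injective.injOn).image Subtype.val).subset
    fun m hm => ?_
  have h : m ≠ 0 := by
    rintro rfl
    exact hm (by rw [polyPhi_zero]; rfl)
  refine ⟨⟨m, h⟩, Finset.mem_coe.2 (Finsupp.mem_support_iff.2 fun hc => hm ?_), rfl⟩
  rw [polyPhi_of_ne n h, hc, zero_smul]

theorem Phi_comp_xxT (n : N2) : (Phi α w).toLinearMap ∘ₗ xxT α w n =
    (fact n : ℝ)⁻¹ • (JH α w n ∘ₗ phiMinus) + lfSum (polyPhi α w n) (finite_polyPhi n) := by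
  refine Finsupp.lhom_ext' fun γ => LinearMap.ext_ring ?_
  change Phi α w (xxT α w n (Finsupp.single γ 1)) =
    (fact n : ℝ)⁻¹ • JH α w n (phiMinus (Finsupp.single γ 1)) +
      ∑ᶠ m, polyPhi α w n m (Finsupp.single γ 1)
  rw [xxT, Finsupp.linearCombination_single, one_smul, phiMinus_single]
  by_cases h : ∃ m, γ.1 = ePoly m
  · obtain ⟨m, hm⟩ := h
    have e : γ = polyIdx m := Subtype.ext hm
    subst e
    rw [hm, phiM_ePoly, map_zero, smul_zero, zero_add, xx_ePoly, finsum_eq_single _ m.1,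
      polyPhi_of_ne n m.2, Finsupp.single_eq_same, one_smul]
    intro m' hm'
    by_cases h0 : m' = 0
    · rw [h0, polyPhi_zero]
      rfl
    · rw [polyPhi_of_ne n h0, Finsupp.single_eq_of_ne, zero_smul]
      exact fun hc => hm' (congrArg Subtype.val (polyIdx_injective hc))
  · rw [finsum_eq_zero_of_forall_eq_zero, add_zero, Phi_xx (by push Not at h; exact h)]
    intro m
    by_cases h0 : m = 0
    · rw [h0, polyPhi_zero]
      rfl
    · rw [polyPhi_of_ne n h0, Finsupp.single_eq_of_ne, zero_smul]
      exact fun hc => h ⟨⟨m, h0⟩, (congrArg Subtype.val hc).symm⟩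

/-- The algebra homomorphism `Φ ⊗ Φ`. -/
def PhiPhi (α : ℝ) (w : Fin 2 → ℝ) : TPlus α w ⊗[ℝ] TPlus α w →ₐ[ℝ] THPlus α w ⊗[ℝ] THPlus α w :=
  Algebra.TensorProduct.map (Phi α w) (Phi α w)

theorem PhiPhi_lTensor (g : T →ₗ[ℝ] TPlus α w) (t : TPlus α w ⊗[ℝ] T) :
    PhiPhi α w (g.lTensor _ t) =
      (Phi α w).toLinearMap.rTensor _ (((Phi α w).toLinearMap ∘ₗ g).lTensor _ t) := by
  induction t using TensorProduct.induction_on with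
  | zero => simp
  | tmul f x => rfl
  | add t t' ht ht' => simp only [map_add, ht, ht']

/-- The component of Δ along z_{e_m} is known from `DeltaExt_polyIdx`. For m = 0 there is no such
vector, and the term that `cop` contains separately takes its place. -/
theorem polyPhi_lTensor (hw : ∀ i, 0 < w i) (hα : 0 < α) (n m : N2) (t : TT) :
    (polyPhi α w n m).lTensor (TPlus α w) (DeltaExt α w t) +
      (if m = 0 then xxL α w m t ⊗ₜ[ℝ] Phi α w (xp α w m n) else 0) =
      xxL α w m t ⊗ₜ[ℝ] Phi α w (xp α w m n) := by
  split_ifs with h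
  · rw [h, polyPhi_zero, LinearMap.lTensor_zero, LinearMap.zero_apply, zero_add]
  · rw [polyPhi, dif_pos h, LinearMap.lTensor_comp, LinearMap.comp_apply, DeltaExt_polyIdx hw hα,
      LinearMap.lTensor_tmul, LinearMap.toSpanSingleton_apply, one_smul, add_zero]

/-- The comodule identity is composed with 𝒥_n in the right leg. The vectors z_{e_m}, on which φ_-
vanishes, account for the sum over m. -/
theorem PhiPhi_cop_single (hw : ∀ i, 0 < w i) (hα : 0 < α) (n : N2) (β : MI) :
    PhiPhi α w (cop α w n (Finsupp.single β 1)) =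
      (fact n : ℝ)⁻¹ • (JH α w n).lTensor (THPlus α w) (DeltaH α w (phiM β)) +
        ∑ᶠ m, Phi α w (xx α w m β) ⊗ₜ[ℝ] Phi α w (xp α w m n) := by
  have hfin : {m | (polyPhi α w n m).lTensor (TPlus α w)
      (DeltaExt α w (Finsupp.single β 1)) ≠ 0}.Finite := finite_lTensor_ne_zero (finite_polyPhi n) _
  have hfin' : {m : N2 | (if m = 0 then xxL α w m (Finsupp.single β 1) ⊗ₜ[ℝ] Phi α w (xp α w m n)
      else 0) ≠ 0}.Finite :=
    (Set.finite_singleton (0 : N2)).subset fun m hm => by_contra fun hc => hm (if_neg hc)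
  have h1 : ∑ᶠ m, xxL α w m (Finsupp.single β 1) ⊗ₜ[ℝ] Phi α w (xp α w m n) =
      (lfSum (polyPhi α w n) (finite_polyPhi n)).lTensor (TPlus α w)
        (DeltaExt α w (Finsupp.single β 1)) + xxL α w 0 (Finsupp.single β 1) ⊗ₜ[ℝ] Phi α w (xp α w 0 n) := by
    rw [lfSum_lTensor, ← finsum_congr fun m => polyPhi_lTensor hw hα n m (Finsupp.single β 1)]
    refine (finsum_add_distrib hfin hfin').trans (congrArg _ ?_)
    exact (finsum_eq_single _ 0 fun m hm => if_neg hm).trans (if_pos rfl)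
  have hfin2 : {m | xxL α w m (Finsupp.single β 1) ⊗ₜ[ℝ] Phi α w (xp α w m n) ≠ 0}.Finite :=
    (finite_xxL_ne_zero (α := α) hw (Finsupp.single β 1)).subset fun m hm hc => hm (by
      rw [hc, TensorProduct.zero_tmul])
  have h2 := map_finsum_linear ((Phi α w).toLinearMap.rTensor (THPlus α w)) hfin2
  simp only [LinearMap.rTensor_tmul, AlgHom.toLinearMap_apply, xxL_single] at h2
  have h3 : PhiPhi α w (if n = 0 then xxL α w 0 (Finsupp.single β 1) ⊗ₜ[ℝ] 1 else 0) =
      (Phi α w).toLinearMap.rTensor (THPlus α w)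
        (xxL α w 0 (Finsupp.single β 1) ⊗ₜ[ℝ] Phi α w (xp α w 0 n)) := by
    rw [xp_zero]
    split_ifs
    · rfl
    · rw [map_zero, map_zero, TensorProduct.tmul_zero, map_zero]
  have h4 : (Phi α w).toLinearMap.rTensor (THPlus α w) ((JH α w n ∘ₗ phiMinus).lTensor (TPlus α w)
      (DeltaExt α w (Finsupp.single β 1))) =
        (JH α w n).lTensor (THPlus α w) (DeltaH α w (phiM β)) := by
    rw [DeltaH_phiM_single hw hα, coactM, LinearMap.comp_apply, LinearMap.lTensor_comp,
      LinearMap.comp_apply, rTensor_lTensor]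
    rfl
  rw [cop, map_add, h3, copT, LinearMap.comp_apply, PhiPhi_lTensor, Phi_comp_xxT,
    LinearMap.lTensor_add, LinearMap.add_apply, LinearMap.lTensor_smul, LinearMap.smul_apply, map_add,
    map_smul, h4, ← h2]
  simp only [xxL_single] at h1 ⊢
  rw [h1, map_add, add_assoc]

theorem finsum_add_left {W : Type} [AddCommMonoid W] (n : N2) {G : N2 → W}
    (h : ∀ m, ¬ n ≤ m → G m = 0) : ∑ᶠ m, G m = ∑ᶠ k, G (n + k) := by
  classical
  rw [← finsum_mem_range (f := G) (add_right_injective n)]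
  refine finsum_congr fun m => ?_
  by_cases hm : n ≤ m
  · rw [finsum_eq_if, if_pos ⟨m - n, add_tsub_cancel_of_le hm⟩]
  · rw [h m hm, finsum_zero]

theorem PhiPhi_cop_ePoly (hw : ∀ i, 0 < w i) (hα : 0 < α) (m : N2ne) :
    PhiPhi α w (cop α w 0 (Finsupp.single (ePoly m) 1)) = DeltaHPlus α w (Phi α w (xp α w m.1 0)) := by
  have e : ∀ m : N2, Phi α w (xp α w m 0) = (fact m : ℝ) • dpow (polXP α w) m := by
    intro m
    have := Phi_xp (α := α) (w := w) 0 m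
    rw [zero_add] at this
    rw [this]
    simp [fact]
  have h : DeltaHPlus α w (dpow (polXP α w) m.1) = _ := coaction_dpow (fun i => DeltaHPlus_inr i) m.1
  rw [PhiPhi_cop_single hw hα, phiM_ePoly, map_zero, map_zero, smul_zero, zero_add,
    finsum_eq_sum_antidiagonal m.1, e, map_smul, h, Finset.smul_sum]
  · refine Finset.sum_congr rfl fun p hp => ?_
    rw [xx_ePoly, ← Finset.HasAntidiagonal.mem_antidiagonal.1 hp, Phi_xp, e, TensorProduct.tmul_smul,
      ← TensorProduct.smul_tmul', smul_smul, mul_comm, mul_assoc, inv_mul_cancel₀ (fact_ne_zero _),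
      mul_one]
    rfl
  · intro n hn
    rw [xx_ePoly, xp_eq_zero hn, map_zero, TensorProduct.zero_tmul]

/-- Only m = n + k contributes to the sum over m, and the factorials in Φ of the binomials turn it
into the jet in the definition of Δ_H⁺. -/
theorem PhiPhi_cop_of_ne (hw : ∀ i, 0 < w i) (hα : 0 < α) {β : MI} (hβ : ∀ m, β ≠ ePoly m) (n : N2) :
    PhiPhi α w (cop α w n (Finsupp.single β 1)) = DeltaHPlus α w (Phi α w (xx α w n β)) := by
  rw [PhiPhi_cop_single hw hα, Phi_xx hβ, map_smul,
    DeltaHPlus_JH hw n (treeSpan_le_TH (phiM_mem_treeSpan β)), smul_add, finsum_add_left n, jet_apply]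
  · congr 1
    refine Eq.trans (finsum_congr fun k => ?_) (smul_finsum _ _).symm
    rw [Phi_xx hβ, Phi_xp, ← TensorProduct.smul_tmul', TensorProduct.tmul_smul, smul_smul, ← mul_assoc,
      inv_mul_cancel₀ (fact_ne_zero _), one_mul]
  · intro m hm
    rw [xp_eq_zero hm, map_zero, TensorProduct.tmul_zero]

theorem DeltaHPlus_comp_Phi (hw : ∀ i, 0 < w i) (hα : 0 < α) :
    (DeltaHPlus α w).comp (Phi α w) = (PhiPhi α w).comp (comulT α w) := by
  refine algHom_ext fun v => ?_
  rw [AlgHom.comp_apply, AlgHom.comp_apply, comulT_X, X_eq_xx]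
  rcases v with a | i
  · refine (PhiPhi_cop_of_ne hw hα (fun m hm => ?_) _).symm
    have hm' : a.1.1 = ePoly m := hm
    exact not_admissible_ePoly m a.1.2 (hm' ▸ a.2)
  · change _ = PhiPhi α w (cop α w 0 (Finsupp.single (ePoly (raise 0 i)) 1))
    rw [PhiPhi_cop_ePoly hw hα, ← xx_ePoly]
    rfl

theorem epsHPlus_comp_Phi : epsHPlus α w ∘ₗ (Phi α w).toLinearMap = epsPlus α w := by
  have : (aug (JIdx α w ⊕ Fin 2)).comp (Phi α w) = aug (LIdx α w) := by
    refine algHom_ext fun v => ?_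
    rw [AlgHom.comp_apply, aeval_X]
    rcases v with a | i
    · rw [Phi, aeval_X, Sum.elim_inl, map_smul, aug_JH, smul_zero]
    · rw [Phi_inr, polXP, aeval_X]
  exact congrArg AlgHom.toLinearMap this

end

end GPAM

end

/-! ### The proposition -/

theorem mainTheorem4 (α : ℝ) (hα : 0 < α) (w : Fin 2 → ℝ) (hw : ∀ i, 0 < w i) :
    ∃ b : Module.Basis (GPAM.PIdx α w) ℝ (GPAM.U α w),
      (∀ p, b p = GPAM.DD α w p) ∧
      (∀ β : GPAM.TIdx, {q : GPAM.PIdx α w × GPAM.TIdx |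
        GPAM.deltaCoeff α w β.1 q.2.1 q.1 ≠ 0}.Finite) ∧
      (∀ p, {q : GPAM.PIdx α w × GPAM.PIdx α w | b.repr (b q.1 * b q.2) p ≠ 0}.Finite) ∧
      (∀ t, GPAM.phiMinus t ∈ GPAM.TH) ∧
      (∀ x ∈ GPAM.TH, GPAM.DeltaH α w x ∈
        LinearMap.range (GPAM.TH.subtype.lTensor (GPAM.THPlus α w))) ∧
      (GPAM.DeltaH α w).toLinearMap ∘ₗ GPAM.phiMinus =
        TensorProduct.map (GPAM.Phi α w).toLinearMap GPAM.phiMinus ∘ₗ GPAM.Delta α w ∧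
      (GPAM.DeltaHPlus α w).toLinearMap ∘ₗ (GPAM.Phi α w).toLinearMap =
        TensorProduct.map (GPAM.Phi α w).toLinearMap (GPAM.Phi α w).toLinearMap ∘ₗ
          GPAM.DeltaPlus α w b ∧
      ∃ (S : GPAM.TPlus α w →ₗ[ℝ] GPAM.TPlus α w) (SH : GPAM.THPlus α w →ₗ[ℝ] GPAM.THPlus α w),
        GPAM.IsHopfAlgebra (GPAM.DeltaPlus α w b) (GPAM.epsPlus α w) S ∧
        GPAM.IsHopfAlgebra (GPAM.DeltaHPlus α w).toLinearMap (GPAM.epsHPlus α w) SH ∧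
        GPAM.epsHPlus α w ∘ₗ (GPAM.Phi α w).toLinearMap = GPAM.epsPlus α w ∧
        (GPAM.Phi α w).toLinearMap ∘ₗ S = SH ∘ₗ (GPAM.Phi α w).toLinearMap := by
  -- This identification carries the Hopf algebra structure and the compatibility with Φ over from
  -- the multiplicative map to the dual of the product.
  have hΔ := GPAM.DeltaPlus_eq_comulT hα hw
  have hc : (GPAM.DeltaHPlus α w).toLinearMap ∘ₗ (GPAM.Phi α w).toLinearMap =
      TensorProduct.map (GPAM.Phi α w).toLinearMap (GPAM.Phi α w).toLinearMap ∘ₗ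
        (GPAM.comulT α w).toLinearMap :=
    congrArg AlgHom.toLinearMap (GPAM.DeltaHPlus_comp_Phi hw hα)
  obtain ⟨S, hS⟩ := GPAM.exists_antipode_TPlus hα hw
  obtain ⟨SH, hSH⟩ := GPAM.exists_antipode_THPlus (α := α) hw
  refine ⟨GPAM.DDbasis α w hw, GPAM.DDbasis_apply hw, fun β => GPAM.finite_deltaCoeff hα hw β.1,
    GPAM.finite_DDbasis_repr_mul hw hα, GPAM.phiMinus_mem_TH, fun x hx => GPAM.DeltaH_TH hw hx,
    GPAM.DeltaH_phiMinus hw hα, ?_, S, SH, ?_, hSH, GPAM.epsHPlus_comp_Phi,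
    hS.map_antipode hSH (GPAM.Phi α w) hc GPAM.epsHPlus_comp_Phi⟩
  · rw [hΔ]
    exact hc
  · rw [hΔ]
    exact hS
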